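/- **Setting.** Let $d\ge 1$ and $s_1,s_2>0$. Let $\Omega\subset\mathbb R^d$ be a bounded polyhedral Lipschitz domain, let $0=t_0<t_1<\dots<t_N=T$, and let $\mathcal P_0=\{I_0\times S_0: I_0\in\mathcal I_0,\ S_0\in\mathcal T_0\}$, where $\mathcal I_0=\{[t_0,t_1),\dots,[t_{N-2},t_{N-1}),[t_{N-1},t_N]\}$ and $\mathcal T_0$ is a conforming triangulation of $\overline\Omega$ into closed $d$-simplices. Write $\Omega_T=[0,T]\times\overline\Omega$. *Bisection.* $\mathrm{BISECT}(1,\cdot)$ halves an interval ($[a,b)$ or $[a,b]$) at its midpoint $m$, the left half being $[a,m)$. $\mathrm{BISECT}(d,\cdot)$ maps a tagged simplex $(x_0,\dots,x_d)_\gamma$ of type $\gamma\in\{0,\dots,d-1\}$, with refinement edge $\mathrm{RE}=[x_0,x_d]$ and $m=\frac{x_0+x_d}2$, to the two tagged simplices $(x_0,m,x_1,\dots,x_{d-1})$ and $(x_d,m,x_1,\dots,x_\gamma,x_{d-1},\dots,x_{\gamma+1})$ of type $(\gamma+1)\bmod d$. The elements of $\mathcal T_0$ are tagged and well-labeled: they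 have the same type, and for any two that share a hyperface, either the refinement edge of one of them lies in both and the two are reflected neighbours, or no such inclusion holds and their two children that share a hyperface are reflected neighbours. Here tagged simplices of the same type are reflected neighbours if the vertex sequence of $(x_0,\dots,x_d)_\gamma$ or of its reversal $(x_d,x_1,\dots,x_\gamma,x_{d-1},\dots,x_{\gamma+1},x_0)_\gamma$ coincides with that of the other simplex on all but one position. The level $\ell(S)$ of a simplex is the number of bisections that produced it, and $\ell(I\times S)=\ell(S)$. For a prism with $n=\ell(S)+1$ and $m=\lceil\frac{ns_2}{s_1d}\rceil-\lceil\frac{(n-1)s_2}{s_1d}\rceil$, $\mathrm{ATOMIC\_SPLIT}(I\times S)$ consists of the products of the $2^m$ intervals obtained from $I$ by $m$ successive bisections with the two children of $S$. *Patch refinement.* For $Q=I\times S\in\mathcal P$ let $\mathcal N_t(Q,\mathcal P)$ be the set of $I'\times S'\in\mathcal P\setminus\{Q\}$ with $\#(\overline I\cap\overline{I'})=1$, $\dim(S\cap S')=d$ and $\ell(S')=\ell(S)-1$. Let $\mathcal N_x(Q,\mathcal P)$ be the set of $I'\times S'\in\mathcal P\setminus\{Q\}$ with $|I\cap I'|>0$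 and, for $d\ge2$, $\dim(S\cap S')=d-1$ and $\mathrm{RE}(S)\subset S'$, respectively, for $d=1$, $\#(S\cap S')=1$ and $\ell(S')=\ell(S)-1$. Put $\mathcal N=\mathcal N_t\cup\mathcal N_x$. $\mathrm{PATCH\_REFINE}(\mathcal P,Q)$ starts with $K=\emptyset$, $F=\{Q\}$. While $F\neq\emptyset$ it puts $F_{new}=\emptyset$ and visits every $Q'\in F$ and every $Q''\in\mathcal N(Q',\mathcal P)\setminus(K\cup F)$, in any order. If $\ell(Q'')=\ell(Q')$, then $Q''$ is added to $F_{new}$. Otherwise $\mathcal P$ is replaced by $\mathrm{PATCH\_REFINE}(\mathcal P,Q'')$ and, if $Q''$ was in $\mathcal N_x(Q',\cdot)$ of the old mesh, all elements of $\mathrm{ATOMIC\_SPLIT}(Q'')$ lying in $\mathcal N(Q',\cdot)$ of the new mesh are added to $F_{new}$. Then $K\leftarrow K\cup F$ and $F\leftarrow F_{new}$. At the end it returns $(\mathcal P\setminus K)\cup\bigcup_{\tilde Q\in K}\mathrm{ATOMIC\_SPLIT}(\tilde Q)$. Let $\mathcal P$ be obtained from $\mathcal P_0$ by finitely many applications of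 $\mathrm{PATCH\_REFINE}$ to elements of the current mesh or, more generally, by finitely many applications of $\mathrm{ATOMIC\_SPLIT}$ in such a way that $\mathcal P$ has the following properties: at every time $t$ the simplices $S$ with $I\times S\in\mathcal P$, $t\in I$ form a conforming triangulation; the levels of $I\times S,I'\times S'\in\mathcal P$ differ by at most one if $\#(\overline I\cap\overline{I'})=1$ and $\dim(S\cap S')=d$; and, if $d=1$, they also differ by at most one if $|I\cap I'|>0$ and $\#(S\cap S')=1$. *Finite elements.* Let $r_1,r_2\ge2$. $\mathbb V_{\mathcal P}$ is the space of continuous $F:\Omega_T\to\mathbb R$ that agree on each $I\times S\in\mathcal P$ with a polynomial $\sum_{i<r_1}\sum_{|\alpha|<r_2}c_{i,\alpha}t^ix^\alpha$. $\mathcal L(I\times S)=\mathcal L(I)\times\mathcal L(S)$, where $\mathcal L(I)$ consists of the $r_1$ equidistant nodes of $\overline I$ (end points included) and $\mathcal L(S)$ of the points of $S$ with barycentric coordinates in $\frac1{r_2-1}\mathbb N_0$. A node $\nu\in\bigcup_{Q\in\mathcal P}\mathcal L(Q)$ is free if $\nu\in\mathcal L(Q)$ for every $Q\in\mathcal P$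 with $\nu\in\overline Q$, and hanging otherwise. For a free node $\nu$, the nodal basis function $\phi_\nu\in\mathbb V_{\mathcal P}$ is defined by $\phi_\nu(\nu)=1$ and $\phi_\nu(\nu')=0$ for all free nodes $\nu'\ne\nu$. *Neighbourhoods.* $\omega^1_{\mathcal P}(Q)=\{Q'\in\mathcal P:\overline Q\cap\overline{Q'}\ne\emptyset\}$ and $\omega^{j}_{\mathcal P}(Q)=\bigcup_{Q''\in\omega^{j-1}_{\mathcal P}(Q)}\omega^1_{\mathcal P}(Q'')$ for $j\ge2$. Put $j(1)=2$ and $j(d)=3$ for $d\ge2$. **Theorem.** Let $\nu$ be a free node of $\mathcal P$. 1. If $Q\in\mathcal P$ and $\nu\in\mathcal L(Q)$, then the support of $\phi_\nu$ is contained in $\omega^{j(d)}_{\mathcal P}(Q)$, i.e. $\{\phi_\nu\neq0\}\subset\bigcup_{Q'\in\omega^{j(d)}_{\mathcal P}(Q)}Q'$ and $\operatorname{supp}\phi_\nu=\overline{\{\phi_\nu\ne0\}}\subset\bigcup_{Q'\in\omega^{j(d)}_{\mathcal P}(Q)}\overline{Q'}$. 2. There is a constant $C>0$ such that $C^{-1}|Q'|\le|\operatorname{supp}\phi_\nu|\le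 C|Q'|$ for all $Q'\in\mathcal P$ with $Q'\subset\operatorname{supp}\phi_\nu$. The constant depends only on $d$, $s_1$, $s_2$, the shape regularity constant $\kappa_{\mathcal P_0}=\max_{I\times S\in\mathcal P_0}\operatorname{diam}(S)/\rho_S$ (with $\rho_S$ the supremum of the radii of balls contained in $S$) and the four numbers $\max|I|$, $\min|I|$, $\max|S|$, $\min|S|$ over $I\times S\in\mathcal P_0$. -/

import Mathlib

open MeasureTheory Set

namespace SpaceTimeMesh

noncomputable section

/-- The spatial Euclidean space `ℝ^d`. -/
abbrev Space (d : ℕ) : Type := EuclideanSpace ℝ (Fin d)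

/-! ### Tagged simplices and the Maubach-Traxler bisection -/

/-- A tagged `d`-simplex `(x₀, …, x_d)_γ`: an ordered list of vertices together with its type
`γ ∈ {0, …, d-1}` and its level, i.e. the number of bisections by which it arose from an element
of the initial triangulation. -/
structure TaggedSimplex (d : ℕ) where
  vertex : Fin (d + 1) → Space d
  type : ℕ
  level : ℕ

namespace TaggedSimplex

variable {d : ℕ}

/-- The closed simplex. -/
def carrier (S : TaggedSimplex d) : Set (Space d) := convexHull ℝ (range S.vertex)

/-- The refinement edge `x₀ x_d`. -/
def refinementEdge (S : TaggedSimplex d) : Set (Space d) :=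
  segment ℝ (S.vertex 0) (S.vertex (Fin.last d))

/-- The child `(x₀, (x₀ + x_d)/2, x₁, …, x_{d-1})_{(γ+1) mod d}`. -/
def leftChild (S : TaggedSimplex d) : TaggedSimplex d where
  vertex k :=
    if (k : ℕ) = 0 then S.vertex 0
    else if (k : ℕ) = 1 then midpoint ℝ (S.vertex 0) (S.vertex (Fin.last d))
    else S.vertex ⟨k - 1, by have := k.isLt; omega⟩
  type := (S.type + 1) % d
  level := S.level + 1

/-- The child `(x_d, (x₀ + x_d)/2, x₁, …, x_γ, x_{d-1}, …, x_{γ+1})_{(γ+1) mod d}`. -/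
def rightChild (S : TaggedSimplex d) : TaggedSimplex d where
  vertex k :=
    if (k : ℕ) = 0 then S.vertex (Fin.last d)
    else if (k : ℕ) = 1 then midpoint ℝ (S.vertex 0) (S.vertex (Fin.last d))
    else if h : (k : ℕ) ≤ S.type + 1 then S.vertex ⟨k - 1, by have := k.isLt; omega⟩
    else S.vertex ⟨d + S.type + 1 - k, by omega⟩
  type := (S.type + 1) % d
  level := S.level + 1

open scoped Classical in
/-- `BISECT(d, S)`. -/
def bisect (S : TaggedSimplex d) : Finset (TaggedSimplex d) := {S.leftChild, S.rightChild}

/-- The tagged simplex `(x_d, x₁, …, x_γ, x_{d-1}, …, x_{γ+1}, x₀)_γ`, which has the same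
children as `(x₀, …, x_d)_γ`. -/
def reverse (S : TaggedSimplex d) : TaggedSimplex d where
  vertex k :=
    if (k : ℕ) = 0 then S.vertex (Fin.last d)
    else if (k : ℕ) = d then S.vertex 0
    else if h : (k : ℕ) ≤ S.type then S.vertex k
    else S.vertex ⟨d + S.type - k, by omega⟩
  type := S.type
  level := S.level

/-- Two simplices are neighbours if they are distinct as sets of vertices and have a common
`(d-1)`-dimensional face. -/
def Neighbours (S S' : TaggedSimplex d) : Prop :=
  (range S.vertex ∩ range S'.vertex).ncard = d ∧ range S.vertex ≠ range S'.vertex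

/-- The vertex sequences coincide on all but one position. -/
def AgreeButOne (S S' : TaggedSimplex d) : Prop :=
  ∃ i, S.vertex i ≠ S'.vertex i ∧ ∀ k, k ≠ i → S.vertex k = S'.vertex k

/-- Reflected neighbours: same type, and the ordered vertices of `S` or of its reversal coincide
with those of `S'` on all but one position. -/
def ReflectedNeighbours (S S' : TaggedSimplex d) : Prop :=
  S.type = S'.type ∧ (S.AgreeButOne S' ∨ S.reverse.AgreeButOne S')

/-- `diam(S)` over the supremum of the radii of balls contained in `S`. -/
def shapeConstant (S : TaggedSimplex d) : ℝ :=
  Metric.diam S.carrier /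
    sSup {ρ : ℝ | 0 < ρ ∧ ∃ x₀ ∈ S.carrier, Metric.ball x₀ ρ ⊆ S.carrier}

/-- The Lagrange nodes of order `r` of `S`, i.e. of polynomials of degree at most `r - 1`: the
points with barycentric coordinates in `(r-1)⁻¹ ℕ₀`. -/
def nodes (r : ℕ) (S : TaggedSimplex d) : Set (Space d) :=
  {x | ∃ α : Fin (d + 1) → ℕ, ∑ i, α i = r - 1 ∧
    x = ∑ i, ((α i : ℝ) / ((r : ℝ) - 1)) • S.vertex i}

end TaggedSimplex

/-- A well-labeled triangulation: all simplices have the same type, and two neighbours are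
reflected neighbours if the refinement edge of one of them lies in both, whereas otherwise their
neighbouring children are reflected neighbours. -/
def WellLabeled {d : ℕ} (𝒯 : Finset (TaggedSimplex d)) : Prop :=
  (∃ γ < d, ∀ S ∈ 𝒯, S.type = γ) ∧
  ∀ S ∈ 𝒯, ∀ S' ∈ 𝒯, S.Neighbours S' →
    ((S.refinementEdge ⊆ S.carrier ∩ S'.carrier ∨ S'.refinementEdge ⊆ S.carrier ∩ S'.carrier) →
      S.ReflectedNeighbours S') ∧
    (¬ (S.refinementEdge ⊆ S.carrier ∩ S'.carrier ∨
        S'.refinementEdge ⊆ S.carrier ∩ S'.carrier) →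
      ∀ R ∈ S.bisect, ∀ R' ∈ S'.bisect, R.Neighbours R' → R.ReflectedNeighbours R')

/-- A conforming (hence non-overlapping) family of simplices: two distinct ones are disjoint or
meet in a common face of dimension at most `d - 1` (the hull of at most `d` vertices of either). -/
def Conforming {d : ℕ} (𝒯 : Finset (TaggedSimplex d)) : Prop :=
  ∀ S ∈ 𝒯, ∀ S' ∈ 𝒯, S = S' ∨ S.carrier ∩ S'.carrier = ∅ ∨
    ∃ a a' : Finset (Fin (d + 1)), a.Nonempty ∧ a'.Nonempty ∧ a.card ≤ d ∧ a'.card ≤ d ∧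
      S.carrier ∩ S'.carrier = convexHull ℝ (S.vertex '' a) ∧
      S.carrier ∩ S'.carrier = convexHull ℝ (S'.vertex '' a')

/-! ### Time intervals -/

/-- A time interval `[lo, hi)` or, if `closedRight`, `[lo, hi]`. -/
structure TimeInterval where
  lo : ℝ
  hi : ℝ
  closedRight : Bool

namespace TimeInterval

def carrier (I : TimeInterval) : Set ℝ :=
  if I.closedRight = true then Icc I.lo I.hi else Ico I.lo I.hi

open scoped Classical in
/-- `BISECT(1, I)`; the left half is half-open, the right half inherits the right end point. -/
def bisect (I : TimeInterval) : Finset TimeInterval :=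
  {⟨I.lo, (I.lo + I.hi) / 2, false⟩, ⟨(I.lo + I.hi) / 2, I.hi, I.closedRight⟩}

open scoped Classical in
/-- `BISECT(1, I)^{⊗ m}`. -/
def bisectIter : ℕ → TimeInterval → Finset TimeInterval
  | 0, I => {I}
  | m + 1, I => (bisectIter m I).biUnion bisect

/-- The `r` equidistant Lagrange nodes of the closed interval. -/
def nodes (r : ℕ) (I : TimeInterval) : Set ℝ :=
  {t | ∃ n : ℕ, n ≤ r - 1 ∧ t = I.lo + ((n : ℝ) / ((r : ℝ) - 1)) * (I.hi - I.lo)}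

end TimeInterval

/-! ### Prisms and their atomic refinement -/

/-- A prism `I × S`. -/
abbrev Prism (d : ℕ) : Type := TimeInterval × TaggedSimplex d

namespace Prism

variable {d : ℕ}

/-- The set `I × S`. -/
def carrier (Q : Prism d) : Set (ℝ × Space d) := Q.1.carrier ×ˢ Q.2.carrier

/-- `ℓ(I × S) = ℓ(S)`. -/
def level (Q : Prism d) : ℕ := Q.2.level

/-- The anisotropic Lagrange nodes. -/
def nodes (r₁ r₂ : ℕ) (Q : Prism d) : Set (ℝ × Space d) := Q.1.nodes r₁ ×ˢ Q.2.nodes r₂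

/-- `ATOMIC_SPLIT(I × S, d, s₁, s₂)`. -/
def atomicSplit (s₁ s₂ : ℝ) (Q : Prism d) : Finset (Prism d) :=
  let n : ℕ := Q.2.level + 1
  let m : ℕ := ⌈(n : ℝ) * s₂ / (s₁ * d)⌉₊ - ⌈((n : ℝ) - 1) * s₂ / (s₁ * d)⌉₊
  Q.1.bisectIter m ×ˢ Q.2.bisect

end Prism

/-! ### The recursive patch refinement -/

section Refinement

variable {d : ℕ}

/-- The dimension of (the affine hull of) a set. -/
def affineDim (A : Set (Space d)) : ℕ := Module.finrank ℝ (affineSpan ℝ A).direction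

open scoped Classical in
/-- Necessary refinements of neighbours in time. -/
def timeNeighbours (P : Finset (Prism d)) (Q : Prism d) : Finset (Prism d) :=
  P.filter fun Q' => Q' ≠ Q ∧ (closure Q.1.carrier ∩ closure Q'.1.carrier).ncard = 1 ∧
    affineDim (Q.2.carrier ∩ Q'.2.carrier) = d ∧ Q'.level + 1 = Q.level

open scoped Classical in
/-- Necessary refinements of neighbours in space: for `d ≥ 2` the prisms that overlap `Q` in time
and whose simplex has a common hyperface with that of `Q` and contains its refinement edge. -/
def spaceNeighbours (P : Finset (Prism d)) (Q : Prism d) : Finset (Prism d) :=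
  P.filter fun Q' => Q' ≠ Q ∧ 0 < volume (Q.1.carrier ∩ Q'.1.carrier) ∧
    if 2 ≤ d then
      affineDim (Q.2.carrier ∩ Q'.2.carrier) = d - 1 ∧ Q.2.refinementEdge ⊆ Q'.2.carrier
    else (Q.2.carrier ∩ Q'.2.carrier).ncard = 1 ∧ Q'.level + 1 = Q.level

open scoped Classical in
/-- The set of necessary refinements of neighbours of `Q` with respect to `P`. -/
def necessaryRefinements (P : Finset (Prism d)) (Q : Prism d) : Finset (Prism d) :=
  timeNeighbours P Q ∪ spaceNeighbours P Q

/- The algorithm `PATCH_REFINE` as a big-step semantics. Its `for`-loops run over the elements of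
a finite set in an arbitrary order; the set is evaluated when the loop is entered. -/
open scoped Classical in
mutual

/-- `PatchRefine s₁ s₂ P Q P'`: a call `PATCH_REFINE(P, Q, d, s₁, s₂)` returns `P'`. -/
inductive PatchRefine (s₁ s₂ : ℝ) :
    Finset (Prism d) → Prism d → Finset (Prism d) → Prop
  | mk {P P₁ K : Finset (Prism d)} {Q : Prism d} :
      WhileLoop s₁ s₂ P ∅ {Q} P₁ K →
      PatchRefine s₁ s₂ P Q ((P₁ \ K) ∪ K.biUnion (Prism.atomicSplit s₁ s₂))

/-- `WhileLoop s₁ s₂ P K F P' K'`: the loop `while F ≠ ∅`, entered with the values `P, K, F`,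
ends with the values `P', K'`. -/
inductive WhileLoop (s₁ s₂ : ℝ) :
    Finset (Prism d) → Finset (Prism d) → Finset (Prism d) →
    Finset (Prism d) → Finset (Prism d) → Prop
  | done {P K : Finset (Prism d)} : WhileLoop s₁ s₂ P K ∅ P K
  | step {P K F P₁ N P₂ K₂ : Finset (Prism d)} {l : List (Prism d)} :
      F ≠ ∅ → l.Nodup → l.toFinset = F →
      OuterLoop s₁ s₂ K F l P ∅ P₁ N →
      WhileLoop s₁ s₂ P₁ (K ∪ F) N P₂ K₂ →
      WhileLoop s₁ s₂ P K F P₂ K₂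

/-- `OuterLoop s₁ s₂ K F l P N P' N'`: the loop over `Q' ∈ F` with the elements of `l` still to
be visited, entered with the mesh `P` and `F_new = N`, ends with `P'` and `F_new = N'`. -/
inductive OuterLoop (s₁ s₂ : ℝ) :
    Finset (Prism d) → Finset (Prism d) → List (Prism d) →
    Finset (Prism d) → Finset (Prism d) → Finset (Prism d) → Finset (Prism d) → Prop
  | nil {K F P N : Finset (Prism d)} : OuterLoop s₁ s₂ K F [] P N P N
  | cons {K F P N P₁ N₁ P₂ N₂ : Finset (Prism d)} {Q' : Prism d} {l l' : List (Prism d)} :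
      l'.Nodup → l'.toFinset = necessaryRefinements P Q' \ (K ∪ F) →
      InnerLoop s₁ s₂ Q' l' P N P₁ N₁ →
      OuterLoop s₁ s₂ K F l P₁ N₁ P₂ N₂ →
      OuterLoop s₁ s₂ K F (Q' :: l) P N P₂ N₂

/-- `InnerLoop s₁ s₂ Q' l P N P' N'`: the loop over the necessary refinements `Q''` of `Q'` with
the elements of `l` still to be visited. -/
inductive InnerLoop (s₁ s₂ : ℝ) :
    Prism d → List (Prism d) →
    Finset (Prism d) → Finset (Prism d) → Finset (Prism d) → Finset (Prism d) → Prop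
  | nil {Q' : Prism d} {P N : Finset (Prism d)} : InnerLoop s₁ s₂ Q' [] P N P N
  | same {Q' Q'' : Prism d} {l : List (Prism d)} {P N P₂ N₂ : Finset (Prism d)} :
      Q'.level = Q''.level →
      InnerLoop s₁ s₂ Q' l P (N ∪ {Q''}) P₂ N₂ →
      InnerLoop s₁ s₂ Q' (Q'' :: l) P N P₂ N₂
  | recurse {Q' Q'' : Prism d} {l : List (Prism d)} {P N P₁ P₂ N₂ : Finset (Prism d)} :
      Q'.level ≠ Q''.level →
      PatchRefine s₁ s₂ P Q'' P₁ →
      InnerLoop s₁ s₂ Q' l P₁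
        (if Q'' ∈ spaceNeighbours P Q' then
          N ∪ (Q''.atomicSplit s₁ s₂).filter (fun R => R ∈ necessaryRefinements P₁ Q')
        else N) P₂ N₂ →
      InnerLoop s₁ s₂ Q' (Q'' :: l) P N P₂ N₂

end

/-- `P` arises from `P₀` by finitely many applications of `PATCH_REFINE(·, ·, d, s₁, s₂)`. -/
inductive Reachable (s₁ s₂ : ℝ) (P₀ : Finset (Prism d)) : Finset (Prism d) → Prop
  | refl : Reachable s₁ s₂ P₀ P₀
  | step {P P' : Finset (Prism d)} {Q : Prism d} :
      Reachable s₁ s₂ P₀ P → Q ∈ P → PatchRefine s₁ s₂ P Q P' → Reachable s₁ s₂ P₀ P'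

/-- `P` arises from `P₀` by finitely many applications of `ATOMIC_SPLIT(·, d, s₁, s₂)` to single
elements. -/
inductive AtomicReachable (s₁ s₂ : ℝ) (P₀ : Finset (Prism d)) : Finset (Prism d) → Prop
  | refl : AtomicReachable s₁ s₂ P₀ P₀
  | step {P P' : Finset (Prism d)} {Q : Prism d} :
      AtomicReachable s₁ s₂ P₀ P → Q ∈ P →
      (∀ R, R ∈ P' ↔ (R ∈ P ∧ R ≠ Q) ∨ R ∈ Q.atomicSplit s₁ s₂) →
      AtomicReachable s₁ s₂ P₀ P'

open scoped Classical in
/-- The active spatial triangulation at time `t`. -/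
def activeTriangulation (P : Finset (Prism d)) (t : ℝ) : Finset (TaggedSimplex d) :=
  (P.filter fun Q => t ∈ Q.1.carrier).image Prod.snd

/-- Conformity in space. -/
def ConformingInSpace (P : Finset (Prism d)) : Prop :=
  ∀ t, Conforming (activeTriangulation P t)

/-- The `1`-irregular rule in time. -/
def OneIrregularInTime (P : Finset (Prism d)) : Prop :=
  ∀ Q ∈ P, ∀ Q' ∈ P, (closure Q.1.carrier ∩ closure Q'.1.carrier).ncard = 1 →
    affineDim (Q.2.carrier ∩ Q'.2.carrier) = d → Q.level ≤ Q'.level + 1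

/-- The `1`-irregular rule in space, used for `d = 1`. -/
def OneIrregularInSpace (P : Finset (Prism d)) : Prop :=
  ∀ Q ∈ P, ∀ Q' ∈ P, 0 < volume (Q.1.carrier ∩ Q'.1.carrier) →
    (Q.2.carrier ∩ Q'.2.carrier).ncard = 1 → Q.level ≤ Q'.level + 1

/-- `P` arises from `P₀` by atomic splits, and it is conforming in space, `1`-irregular in time
and, if `d = 1`, `1`-irregular in space. -/
structure IsRegularRefinement (s₁ s₂ : ℝ) (P₀ P : Finset (Prism d)) : Prop where
  atomicReachable : AtomicReachable s₁ s₂ P₀ P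
  conformingInSpace : ConformingInSpace P
  oneIrregularInTime : OneIrregularInTime P
  oneIrregularInSpace : d = 1 → OneIrregularInSpace P

end Refinement

/-! ### The initial mesh -/

/-- A bounded Lipschitz domain: a bounded, connected open set which, near every boundary point, is
the strict epigraph of a Lipschitz function over a hyperplane `eᗮ`. -/
structure IsBoundedLipschitzDomain {d : ℕ} (Ω : Set (Space d)) : Prop where
  isOpen : IsOpen Ω
  isBounded : Bornology.IsBounded Ω
  isConnected : IsConnected Ω
  lipschitz : ∀ p ∈ frontier Ω, ∃ (e : Space d) (g : Space d → ℝ) (L : NNReal) (r : ℝ),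
    ‖e‖ = 1 ∧ LipschitzWith L g ∧ 0 < r ∧
    ∀ x ∈ Metric.ball p r, x ∈ Ω ↔ g (x - inner ℝ e x • e) < inner ℝ e x

/-- The data of a tensor product initial mesh: a bounded polyhedral Lipschitz domain `Ω` with a
well-labeled conforming triangulation of (the closure of) `Ω` into nondegenerate closed simplices,
and a partition `0 = t₀ < t₁ < … < t_N = T` of the time interval. -/
structure InitialMesh (d : ℕ) where
  Ω : Set (Space d)
  domain : IsBoundedLipschitzDomain Ω
  triangulation : Finset (TaggedSimplex d)
  level_eq_zero : ∀ S ∈ triangulation, S.level = 0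
  nondegenerate : ∀ S ∈ triangulation, AffineIndependent ℝ S.vertex
  cover : ⋃ S ∈ triangulation, S.carrier = closure Ω
  conforming : Conforming triangulation
  wellLabeled : WellLabeled triangulation
  N : ℕ
  N_pos : 0 < N
  time : Fin (N + 1) → ℝ
  time_strictMono : StrictMono time
  time_zero : time 0 = 0

namespace InitialMesh

variable {d : ℕ} (M : InitialMesh d)

/-- The final time `T = t_N`. -/
def T : ℝ := M.time (Fin.last M.N)

/-- The space-time cylinder. -/
def cylinder : Set (ℝ × Space d) := Icc 0 M.T ×ˢ closure M.Ω

open scoped Classical in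
/-- The intervals `[t_i, t_{i+1})`, the last one being closed. -/
def intervals : Finset TimeInterval :=
  Finset.univ.image fun i : Fin M.N =>
    ⟨M.time i.castSucc, M.time i.succ, decide ((i : ℕ) + 1 = M.N)⟩

/-- The tensor product mesh `P₀`. -/
def mesh : Finset (Prism d) := M.intervals ×ˢ M.triangulation

/-- The shape regularity constant `κ` of `P₀`. -/
def kappa : ℝ := ⨆ Q : M.mesh, (Q : Prism d).2.shapeConstant

/-- The maximal interval length in `P₀`. -/
def mu₁ : ℝ := ⨆ Q : M.mesh, volume.real (Q : Prism d).1.carrier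

/-- The minimal interval length in `P₀`. -/
def mu₂ : ℝ := ⨅ Q : M.mesh, volume.real (Q : Prism d).1.carrier

/-- The maximal simplex volume in `P₀`. -/
def mu₃ : ℝ := ⨆ Q : M.mesh, volume.real (Q : Prism d).2.carrier

/-- The minimal simplex volume in `P₀`. -/
def mu₄ : ℝ := ⨅ Q : M.mesh, volume.real (Q : Prism d).2.carrier

end InitialMesh

/-! ### Neighbourhoods, finite elements, nodes -/

section FiniteElements

variable {d : ℕ}

/-- The neighbourhood of `Q` in `P`. -/
def neighbourhood (P : Finset (Prism d)) (Q : Prism d) : Set (Prism d) :=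
  {Q' | Q' ∈ P ∧ (closure Q.carrier ∩ closure Q'.carrier).Nonempty}

/-- The extended neighbourhood of degree `j` of `Q` in `P`; degree `1` is `neighbourhood P Q`. -/
def extendedNeighbourhood (P : Finset (Prism d)) (Q : Prism d) : ℕ → Set (Prism d)
  | 0 => {Q}
  | j + 1 => {Q' | ∃ Q'' ∈ extendedNeighbourhood P Q j, Q' ∈ neighbourhood P Q''}

/-- `F` agrees on `D` with an anisotropic polynomial of temporal order `r₁` and spatial order `r₂`
(i.e. degrees `< r₁` and `< r₂`). -/
def IsAnisoPolyOn (r₁ r₂ : ℕ) (D : Set (ℝ × Space d)) (F : ℝ × Space d → ℝ) : Prop :=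
  ∃ p : Fin r₁ → MvPolynomial (Fin d) ℝ, (∀ i, (p i).totalDegree < r₂) ∧
    ∀ z ∈ D, F z = ∑ i : Fin r₁, z.1 ^ (i : ℕ) * MvPolynomial.eval (fun k => z.2 k) (p i)

/-- Continuous anisotropic finite elements on the cylinder `ΩT`; a function on `ΩT` is represented
by its extension by zero. -/
structure IsFiniteElement (ΩT : Set (ℝ × Space d)) (P : Finset (Prism d)) (r₁ r₂ : ℕ)
    (F : ℝ × Space d → ℝ) : Prop where
  continuousOn : ContinuousOn F ΩT
  poly : ∀ Q ∈ P, IsAnisoPolyOn r₁ r₂ Q.carrier F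
  zero_off : ∀ z ∉ ΩT, F z = 0

/-- All local degrees of freedom. -/
def allNodes (P : Finset (Prism d)) (r₁ r₂ : ℕ) : Set (ℝ × Space d) :=
  ⋃ Q ∈ P, Q.nodes r₁ r₂

/-- The hanging nodes. -/
def hangingNodes (P : Finset (Prism d)) (r₁ r₂ : ℕ) : Set (ℝ × Space d) :=
  {ν | ν ∈ allNodes P r₁ r₂ ∧ ∃ Q ∈ P, ν ∈ closure Q.carrier ∧ ν ∉ Q.nodes r₁ r₂}

/-- The free nodes. -/
def freeNodes (P : Finset (Prism d)) (r₁ r₂ : ℕ) : Set (ℝ × Space d) :=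
  allNodes P r₁ r₂ \ hangingNodes P r₁ r₂

open scoped Classical in
/-- `φ` is the nodal basis function of the free node `ν`. -/
structure IsNodalBasisFunction (ΩT : Set (ℝ × Space d)) (P : Finset (Prism d)) (r₁ r₂ : ℕ)
    (ν : ℝ × Space d) (φ : ℝ × Space d → ℝ) : Prop where
  isFiniteElement : IsFiniteElement ΩT P r₁ r₂ φ
  nodal : ∀ ν' ∈ freeNodes P r₁ r₂, φ ν' = if ν' = ν then 1 else 0

end FiniteElements

/-- The degree of the extended neighbourhood: `j(1) = 2` and `j(d) = 3` for `d ≥ 2`. -/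
def supportDegree (d : ℕ) : ℕ := if d = 1 then 2 else 3

end

end SpaceTimeMesh

/-!
Newest vertex bisection generates a forest of simplices over the initial triangulation. Adjacent
simplices of the same level remain compatible under bisection (`forest_matched`): they are reflected
neighbours, or their children at the common hyperface are. It follows that adjacent simplices of the
same level have a common refinement edge as soon as one of the edges lies in the common hyperface
(`InForest.sameEdge`), and that in dimension `d ≥ 2` the levels of any two adjacent simplices differ
by at most one (`Adjacent.level_le_succ`). Every mesh that arises by atomic splits consists of prisms
over this forest, and its simplices at a fixed time form a cut through the forest (`MeshInv`).
Statements on the star of a point are obtained by walking through adjacent simplices. This is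
possible since faces of codimension two do not separate a Lipschitz domain locally
(`exists_adjacent_of_star`).

The patch refinement preserves conformity in space and one-irregularity in time
(`PatchRefine.patchGoal`, `Reachable.regular`). The elements that it collects have the same time
interval and the same refinement edge, and they contain all their necessary refinements of
neighbours. Therefore they form the whole star of the midpoint of this edge
(`Regular.mem_of_mid_mem`), and such a star can be split without violating the conditions
(`Regular.split_star`). The delicate point of the induction is that a recursive call may split
several neighbours of an element at the same time; their new parts are still found, since each of
them is a neighbour of a part that has been collected (`Regular.exists_nbr_of_joint_split`).

For the first claim, suppose that the nodal basis function `φ` of `ν` does not vanish at some point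
of a prism. A polynomial on a prism is determined by its values at the nodes, separately in space
and in time, so `φ` does not vanish at a node of the prism. If this node is free, it is `ν`. If it
hangs since it is not a node of some simplex `S` touching it, then across the time interface all
simplices that overlap `S` are finer than `S`, so that all nodes of `S` are nodes of every touching
simplex (`MeshInv.nodes_of_hanging_in_space`), and one of them is a node with `φ ≠ 0` that hangs at
most in time.
If a node hangs only in time, then all nodes on the temporal edge through it of a touching prism of
minimal level are free (`MeshInv.nodes_of_hanging_in_time`), and `φ` does not vanish at one of them,
which has to be `ν`. This bounds the number of steps from the prism to a prism with the node `ν`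
(`MeshInv.mem_extendedNeighbourhood`).

For the second claim, simplices of level `n` have diameters bounded by a multiple of `2 ^ (-n / d)`
(`InForest.dist_pow_le`, by a monotone combination of the lengths of two polygonal paths) and volumes
bounded below by a multiple of `2 ^ (-n)` (`InForest.volume_ge`). So the stars have a bounded number
of elements (`card_star_le`). As the levels in a star leave no gaps, the levels of touching prisms
differ by a bounded amount (`Regular.level_le_of_touch`). Hence the support lies in a box whose
volume is comparable to that of every prism in the support (`Regular.volume_tsupport_le`).
-/

namespace SpaceTimeMesh

/-! ### Faces and halves of a simplex given by its vertex set -/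

section Hull

variable {E : Type*} [AddCommGroup E] [Module ℝ E]

open scoped Classical in
/-- The vertex set of the half containing `e` of the simplex with vertex set `V`, bisected at the
midpoint of its edge `e e'`. -/
noncomputable def halfVerts (V : Finset E) (e e' : E) : Finset E :=
  insert (midpoint ℝ e e') (V.erase e')

theorem mem_halfVerts {V : Finset E} {e e' v : E} :
    v ∈ halfVerts V e e' ↔ v = midpoint ℝ e e' ∨ (v ≠ e' ∧ v ∈ V) := by
  classical
  rw [halfVerts, Finset.mem_insert, Finset.mem_erase]

theorem affineIndependent_coe_iff {V : Finset E} :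
    AffineIndependent ℝ ((↑) : V → E) ↔
      ∀ w : E → ℝ, ∑ v ∈ V, w v = 0 → ∑ v ∈ V, w v • v = 0 → ∀ v ∈ V, w v = 0 := by
  classical
  rw [affineIndependent_iff_of_fintype]
  constructor
  · intro h w h0 h1 v hv
    have := h (fun x => w x) (by rw [← h0]; exact Finset.sum_coe_sort V w) (by
      rw [Finset.univ.weightedVSub_eq_linear_combination (w := fun x : V => w x)
        (by rw [← h0]; exact Finset.sum_coe_sort V w), ← h1]
      exact Finset.sum_coe_sort V fun v => w v • v) ⟨v, hv⟩
    exact this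
  · intro h w h0 h1 i
    rw [Finset.univ.weightedVSub_eq_linear_combination h0] at h1
    have key := h (fun v => if hv : v ∈ V then w ⟨v, hv⟩ else 0) (by
      rw [← h0, ← Finset.sum_coe_sort V]; simp) (by
      rw [← h1, ← Finset.sum_coe_sort V]; simp) i i.2
    simpa using key

theorem weights_unique {V : Finset E} (hV : AffineIndependent ℝ ((↑) : V → E)) {a b : E → ℝ}
    (h0 : ∑ v ∈ V, a v = ∑ v ∈ V, b v) (h1 : ∑ v ∈ V, a v • v = ∑ v ∈ V, b v • v) :
    ∀ v ∈ V, a v = b v := by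
  intro v hv
  have := affineIndependent_coe_iff.1 hV (fun v => a v - b v) (by simp [h0])
    (by simp [sub_smul, h1]) v hv
  linarith

theorem affineIndependent_subset {V W : Finset E} (hV : AffineIndependent ℝ ((↑) : V → E))
    (h : W ⊆ V) : AffineIndependent ℝ ((↑) : W → E) :=
  AffineIndependent.mono (s := (W : Set E)) (t := (V : Set E)) hV (by exact_mod_cast h)

theorem mem_hull_face {V W : Finset E} (hV : AffineIndependent ℝ ((↑) : V → E)) (hW : W ⊆ V)
    {a : E → ℝ} (ha : ∑ v ∈ V, a v = 1) :
    ∑ v ∈ V, a v • v ∈ convexHull ℝ (W : Set E) ↔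
      ∀ v ∈ V, 0 ≤ a v ∧ (v ∉ W → a v = 0) := by
  classical
  rw [Finset.mem_convexHull']
  constructor
  · rintro ⟨b, hb0, hb1, hb⟩
    have key := weights_unique hV (a := a) (b := fun v => if v ∈ W then b v else 0)
      (by rw [ha, Finset.sum_ite_mem, Finset.inter_eq_right.2 hW, hb1])
      (by simp only [ite_smul, zero_smul]
          rw [Finset.sum_ite_mem, Finset.inter_eq_right.2 hW, hb])
    intro v hv
    rw [key v hv]
    by_cases h : v ∈ W
    · simp [h, hb0 v h]
    · simp [h]
  · intro h
    refine ⟨a, fun v hv => (h v (hW hv)).1, ?_, ?_⟩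
    · rw [← ha]
      exact Finset.sum_subset hW fun v hv hv' => (h v hv).2 hv'
    · exact Finset.sum_subset hW fun v hv hv' => by rw [(h v hv).2 hv', zero_smul]

theorem exists_weights {V : Finset E} {y : E} (hy : y ∈ convexHull ℝ (V : Set E)) :
    ∃ a : E → ℝ, (∀ v ∈ V, 0 ≤ a v) ∧ ∑ v ∈ V, a v = 1 ∧ y = ∑ v ∈ V, a v • v := by
  obtain ⟨a, h0, h1, h2⟩ := Finset.mem_convexHull'.1 hy
  exact ⟨a, h0, h1, h2.symm⟩

theorem midpoint_eq_half (e e' : E) : midpoint ℝ e e' = (1 / 2 : ℝ) • e + (1 / 2 : ℝ) • e' := by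
  rw [midpoint_eq_smul_add, smul_add]
  norm_num

theorem midpoint_notMem {V : Finset E} (hV : AffineIndependent ℝ ((↑) : V → E)) {e e' : E}
    (he : e ∈ V) (he' : e' ∈ V) (hne : e ≠ e') : midpoint ℝ e e' ∉ V := by
  classical
  intro hm
  have key := weights_unique hV (a := fun v => if v = midpoint ℝ e e' then 1 else 0)
    (b := fun v => (if v = e then 1 / 2 else 0) + if v = e' then 1 / 2 else 0)
    (by simp only [Finset.sum_add_distrib, Finset.sum_ite_eq', hm, he, he', if_true]; norm_num)
    (by simp only [Finset.sum_add_distrib, add_smul, ite_smul, zero_smul, Finset.sum_ite_eq', hm,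
          he, he', if_true, one_smul, ← midpoint_eq_half]) _ hm
  have h1 : midpoint ℝ e e' ≠ e := fun h => hne ((midpoint_eq_left_iff (R := ℝ)).1 h)
  have h2 : midpoint ℝ e e' ≠ e' := fun h => hne ((midpoint_eq_right_iff (R := ℝ)).1 h)
  simp [h1, h2] at key

open scoped Classical in
/-- Rewriting a combination of the vertices of a half in terms of the vertices of the simplex. -/
theorem sum_halfVerts {V : Finset E} {e e' : E} (hm : midpoint ℝ e e' ∉ V)
    (he : e ∈ V) (he' : e' ∈ V) (hne : e ≠ e') {M : Type*} [AddCommGroup M] [Module ℝ M]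
    (b : E → ℝ) (f : E → M) (hf : f (midpoint ℝ e e') = (1 / 2 : ℝ) • f e + (1 / 2 : ℝ) • f e') :
    ∑ v ∈ halfVerts V e e', b v • f v =
      ∑ v ∈ V, (if v = e' then b (midpoint ℝ e e') / 2
        else if v = e then b e + b (midpoint ℝ e e') / 2 else b v) • f v := by
  set m := midpoint ℝ e e'
  rw [halfVerts, Finset.sum_insert (fun h => hm (Finset.mem_of_mem_erase h)),
    ← Finset.add_sum_erase V _ he', if_pos rfl, hf,
    ← Finset.add_sum_erase (V.erase e') _ (Finset.mem_erase.2 ⟨hne, he⟩),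
    ← Finset.add_sum_erase (V.erase e') (fun v => (if v = e' then b m / 2
      else if v = e then b e + b m / 2 else b v) • f v) (Finset.mem_erase.2 ⟨hne, he⟩),
    if_neg hne, if_pos rfl]
  have : ∑ v ∈ (V.erase e').erase e, (if v = e' then b m / 2
      else if v = e then b e + b m / 2 else b v) • f v =
      ∑ v ∈ (V.erase e').erase e, b v • f v := by
    refine Finset.sum_congr rfl fun v hv => ?_
    simp only [Finset.mem_erase] at hv
    rw [if_neg hv.2.1, if_neg hv.1]
  rw [this]
  module

theorem sum_halfVerts_coeff {V : Finset E} {e e' : E} (hm : midpoint ℝ e e' ∉ V)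
    (he : e ∈ V) (he' : e' ∈ V) (hne : e ≠ e') (b : E → ℝ) [DecidableEq E] :
    ∑ v ∈ halfVerts V e e', b v =
      ∑ v ∈ V, (if v = e' then b (midpoint ℝ e e') / 2
        else if v = e then b e + b (midpoint ℝ e e') / 2 else b v) := by
  have := sum_halfVerts hm he he' hne b (fun _ => (1 : ℝ)) (by norm_num)
  simp only [smul_eq_mul, mul_one] at this
  convert this

theorem halfVerts_affineIndependent {V : Finset E} (hV : AffineIndependent ℝ ((↑) : V → E))
    {e e' : E} (he : e ∈ V) (he' : e' ∈ V) (hne : e ≠ e') :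
    AffineIndependent ℝ ((↑) : halfVerts V e e' → E) := by
  classical
  have hm := midpoint_notMem hV he he' hne
  rw [affineIndependent_coe_iff] at hV ⊢
  intro w h0 h1
  rw [sum_halfVerts_coeff hm he he' hne] at h0
  have h2 := sum_halfVerts hm he he' hne w id (midpoint_eq_half e e')
  simp only [id] at h2
  rw [h2] at h1
  have key := hV _ h0 h1
  have k1 := key e' he'
  have k2 := key e he
  simp only [if_true, if_neg hne] at k1 k2
  intro v hv
  simp only [halfVerts, Finset.mem_insert, Finset.mem_erase] at hv
  rcases hv with rfl | ⟨hv, hv'⟩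
  · linarith
  · by_cases h : v = e
    · subst h; linarith
    · simpa [h, hv] using key v hv'

theorem card_halfVerts {V : Finset E} (hV : AffineIndependent ℝ ((↑) : V → E))
    {e e' : E} (he : e ∈ V) (he' : e' ∈ V) (hne : e ≠ e') :
    (halfVerts V e e').card = V.card := by
  classical
  have hm := midpoint_notMem hV he he' hne
  rw [halfVerts, Finset.card_insert_of_notMem (fun h => hm (Finset.mem_of_mem_erase h)),
    Finset.card_erase_add_one he']

/-- In barycentric coordinates, the half of a simplex that contains `e` consists of the points whose
coordinate at `e` is at least that at `e'`. -/
theorem mem_hull_half {V : Finset E} (hV : AffineIndependent ℝ ((↑) : V → E))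
    {e e' : E} (he : e ∈ V) (he' : e' ∈ V) (hne : e ≠ e') {a : E → ℝ} (ha : ∑ v ∈ V, a v = 1) :
    ∑ v ∈ V, a v • v ∈ convexHull ℝ (halfVerts V e e' : Set E) ↔
      (∀ v ∈ V, 0 ≤ a v) ∧ a e' ≤ a e := by
  classical
  have hm := midpoint_notMem hV he he' hne
  have hme : ∀ v ∈ V, v ≠ midpoint ℝ e e' := fun v hv h => hm (h ▸ hv)
  rw [Finset.mem_convexHull']
  constructor
  · rintro ⟨b, hb0, hb1, hb⟩
    rw [sum_halfVerts_coeff hm he he' hne] at hb1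
    have hb2 := sum_halfVerts hm he he' hne b id (midpoint_eq_half e e')
    simp only [id] at hb2
    rw [hb2] at hb
    have key := weights_unique hV (ha.trans hb1.symm) hb.symm
    have hbm := hb0 (midpoint ℝ e e') (Finset.mem_insert_self _ _)
    have hbe := hb0 e (Finset.mem_insert_of_mem (Finset.mem_erase.2 ⟨hne, he⟩))
    have k1 := key e' he'
    have k2 := key e he
    simp only [if_true, if_neg hne] at k1 k2
    refine ⟨fun v hv => ?_, by linarith⟩
    rw [key v hv]
    split_ifs with h1 h2
    · linarith
    · linarith
    · exact hb0 v (Finset.mem_insert_of_mem (Finset.mem_erase.2 ⟨h1, hv⟩))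
  · rintro ⟨h0, h1⟩
    -- shift the weight of `e'`, together with an equal part of that of `e`, to the midpoint
    set b : E → ℝ := fun v => if v = midpoint ℝ e e' then 2 * a e'
      else if v = e then a e - a e' else a v with hb
    have hbv : ∀ v ∈ V, (if v = e' then b (midpoint ℝ e e') / 2
        else if v = e then b e + b (midpoint ℝ e e') / 2 else b v) = a v := by
      intro v hv
      simp only [hb, if_true, if_neg (hme v hv), if_neg (hme e he)]
      split_ifs with h2 h3
      · subst h2; ring
      · subst h3; ring
      · rfl
    refine ⟨b, fun v hv => ?_, ?_, ?_⟩
    · simp only [hb]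
      split_ifs with h2 h3
      · linarith [h0 e' he']
      · linarith
      · simp only [halfVerts, Finset.mem_insert, Finset.mem_erase, h2, false_or] at hv
        exact h0 v hv.2
    · rw [sum_halfVerts_coeff hm he he' hne, ← ha]
      exact Finset.sum_congr rfl hbv
    · have := sum_halfVerts hm he he' hne b id (midpoint_eq_half e e')
      simp only [id] at this
      rw [this]
      exact Finset.sum_congr rfl fun v hv => by rw [hbv v hv]

theorem halfVerts_hull_subset {V : Finset E} {e e' : E} (he : e ∈ V) (he' : e' ∈ V) :
    convexHull ℝ (halfVerts V e e' : Set E) ⊆ convexHull ℝ (V : Set E) := by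
  classical
  refine convexHull_min (fun v hv => ?_) (convex_convexHull ℝ _)
  simp only [halfVerts, Finset.coe_insert, Finset.coe_erase, mem_insert_iff, mem_sdiff,
    Finset.mem_coe] at hv
  rcases hv with rfl | ⟨hv, -⟩
  · exact (convex_convexHull ℝ _).midpoint_mem (subset_convexHull ℝ _ he)
      (subset_convexHull ℝ _ he')
  · exact subset_convexHull ℝ _ hv

theorem hull_eq_union_halves {V : Finset E} (hV : AffineIndependent ℝ ((↑) : V → E))
    {e e' : E} (he : e ∈ V) (he' : e' ∈ V) (hne : e ≠ e') :
    convexHull ℝ (V : Set E) =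
      convexHull ℝ (halfVerts V e e' : Set E) ∪ convexHull ℝ (halfVerts V e' e : Set E) := by
  refine Subset.antisymm (fun y hy => ?_)
    (union_subset (halfVerts_hull_subset he he') (halfVerts_hull_subset he' he))
  obtain ⟨a, h0, h1, rfl⟩ := exists_weights hy
  rw [mem_union, mem_hull_half hV he he' hne h1, mem_hull_half hV he' he hne.symm h1]
  rcases le_total (a e') (a e) with h | h
  · exact Or.inl ⟨h0, h⟩
  · exact Or.inr ⟨h0, h⟩

/-- A face without the edge `e e'` meets a half of the simplex in a face of both. -/
theorem hull_inter_half_of_notMem [DecidableEq E] {V W : Finset E} (hV : AffineIndependent ℝ ((↑) : V → E))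
    (hW : W ⊆ V) {e e' : E} (he : e ∈ V) (he' : e' ∈ V) (hne : e ≠ e') (h : e ∉ W ∨ e' ∉ W) :
    convexHull ℝ (W : Set E) ∩ convexHull ℝ (halfVerts V e e' : Set E) =
      convexHull ℝ (W.erase e' : Finset E) := by
  have hsub : W.erase e' ⊆ halfVerts V e e' := fun v hv =>
    mem_halfVerts.2 (Or.inr ⟨(Finset.mem_erase.1 hv).1, hW (Finset.mem_erase.1 hv).2⟩)
  refine Subset.antisymm ?_ (subset_inter (convexHull_mono (by
    exact_mod_cast Finset.erase_subset _ _)) (convexHull_mono (by exact_mod_cast hsub)))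
  rintro y ⟨hy, hy'⟩
  obtain ⟨a, h0, h1, rfl⟩ := exists_weights (convexHull_mono (by exact_mod_cast hW) hy)
  rw [mem_hull_face hV hW h1] at hy
  rw [mem_hull_half hV he he' hne h1] at hy'
  rw [mem_hull_face hV ((Finset.erase_subset _ _).trans hW) h1]
  refine fun v hv => ⟨h0 v hv, fun hvW => ?_⟩
  by_cases hvW' : v ∈ W
  · have hve : v = e' := by by_contra hc; exact hvW (Finset.mem_erase.2 ⟨hc, hvW'⟩)
    subst hve
    rcases h with h | h
    · have := (hy e he).2 h
      linarith [h0 v hv]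
    · exact absurd hvW' h
  · exact (hy v hv).2 hvW'

/-- A face containing the edge `e e'` meets a half of the simplex in the half of the face. -/
theorem hull_inter_half_of_mem {V W : Finset E} (hV : AffineIndependent ℝ ((↑) : V → E))
    (hW : W ⊆ V) {e e' : E} (he : e ∈ W) (he' : e' ∈ W) (hne : e ≠ e') :
    convexHull ℝ (W : Set E) ∩ convexHull ℝ (halfVerts V e e' : Set E) =
      convexHull ℝ (halfVerts W e e' : Set E) := by
  classical
  refine Subset.antisymm ?_ (subset_inter (halfVerts_hull_subset he he') (convexHull_mono (by
    exact_mod_cast Finset.insert_subset_insert _ (Finset.erase_subset_erase _ hW))))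
  rintro y ⟨hy, hy'⟩
  have hyW := hy
  obtain ⟨b, hb0, hb1, hb⟩ := exists_weights hyW
  obtain ⟨a, h0, h1, rfl⟩ := exists_weights (convexHull_mono (by exact_mod_cast hW) hy)
  rw [mem_hull_face hV hW h1] at hy
  rw [mem_hull_half hV (hW he) (hW he') hne h1] at hy'
  have hs : ∑ v ∈ V, a v • v = ∑ v ∈ W, a v • v :=
    (Finset.sum_subset hW fun v hv hv' => by rw [(hy v hv).2 hv', zero_smul]).symm
  have hs1 : ∑ v ∈ W, a v = 1 := by
    rw [← h1]; exact Finset.sum_subset hW fun v hv hv' => (hy v hv).2 hv'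
  rw [hs, mem_hull_half (affineIndependent_subset hV hW) he he' hne hs1]
  exact ⟨fun v hv => h0 v (hW hv), hy'.2⟩

/-- The two halves of a simplex meet in a common hyperface. -/
theorem half_inter_half [DecidableEq E] {V : Finset E} (hV : AffineIndependent ℝ ((↑) : V → E))
    {e e' : E} (he : e ∈ V) (he' : e' ∈ V) (hne : e ≠ e') :
    convexHull ℝ (halfVerts V e e' : Set E) ∩ convexHull ℝ (halfVerts V e' e : Set E) =
      convexHull ℝ (halfVerts V e e' ∩ halfVerts V e' e : Finset E) := by
  refine Subset.antisymm ?_ (subset_inter (convexHull_mono (by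
    exact_mod_cast Finset.inter_subset_left)) (convexHull_mono (by
    exact_mod_cast Finset.inter_subset_right)))
  rintro y ⟨hy, hy'⟩
  obtain ⟨a, h0, h1, rfl⟩ := exists_weights (halfVerts_hull_subset he he' hy)
  have hh := (mem_hull_half hV he he' hne h1).1 hy
  have hh' := (mem_hull_half hV he' he hne.symm h1).1 hy'
  have hm := midpoint_notMem hV he he' hne
  have hme : ∀ v ∈ V, v ≠ midpoint ℝ e e' := fun v hv h => hm (h ▸ hv)
  -- on the common hyperface the whole weight of `e` and `e'` is shifted to the midpoint
  have heq : a e = a e' := le_antisymm hh'.2 hh.2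
  set b : E → ℝ := fun v => if v = midpoint ℝ e e' then 2 * a e'
      else if v = e then 0 else a v with hb
  have hbv : ∀ v ∈ V, (if v = e' then b (midpoint ℝ e e') / 2
        else if v = e then b e + b (midpoint ℝ e e') / 2 else b v) = a v := by
    intro v hv
    simp only [hb, if_true, if_neg (hme v hv), if_neg (hme e he)]
    split_ifs with h2 h3
    · subst h2; ring
    · subst h3; linarith
    · rfl
  have hb1 : ∑ v ∈ halfVerts V e e', b v = 1 := by
    rw [sum_halfVerts_coeff hm he he' hne, ← h1]
    exact Finset.sum_congr rfl fun v hv => hbv v hv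
  have hb2 : ∑ v ∈ V, a v • v = ∑ v ∈ halfVerts V e e', b v • v := by
    have := sum_halfVerts hm he he' hne b id (midpoint_eq_half e e')
    simp only [id] at this
    rw [this]
    refine Finset.sum_congr rfl fun v hv => ?_
    rw [← hbv v hv]
    congr!
  rw [hb2, mem_hull_face (halfVerts_affineIndependent hV he he' hne) Finset.inter_subset_left hb1]
  intro v hv
  constructor
  · simp only [hb]
    split_ifs with h2 h3
    · linarith [h0 e' he']
    · rfl
    · simp only [mem_halfVerts, h2, false_or] at hv
      exact h0 v hv.2
  · intro hv'
    have hv2 := hv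
    simp only [mem_halfVerts] at hv2
    have hne' : v ≠ midpoint ℝ e e' := by
      rintro rfl
      refine hv' (Finset.mem_inter.2 ⟨hv, ?_⟩)
      rw [midpoint_comm]
      exact mem_halfVerts.2 (Or.inl rfl)
    simp only [hne', false_or] at hv2
    have hve : v = e := by
      by_contra hc
      exact hv' (Finset.mem_inter.2 ⟨hv, mem_halfVerts.2 (Or.inr ⟨hc, hv2.2⟩)⟩)
    simp [hb, hve, fun h => hne h]

theorem mem_of_vertex_mem_hull {V W : Finset E} (hV : AffineIndependent ℝ ((↑) : V → E))
    (hW : W ⊆ V) {v : E} (hv : v ∈ V) (h : v ∈ convexHull ℝ (W : Set E)) : v ∈ W := by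
  classical
  have hs : ∑ u ∈ V, (if u = v then (1 : ℝ) else 0) = 1 := by simp [hv]
  have hs' : ∑ u ∈ V, (if u = v then (1 : ℝ) else 0) • u = v := by simp [hv]
  rw [← hs', mem_hull_face hV hW hs] at h
  by_contra hc
  simpa using (h v hv).2 hc

/-- A face containing the midpoint of an edge contains the edge. -/
theorem edge_subset_of_midpoint_mem {V W : Finset E} (hV : AffineIndependent ℝ ((↑) : V → E))
    (hW : W ⊆ V) {e e' : E} (he : e ∈ V) (he' : e' ∈ V) (hne : e ≠ e')
    (h : midpoint ℝ e e' ∈ convexHull ℝ (W : Set E)) : e ∈ W ∧ e' ∈ W := by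
  classical
  set b : E → ℝ := fun v => (if v = e then 1 / 2 else 0) + if v = e' then 1 / 2 else 0 with hb
  have hs : ∑ u ∈ V, b u = 1 := by
    simp only [hb, Finset.sum_add_distrib, Finset.sum_ite_eq', he, he', if_true]; norm_num
  have hs' : ∑ u ∈ V, b u • u = midpoint ℝ e e' := by
    simp only [hb, Finset.sum_add_distrib, add_smul, ite_smul, zero_smul, Finset.sum_ite_eq',
          he, he', if_true, ← midpoint_eq_half]
  rw [← hs', mem_hull_face hV hW hs] at h
  constructor
  · by_contra hc
    have := (h e he).2 hc
    simp [hb, hne] at this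
  · by_contra hc
    have := (h e' he').2 hc
    simp [hb, hne.symm] at this

/-! ### Lattice nodes of a simplex given by its vertex set -/

/-- The Lagrange nodes of order `r` of the simplex with vertex set `V`. -/
def latticeNodes (r : ℕ) (V : Finset E) : Set E :=
  {x | ∃ β : E → ℕ, ∑ v ∈ V, β v = r - 1 ∧ x = ∑ v ∈ V, ((β v : ℝ) / ((r : ℝ) - 1)) • v}

theorem sum_lattice_weights {ι : Type*} {r : ℕ} (hr : 2 ≤ r) {V : Finset ι} {β : ι → ℕ}
    (h : ∑ v ∈ V, β v = r - 1) : ∑ v ∈ V, (β v : ℝ) / ((r : ℝ) - 1) = 1 := by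
  have h2 : (2 : ℝ) ≤ r := by exact_mod_cast hr
  rw [← Finset.sum_div, ← Nat.cast_sum, h, Nat.cast_sub (by omega), Nat.cast_one, div_self]
  linarith

theorem latticeNodes_subset_hull {r : ℕ} (hr : 2 ≤ r) {V : Finset E} :
    latticeNodes r V ⊆ convexHull ℝ (V : Set E) := by
  have h2 : (2 : ℝ) ≤ r := by exact_mod_cast hr
  rintro x ⟨β, hβ, rfl⟩
  refine Finset.mem_convexHull'.2 ⟨fun v => (β v : ℝ) / ((r : ℝ) - 1), fun v _ => ?_,
    sum_lattice_weights hr hβ, rfl⟩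
  exact div_nonneg (Nat.cast_nonneg _) (by linarith)

theorem latticeNodes_mono {r : ℕ} {V W : Finset E} (hW : W ⊆ V) :
    latticeNodes r W ⊆ latticeNodes r V := by
  classical
  rintro x ⟨β, hβ, rfl⟩
  refine ⟨fun v => if v ∈ W then β v else 0, ?_, ?_⟩
  · rw [Finset.sum_ite_mem, Finset.inter_eq_right.2 hW, hβ]
  · symm
    rw [← Finset.sum_subset hW]
    · exact Finset.sum_congr rfl fun v hv => by simp [hv]
    · intro v _ hv; simp [hv]

/-- The nodes of a simplex that lie on a face are nodes of the face. -/
theorem latticeNodes_face {r : ℕ} (hr : 2 ≤ r) {V W : Finset E}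
    (hV : AffineIndependent ℝ ((↑) : V → E)) (hW : W ⊆ V) {x : E}
    (hx : x ∈ convexHull ℝ (W : Set E)) (h : x ∈ latticeNodes r V) : x ∈ latticeNodes r W := by
  have h2 : (2 : ℝ) ≤ r := by exact_mod_cast hr
  obtain ⟨β, hβ, rfl⟩ := h
  rw [mem_hull_face hV hW (sum_lattice_weights hr hβ)] at hx
  have hz : ∀ v ∈ V, v ∉ W → β v = 0 := by
    intro v hv hvW
    have := (hx v hv).2 hvW
    rw [div_eq_zero_iff] at this
    rcases this with h | h
    · exact_mod_cast h
    · linarith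
  refine ⟨β, ?_, ?_⟩
  · rw [← hβ]; exact Finset.sum_subset hW hz
  · symm
    exact Finset.sum_subset hW fun v hv hv' => by rw [hz v hv hv']; simp

/-- The nodes of a simplex that lie in one of its halves are nodes of the half. -/
theorem latticeNodes_half {r : ℕ} (hr : 2 ≤ r) {V : Finset E}
    (hV : AffineIndependent ℝ ((↑) : V → E)) {e e' : E} (he : e ∈ V) (he' : e' ∈ V) (hne : e ≠ e')
    {x : E} (hx : x ∈ convexHull ℝ (halfVerts V e e' : Set E)) (h : x ∈ latticeNodes r V) :
    x ∈ latticeNodes r (halfVerts V e e') := by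
  classical
  have h2 : (2 : ℝ) ≤ r := by exact_mod_cast hr
  have hr0 : (0 : ℝ) < (r : ℝ) - 1 := by linarith
  obtain ⟨β, hβ, rfl⟩ := h
  rw [mem_hull_half hV he he' hne (sum_lattice_weights hr hβ)] at hx
  have hle : β e' ≤ β e := by
    have := hx.2
    rw [div_le_div_iff_of_pos_right hr0] at this
    exact_mod_cast this
  have hm := midpoint_notMem hV he he' hne
  have hme : ∀ v ∈ V, v ≠ midpoint ℝ e e' := fun v hv h => hm (h ▸ hv)
  -- the weights of the half are again integers: the midpoint receives `2 * β e'`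
  set β' : E → ℕ := fun v => if v = midpoint ℝ e e' then 2 * β e'
      else if v = e then β e - β e' else β v with hb
  have hbv : ∀ v ∈ V, (if v = e' then ((β' (midpoint ℝ e e') : ℝ) / ((r : ℝ) - 1)) / 2
        else if v = e then (β' e : ℝ) / ((r : ℝ) - 1) +
          ((β' (midpoint ℝ e e') : ℝ) / ((r : ℝ) - 1)) / 2
        else (β' v : ℝ) / ((r : ℝ) - 1)) = (β v : ℝ) / ((r : ℝ) - 1) := by
    intro v hv
    simp only [hb, if_true, if_neg (hme v hv), if_neg (hme e he)]
    split_ifs with h2 h3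
    · subst h2; push_cast; ring
    · subst h3; push_cast [Nat.cast_sub hle]; ring
    · rfl
  refine ⟨β', ?_, ?_⟩
  · have h3 : ∑ v ∈ halfVerts V e e', (β' v : ℝ) / ((r : ℝ) - 1) = 1 := by
      rw [sum_halfVerts_coeff hm he he' hne fun v => (β' v : ℝ) / ((r : ℝ) - 1)]
      exact (Finset.sum_congr rfl hbv).trans (sum_lattice_weights hr hβ)
    rw [← Finset.sum_div, div_eq_one_iff_eq hr0.ne'] at h3
    have h4 : ((∑ v ∈ halfVerts V e e', β' v : ℕ) : ℝ) = ((r - 1 : ℕ) : ℝ) := by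
      rw [Nat.cast_sub (by omega)]; push_cast; exact h3
    exact_mod_cast h4
  · have := sum_halfVerts hm he he' hne (fun v => (β' v : ℝ) / ((r : ℝ) - 1)) id
      (midpoint_eq_half e e')
    simp only [id] at this
    rw [this]
    exact Finset.sum_congr rfl fun v hv => by rw [hbv v hv]

end Hull

end SpaceTimeMesh
namespace SpaceTimeMesh

/-! ### Vertices, faces and children of a tagged simplex -/

namespace TaggedSimplex

variable {d : ℕ}

open scoped Classical in
/-- The set of vertices. -/
noncomputable def verts (S : TaggedSimplex d) : Finset (Space d) := Finset.univ.image S.vertex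

/-- The first end point of the refinement edge. -/
def head (S : TaggedSimplex d) : Space d := S.vertex 0

/-- The last end point of the refinement edge. -/
def tail (S : TaggedSimplex d) : Space d := S.vertex (Fin.last d)

/-- The midpoint of the refinement edge, the new vertex of the children. -/
noncomputable def mid (S : TaggedSimplex d) : Space d := midpoint ℝ S.head S.tail

variable {S S' : TaggedSimplex d}

theorem coe_verts (S : TaggedSimplex d) : (S.verts : Set (Space d)) = range S.vertex := by
  simp [verts]

theorem carrier_eq (S : TaggedSimplex d) : S.carrier = convexHull ℝ (S.verts : Set (Space d)) := by
  rw [carrier, coe_verts]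

theorem vertex_mem (S : TaggedSimplex d) (i : Fin (d + 1)) : S.vertex i ∈ S.verts := by
  simp [verts]

theorem head_mem (S : TaggedSimplex d) : S.head ∈ S.verts := S.vertex_mem _

theorem tail_mem (S : TaggedSimplex d) : S.tail ∈ S.verts := S.vertex_mem _

theorem mem_verts {v : Space d} : v ∈ S.verts ↔ ∃ i, S.vertex i = v := by
  simp [verts]

theorem vertex_congr (S : TaggedSimplex d) {i j : Fin (d + 1)} (h : (i : ℕ) = j) :
    S.vertex i = S.vertex j := by
  rw [Fin.ext h]

/-- A tagged simplex is nondegenerate if its vertices are affinely independent. -/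
def Nondeg (S : TaggedSimplex d) : Prop := AffineIndependent ℝ S.vertex

theorem Nondeg.injective (h : S.Nondeg) : Function.Injective S.vertex := AffineIndependent.injective h

theorem Nondeg.verts (h : S.Nondeg) : AffineIndependent ℝ ((↑) : S.verts → Space d) := by
  have h1 : AffineIndependent ℝ ((↑) : range S.vertex → Space d) := AffineIndependent.range h
  rw [← coe_verts] at h1
  exact h1

theorem Nondeg.card (h : S.Nondeg) : S.verts.card = d + 1 := by
  classical
  rw [TaggedSimplex.verts, Finset.card_image_of_injective _ h.injective, Finset.card_univ,
    Fintype.card_fin]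

theorem nondeg_of_verts (h : AffineIndependent ℝ ((↑) : S.verts → Space d))
    (hc : S.verts.card = d + 1) : S.Nondeg := by
  classical
  have hinj : Function.Injective S.vertex := by
    have : (Finset.univ.image S.vertex).card = (Finset.univ : Finset (Fin (d + 1))).card := by
      rw [Finset.card_univ, Fintype.card_fin]
      convert hc
      ext v
      simp [TaggedSimplex.verts]
    rw [Finset.card_image_iff] at this
    simpa using this
  have h2 := h.comp_embedding (⟨fun i => ⟨S.vertex i, S.vertex_mem i⟩, fun i j hij => hinj (by
    simpa using hij)⟩ : Fin (d + 1) ↪ S.verts)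
  exact h2

theorem Nondeg.head_ne_tail (h : S.Nondeg) (hd : 1 ≤ d) : S.head ≠ S.tail := by
  intro hc
  have := h.injective hc
  have := congrArg Fin.val this
  simp at this
  omega

theorem verts_leftChild (h : S.Nondeg) (hd : 1 ≤ d) :
    S.leftChild.verts = halfVerts S.verts S.head S.tail := by
  classical
  ext v
  rw [mem_verts, mem_halfVerts]
  constructor
  · rintro ⟨k, rfl⟩
    simp only [leftChild]
    split_ifs with h0 h1
    · exact Or.inr ⟨h.head_ne_tail hd, S.head_mem⟩
    · exact Or.inl rfl
    · refine Or.inr ⟨fun hc => ?_, S.vertex_mem _⟩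
      have h2 : (k : ℕ) - 1 = d := congrArg Fin.val (h.injective hc)
      have := k.isLt
      omega
  · rintro (rfl | ⟨hne, hv⟩)
    · exact ⟨⟨1, by omega⟩, by simp [leftChild, head, tail]⟩
    · obtain ⟨i, rfl⟩ := mem_verts.1 hv
      have hi : (i : ℕ) ≠ d := fun hc => hne (S.vertex_congr (by simpa using hc))
      have := i.isLt
      by_cases h0 : (i : ℕ) = 0
      · exact ⟨0, by simp only [leftChild]; simp; exact S.vertex_congr (by simp [h0])⟩
      · refine ⟨⟨i + 1, by omega⟩, ?_⟩
        simp only [leftChild]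
        rw [if_neg (by omega), if_neg (by omega)]
        exact S.vertex_congr (by simp)

theorem verts_rightChild (h : S.Nondeg) (hd : 1 ≤ d) (ht : S.type < d) :
    S.rightChild.verts = halfVerts S.verts S.tail S.head := by
  classical
  ext v
  rw [mem_verts, mem_halfVerts]
  constructor
  · rintro ⟨k, rfl⟩
    have := k.isLt
    simp only [rightChild]
    split_ifs with h0 h1 h2
    · exact Or.inr ⟨(h.head_ne_tail hd).symm, S.tail_mem⟩
    · exact Or.inl (midpoint_comm _ _)
    · refine Or.inr ⟨fun hc => ?_, S.vertex_mem _⟩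
      have := congrArg Fin.val (h.injective hc)
      simp at this
      omega
    · refine Or.inr ⟨fun hc => ?_, S.vertex_mem _⟩
      have := congrArg Fin.val (h.injective hc)
      simp at this
      omega
  · rintro (rfl | ⟨hne, hv⟩)
    · exact ⟨⟨1, by omega⟩, by simp [rightChild, head, tail, midpoint_comm]⟩
    · obtain ⟨i, rfl⟩ := mem_verts.1 hv
      have hi : (i : ℕ) ≠ 0 := fun hc => hne (S.vertex_congr (by simpa using hc))
      have := i.isLt
      by_cases h0 : (i : ℕ) = d
      · exact ⟨0, by simp only [rightChild]; simp; exact S.vertex_congr (by simp [h0])⟩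
      · by_cases h1 : (i : ℕ) ≤ S.type
        · refine ⟨⟨i + 1, by omega⟩, ?_⟩
          simp only [rightChild]
          rw [if_neg (by omega), if_neg (by omega), dif_pos (by omega)]
          exact S.vertex_congr (by simp)
        · refine ⟨⟨d + S.type + 1 - i, by omega⟩, ?_⟩
          simp only [rightChild]
          rw [if_neg (by omega), if_neg (by omega), dif_neg (by omega)]
          exact S.vertex_congr (by simp; omega)

/-- `R` is one of the two children of `S`. -/
def IsChild (S R : TaggedSimplex d) : Prop := R = S.leftChild ∨ R = S.rightChild

theorem mem_bisect {R : TaggedSimplex d} : R ∈ S.bisect ↔ S.IsChild R := by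
  simp [bisect, IsChild]

theorem IsChild.level {R : TaggedSimplex d} (h : S.IsChild R) : R.level = S.level + 1 := by
  rcases h with rfl | rfl <;> rfl

theorem IsChild.type {R : TaggedSimplex d} (h : S.IsChild R) : R.type = (S.type + 1) % d := by
  rcases h with rfl | rfl <;> rfl

theorem IsChild.type_lt {R : TaggedSimplex d} (h : S.IsChild R) (hd : 1 ≤ d) : R.type < d := by
  rw [h.type]; exact Nat.mod_lt _ hd

/-- The child `R` of `S` is the half of `S` that contains the end point `e`, not `e'`, of the
refinement edge. -/
structure IsHalf (S R : TaggedSimplex d) (e e' : Space d) : Prop where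
  mem : e ∈ S.verts
  mem' : e' ∈ S.verts
  ne : e ≠ e'
  ends : (e = S.head ∧ e' = S.tail) ∨ (e = S.tail ∧ e' = S.head)
  mid_eq : S.mid = midpoint ℝ e e'
  verts_eq : R.verts = halfVerts S.verts e e'

theorem isHalf_left (h : S.Nondeg) (hd : 1 ≤ d) : IsHalf S S.leftChild S.head S.tail :=
  ⟨S.head_mem, S.tail_mem, h.head_ne_tail hd, Or.inl ⟨rfl, rfl⟩, rfl, verts_leftChild h hd⟩

theorem isHalf_right (h : S.Nondeg) (hd : 1 ≤ d) (ht : S.type < d) :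
    IsHalf S S.rightChild S.tail S.head :=
  ⟨S.tail_mem, S.head_mem, (h.head_ne_tail hd).symm, Or.inr ⟨rfl, rfl⟩, midpoint_comm _ _,
    verts_rightChild h hd ht⟩

theorem IsChild.exists_isHalf {R : TaggedSimplex d} (hR : S.IsChild R) (h : S.Nondeg) (hd : 1 ≤ d)
    (ht : S.type < d) : ∃ e e', IsHalf S R e e' := by
  rcases hR with rfl | rfl
  · exact ⟨_, _, isHalf_left h hd⟩
  · exact ⟨_, _, isHalf_right h hd ht⟩

theorem IsHalf.carrier_subset {R : TaggedSimplex d} {e e' : Space d} (h : IsHalf S R e e') :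
    R.carrier ⊆ S.carrier := by
  rw [carrier_eq, carrier_eq, h.verts_eq]
  exact halfVerts_hull_subset h.mem h.mem'

theorem IsHalf.nondeg {R : TaggedSimplex d} {e e' : Space d} (h : IsHalf S R e e')
    (hS : S.Nondeg) : R.Nondeg := by
  refine nondeg_of_verts ?_ ?_
  · rw [h.verts_eq]; exact halfVerts_affineIndependent hS.verts h.mem h.mem' h.ne
  · rw [h.verts_eq, card_halfVerts hS.verts h.mem h.mem' h.ne, hS.card]

theorem IsHalf.mid_mem {R : TaggedSimplex d} {e e' : Space d} (h : IsHalf S R e e') :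
    S.mid ∈ R.verts := by
  classical
  rw [h.verts_eq, h.mid_eq]
  exact mem_halfVerts.2 (Or.inl rfl)

theorem IsHalf.notMem {R : TaggedSimplex d} {e e' : Space d} (h : IsHalf S R e e')
    (hS : S.Nondeg) : e' ∉ R.verts := by
  classical
  rw [h.verts_eq, mem_halfVerts]
  rintro (h1 | h1)
  · exact midpoint_notMem hS.verts h.mem h.mem' h.ne (h1 ▸ h.mem')
  · exact h1.1 rfl

theorem mid_notMem (hS : S.Nondeg) (hd : 1 ≤ d) : S.mid ∉ S.verts :=
  midpoint_notMem hS.verts S.head_mem S.tail_mem (hS.head_ne_tail hd)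

theorem mid_mem_carrier (S : TaggedSimplex d) : S.mid ∈ S.carrier := by
  rw [carrier_eq]
  exact (convex_convexHull ℝ _).midpoint_mem (subset_convexHull ℝ _ S.head_mem)
      (subset_convexHull ℝ _ S.tail_mem)

theorem exists_child_of_mem (h : S.Nondeg) (hd : 1 ≤ d) (ht : S.type < d) {x : Space d}
    (hx : x ∈ S.carrier) : ∃ R, S.IsChild R ∧ x ∈ R.carrier := by
  rw [carrier_eq, hull_eq_union_halves h.verts S.head_mem S.tail_mem (h.head_ne_tail hd)] at hx
  rcases hx with hx | hx
  · refine ⟨_, Or.inl rfl, ?_⟩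
    rwa [carrier_eq, verts_leftChild h hd]
  · refine ⟨_, Or.inr rfl, ?_⟩
    rwa [carrier_eq, verts_rightChild h hd ht]

theorem nodes_eq (h : S.Nondeg) (r : ℕ) : S.nodes r = latticeNodes r S.verts := by
  classical
  ext x
  constructor
  · rintro ⟨α, hα, rfl⟩
    have hinv : ∀ i, Function.invFun S.vertex (S.vertex i) = i :=
      Function.leftInverse_invFun h.injective
    refine ⟨fun v => α (Function.invFun S.vertex v), ?_, ?_⟩
    · rw [verts, Finset.sum_image (fun i _ j _ hij => h.injective hij)]
      simpa [hinv] using hα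
    · rw [verts, Finset.sum_image (fun i _ j _ hij => h.injective hij)]
      simp [hinv]
  · rintro ⟨β, hβ, rfl⟩
    refine ⟨fun i => β (S.vertex i), ?_, ?_⟩
    · rw [← hβ, verts, Finset.sum_image (fun i _ j _ hij => h.injective hij)]
    · rw [verts, Finset.sum_image (fun i _ j _ hij => h.injective hij)]

theorem nodes_subset_carrier (h : S.Nondeg) {r : ℕ} (hr : 2 ≤ r) : S.nodes r ⊆ S.carrier := by
  rw [nodes_eq h, carrier_eq]
  exact latticeNodes_subset_hull hr

theorem isCompact_carrier (S : TaggedSimplex d) : IsCompact S.carrier := by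
  rw [carrier_eq]
  exact S.verts.finite_toSet.isCompact_convexHull (𝕜 := ℝ)

theorem convex_carrier (S : TaggedSimplex d) : Convex ℝ S.carrier := convex_convexHull ℝ _

theorem carrier_nonempty (S : TaggedSimplex d) : S.carrier.Nonempty :=
  ⟨S.mid, S.mid_mem_carrier⟩

/-! ### Dimensions of intersections -/

end TaggedSimplex

section Dim

variable {d : ℕ}

theorem affineDim_mono {A B : Set (Space d)} (h : A ⊆ B) : affineDim A ≤ affineDim B :=
  Submodule.finrank_mono (AffineSubspace.direction_le (affineSpan_mono ℝ h))

theorem affineDim_convexHull (A : Set (Space d)) : affineDim (convexHull ℝ A) = affineDim A := by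
  rw [affineDim, affineSpan_convexHull, affineDim]

theorem affineDim_finset_lt {V : Finset (Space d)} (hV : V.Nonempty) :
    affineDim (convexHull ℝ (V : Set (Space d))) < V.card := by
  rw [affineDim_convexHull, affineDim, direction_affineSpan]
  have h1 : 0 < V.card := hV.card_pos
  have := finrank_vectorSpan_image_finset_le ℝ (id : Space d → Space d) V (n := V.card - 1)
    (by omega)
  rw [Finset.image_id] at this
  omega

theorem affineDim_of_affineIndependent {V : Finset (Space d)}
    (hV : AffineIndependent ℝ ((↑) : V → Space d)) :
    affineDim (convexHull ℝ (V : Set (Space d))) = V.card - 1 := by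
  rw [affineDim_convexHull, affineDim, direction_affineSpan]
  rcases V.eq_empty_or_nonempty with rfl | hne
  · simp
  · have h1 : 0 < V.card := hne.card_pos
    have := hV.finrank_vectorSpan (n := V.card - 1) (by simp; omega)
    rwa [show range ((↑) : V → Space d) = (V : Set (Space d)) by simp] at this

theorem affineDim_le (A : Set (Space d)) : affineDim A ≤ d := by
  have := Submodule.finrank_le (affineSpan ℝ A).direction
  simpa [affineDim] using this

/-- The set contains `d` affinely independent points. -/
def HyperDim (A : Set (Space d)) : Prop := A.Nonempty ∧ d ≤ affineDim A + 1

theorem HyperDim.mono {A B : Set (Space d)} (hA : HyperDim A) (h : A ⊆ B) : HyperDim B :=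
  ⟨hA.1.mono h, hA.2.trans (Nat.add_le_add_right (affineDim_mono h) 1)⟩

theorem HyperDim.card_le {V : Finset (Space d)} (h : HyperDim (convexHull ℝ (V : Set (Space d)))) :
    d ≤ V.card := by
  have hne : V.Nonempty := by simpa using h.1
  have := affineDim_finset_lt hne
  have := h.2
  omega

theorem hyperDim_of_card {V : Finset (Space d)} (hd : 1 ≤ d)
    (hV : AffineIndependent ℝ ((↑) : V → Space d)) (h : V.card = d) :
    HyperDim (convexHull ℝ (V : Set (Space d))) := by
  refine ⟨?_, ?_⟩
  · rw [convexHull_nonempty_iff, Finset.coe_nonempty, ← Finset.card_pos]; omega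
  · rw [affineDim_of_affineIndependent hV]; omega

theorem hyperDim_of_affineDim_eq {A : Set (Space d)} (hd : 1 ≤ d) (h : affineDim A = d) :
    HyperDim A := by
  refine ⟨?_, by omega⟩
  rw [Set.nonempty_iff_ne_empty]
  rintro rfl
  have : affineDim (∅ : Set (Space d)) = 0 := by
    rw [affineDim, direction_affineSpan, vectorSpan_empty, finrank_bot]
  omega

theorem TaggedSimplex.Nondeg.affineDim_carrier {S : TaggedSimplex d} (h : S.Nondeg) :
    affineDim S.carrier = d := by
  rw [S.carrier_eq, affineDim_of_affineIndependent h.verts, h.card]; rfl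

end Dim

end SpaceTimeMesh
namespace SpaceTimeMesh

/-! ### The bisection forest -/

variable {d : ℕ}

open TaggedSimplex

/-- The simplices that arise from the initial triangulation by bisection. -/
inductive InForest (M : InitialMesh d) : TaggedSimplex d → Prop
  | base {S : TaggedSimplex d} : S ∈ M.triangulation → InForest M S
  | child {S R : TaggedSimplex d} : InForest M S → S.IsChild R → InForest M R

/-- `R` arises from `S` by repeated bisection. -/
inductive Desc (S : TaggedSimplex d) : TaggedSimplex d → Prop
  | refl : Desc S S
  | child {R R' : TaggedSimplex d} : Desc S R → R.IsChild R' → Desc S R'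

theorem Desc.trans {S R R' : TaggedSimplex d} (h : Desc S R) (h' : Desc R R') : Desc S R' := by
  induction h' with
  | refl => exact h
  | child _ hc ih => exact ih.child hc

theorem Desc.level_le {S R : TaggedSimplex d} (h : Desc S R) : S.level ≤ R.level := by
  induction h with
  | refl => exact le_rfl
  | child _ hc ih => rw [hc.level]; omega

theorem Desc.eq_of_level {S R : TaggedSimplex d} (h : Desc S R) (hl : R.level ≤ S.level) :
    S = R := by
  cases h with
  | refl => rfl
  | child h' hc => have := h'.level_le; rw [hc.level] at hl; omega

/-- A proper descendant is a descendant of a child. -/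
theorem Desc.exists_child {S R : TaggedSimplex d} (h : Desc S R) (hl : S.level < R.level) :
    ∃ c, S.IsChild c ∧ Desc c R := by
  induction h with
  | refl => omega
  | @child R R' h' hc ih =>
    by_cases h1 : S.level < R.level
    · obtain ⟨c, hc1, hc2⟩ := ih h1
      exact ⟨c, hc1, hc2.child hc⟩
    · have := h'.eq_of_level (by omega)
      subst this
      exact ⟨R', hc, Desc.refl⟩

/-- Two simplices of which one arises from the other by bisection. -/
def Comparable (S R : TaggedSimplex d) : Prop := Desc S R ∨ Desc R S

theorem Comparable.symm {S R : TaggedSimplex d} (h : Comparable S R) : Comparable R S := Or.symm h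

namespace InForest

variable {M : InitialMesh d} {S S' R R' : TaggedSimplex d}

theorem desc (hS : InForest M S) (h : Desc S R) : InForest M R := by
  induction h with
  | refl => exact hS
  | child _ hc ih => exact ih.child hc

theorem type_lt (hd : 1 ≤ d) (hS : InForest M S) : S.type < d := by
  cases hS with
  | base h =>
    obtain ⟨⟨γ, hγ, h1⟩, -⟩ := M.wellLabeled
    rw [h1 _ h]; exact hγ
  | child _ hc => exact hc.type_lt hd

theorem nondeg (hd : 1 ≤ d) (hS : InForest M S) : S.Nondeg := by
  induction hS with
  | base h => exact M.nondegenerate _ h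
  | child h hc ih =>
    obtain ⟨e, e', he⟩ := hc.exists_isHalf ih hd (h.type_lt hd)
    exact he.nondeg ih

theorem exists_isHalf (hd : 1 ≤ d) (hS : InForest M S) (hR : S.IsChild R) :
    ∃ e e', IsHalf S R e e' :=
  hR.exists_isHalf (hS.nondeg hd) hd (hS.type_lt hd)

theorem desc_carrier (hd : 1 ≤ d) (hS : InForest M S) (h : Desc S R) : R.carrier ⊆ S.carrier := by
  induction h with
  | refl => exact Subset.rfl
  | child h' hc ih =>
    obtain ⟨e, e', he⟩ := (hS.desc h').exists_isHalf hd hc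
    exact he.carrier_subset.trans ih

theorem type_eq (hS : InForest M S) (hS' : InForest M S')
    (hl : S.level = S'.level) : S.type = S'.type := by
  obtain ⟨⟨γ, hγ, h1⟩, -⟩ := M.wellLabeled
  have key : ∀ R, InForest M R → R.type = (γ + R.level) % d := by
    intro R hR
    induction hR with
    | base h => rw [h1 _ h, M.level_eq_zero _ h, Nat.add_zero, Nat.mod_eq_of_lt hγ]
    | child h hc ih => rw [hc.type, hc.level, ih, Nat.mod_add_mod, Nat.add_assoc]
  rw [key S hS, key S' hS', hl]

/-- Every simplex of the forest has an ancestor on each smaller level. -/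
theorem exists_ancestor (hS : InForest M S) {k : ℕ} (hk : k ≤ S.level) :
    ∃ A, InForest M A ∧ A.level = k ∧ Desc A S := by
  induction hS with
  | base h =>
    rw [M.level_eq_zero _ h] at hk
    exact ⟨_, base h, by rw [M.level_eq_zero _ h]; omega, Desc.refl⟩
  | @child S R h hc ih =>
    rcases hk.eq_or_lt with h1 | h1
    · exact ⟨R, h.child hc, h1.symm, Desc.refl⟩
    · rw [hc.level] at h1
      obtain ⟨A, h2, h3, h4⟩ := ih (by omega)
      exact ⟨A, h2, h3, h4.child hc⟩

theorem mem_of_level_eq_zero (hS : InForest M S) (h : S.level = 0) : S ∈ M.triangulation := by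
  cases hS with
  | base h => exact h
  | child _ hc => rw [hc.level] at h; omega

/-- The nodes of an ancestor are nodes of a descendant. -/
theorem nodes_desc (hd : 1 ≤ d) (hS : InForest M S) (h : Desc S R) {r : ℕ} (hr : 2 ≤ r)
    {x : Space d} (hx : x ∈ S.nodes r) (hxR : x ∈ R.carrier) : x ∈ R.nodes r := by
  induction h with
  | refl => exact hx
  | child h' hc ih =>
    have hf := hS.desc h'
    obtain ⟨e, e', he⟩ := hf.exists_isHalf hd hc
    have h1 := ih (he.carrier_subset hxR)
    rw [nodes_eq (hf.nondeg hd)] at h1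
    rw [nodes_eq ((hf.child hc).nondeg hd), he.verts_eq]
    rw [carrier_eq, he.verts_eq] at hxR
    exact latticeNodes_half hr (hf.nondeg hd).verts he.mem he.mem' he.ne hxR h1

end InForest

/-! ### Matching neighbours on a common level -/

/-- Two simplices that meet in a common face and have different vertex sets. -/
structure MeetInFace (S S' : TaggedSimplex d) : Prop where
  inter_eq : S.carrier ∩ S'.carrier =
    convexHull ℝ ((S.verts ∩ S'.verts : Finset (Space d)) : Set (Space d))
  ne : S.verts ≠ S'.verts

theorem MeetInFace.symm {S S' : TaggedSimplex d} (h : MeetInFace S S') : MeetInFace S' S :=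
  ⟨by rw [inter_comm, h.inter_eq, Finset.inter_comm], h.ne.symm⟩

/-- Two simplices that meet in a common hyperface. -/
structure Adjacent (S S' : TaggedSimplex d) : Prop extends MeetInFace S S' where
  card_eq : (S.verts ∩ S'.verts).card = d

theorem Adjacent.symm {S S' : TaggedSimplex d} (h : Adjacent S S') : Adjacent S' S :=
  ⟨h.toMeetInFace.symm, by rw [Finset.inter_comm, h.card_eq]⟩

theorem MeetInFace.card_le {S S' : TaggedSimplex d} (h : MeetInFace S S') (hS : S.Nondeg)
    (hS' : S'.Nondeg) : (S.verts ∩ S'.verts).card ≤ d := by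
  by_contra hc
  have h1 : S.verts ∩ S'.verts = S.verts :=
    Finset.eq_of_subset_of_card_le Finset.inter_subset_left (by rw [hS.card]; omega)
  have h2 : S.verts ∩ S'.verts = S'.verts :=
    Finset.eq_of_subset_of_card_le Finset.inter_subset_right (by rw [hS'.card]; omega)
  exact h.ne (h1.symm.trans h2)

theorem MeetInFace.affineDim_lt {S S' : TaggedSimplex d} (h : MeetInFace S S') (hd : 1 ≤ d)
    (hS : S.Nondeg) (hS' : S'.Nondeg) : affineDim (S.carrier ∩ S'.carrier) < d := by
  rw [h.inter_eq, affineDim_of_affineIndependent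
    (affineIndependent_subset hS.verts Finset.inter_subset_left)]
  have := h.card_le hS hS'
  omega

theorem MeetInFace.adjacent {S S' : TaggedSimplex d} (h : MeetInFace S S')
    (hS : S.Nondeg) (hS' : S'.Nondeg) (hH : HyperDim (S.carrier ∩ S'.carrier)) :
    Adjacent S S' :=
  ⟨h, le_antisymm (h.card_le hS hS') (by rw [h.inter_eq] at hH; exact hH.card_le)⟩

theorem Adjacent.hyperDim {S S' : TaggedSimplex d} (h : Adjacent S S') (hd : 1 ≤ d)
    (hS : S.Nondeg) : HyperDim (S.carrier ∩ S'.carrier) := by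
  rw [h.inter_eq]
  exact hyperDim_of_card hd (affineIndependent_subset hS.verts Finset.inter_subset_left) h.card_eq

theorem eq_of_weight_eq_one {W : Finset (Space d)} {α : Space d → ℝ} {v : Space d} (hv : v ∈ W)
    (h0 : ∀ u ∈ W, 0 ≤ α u) (h1 : ∑ u ∈ W, α u = 1) (h : α v = 1) : ∑ u ∈ W, α u • u = v := by
  have h2 : ∑ u ∈ W.erase v, α u = 0 := by
    have := Finset.add_sum_erase W α hv
    linarith
  rw [Finset.sum_eq_zero_iff_of_nonneg (fun u hu => h0 u (Finset.mem_of_mem_erase hu))] at h2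
  rw [Finset.sum_eq_single v (fun u hu huv => by rw [h2 u (Finset.mem_erase.2 ⟨huv, hu⟩), zero_smul])
    (fun h => absurd hv h), h, one_smul]

/-- A vertex of a simplex that lies in the hull of a set of points of the simplex belongs to this
set: without an extreme point a convex set remains convex. -/
theorem extreme_of_hull_subset {W W' : Finset (Space d)}
    (hW : AffineIndependent ℝ ((↑) : W → Space d))
    (hsub : convexHull ℝ (W' : Set (Space d)) ⊆ convexHull ℝ (W : Set (Space d)))
    {v : Space d} (hv : v ∈ W) (hv' : v ∈ convexHull ℝ (W' : Set (Space d))) : v ∈ W' := by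
  classical
  by_contra hc
  have h2 : convexHull ℝ (W' : Set (Space d)) ⊆
      {y | y ∈ convexHull ℝ (W : Set (Space d)) ∧ y ≠ v} := by
    refine convexHull_min (fun y hy => ⟨hsub (subset_convexHull ℝ _ hy), fun h => hc (h ▸ hy)⟩) ?_
    intro y hy z hz s t hs ht hst
    refine ⟨convex_convexHull ℝ _ hy.1 hz.1 hs ht hst, fun hyz => ?_⟩
    obtain ⟨α, hα0, hα1, hα⟩ := exists_weights hy.1
    obtain ⟨β, hβ0, hβ1, hβ⟩ := exists_weights hz.1
    have hle : ∀ γ : Space d → ℝ, (∀ u ∈ W, 0 ≤ γ u) → ∑ u ∈ W, γ u = 1 →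
        ∑ u ∈ W, γ u • u ≠ v → γ v < 1 := fun γ h0 h1 hne =>
      lt_of_le_of_ne (h1 ▸ Finset.single_le_sum h0 hv)
        fun h => hne (eq_of_weight_eq_one hv h0 h1 h)
    have hw := weights_unique hW (a := fun u => s * α u + t * β u)
      (b := fun u => if u = v then 1 else 0)
      (by rw [Finset.sum_add_distrib, ← Finset.mul_sum, ← Finset.mul_sum, hα1, hβ1]
          simp [hv, hst])
      (by simp only [add_smul, mul_smul, Finset.sum_add_distrib, ← Finset.smul_sum,
            ← hα, ← hβ, hyz]
          simp [hv]) v hv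
    simp only [if_true] at hw
    have a1 := hle α hα0 hα1 (hα ▸ hy.2)
    have b1 := hle β hβ0 hβ1 (hβ ▸ hz.2)
    rcases hs.eq_or_lt with rfl | hs
    · rw [zero_add] at hst
      subst hst
      linarith
    · nlinarith
  exact (h2 hv').2 rfl

/-- In a conforming family two simplices meet exactly in the hull of their common vertices. -/
theorem Conforming.meetInFace {T : Finset (TaggedSimplex d)} (hT : Conforming T)
    {S S' : TaggedSimplex d} (hS : S ∈ T) (hS' : S' ∈ T) (hn : S.Nondeg) (hn' : S'.Nondeg)
    (hne : S ≠ S') : MeetInFace S S' := by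
  classical
  rcases hT S hS S' hS' with h | h | ⟨a, a', -, -, hac, hac', ha, ha'⟩
  · exact absurd h hne
  · have h1 : S.verts ∩ S'.verts = ∅ := by
      rw [Finset.eq_empty_iff_forall_notMem]
      intro v hv
      rw [Finset.mem_inter] at hv
      have : v ∈ S.carrier ∩ S'.carrier := by
        rw [carrier_eq, carrier_eq]
        exact ⟨subset_convexHull ℝ _ hv.1, subset_convexHull ℝ _ hv.2⟩
      rw [h] at this
      exact this
    refine ⟨by rw [h, h1]; simp, fun hc => ?_⟩
    rw [hc, Finset.inter_self] at h1
    have := hn'.card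
    rw [h1] at this
    simp at this
  · set W := a.image S.vertex with hW
    set W' := a'.image S'.vertex with hW'
    have hWV : W ⊆ S.verts := fun v hv => by
      obtain ⟨i, -, rfl⟩ := Finset.mem_image.1 hv
      exact S.vertex_mem i
    have hWV' : W' ⊆ S'.verts := fun v hv => by
      obtain ⟨i, -, rfl⟩ := Finset.mem_image.1 hv
      exact S'.vertex_mem i
    have e1 : S.carrier ∩ S'.carrier = convexHull ℝ (W : Set (Space d)) := by
      rw [ha, hW, Finset.coe_image]
    have e2 : S.carrier ∩ S'.carrier = convexHull ℝ (W' : Set (Space d)) := by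
      rw [ha', hW', Finset.coe_image]
    have key : S.verts ∩ S'.verts ⊆ W := by
      intro v hv
      rw [Finset.mem_inter] at hv
      refine mem_of_vertex_mem_hull hn.verts hWV hv.1 ?_
      rw [← e1, carrier_eq, carrier_eq]
      exact ⟨subset_convexHull ℝ _ hv.1, subset_convexHull ℝ _ hv.2⟩
    have key' : S.verts ∩ S'.verts ⊆ W' := by
      intro v hv
      rw [Finset.mem_inter] at hv
      refine mem_of_vertex_mem_hull hn'.verts hWV' hv.2 ?_
      rw [← e2, carrier_eq, carrier_eq]
      exact ⟨subset_convexHull ℝ _ hv.1, subset_convexHull ℝ _ hv.2⟩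
    -- the vertices of the intersection are its extreme points, hence vertices of both simplices
    have hext : ∀ v ∈ W, v ∈ W' := fun v hv =>
      extreme_of_hull_subset (affineIndependent_subset hn.verts hWV) (by rw [← e2, e1]) hv
        (by rw [← e2, e1]; exact subset_convexHull ℝ _ hv)
    have hWe : W = S.verts ∩ S'.verts := Finset.Subset.antisymm
      (fun v hv => Finset.mem_inter.2 ⟨hWV hv, hWV' (hext v hv)⟩) key
    refine ⟨by rw [e1, hWe], fun hc => ?_⟩
    have h3 : W.card ≤ d := Finset.card_image_le.trans hac
    rw [hWe, ← hc, Finset.inter_self, hn.card] at h3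
    omega

end SpaceTimeMesh
namespace SpaceTimeMesh

variable {d : ℕ}

open TaggedSimplex

theorem carrier_inter_subset_hull {S S' R R' : TaggedSimplex d} (h : MeetInFace S S')
    (hR : R.carrier ⊆ S.carrier) (hR' : R'.carrier ⊆ S'.carrier) :
    R.carrier ∩ R'.carrier ⊆
      convexHull ℝ ((S.verts ∩ S'.verts : Finset (Space d)) : Set (Space d)) := by
  rw [← h.inter_eq]
  exact inter_subset_inter hR hR'

/-- Corresponding halves of two simplices with a common refinement edge meet in a common face. -/
theorem MeetInFace.halves {S S' R R' : TaggedSimplex d} (h : MeetInFace S S')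
    (hS : S.Nondeg) (hS' : S'.Nondeg) {e e' : Space d} (hR : IsHalf S R e e')
    (hR' : IsHalf S' R' e e') : MeetInFace R R' := by
  have he : e ∈ S.verts ∩ S'.verts := Finset.mem_inter.2 ⟨hR.mem, hR'.mem⟩
  have he' : e' ∈ S.verts ∩ S'.verts := Finset.mem_inter.2 ⟨hR.mem', hR'.mem'⟩
  have hv : R.verts ∩ R'.verts = halfVerts (S.verts ∩ S'.verts) e e' := by
    ext v
    simp only [hR.verts_eq, hR'.verts_eq, Finset.mem_inter, mem_halfVerts]
    tauto
  refine ⟨?_, fun hc => ?_⟩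
  · rw [hv, ← hull_inter_half_of_mem hS.verts Finset.inter_subset_left he he' hR.ne]
    refine Subset.antisymm (subset_inter (carrier_inter_subset_hull h hR.carrier_subset
      hR'.carrier_subset) (by rw [← hR.verts_eq, ← carrier_eq]; exact inter_subset_left)) ?_
    rintro y ⟨hy, hy'⟩
    refine ⟨by rwa [carrier_eq, hR.verts_eq], ?_⟩
    rw [carrier_eq, hR'.verts_eq]
    have : y ∈ convexHull ℝ (halfVerts (S.verts ∩ S'.verts) e e' : Set (Space d)) := by
      rw [← hull_inter_half_of_mem hS.verts Finset.inter_subset_left he he' hR.ne]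
      exact ⟨hy, hy'⟩
    rw [← hull_inter_half_of_mem hS'.verts Finset.inter_subset_right he he' hR.ne] at this
    exact this.2
  · have h1 := card_halfVerts (affineIndependent_subset hS.verts Finset.inter_subset_left)
      he he' hR.ne
    rw [← hv, ← hc, Finset.inter_self, (hR.nondeg hS).card] at h1
    have := h.card_le hS hS'
    omega

/-- Opposite halves of two simplices with a common refinement edge meet in a common face. -/
theorem MeetInFace.opposite_halves {S S' R R' : TaggedSimplex d} (h : MeetInFace S S')
    (hS : S.Nondeg) (hS' : S'.Nondeg) {e e' : Space d} (hR : IsHalf S R e e')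
    (hR' : IsHalf S' R' e' e) : MeetInFace R R' ∧ (R.verts ∩ R'.verts).card < d := by
  have he : e ∈ S.verts ∩ S'.verts := Finset.mem_inter.2 ⟨hR.mem, hR'.mem'⟩
  have he' : e' ∈ S.verts ∩ S'.verts := Finset.mem_inter.2 ⟨hR.mem', hR'.mem⟩
  have hW := affineIndependent_subset hS.verts
    (Finset.inter_subset_left (s₁ := S.verts) (s₂ := S'.verts))
  have hv : R.verts ∩ R'.verts = halfVerts (S.verts ∩ S'.verts) e e' ∩
      halfVerts (S.verts ∩ S'.verts) e' e := by
    have hm := midpoint_notMem hS.verts hR.mem hR.mem' hR.ne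
    have hm' := midpoint_notMem hS'.verts hR'.mem hR'.mem' hR'.ne
    ext v
    simp only [hR.verts_eq, hR'.verts_eq, Finset.mem_inter, mem_halfVerts,
      midpoint_comm (R := ℝ) e' e]
    tauto
  have hcard : (R.verts ∩ R'.verts).card < d := by
    have h1 := card_halfVerts hW he he' hR.ne
    have h2 := h.card_le hS hS'
    refine lt_of_lt_of_le (Finset.card_lt_card ?_) (h1.trans_le h2)
    rw [hv]
    refine Finset.ssubset_iff_subset_ne.2 ⟨Finset.inter_subset_left, fun hc => ?_⟩
    have : e ∈ halfVerts (S.verts ∩ S'.verts) e e' := mem_halfVerts.2 (Or.inr ⟨hR.ne, he⟩)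
    rw [← hc, Finset.mem_inter] at this
    rcases mem_halfVerts.1 this.2 with h3 | h3
    · exact midpoint_notMem hW he' he hR.ne.symm (h3 ▸ he)
    · exact h3.1 rfl
  refine ⟨⟨?_, fun hc => ?_⟩, hcard⟩
  · rw [hv, ← half_inter_half hW he he' hR.ne,
      ← hull_inter_half_of_mem hS.verts Finset.inter_subset_left he he' hR.ne,
      ← hull_inter_half_of_mem hS'.verts Finset.inter_subset_right he' he hR.ne.symm,
      ← hR.verts_eq, ← hR'.verts_eq, ← carrier_eq, ← carrier_eq]
    have := carrier_inter_subset_hull h hR.carrier_subset hR'.carrier_subset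
    exact Subset.antisymm (fun y hy => ⟨⟨this hy, hy.1⟩, this hy, hy.2⟩)
      fun y hy => ⟨hy.1.2, hy.2.2⟩
  · rw [← hc, Finset.inter_self, (hR.nondeg hS).card] at hcard
    omega

/-- A half meets a simplex that does not contain the refinement edge in a common face. -/
theorem MeetInFace.half_left {S S' R : TaggedSimplex d} (h : MeetInFace S S')
    (hS : S.Nondeg) (hS' : S'.Nondeg) {e e' : Space d} (hR : IsHalf S R e e')
    (hn : e ∉ S'.verts ∨ e' ∉ S'.verts) (hm : S.mid ∉ S'.verts) : MeetInFace R S' := by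
  have hn' : e ∉ S.verts ∩ S'.verts ∨ e' ∉ S.verts ∩ S'.verts := by
    simp only [Finset.mem_inter]; tauto
  have hv : R.verts ∩ S'.verts = (S.verts ∩ S'.verts).erase e' := by
    ext v
    rw [hR.mid_eq] at hm
    simp only [hR.verts_eq, Finset.mem_inter, mem_halfVerts, Finset.mem_erase]
    constructor
    · rintro ⟨rfl | h1, h2⟩
      · exact absurd h2 hm
      · tauto
    · tauto
  refine ⟨?_, fun hc => ?_⟩
  · rw [hv, ← hull_inter_half_of_notMem hS.verts Finset.inter_subset_left hR.mem hR.mem' hR.ne hn',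
      ← h.inter_eq, ← hR.verts_eq, ← carrier_eq]
    exact Subset.antisymm (fun y hy => ⟨⟨hR.carrier_subset hy.1, hy.2⟩, hy.1⟩)
      fun y hy => ⟨hy.2, hy.1.2⟩
  · have h1 : R.verts ⊆ S.verts ∩ S'.verts := fun v hv' =>
      Finset.mem_of_mem_erase (hv ▸ Finset.mem_inter.2 ⟨hv', hc ▸ hv'⟩)
    have h2 := Finset.card_le_card h1
    rw [(hR.nondeg hS).card] at h2
    have := h.card_le hS hS'
    omega

/-- The two children of a simplex are adjacent. -/
theorem siblings_adjacent {S R R' : TaggedSimplex d} (hS : S.Nondeg) {e e' : Space d}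
    (hR : IsHalf S R e e') (hR' : IsHalf S R' e' e) : Adjacent R R' := by
  have hv : R.verts ∩ R'.verts = halfVerts (S.verts.erase e) e e' := by
    have hm := midpoint_notMem hS.verts hR.mem hR.mem' hR.ne
    ext v
    simp only [hR.verts_eq, hR'.verts_eq, Finset.mem_inter, mem_halfVerts, Finset.mem_erase,
      midpoint_comm (R := ℝ) e' e]
    tauto
  have hcard : (R.verts ∩ R'.verts).card = d := by
    classical
    have hm := midpoint_notMem hS.verts hR.mem hR.mem' hR.ne
    have : R.verts ∩ R'.verts = insert (midpoint ℝ e e') ((S.verts.erase e).erase e') := by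
      rw [hv]; ext v
      simp only [mem_halfVerts, Finset.mem_insert, Finset.mem_erase]
    rw [this, Finset.card_insert_of_notMem (fun h => hm (Finset.mem_of_mem_erase
      (Finset.mem_of_mem_erase h))), Finset.card_erase_of_mem
      (Finset.mem_erase.2 ⟨hR.ne.symm, hR.mem'⟩), Finset.card_erase_of_mem hR.mem, hS.card]
    have : 1 < S.verts.card := Finset.one_lt_card.2 ⟨e, hR.mem, e', hR.mem', hR.ne⟩
    rw [hS.card] at this
    omega
  refine ⟨⟨?_, fun hc => ?_⟩, hcard⟩
  · rw [carrier_eq, carrier_eq, hR.verts_eq, hR'.verts_eq,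
      half_inter_half hS.verts hR.mem hR.mem' hR.ne]
  · rw [← hc, Finset.inter_self, (hR.nondeg hS).card] at hcard
    omega

/-- If neither refinement edge lies in the common hyperface, only the two children that contain
this hyperface can share one. -/
theorem Adjacent.halves_of_not_edge {S S' R R' : TaggedSimplex d} (h : Adjacent S S')
    (hS : S.Nondeg) (hS' : S'.Nondeg) {e e' f f' : Space d} (hR : IsHalf S R e e')
    (hR' : IsHalf S' R' f f') (hn : ¬ (e ∈ S.verts ∩ S'.verts ∧ e' ∈ S.verts ∩ S'.verts))
    (hn' : ¬ (f ∈ S.verts ∩ S'.verts ∧ f' ∈ S.verts ∩ S'.verts))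
    (hH : HyperDim (R.carrier ∩ R'.carrier)) :
    e' ∉ S.verts ∩ S'.verts ∧ f' ∉ S.verts ∩ S'.verts ∧
      R.verts ∩ R'.verts = S.verts ∩ S'.verts ∧ Adjacent R R' ∧ S.mid ≠ S'.mid := by
  set W := S.verts ∩ S'.verts with hW
  have hWS : W ⊆ S.verts := Finset.inter_subset_left
  have hWS' : W ⊆ S'.verts := Finset.inter_subset_right
  have hsub := carrier_inter_subset_hull h.toMeetInFace hR.carrier_subset hR'.carrier_subset
  -- a child that misses a vertex of the common hyperface meets the other simplex in a face with
  -- `d - 1` vertices only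
  have he' : e' ∉ W := by
    intro hc
    have h1 : R.carrier ∩ R'.carrier ⊆ convexHull ℝ (W.erase e' : Finset (Space d)) := by
      rw [← hull_inter_half_of_notMem hS.verts hWS hR.mem hR.mem' hR.ne (by tauto),
        ← hR.verts_eq, ← carrier_eq]
      exact subset_inter hsub inter_subset_left
    have := (hH.mono h1).card_le
    rw [Finset.card_erase_of_mem hc, h.card_eq] at this
    have : 0 < W.card := Finset.card_pos.2 ⟨_, hc⟩
    rw [h.card_eq] at this
    omega
  have hf' : f' ∉ W := by
    intro hc
    have h1 : R.carrier ∩ R'.carrier ⊆ convexHull ℝ (W.erase f' : Finset (Space d)) := by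
      rw [← hull_inter_half_of_notMem hS'.verts hWS' hR'.mem hR'.mem' hR'.ne (by tauto),
        ← hR'.verts_eq, ← carrier_eq]
      exact subset_inter hsub inter_subset_right
    have := (hH.mono h1).card_le
    rw [Finset.card_erase_of_mem hc, h.card_eq] at this
    have : 0 < W.card := Finset.card_pos.2 ⟨_, hc⟩
    rw [h.card_eq] at this
    omega
  have hWR : W ⊆ R.verts := fun v hv => by
    rw [hR.verts_eq, mem_halfVerts]
    exact Or.inr ⟨fun hc => he' (hc ▸ hv), hWS hv⟩
  have hWR' : W ⊆ R'.verts := fun v hv => by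
    rw [hR'.verts_eq, mem_halfVerts]
    exact Or.inr ⟨fun hc => hf' (hc ▸ hv), hWS' hv⟩
  -- the new vertices lie outside the common hyperface, so that they are not shared
  have hmW : S.mid ∉ convexHull ℝ (W : Set (Space d)) := fun hc => by
    rw [hR.mid_eq] at hc
    exact hn (edge_subset_of_midpoint_mem hS.verts hWS hR.mem hR.mem' hR.ne hc)
  have hmR' : S.mid ∉ R'.verts := fun hc => hmW (by
    rw [hW, ← h.inter_eq]
    refine ⟨S.mid_mem_carrier, hR'.carrier_subset ?_⟩
    rw [carrier_eq]
    exact subset_convexHull ℝ _ hc)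
  have hSW : ∀ v ∈ S.verts, v ≠ e' → v ∈ W := by
    have : W = S.verts.erase e' := Finset.eq_of_subset_of_card_le
      (fun v hv => Finset.mem_erase.2 ⟨fun hc => he' (hc ▸ hv), hWS hv⟩) (by
        rw [Finset.card_erase_of_mem hR.mem', hS.card, h.card_eq]; omega)
    intro v hv hne
    rw [this]
    exact Finset.mem_erase.2 ⟨hne, hv⟩
  have hv : R.verts ∩ R'.verts = W := by
    refine Finset.Subset.antisymm (fun v hv => ?_) (Finset.subset_inter hWR hWR')
    rw [Finset.mem_inter] at hv
    have h1 := hv.1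
    rw [hR.verts_eq, mem_halfVerts, ← hR.mid_eq] at h1
    rcases h1 with rfl | h1
    · exact absurd hv.2 hmR'
    · exact hSW v h1.2 h1.1
  refine ⟨he', hf', hv, ⟨⟨?_, fun hc => ?_⟩, by rw [hv, h.card_eq]⟩, fun hc => ?_⟩
  · rw [hv]
    refine Subset.antisymm hsub (subset_inter ?_ ?_)
    · rw [carrier_eq]; exact convexHull_mono (by exact_mod_cast hWR)
    · rw [carrier_eq]; exact convexHull_mono (by exact_mod_cast hWR')
  · exact hmR' (hc ▸ hR.mid_mem)
  · exact hmR' (hc ▸ hR'.mid_mem)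

/-! ### Reversal -/

namespace TaggedSimplex

variable {S S' : TaggedSimplex d}

theorem eq_of_fields {S S' : TaggedSimplex d} (h1 : ∀ k, S.vertex k = S'.vertex k)
    (h2 : S.type = S'.type) (h3 : S.level = S'.level) : S = S' := by
  obtain ⟨v, t, l⟩ := S
  obtain ⟨v', t', l'⟩ := S'
  have : v = v' := funext h1
  simp_all

theorem leftChild_reverse (S : TaggedSimplex d) (hd : 1 ≤ d) :
    S.reverse.leftChild = S.rightChild := by
  refine eq_of_fields (fun k => ?_) rfl rfl
  have := k.isLt
  simp only [leftChild, rightChild, reverse, Fin.val_zero, Fin.val_last, if_true]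
  split_ifs <;> first | rfl | omega | (exact midpoint_comm _ _) |
    (exact S.vertex_congr (by simp; try omega))

theorem rightChild_reverse (S : TaggedSimplex d) (hd : 1 ≤ d) :
    S.reverse.rightChild = S.leftChild := by
  refine eq_of_fields (fun k => ?_) rfl rfl
  have := k.isLt
  simp only [leftChild, rightChild, reverse, Fin.val_zero, Fin.val_last, if_true]
  split_ifs <;> first | rfl | omega | (exact midpoint_comm _ _) |
    (exact S.vertex_congr (by simp; try omega))

theorem verts_reverse (S : TaggedSimplex d) (ht : S.type < d) : S.reverse.verts = S.verts := by
  ext v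
  rw [mem_verts, mem_verts]
  constructor
  · rintro ⟨k, rfl⟩
    simp only [reverse]
    split_ifs <;> exact ⟨_, rfl⟩
  · rintro ⟨i, rfl⟩
    have := i.isLt
    by_cases h0 : (i : ℕ) = 0
    · refine ⟨Fin.last d, ?_⟩
      simp only [reverse, Fin.val_last]
      rw [if_neg (by omega), if_pos trivial]
      exact S.vertex_congr (by simp [h0])
    by_cases h1 : (i : ℕ) = d
    · exact ⟨0, by simp only [reverse, Fin.val_zero, if_true]; exact S.vertex_congr (by simp [h1])⟩
    by_cases h2 : (i : ℕ) ≤ S.type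
    · exact ⟨i, by simp only [reverse]; rw [if_neg h0, if_neg h1, dif_pos h2]⟩
    · refine ⟨⟨d + S.type - i, by omega⟩, ?_⟩
      simp only [reverse]
      rw [if_neg (by omega), if_neg (by omega), dif_neg (by omega)]
      exact S.vertex_congr (by simp; omega)

theorem carrier_reverse (S : TaggedSimplex d) (ht : S.type < d) :
    S.reverse.carrier = S.carrier := by
  rw [carrier_eq, carrier_eq, verts_reverse S ht]

theorem isChild_reverse {R : TaggedSimplex d} (hd : 1 ≤ d) :
    S.reverse.IsChild R ↔ S.IsChild R := by
  rw [IsChild, IsChild, leftChild_reverse S hd, rightChild_reverse S hd, or_comm]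

theorem Nondeg.reverse (h : S.Nondeg) (ht : S.type < d) : S.reverse.Nondeg :=
  nondeg_of_verts (by rw [verts_reverse S ht]; exact h.verts) (by rw [verts_reverse S ht, h.card])

theorem head_reverse (S : TaggedSimplex d) : S.reverse.head = S.tail := by
  simp [head, tail, TaggedSimplex.reverse]

theorem tail_reverse (S : TaggedSimplex d) (hd : 1 ≤ d) : S.reverse.tail = S.head := by
  simp only [head, tail, TaggedSimplex.reverse, Fin.val_last]
  rw [if_neg (by omega), if_pos trivial]

end TaggedSimplex

end SpaceTimeMesh
namespace SpaceTimeMesh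

variable {d : ℕ}

open TaggedSimplex

/-! ### Uniform refinements are matched -/

/-- The compatibility of two adjacent simplices of the same level that is inherited by their
children: they are reflected neighbours, or neither refinement edge lies in the common hyperface
and the children that contain it are reflected neighbours. -/
def Matched (S S' : TaggedSimplex d) : Prop :=
  S.ReflectedNeighbours S' ∨
    (¬ (S.head ∈ S.verts ∩ S'.verts ∧ S.tail ∈ S.verts ∩ S'.verts) ∧
      ¬ (S'.head ∈ S.verts ∩ S'.verts ∧ S'.tail ∈ S.verts ∩ S'.verts) ∧
      ∀ R R', S.IsChild R → S'.IsChild R' → S.verts ∩ S'.verts ⊆ R.verts →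
        S.verts ∩ S'.verts ⊆ R'.verts → R.ReflectedNeighbours R')

theorem TaggedSimplex.AgreeButOne.notMem {S S' : TaggedSimplex d} {i : Fin (d + 1)}
    (h : Adjacent S S') (hS : S.Nondeg) (hi : ∀ k, k ≠ i → S.vertex k = S'.vertex k) :
    S.vertex i ∉ S.verts ∩ S'.verts := by
  intro hc
  have : S.verts ⊆ S.verts ∩ S'.verts := by
    intro v hv
    obtain ⟨k, rfl⟩ := mem_verts.1 hv
    by_cases hk : k = i
    · rw [hk]; exact hc
    · exact Finset.mem_inter.2 ⟨hv, by rw [hi k hk]; exact S'.vertex_mem k⟩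
  have := Finset.card_le_card this
  rw [h.card_eq, hS.card] at this
  omega

theorem TaggedSimplex.IsHalf.not_edge {S R : TaggedSimplex d} {e e' : Space d} (h : IsHalf S R e e')
    {W : Finset (Space d)} (hn : ¬ (S.head ∈ W ∧ S.tail ∈ W)) : ¬ (e ∈ W ∧ e' ∈ W) := by
  rcases h.ends with ⟨rfl, rfl⟩ | ⟨rfl, rfl⟩ <;> tauto

/-- Bisection of adjacent simplices whose vertex sequences differ at one position `i`. If `i` is the
first or the last position, then the refinement edges leave the common hyperface, and only the
children containing this hyperface are adjacent: they differ in their new vertices. Otherwise the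
refinement edge is common, and the children on the same side of it differ in the image of `i`. -/
theorem matched_step_agree (hd : 1 ≤ d) {S S' R R' : TaggedSimplex d} (hS : S.Nondeg)
    (hS' : S'.Nondeg) (ht : S.type < d) (hty : S.type = S'.type) (h : Adjacent S S')
    (ha : S.AgreeButOne S') (hR : S.IsChild R) (hR' : S'.IsChild R')
    (hH : HyperDim (R.carrier ∩ R'.carrier)) : Adjacent R R' ∧ R.ReflectedNeighbours R' := by
  obtain ⟨i, hi, hik⟩ := ha
  have hty' : R.type = R'.type := by rw [hR.type, hR'.type, hty]
  have hiW := AgreeButOne.notMem h hS hik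
  have ht' : S'.type < d := hty ▸ ht
  have hik' : ∀ k, k ≠ i → S'.vertex k = S.vertex k := fun k hk => (hik k hk).symm
  have hiW' : S'.vertex i ∉ S.verts ∩ S'.verts := by
    rw [Finset.inter_comm]; exact AgreeButOne.notMem h.symm hS' hik'
  have hl := isHalf_left hS hd
  have hr := isHalf_right hS hd ht
  have hl' := isHalf_left hS' hd
  have hr' := isHalf_right hS' hd ht'
  have hilt := i.isLt
  by_cases h0 : i = 0
  · subst h0
    have hn : ¬ (S.head ∈ S.verts ∩ S'.verts ∧ S.tail ∈ S.verts ∩ S'.verts) := fun hc => hiW hc.1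
    have hn' : ¬ (S'.head ∈ S.verts ∩ S'.verts ∧ S'.tail ∈ S.verts ∩ S'.verts) :=
      fun hc => hiW' hc.1
    have hlast : S.tail = S'.tail := hik _ (by rw [ne_eq, Fin.ext_iff]; simp; omega)
    have htW : S.tail ∈ S.verts ∩ S'.verts :=
      Finset.mem_inter.2 ⟨S.tail_mem, hlast ▸ S'.tail_mem⟩
    rcases hR with rfl | rfl
    · obtain ⟨f, f', hf⟩ := hR'.exists_isHalf hS' hd ht'
      exact absurd htW (h.halves_of_not_edge hS hS' hl hf (hl.not_edge hn) (hf.not_edge hn') hH).1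
    rcases hR' with rfl | rfl
    · exact absurd (hlast ▸ htW)
        (h.halves_of_not_edge hS hS' hr hl' (hr.not_edge hn) (hl'.not_edge hn') hH).2.1
    -- both are the children at the common vertex `tail`; their midpoints are at position `1`
    obtain ⟨-, -, -, h1, h2⟩ :=
      h.halves_of_not_edge hS hS' hr hr' (hr.not_edge hn) (hr'.not_edge hn') hH
    refine ⟨h1, hty', Or.inl ⟨⟨1, by omega⟩, ?_, fun k hk => ?_⟩⟩
    · simpa [rightChild, mid, head, tail] using h2
    · have := k.isLt
      rw [ne_eq, Fin.ext_iff] at hk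
      simp only at hk
      simp only [rightChild, hty]
      split_ifs with c0 c1
      · exact hlast
      · exact hik _ (by rw [ne_eq, Fin.ext_iff]; simp; omega)
      · exact hik _ (by rw [ne_eq, Fin.ext_iff]; simp; omega)
  by_cases hd' : i = Fin.last d
  · subst hd'
    have hn : ¬ (S.head ∈ S.verts ∩ S'.verts ∧ S.tail ∈ S.verts ∩ S'.verts) := fun hc => hiW hc.2
    have hn' : ¬ (S'.head ∈ S.verts ∩ S'.verts ∧ S'.tail ∈ S.verts ∩ S'.verts) :=
      fun hc => hiW' hc.2
    have hfirst : S.head = S'.head := hik _ (Ne.symm h0)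
    have htW : S.head ∈ S.verts ∩ S'.verts :=
      Finset.mem_inter.2 ⟨S.head_mem, hfirst ▸ S'.head_mem⟩
    rcases hR with rfl | rfl
    swap
    · obtain ⟨f, f', hf⟩ := hR'.exists_isHalf hS' hd ht'
      exact absurd htW (h.halves_of_not_edge hS hS' hr hf (hr.not_edge hn) (hf.not_edge hn') hH).1
    rcases hR' with rfl | rfl
    swap
    · exact absurd (hfirst ▸ htW)
        (h.halves_of_not_edge hS hS' hl hr' (hl.not_edge hn) (hr'.not_edge hn') hH).2.1
    -- both are the children at the common vertex `head`; their midpoints are at position `1`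
    obtain ⟨-, -, -, h1, h2⟩ :=
      h.halves_of_not_edge hS hS' hl hl' (hl.not_edge hn) (hl'.not_edge hn') hH
    refine ⟨h1, hty', Or.inl ⟨⟨1, by omega⟩, ?_, fun k hk => ?_⟩⟩
    · simpa [leftChild, mid, head, tail] using h2
    · have := k.isLt
      rw [ne_eq, Fin.ext_iff] at hk
      simp only [leftChild]
      split_ifs with c0
      · exact hfirst
      · exact hik _ (by rw [ne_eq, Fin.ext_iff]; simp; omega)
  · -- the refinement edge is common: equal sides give adjacent children, opposite sides do not
    have hfirst : S.head = S'.head := hik _ (Ne.symm h0)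
    have hlast : S.tail = S'.tail := hik _ (Ne.symm hd')
    rw [Fin.ext_iff] at h0 hd'
    simp only [Fin.val_zero, Fin.val_last] at h0 hd'
    rcases hR with rfl | rfl <;> rcases hR' with rfl | rfl
    · rw [← hfirst, ← hlast] at hl'
      have h1 := h.toMeetInFace.halves hS hS' hl hl'
      refine ⟨h1.adjacent (hl.nondeg hS) (hl'.nondeg hS') hH, hty',
        Or.inl ⟨⟨i + 1, by omega⟩, ?_, fun k hk => ?_⟩⟩
      · simp only [leftChild]
        rw [if_neg (by omega), if_neg (by omega), if_neg (by omega), if_neg (by omega)]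
        simpa using hi
      · have := k.isLt
        rw [ne_eq, Fin.ext_iff] at hk
        simp only at hk
        simp only [leftChild]
        split_ifs with c0 c1
        · exact hfirst
        · rw [show S.vertex 0 = S'.vertex 0 from hfirst, show S.vertex (Fin.last d) =
            S'.vertex (Fin.last d) from hlast]
        · exact hik _ (by rw [ne_eq, Fin.ext_iff]; simp; omega)
    · rw [← hfirst, ← hlast] at hr'
      obtain ⟨h1, h2⟩ := h.toMeetInFace.opposite_halves hS hS' hl hr'
      rw [h1.inter_eq] at hH
      have := hH.card_le
      omega
    · rw [← hfirst, ← hlast] at hl'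
      obtain ⟨h1, h2⟩ := h.toMeetInFace.opposite_halves hS hS' hr hl'
      rw [h1.inter_eq] at hH
      have := hH.card_le
      omega
    · rw [← hfirst, ← hlast] at hr'
      have h1 := h.toMeetInFace.halves hS hS' hr hr'
      refine ⟨h1.adjacent (hr.nondeg hS) (hr'.nondeg hS') hH, hty', Or.inl ?_⟩
      by_cases hiγ : (i : ℕ) ≤ S.type
      · refine ⟨⟨i + 1, by omega⟩, ?_, fun k hk => ?_⟩
        · simp only [rightChild, ← hty]
          rw [if_neg (by omega), if_neg (by omega), if_neg (by omega), if_neg (by omega),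
            dif_pos (by omega), dif_pos (by omega)]
          simpa using hi
        · have := k.isLt
          rw [ne_eq, Fin.ext_iff] at hk
          simp only at hk
          simp only [rightChild, ← hty]
          split_ifs with c0 c1 c2
          · exact hlast
          · rw [show S.vertex 0 = S'.vertex 0 from hfirst, show S.vertex (Fin.last d) =
              S'.vertex (Fin.last d) from hlast]
          · exact hik _ (by rw [ne_eq, Fin.ext_iff]; simp; omega)
          · exact hik _ (by rw [ne_eq, Fin.ext_iff]; simp; omega)
      · refine ⟨⟨d + S.type + 1 - i, by omega⟩, ?_, fun k hk => ?_⟩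
        · simp only [rightChild, ← hty]
          rw [if_neg (by omega), if_neg (by omega), if_neg (by omega), if_neg (by omega),
            dif_neg (by omega), dif_neg (by omega)]
          intro hc
          refine hi ?_
          rw [S.vertex_congr (j := ⟨d + S.type + 1 - (d + S.type + 1 - i), by omega⟩)
            (by simp; omega), S'.vertex_congr (j := ⟨d + S.type + 1 - (d + S.type + 1 - i),
            by omega⟩) (by simp; omega)]
          exact hc
        · have := k.isLt
          rw [ne_eq, Fin.ext_iff] at hk
          simp only at hk
          simp only [rightChild, ← hty]
          split_ifs with c0 c1 c2
          · exact hlast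
          · rw [show S.vertex 0 = S'.vertex 0 from hfirst, show S.vertex (Fin.last d) =
              S'.vertex (Fin.last d) from hlast]
          · exact hik _ (by rw [ne_eq, Fin.ext_iff]; simp; omega)
          · exact hik _ (by rw [ne_eq, Fin.ext_iff]; simp; omega)

theorem Adjacent.reverse {S S' : TaggedSimplex d} (ht : S.type < d) (h : Adjacent S S') :
    Adjacent S.reverse S' :=
  ⟨⟨by rw [carrier_reverse S ht, verts_reverse S ht, h.inter_eq],
    by rw [verts_reverse S ht]; exact h.ne⟩, by rw [verts_reverse S ht, h.card_eq]⟩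

/-- The induction step of `forest_matched` for children of different parents. Such children are even
reflected neighbours, so that the weaker alternative in `Matched` only concerns siblings and initial
simplices. -/
theorem matched_step (hd : 1 ≤ d) {S S' R R' : TaggedSimplex d} (hS : S.Nondeg)
    (hS' : S'.Nondeg) (ht : S.type < d) (hty : S.type = S'.type) (h : Adjacent S S')
    (hm : Matched S S') (hR : S.IsChild R) (hR' : S'.IsChild R')
    (hH : HyperDim (R.carrier ∩ R'.carrier)) : Adjacent R R' ∧ Matched R R' := by
  rcases hm with ⟨-, ha | ha⟩ | ⟨h1, h2, h3⟩
  · obtain ⟨h1, h2⟩ := matched_step_agree hd hS hS' ht hty h ha hR hR' hH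
    exact ⟨h1, Or.inl h2⟩
  · obtain ⟨h1, h2⟩ := matched_step_agree hd (hS.reverse ht) hS' (S := S.reverse) ht hty
      (h.reverse ht) ha ((isChild_reverse hd).2 hR) hR' hH
    exact ⟨h1, Or.inl h2⟩
  · obtain ⟨e, e', he⟩ := hR.exists_isHalf hS hd ht
    obtain ⟨f, f', hf⟩ := hR'.exists_isHalf hS' hd (hty ▸ ht)
    obtain ⟨-, -, h4, h5, -⟩ :=
      h.halves_of_not_edge hS hS' he hf (he.not_edge h1) (hf.not_edge h2) hH
    exact ⟨h5, Or.inl (h3 R R' hR hR' (by rw [← h4]; exact Finset.inter_subset_left)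
      (by rw [← h4]; exact Finset.inter_subset_right))⟩

namespace TaggedSimplex

theorem leftChild_vertex (S : TaggedSimplex d) (k : ℕ) (h2 : 2 ≤ k) (hk : k < d + 1 := by omega) :
    S.leftChild.vertex ⟨k, hk⟩ = S.vertex ⟨k - 1, by omega⟩ := by
  simp only [leftChild]
  rw [if_neg (by omega), if_neg (by omega)]

theorem rightChild_vertex_low (S : TaggedSimplex d) (k : ℕ) (h2 : 2 ≤ k) (h : k ≤ S.type + 1)
    (hk : k < d + 1 := by omega) : S.rightChild.vertex ⟨k, hk⟩ = S.vertex ⟨k - 1, by omega⟩ := by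
  simp only [rightChild]
  rw [if_neg (by omega), if_neg (by omega), dif_pos h]

theorem rightChild_vertex_high (S : TaggedSimplex d) (k : ℕ) (h2 : 2 ≤ k) (h : S.type + 1 < k)
    (hk : k < d + 1 := by omega) :
    S.rightChild.vertex ⟨k, hk⟩ = S.vertex ⟨d + S.type + 1 - k, by omega⟩ := by
  simp only [rightChild]
  rw [if_neg (by omega), if_neg (by omega), dif_neg (by omega)]

end TaggedSimplex

/-- The induction step of `forest_matched` for the two children of a simplex. If the type is at least
`d - 2`, then the reversed part of the right child is trivial, and the children differ in their first
vertices. Otherwise the refinement edges of the children leave their common hyperface, and the two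
grandchildren that contain it are reflected neighbours. -/
theorem siblings_matched (hd : 1 ≤ d) {S : TaggedSimplex d} (hS : S.Nondeg) (ht : S.type < d) :
    Matched S.leftChild S.rightChild := by
  have hl := isHalf_left hS hd
  have hr := isHalf_right hS hd ht
  by_cases hγ : d ≤ S.type + 2
  · refine Or.inl ⟨rfl, Or.inl ⟨0, ?_, fun k hk => ?_⟩⟩
    · simpa [leftChild, rightChild, head, tail] using hS.head_ne_tail hd
    · have := k.isLt
      rw [ne_eq, Fin.ext_iff] at hk
      simp only [Fin.val_zero] at hk
      simp only [leftChild, rightChild]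
      rw [if_neg hk, if_neg hk]
      split_ifs with c1 c2
      · rfl
      · rfl
      · exact S.vertex_congr (by simp; omega)
  · have hadj := siblings_adjacent hS hl hr
    have hhead : S.leftChild.head ∉ S.rightChild.verts := by
      have : S.leftChild.head = S.head := by simp [head, leftChild]
      rw [this]; exact hr.notMem hS
    have hhead' : S.rightChild.head ∉ S.leftChild.verts := by
      have : S.rightChild.head = S.tail := by simp [head, tail, rightChild]
      rw [this]; exact hl.notMem hS
    have hmodlt : (S.type + 1) % d = S.type + 1 := Nat.mod_eq_of_lt (by omega)
    have hmodlt2 : (S.type + 1 + 1) % d = S.type + 2 := Nat.mod_eq_of_lt (by omega)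
    have hL : S.leftChild.Nondeg := hl.nondeg hS
    have hRt : S.rightChild.Nondeg := hr.nondeg hS
    have htL : S.leftChild.type < d := by simp only [leftChild]; omega
    have htR : S.rightChild.type < d := by simp only [rightChild]; omega
    have htail : S.leftChild.tail = S.vertex ⟨d - 1, by omega⟩ := by
      simp only [tail, leftChild, Fin.val_last]
      rw [if_neg (by omega), if_neg (by omega)]
    have htail' : S.rightChild.tail = S.vertex ⟨S.type + 1, by omega⟩ := by
      simp only [tail, rightChild, Fin.val_last]
      rw [if_neg (by omega), if_neg (by omega), dif_neg (by omega)]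
      exact S.vertex_congr (by simp; omega)
    have hvne : ∀ (j : ℕ) (hj : j < d + 1), j ≠ 0 → j ≠ d →
        S.vertex ⟨j, hj⟩ ∈ S.leftChild.verts ∩ S.rightChild.verts := by
      intro j hj h0 h1
      rw [Finset.mem_inter, hl.verts_eq, hr.verts_eq, mem_halfVerts, mem_halfVerts]
      refine ⟨Or.inr ⟨fun hc => ?_, S.vertex_mem _⟩, Or.inr ⟨fun hc => ?_, S.vertex_mem _⟩⟩
      · exact h1 (congrArg Fin.val (hS.injective hc))
      · exact h0 (congrArg Fin.val (hS.injective hc))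
    refine Or.inr ⟨fun hc => hhead (Finset.mem_inter.1 hc.1).2,
      fun hc => hhead' (Finset.mem_inter.1 hc.1).1, fun R R' hR hR' hW hW' => ?_⟩
    rcases hR with rfl | rfl
    · refine absurd ?_ ((isHalf_left hL hd).notMem hL)
      rw [htail]
      exact hW (hvne _ _ (by omega) (by omega))
    rcases hR' with rfl | rfl
    · refine absurd ?_ ((isHalf_left hRt hd).notMem hRt)
      rw [htail']
      exact hW' (hvne _ _ (by omega) (by omega))
    -- the right grandchildren contain the common hyperface; one of them and the reversal of the other
    -- differ in the midpoints at position `1` only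
    refine ⟨rfl, Or.inr ⟨⟨1, by omega⟩, ?_, fun k hk => ?_⟩⟩
    · have hmid : S.leftChild.mid ≠ S.rightChild.mid := by
        intro hc
        have : S.leftChild.mid ∈ S.leftChild.carrier ∩ S.rightChild.carrier :=
          ⟨S.leftChild.mid_mem_carrier, hc ▸ S.rightChild.mid_mem_carrier⟩
        rw [hadj.inter_eq] at this
        exact hhead (Finset.mem_inter.1 (edge_subset_of_midpoint_mem hL.verts
          Finset.inter_subset_left S.leftChild.head_mem S.leftChild.tail_mem
          (hL.head_ne_tail hd) this).1).2
      have e1 : S.leftChild.rightChild.reverse.vertex ⟨1, by omega⟩ = S.leftChild.mid := by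
        simp only [reverse]
        rw [if_neg (by omega), if_neg (by omega), dif_pos (by simp [leftChild, rightChild]; omega)]
        simp [rightChild, mid, head, tail]
      have e2 : S.rightChild.rightChild.vertex ⟨1, by omega⟩ = S.rightChild.mid := by
        simp [rightChild, mid, head, tail]
      rw [e1, e2]
      exact hmid
    · have := k.isLt
      obtain ⟨k, hklt⟩ := k
      rw [ne_eq, Fin.ext_iff] at hk
      simp only at hk
      have hlt : S.leftChild.rightChild.type = S.type + 2 := by
        simp only [leftChild, rightChild, hmodlt, hmodlt2]
      have hll : S.leftChild.type = S.type + 1 := hmodlt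
      have hrr : S.rightChild.type = S.type + 1 := hmodlt
      rcases Nat.eq_zero_or_pos k with h0 | h0
      · subst h0
        rw [show (⟨0, hklt⟩ : Fin (d + 1)) = 0 from rfl,
          show S.leftChild.rightChild.reverse.vertex 0 = _ from head_reverse _,
          tail, show Fin.last d = ⟨d, by omega⟩ from rfl,
          rightChild_vertex_high _ d (by omega) (by omega), show S.rightChild.rightChild.vertex 0 =
            S.rightChild.tail by simp [rightChild, tail], htail',
          leftChild_vertex _ _ (by omega)]
        exact S.vertex_congr (by simp; omega)
      by_cases h1 : k = d
      · subst h1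
        rw [show S.leftChild.rightChild.reverse.vertex ⟨k, hklt⟩ = _ from tail_reverse _ hd,
          show S.leftChild.rightChild.head = S.leftChild.tail by simp [rightChild, head, tail],
          htail, rightChild_vertex_high _ k (by omega) (by omega),
          rightChild_vertex_high _ _ (by omega) (by omega)]
        exact S.vertex_congr (by simp; omega)
      by_cases h2 : k ≤ S.type + 2
      · rw [show S.leftChild.rightChild.reverse.vertex ⟨k, hklt⟩ =
            S.leftChild.rightChild.vertex ⟨k, hklt⟩ by
          simp only [reverse]
          rw [if_neg (by omega), if_neg (by omega), dif_pos (by omega)],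
          rightChild_vertex_low _ k (by omega) (by omega),
          rightChild_vertex_low _ k (by omega) (by omega)]
        rcases (show k = 2 ∨ 3 ≤ k by omega) with h3 | h3
        · subst h3; simp [leftChild, rightChild]
        · rw [leftChild_vertex _ _ (by omega), rightChild_vertex_low _ _ (by omega) (by omega)]
      · rw [show S.leftChild.rightChild.reverse.vertex ⟨k, hklt⟩ =
            S.leftChild.rightChild.vertex ⟨d + S.type + 2 - k, by omega⟩ by
          simp only [reverse]
          rw [if_neg (by omega), if_neg (by omega), dif_neg (by omega)]
          exact vertex_congr _ (by simp; omega),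
          rightChild_vertex_high _ _ (by omega) (by omega),
          rightChild_vertex_high _ k (by omega) (by omega),
          rightChild_vertex_high _ _ (by omega) (by omega), leftChild_vertex _ _ (by omega)]
        exact S.vertex_congr (by simp; omega)

end SpaceTimeMesh
namespace SpaceTimeMesh

variable {d : ℕ}

open TaggedSimplex

theorem Adjacent.neighbours {S S' : TaggedSimplex d} (h : Adjacent S S') : S.Neighbours S' := by
  refine ⟨?_, fun hc => h.ne ?_⟩
  · rw [← coe_verts, ← coe_verts, ← Finset.coe_inter, Set.ncard_coe_finset, h.card_eq]
  · rw [← coe_verts, ← coe_verts] at hc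
    exact_mod_cast hc

theorem MeetInFace.mem_inter {S S' : TaggedSimplex d} (h : MeetInFace S S') (hS : S.Nondeg)
    {v : Space d} (hv : v ∈ S.verts) (hv' : v ∈ S'.carrier) : v ∈ S.verts ∩ S'.verts := by
  refine mem_of_vertex_mem_hull hS.verts Finset.inter_subset_left hv ?_
  rw [← h.inter_eq]
  exact ⟨by rw [carrier_eq]; exact subset_convexHull ℝ _ hv, hv'⟩

theorem verts_subset_carrier (S : TaggedSimplex d) {v : Space d} (hv : v ∈ S.verts) :
    v ∈ S.carrier := by
  rw [carrier_eq]; exact subset_convexHull ℝ _ hv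

theorem MeetInFace.edge_subset_iff {S S' : TaggedSimplex d} (h : MeetInFace S S')
    (hS : S.Nondeg) : S.refinementEdge ⊆ S'.carrier ↔
      (S.head ∈ S.verts ∩ S'.verts ∧ S.tail ∈ S.verts ∩ S'.verts) := by
  constructor
  · intro hsub
    exact ⟨h.mem_inter hS S.head_mem (hsub (left_mem_segment ℝ _ _)),
      h.mem_inter hS S.tail_mem (hsub (right_mem_segment ℝ _ _))⟩
  · rintro ⟨h1, h2⟩
    exact S'.convex_carrier.segment_subset
      (verts_subset_carrier S' (Finset.mem_inter.1 h1).2)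
      (verts_subset_carrier S' (Finset.mem_inter.1 h2).2)

theorem refinementEdge_subset_carrier (S : TaggedSimplex d) : S.refinementEdge ⊆ S.carrier :=
  S.convex_carrier.segment_subset (verts_subset_carrier S S.head_mem)
    (verts_subset_carrier S S.tail_mem)

variable {M : InitialMesh d}

theorem matched_of_initial (hd : 1 ≤ d) {S S' : TaggedSimplex d} (hS : S ∈ M.triangulation)
    (hS' : S' ∈ M.triangulation) (h : Adjacent S S') : Matched S S' := by
  have hn : S.Nondeg := M.nondegenerate _ hS
  have hn' : S'.Nondeg := M.nondegenerate _ hS'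
  have hw := M.wellLabeled.2 S hS S' hS' h.neighbours
  have e1 : S.refinementEdge ⊆ S.carrier ∩ S'.carrier ↔
      (S.head ∈ S.verts ∩ S'.verts ∧ S.tail ∈ S.verts ∩ S'.verts) := by
    rw [← h.toMeetInFace.edge_subset_iff hn, subset_inter_iff]
    exact and_iff_right (refinementEdge_subset_carrier S)
  have e2 : S'.refinementEdge ⊆ S.carrier ∩ S'.carrier ↔
      (S'.head ∈ S.verts ∩ S'.verts ∧ S'.tail ∈ S.verts ∩ S'.verts) := by
    rw [Finset.inter_comm, ← h.symm.toMeetInFace.edge_subset_iff hn', subset_inter_iff]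
    exact and_iff_left (refinementEdge_subset_carrier S')
  rw [e1, e2] at hw
  by_cases hc : (S.head ∈ S.verts ∩ S'.verts ∧ S.tail ∈ S.verts ∩ S'.verts) ∨
      (S'.head ∈ S.verts ∩ S'.verts ∧ S'.tail ∈ S.verts ∩ S'.verts)
  · exact Or.inl (hw.1 hc)
  · have hc' := not_or.1 hc
    refine Or.inr ⟨hc'.1, hc'.2, fun R R' hR hR' hW hW' => ?_⟩
    obtain ⟨e, e', he⟩ := (InForest.base hS).exists_isHalf hd hR
    obtain ⟨f, f', hf⟩ := (InForest.base hS').exists_isHalf hd hR'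
    have hH : HyperDim (R.carrier ∩ R'.carrier) := by
      refine (h.hyperDim hd hn).mono ?_
      rw [h.inter_eq, carrier_eq, carrier_eq]
      exact subset_inter (convexHull_mono (by exact_mod_cast hW))
        (convexHull_mono (by exact_mod_cast hW'))
    obtain ⟨-, -, -, h5, -⟩ :=
      h.halves_of_not_edge hn hn' he hf (he.not_edge hc'.1) (hf.not_edge hc'.2) hH
    exact hw.2 hc R (mem_bisect.2 hR) R' (mem_bisect.2 hR') h5.neighbours

/-- Uniform refinements of a well-labeled triangulation: two simplices of the same level that share
`d` affinely independent points meet in a common hyperface, and they are matched. By induction on the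
level: the parents are equal, or they satisfy the statement themselves. -/
theorem forest_matched (hd : 1 ≤ d) (n : ℕ) : ∀ S S' : TaggedSimplex d, InForest M S →
    InForest M S' → S.level = n → S'.level = n → S ≠ S' → HyperDim (S.carrier ∩ S'.carrier) →
    Adjacent S S' ∧ (Matched S S' ∨ Matched S' S) := by
  induction n with
  | zero =>
    intro S S' hS hS' hl hl' hne hH
    have h1 := hS.mem_of_level_eq_zero hl
    have h2 := hS'.mem_of_level_eq_zero hl'
    have h3 := M.conforming.meetInFace h1 h2 (hS.nondeg hd) (hS'.nondeg hd) hne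
    have h4 := h3.adjacent (hS.nondeg hd) (hS'.nondeg hd) hH
    exact ⟨h4, Or.inl (matched_of_initial hd h1 h2 h4)⟩
  | succ n ih =>
    intro R R' hR hR' hl hl' hne hH
    cases hR with
    | base h => rw [M.level_eq_zero _ h] at hl; omega
    | @child S _ hS hc =>
    cases hR' with
    | base h => rw [M.level_eq_zero _ h] at hl'; omega
    | @child S' _ hS' hc' =>
    rw [hc.level] at hl
    rw [hc'.level] at hl'
    by_cases hSS : S = S'
    · subst hSS
      have hn := hS.nondeg hd
      have hlt := isHalf_left hn hd
      have hrt := isHalf_right hn hd (hS.type_lt hd)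
      have hm := siblings_matched hd hn (hS.type_lt hd)
      rcases hc with rfl | rfl <;> rcases hc' with rfl | rfl
      · exact absurd rfl hne
      · exact ⟨siblings_adjacent hn hlt hrt, Or.inl hm⟩
      · exact ⟨siblings_adjacent hn hrt hlt, Or.inr hm⟩
      · exact absurd rfl hne
    · obtain ⟨e, e', he⟩ := hS.exists_isHalf hd hc
      obtain ⟨f, f', hf⟩ := hS'.exists_isHalf hd hc'
      obtain ⟨h1, h2⟩ := ih S S' hS hS' (by omega) (by omega) hSS
        (hH.mono (inter_subset_inter he.carrier_subset hf.carrier_subset))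
      have hty := hS.type_eq hS' (by omega)
      rcases h2 with h2 | h2
      · obtain ⟨h3, h4⟩ := matched_step hd (hS.nondeg hd) (hS'.nondeg hd) (hS.type_lt hd) hty h1 h2
          hc hc' hH
        exact ⟨h3, Or.inl h4⟩
      · rw [inter_comm] at hH
        obtain ⟨h3, h4⟩ := matched_step hd (hS'.nondeg hd) (hS.nondeg hd) (hS'.type_lt hd)
          hty.symm h1.symm h2 hc' hc hH
        exact ⟨h3.symm, Or.inr h4⟩

namespace InForest

variable {S S' R : TaggedSimplex d}

/-- Simplices of the same level with overlapping interiors are equal. -/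
theorem eq_of_overlap (hd : 1 ≤ d) (hS : InForest M S) (hS' : InForest M S')
    (hl : S.level = S'.level) (h : affineDim (S.carrier ∩ S'.carrier) = d) : S = S' := by
  by_contra hne
  have h1 := (forest_matched hd _ S S' hS hS' rfl hl.symm hne
    (hyperDim_of_affineDim_eq hd h)).1
  have := h1.toMeetInFace.affineDim_lt hd (hS.nondeg hd) (hS'.nondeg hd)
  omega

theorem desc_of_overlap (hd : 1 ≤ d) (hS : InForest M S) (hR : InForest M R)
    (hl : S.level ≤ R.level) (h : affineDim (S.carrier ∩ R.carrier) = d) : Desc S R := by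
  obtain ⟨A, hA, hAl, hAR⟩ := hR.exists_ancestor hl
  have h1 : affineDim (S.carrier ∩ A.carrier) = d := le_antisymm (affineDim_le _)
    (h.symm.le.trans (affineDim_mono (inter_subset_inter Subset.rfl (hA.desc_carrier hd hAR))))
  rw [hS.eq_of_overlap hd hA hAl.symm h1]
  exact hAR

theorem overlap_of_desc (hd : 1 ≤ d) (hS : InForest M S) (h : Desc S R) :
    affineDim (S.carrier ∩ R.carrier) = d := by
  rw [inter_eq_right.2 (hS.desc_carrier hd h)]
  exact ((hS.desc h).nondeg hd).affineDim_carrier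

theorem overlap_of_comparable (hd : 1 ≤ d) (hS : InForest M S) (hR : InForest M R)
    (h : Comparable S R) : affineDim (S.carrier ∩ R.carrier) = d := by
  rcases h with h | h
  · exact hS.overlap_of_desc hd h
  · rw [inter_comm]; exact hR.overlap_of_desc hd h

theorem comparable_of_overlap (hd : 1 ≤ d) (hS : InForest M S) (hR : InForest M R)
    (h : affineDim (S.carrier ∩ R.carrier) = d) : Comparable S R := by
  rcases le_total S.level R.level with h1 | h1
  · exact Or.inl (hS.desc_of_overlap hd hR h1 h)
  · exact Or.inr (hR.desc_of_overlap hd hS h1 (by rwa [inter_comm]))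

end InForest

/-- The refinement edges coincide. -/
def SameEdge (S S' : TaggedSimplex d) : Prop :=
  (S'.head = S.head ∧ S'.tail = S.tail) ∨ (S'.head = S.tail ∧ S'.tail = S.head)

theorem SameEdge.mid_eq {S S' : TaggedSimplex d} (h : SameEdge S S') : S'.mid = S.mid := by
  rcases h with ⟨h1, h2⟩ | ⟨h1, h2⟩
  · rw [mid, mid, h1, h2]
  · rw [mid, mid, h1, h2, midpoint_comm]

theorem SameEdge.refl (S : TaggedSimplex d) : SameEdge S S := Or.inl ⟨rfl, rfl⟩

theorem SameEdge.symm {S S' : TaggedSimplex d} (h : SameEdge S S') : SameEdge S' S := by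
  rcases h with ⟨h1, h2⟩ | ⟨h1, h2⟩
  · exact Or.inl ⟨h1.symm, h2.symm⟩
  · exact Or.inr ⟨h2.symm, h1.symm⟩

theorem SameEdge.trans {S S' R : TaggedSimplex d} (h : SameEdge S S') (h' : SameEdge S' R) :
    SameEdge S R := by
  rcases h with ⟨h1, h2⟩ | ⟨h1, h2⟩ <;> rcases h' with ⟨h3, h4⟩ | ⟨h3, h4⟩ <;>
    simp [SameEdge, h1, h2, h3, h4]

theorem sameEdge_of_reflected {S S' : TaggedSimplex d} (hd : 1 ≤ d) (hS : S.Nondeg)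
    (ht : S.type < d) (h : Adjacent S S') (hr : S.ReflectedNeighbours S')
    (he : S.head ∈ S.verts ∩ S'.verts ∧ S.tail ∈ S.verts ∩ S'.verts) : SameEdge S S' := by
  rcases hr with ⟨-, ⟨i, -, hik⟩ | ⟨i, -, hik⟩⟩
  · have hi := AgreeButOne.notMem h hS hik
    refine Or.inl ⟨(hik 0 fun hc => ?_).symm, (hik (Fin.last d) fun hc => ?_).symm⟩
    · subst hc; exact hi he.1
    · subst hc; exact hi he.2
  · have hi := AgreeButOne.notMem (h.reverse ht) (hS.reverse ht) hik
    rw [verts_reverse S ht] at hi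
    refine Or.inr ⟨?_, ?_⟩
    · rw [← head_reverse S]
      refine (hik 0 fun hc => ?_).symm
      subst hc
      rw [show S.reverse.vertex 0 = _ from head_reverse S] at hi
      exact hi he.2
    · rw [← tail_reverse S hd]
      refine (hik (Fin.last d) fun hc => ?_).symm
      subst hc
      rw [show S.reverse.vertex (Fin.last d) = _ from tail_reverse S hd] at hi
      exact hi he.1

theorem AgreeButOne.symm {S S' : TaggedSimplex d} (h : S.AgreeButOne S') : S'.AgreeButOne S := by
  obtain ⟨i, hi, hk⟩ := h
  exact ⟨i, hi.symm, fun k hki => (hk k hki).symm⟩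

/-- On a common level, adjacent simplices have the same refinement edge as soon as one of the
refinement edges lies in the common hyperface. -/
theorem InForest.sameEdge (hd : 1 ≤ d) {S S' : TaggedSimplex d} (hS : InForest M S)
    (hS' : InForest M S') (hl : S.level = S'.level) (h : Adjacent S S')
    (he : S.head ∈ S.verts ∩ S'.verts ∧ S.tail ∈ S.verts ∩ S'.verts) : SameEdge S S' := by
  have hne : S ≠ S' := fun hc => h.ne (by rw [hc])
  obtain ⟨-, hm⟩ := forest_matched hd _ S S' hS hS' rfl hl.symm hne
    (h.hyperDim hd (hS.nondeg hd))
  rcases hm with (hm | ⟨hm, -, -⟩) | (hm | ⟨-, hm, -⟩)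
  · exact sameEdge_of_reflected hd (hS.nondeg hd) (hS.type_lt hd) h hm he
  · exact absurd he hm
  · -- the reflection is read from `S'` to `S`
    rcases hm with ⟨-, ha | ⟨i, -, hik⟩⟩
    · exact sameEdge_of_reflected hd (hS.nondeg hd) (hS.type_lt hd) h
        ⟨hS.type_eq hS' hl, Or.inl (AgreeButOne.symm ha)⟩ he
    · have ht' := hS'.type_lt hd
      have hadj := (h.symm.reverse ht').symm
      have hi := AgreeButOne.notMem hadj (hS.nondeg hd) (fun k hk => (hik k hk).symm)
      rw [verts_reverse S' ht'] at hi
      refine Or.inr ⟨?_, ?_⟩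
      · rw [← tail_reverse S' hd]
        refine hik (Fin.last d) fun hc => ?_
        subst hc
        exact hi he.2
      · rw [← head_reverse S']
        refine hik 0 fun hc => ?_
        subst hc
        exact hi he.1
  · rw [Finset.inter_comm] at hm
    exact absurd he hm

theorem TaggedSimplex.IsHalf.notMem_carrier {S R : TaggedSimplex d} {e e' : Space d}
    (h : IsHalf S R e e') (hS : S.Nondeg) : e' ∉ R.carrier := by
  classical
  intro hc
  rw [carrier_eq, h.verts_eq] at hc
  have hs : ∑ u ∈ S.verts, (if u = e' then (1 : ℝ) else 0) = 1 := by simp [h.mem']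
  have hs' : ∑ u ∈ S.verts, (if u = e' then (1 : ℝ) else 0) • u = e' := by simp [h.mem']
  have := ((mem_hull_half hS.verts h.mem h.mem' h.ne hs).1 (by rw [hs']; exact hc)).2
  simp [h.ne] at this
  linarith

/-- If a neighbour is finer, its ancestor on the level of the simplex shares the same hyperface,
which lies in a child of the ancestor. -/
theorem Adjacent.finer (hd : 1 ≤ d) {S S' : TaggedSimplex d} (hS : InForest M S)
    (hS' : InForest M S') (h : Adjacent S S') (hl : S.level < S'.level) :
    ∃ A c e e', InForest M A ∧ A.level = S.level ∧ Adjacent S A ∧ IsHalf A c e e' ∧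
      A.IsChild c ∧ Desc c S' ∧ S.verts ∩ A.verts = S.verts ∩ S'.verts ∧
      e' ∉ S.verts ∩ S'.verts ∧ S.verts ∩ S'.verts ⊆ c.verts := by
  obtain ⟨A, hA, hAl, hAS⟩ := hS'.exists_ancestor hl.le
  have hAne : S ≠ A := by
    rintro rfl
    have h1 := hS.overlap_of_desc hd hAS
    have h2 := h.toMeetInFace.affineDim_lt hd (hS.nondeg hd) (hS'.nondeg hd)
    omega
  have hH := (h.hyperDim hd (hS.nondeg hd)).mono
    (inter_subset_inter (Subset.rfl (s := S.carrier)) (hA.desc_carrier hd hAS))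
  have hadj := (forest_matched hd _ S A hS hA rfl hAl hAne hH).1
  have hWsub : S.verts ∩ S'.verts ⊆ S.verts ∩ A.verts := fun v hv =>
    hadj.toMeetInFace.mem_inter (hS.nondeg hd) (Finset.mem_inter.1 hv).1
      (hA.desc_carrier hd hAS (verts_subset_carrier S' (Finset.mem_inter.1 hv).2))
  have hWeq : S.verts ∩ S'.verts = S.verts ∩ A.verts :=
    Finset.eq_of_subset_of_card_le hWsub (by rw [h.card_eq, hadj.card_eq])
  obtain ⟨c, hc, hcS⟩ := hAS.exists_child (by omega)
  obtain ⟨e, e', he⟩ := hA.exists_isHalf hd hc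
  have he' : e' ∉ S.verts ∩ S'.verts := fun hm =>
    he.notMem_carrier (hA.nondeg hd) ((hA.child hc).desc_carrier hd hcS
      (verts_subset_carrier S' (Finset.mem_inter.1 hm).2))
  refine ⟨A, c, e, e', hA, hAl, hadj, he, hc, hcS, hWeq.symm, he', fun v hv => ?_⟩
  rw [he.verts_eq, mem_halfVerts]
  refine Or.inr ⟨fun hv' => he' (hv' ▸ hv), ?_⟩
  rw [hWeq] at hv
  exact (Finset.mem_inter.1 hv).2

/-- A neighbour that contains the refinement edge is not finer. -/
theorem Adjacent.level_le_of_edge (hd : 1 ≤ d) {S S' : TaggedSimplex d} (hS : InForest M S)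
    (hS' : InForest M S') (h : Adjacent S S')
    (he : S.head ∈ S.verts ∩ S'.verts ∧ S.tail ∈ S.verts ∩ S'.verts) : S'.level ≤ S.level := by
  by_contra hl
  obtain ⟨A, c, e, e', hA, hAl, hadj, hh, -, -, hW, he', -⟩ := h.finer hd hS hS' (by omega)
  rw [← hW] at he he'
  have hse := hS.sameEdge hd hA hAl.symm hadj he
  rcases hh.ends with ⟨h1, h2⟩ | ⟨h1, h2⟩ <;> rcases hse with ⟨h3, h4⟩ | ⟨h3, h4⟩ <;>
    simp_all

theorem TaggedSimplex.mid_eq_vertex_one {S R : TaggedSimplex d} (hd : 1 ≤ d) (h : S.IsChild R) :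
    S.mid = R.vertex ⟨1, by omega⟩ := by
  rcases h with rfl | rfl <;> simp [leftChild, rightChild, mid, head, tail]

/-- In dimension at least two, the levels of neighbours differ by at most one: after one bisection
the refinement edge lies in the common hyperface. -/
theorem Adjacent.level_le_succ (hd : 2 ≤ d) {S S' : TaggedSimplex d} (hS : InForest M S)
    (hS' : InForest M S') (h : Adjacent S S') : S'.level ≤ S.level + 1 := by
  have hd1 : 1 ≤ d := by omega
  by_contra hl
  obtain ⟨A, c, e, e', hA, hAl, hadj, hh, hc, hcS, hW, he', hWc⟩ := h.finer hd1 hS hS' (by omega)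
  have hcf := hA.child hc
  have hcn := hcf.nondeg hd1
  -- all vertices of `c` but the new one lie in the common hyperface
  have hcW : ∀ v ∈ c.verts, v ≠ A.mid → v ∈ S.verts ∩ S'.verts := by
    have hm : A.mid ∉ S.verts ∩ S'.verts := by
      rw [← hW, Finset.mem_inter]
      exact fun hm => mid_notMem (hA.nondeg hd1) hd1 hm.2
    have : S.verts ∩ S'.verts = c.verts.erase A.mid := Finset.eq_of_subset_of_card_le
      (fun v hv => Finset.mem_erase.2 ⟨fun hv' => hm (hv' ▸ hv), hWc hv⟩) (by
        rw [Finset.card_erase_of_mem hh.mid_mem, hcn.card, h.card_eq]; omega)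
    intro v hv hne
    rw [this]
    exact Finset.mem_erase.2 ⟨hne, hv⟩
  have hmid := TaggedSimplex.mid_eq_vertex_one hd1 hc
  have hhead : c.head ∈ S.verts ∩ S'.verts := hcW _ c.head_mem (by
    rw [hmid]; intro hc'
    have := congrArg Fin.val (hcn.injective hc')
    simp at this)
  have htail : c.tail ∈ S.verts ∩ S'.verts := hcW _ c.tail_mem (by
    rw [hmid]; intro hc'
    have := congrArg Fin.val (hcn.injective hc')
    simp at this
    omega)
  have hcl := hc.level
  obtain ⟨c', hc', hcS'⟩ := hcS.exists_child (by omega)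
  obtain ⟨f, f', hf⟩ := hcf.exists_isHalf hd1 hc'
  have hf' : f' ∈ S'.verts := by
    rcases hf.ends with ⟨-, h2⟩ | ⟨-, h2⟩
    · rw [h2]; exact (Finset.mem_inter.1 htail).2
    · rw [h2]; exact (Finset.mem_inter.1 hhead).2
  exact hf.notMem_carrier hcn ((hcf.child hc').desc_carrier hd1 hcS'
    (verts_subset_carrier S' hf'))

end SpaceTimeMesh
namespace SpaceTimeMesh

/-! ### The dyadic forest of time intervals -/

namespace TimeInterval

theorem mem_carrier {I : TimeInterval} {t : ℝ} :
    t ∈ I.carrier ↔ I.lo ≤ t ∧ t ≤ I.hi ∧ (t < I.hi ∨ I.closedRight = true) := by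
  unfold carrier
  split_ifs with h
  · simp [h]
  · simp only [mem_Ico, h, Bool.false_eq_true, or_false]
    exact ⟨fun ⟨h1, h2⟩ => ⟨h1, h2.le, h2⟩, fun ⟨h1, _, h2⟩ => ⟨h1, h2⟩⟩

theorem Ioo_subset_carrier (I : TimeInterval) : Ioo I.lo I.hi ⊆ I.carrier := fun _ ht =>
  mem_carrier.2 ⟨ht.1.le, ht.2.le, Or.inl ht.2⟩

theorem carrier_subset_Icc (I : TimeInterval) : I.carrier ⊆ Icc I.lo I.hi := fun _ ht =>
  ⟨(mem_carrier.1 ht).1, (mem_carrier.1 ht).2.1⟩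

theorem closure_carrier {I : TimeInterval} (h : I.lo < I.hi) : closure I.carrier = Icc I.lo I.hi := by
  refine Subset.antisymm (closure_minimal I.carrier_subset_Icc isClosed_Icc) ?_
  rw [← closure_Ioo h.ne]
  exact closure_mono I.Ioo_subset_carrier

theorem mem_bisect {I J : TimeInterval} : J ∈ I.bisect ↔
    J = ⟨I.lo, (I.lo + I.hi) / 2, false⟩ ∨ J = ⟨(I.lo + I.hi) / 2, I.hi, I.closedRight⟩ := by
  simp [bisect]

theorem lo_lt_hi_of_bisect {I J : TimeInterval} (h : I.lo < I.hi) (hJ : J ∈ I.bisect) :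
    J.lo < J.hi ∧ I.lo ≤ J.lo ∧ J.hi ≤ I.hi ∧ J.hi - J.lo = (I.hi - I.lo) / 2 := by
  rcases mem_bisect.1 hJ with rfl | rfl
  · exact ⟨by simp only; linarith, le_rfl, by simp only; linarith, by simp only; ring⟩
  · exact ⟨by simp only; linarith, by simp only; linarith, le_rfl, by simp only; ring⟩

theorem carrier_subset_of_bisect {I J : TimeInterval} (h : I.lo < I.hi) (hJ : J ∈ I.bisect) :
    J.carrier ⊆ I.carrier := by
  intro t ht
  rw [mem_carrier] at ht ⊢
  rcases mem_bisect.1 hJ with rfl | rfl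
  · simp only [Bool.false_eq_true, or_false] at ht
    exact ⟨ht.1, by linarith [ht.2.1], Or.inl (by linarith [ht.2.1])⟩
  · exact ⟨by linarith [ht.1], ht.2⟩

theorem exists_bisect_of_mem {I : TimeInterval} {t : ℝ} (ht : t ∈ I.carrier) :
    ∃ J ∈ I.bisect, t ∈ J.carrier := by
  rw [mem_carrier] at ht
  rcases lt_or_ge t ((I.lo + I.hi) / 2) with h | h
  · exact ⟨_, mem_bisect.2 (Or.inl rfl), mem_carrier.2 ⟨ht.1, h.le, Or.inl h⟩⟩
  · exact ⟨_, mem_bisect.2 (Or.inr rfl), mem_carrier.2 ⟨h, ht.2⟩⟩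

theorem eq_of_mem_bisect {I J J' : TimeInterval} (hJ : J ∈ I.bisect) (hJ' : J' ∈ I.bisect) {t : ℝ}
    (ht : t ∈ J.carrier) (ht' : t ∈ J'.carrier) : J = J' := by
  rw [mem_carrier] at ht ht'
  rcases mem_bisect.1 hJ with rfl | rfl <;> rcases mem_bisect.1 hJ' with rfl | rfl
  · rfl
  · simp only [Bool.false_eq_true, or_false] at ht ht'
    linarith [ht.2.2, ht'.1]
  · simp only [Bool.false_eq_true, or_false] at ht ht'
    linarith [ht'.2.2, ht.1]
  · rfl

/-- Equidistant nodes of an interval that lie in one of its halves are nodes of the half. -/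
theorem nodes_bisect {I J : TimeInterval} (h : I.lo < I.hi) (hJ : J ∈ I.bisect) {r : ℕ} (hr : 2 ≤ r)
    {t : ℝ} (ht : t ∈ I.nodes r) (htJ : t ∈ Icc J.lo J.hi) : t ∈ J.nodes r := by
  obtain ⟨n, hn, rfl⟩ := ht
  have h2 : (2 : ℝ) ≤ r := by exact_mod_cast hr
  have hr0 : (0 : ℝ) < (r : ℝ) - 1 := by linarith
  have hcast : ((r - 1 : ℕ) : ℝ) = (r : ℝ) - 1 := by rw [Nat.cast_sub (by omega)]; simp
  have hpos : 0 < I.hi - I.lo := by linarith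
  rcases mem_bisect.1 hJ with rfl | rfl
  · have h1 : ((n : ℝ) / ((r : ℝ) - 1)) * (I.hi - I.lo) ≤ (1 / 2) * (I.hi - I.lo) := by
      have := htJ.2; simp only at this; linarith
    have h3 := le_of_mul_le_mul_right h1 hpos
    rw [div_le_iff₀ hr0] at h3
    refine ⟨2 * n, ?_, ?_⟩
    · have : ((2 * n : ℕ) : ℝ) ≤ ((r - 1 : ℕ) : ℝ) := by rw [hcast]; push_cast; linarith
      exact_mod_cast this
    · push_cast; ring
  · have h1 : (1 / 2) * (I.hi - I.lo) ≤ ((n : ℝ) / ((r : ℝ) - 1)) * (I.hi - I.lo) := by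
      have := htJ.1; simp only at this; linarith
    have h3 := le_of_mul_le_mul_right h1 hpos
    rw [le_div_iff₀ hr0] at h3
    have h4 : r - 1 ≤ 2 * n := by
      have : ((r - 1 : ℕ) : ℝ) ≤ ((2 * n : ℕ) : ℝ) := by rw [hcast]; push_cast; linarith
      exact_mod_cast this
    refine ⟨2 * n - (r - 1), by omega, ?_⟩
    rw [Nat.cast_sub h4, hcast]
    push_cast
    field_simp
    ring

theorem lo_mem_nodes (I : TimeInterval) (r : ℕ) : I.lo ∈ I.nodes r := ⟨0, by simp, by simp⟩

theorem hi_mem_nodes (I : TimeInterval) {r : ℕ} (hr : 2 ≤ r) : I.hi ∈ I.nodes r := by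
  have h2 : (2 : ℝ) ≤ r := by exact_mod_cast hr
  refine ⟨r - 1, le_rfl, ?_⟩
  rw [Nat.cast_sub (by omega), Nat.cast_one, div_self (by linarith)]
  ring

theorem nodes_subset_Icc {I : TimeInterval} (h : I.lo < I.hi) {r : ℕ} (hr : 2 ≤ r) :
    I.nodes r ⊆ Icc I.lo I.hi := by
  rintro t ⟨n, hn, rfl⟩
  have h2 : (2 : ℝ) ≤ r := by exact_mod_cast hr
  have hr0 : (0 : ℝ) < (r : ℝ) - 1 := by linarith
  have hcast : ((r - 1 : ℕ) : ℝ) = (r : ℝ) - 1 := by rw [Nat.cast_sub (by omega)]; simp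
  have h3 : (n : ℝ) / ((r : ℝ) - 1) ≤ 1 := by
    rw [div_le_one hr0, ← hcast]; exact_mod_cast hn
  have h4 : 0 ≤ (n : ℝ) / ((r : ℝ) - 1) := by positivity
  constructor <;> nlinarith

end TimeInterval

variable {d : ℕ} {M : InitialMesh d}

/-- The intervals that arise from the initial partition by `k` bisections. -/
inductive InTimeForest (M : InitialMesh d) : ℕ → TimeInterval → Prop
  | base {I : TimeInterval} : I ∈ M.intervals → InTimeForest M 0 I
  | child {k : ℕ} {I J : TimeInterval} : InTimeForest M k I → J ∈ I.bisect →
      InTimeForest M (k + 1) J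

/-- `J` arises from `I` by repeated bisection. -/
inductive TimeDesc (I : TimeInterval) : TimeInterval → Prop
  | refl : TimeDesc I I
  | child {J J' : TimeInterval} : TimeDesc I J → J' ∈ J.bisect → TimeDesc I J'

theorem mem_intervals {I : TimeInterval} : I ∈ M.intervals ↔ ∃ i : Fin M.N,
    I = ⟨M.time i.castSucc, M.time i.succ, decide ((i : ℕ) + 1 = M.N)⟩ := by
  simp [InitialMesh.intervals, eq_comm]

theorem intervals_lt {I : TimeInterval} (h : I ∈ M.intervals) :
    I.lo < I.hi ∧ 0 ≤ I.lo ∧ I.hi ≤ M.T := by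
  obtain ⟨i, rfl⟩ := mem_intervals.1 h
  refine ⟨M.time_strictMono (Fin.castSucc_lt_succ), ?_, ?_⟩
  · rw [← M.time_zero]; exact M.time_strictMono.monotone (Fin.zero_le _)
  · exact M.time_strictMono.monotone (Fin.le_last _)

theorem intervals_eq_of_mem {I J : TimeInterval} (hI : I ∈ M.intervals) (hJ : J ∈ M.intervals)
    {t : ℝ} (ht : t ∈ I.carrier) (ht' : t ∈ J.carrier) : I = J := by
  have key : ∀ i j : Fin M.N, i < j →
      t ∈ (⟨M.time i.castSucc, M.time i.succ, decide ((i : ℕ) + 1 = M.N)⟩ :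
        TimeInterval).carrier →
      t ∈ (⟨M.time j.castSucc, M.time j.succ, decide ((j : ℕ) + 1 = M.N)⟩ :
        TimeInterval).carrier → False := by
    intro i j hij h1 h2
    rw [TimeInterval.mem_carrier] at h1 h2
    have hij' : (i : ℕ) < j := hij
    have hjl := j.isLt
    have h3 : M.time i.succ ≤ M.time j.castSucc :=
      M.time_strictMono.monotone (by rw [Fin.le_iff_val_le_val]; simp; omega)
    have h4 : ¬ ((i : ℕ) + 1 = M.N) := by omega
    simp only [h4, decide_false, Bool.false_eq_true, or_false] at h1
    linarith [h1.2.2, h2.1]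
  obtain ⟨i, rfl⟩ := mem_intervals.1 hI
  obtain ⟨j, rfl⟩ := mem_intervals.1 hJ
  rcases lt_trichotomy i j with h | h | h
  · exact (key i j h ht ht').elim
  · rw [h]
  · exact (key j i h ht' ht).elim

theorem exists_interval {t : ℝ} (ht : t ∈ Icc 0 M.T) : ∃ I ∈ M.intervals, t ∈ I.carrier := by
  classical
  set A : Finset (Fin M.N) := Finset.univ.filter fun i => M.time i.castSucc ≤ t with hA
  have hne : A.Nonempty := by
    refine ⟨⟨0, M.N_pos⟩, ?_⟩
    rw [hA, Finset.mem_filter]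
    refine ⟨Finset.mem_univ _, ?_⟩
    have : (⟨0, M.N_pos⟩ : Fin M.N).castSucc = 0 := by ext; simp
    rw [this, M.time_zero]
    exact ht.1
  set i := A.max' hne with hi
  have hiA : M.time i.castSucc ≤ t := (Finset.mem_filter.1 (A.max'_mem hne)).2
  refine ⟨_, mem_intervals.2 ⟨i, rfl⟩, TimeInterval.mem_carrier.2 ⟨hiA, ?_⟩⟩
  by_cases hN : (i : ℕ) + 1 = M.N
  · have : i.succ = Fin.last M.N := by ext; simpa using hN
    simp only [this, hN, decide_true, or_true, and_true]
    exact ht.2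
  · have hlt : t < M.time i.succ := by
      by_contra hc
      have hil := i.isLt
      have h1 : (⟨i + 1, by omega⟩ : Fin M.N) ∈ A := by
        rw [hA, Finset.mem_filter]
        refine ⟨Finset.mem_univ _, ?_⟩
        rw [show (⟨i + 1, by omega⟩ : Fin M.N).castSucc = i.succ by ext; simp]
        exact not_lt.1 hc
      have h2 := A.le_max' _ h1
      rw [← hi, Fin.le_iff_val_le_val] at h2
      simp at h2
    exact ⟨hlt.le, Or.inl hlt⟩

namespace InTimeForest

variable {k k' : ℕ} {I J : TimeInterval}

theorem lt (h : InTimeForest M k I) : I.lo < I.hi := by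
  induction h with
  | base h => exact (intervals_lt h).1
  | child _ hJ ih => exact (TimeInterval.lo_lt_hi_of_bisect ih hJ).1

theorem Icc_subset (h : InTimeForest M k I) : Icc I.lo I.hi ⊆ Icc 0 M.T := by
  induction h with
  | base h => exact Icc_subset_Icc (intervals_lt h).2.1 (intervals_lt h).2.2
  | child h hJ ih =>
    obtain ⟨-, h1, h2, -⟩ := TimeInterval.lo_lt_hi_of_bisect h.lt hJ
    exact (Icc_subset_Icc h1 h2).trans ih

theorem closure_eq (h : InTimeForest M k I) : closure I.carrier = Icc I.lo I.hi :=
  TimeInterval.closure_carrier h.lt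

theorem exists_length (h : InTimeForest M k I) :
    ∃ I₀ ∈ M.intervals, I.hi - I.lo = (I₀.hi - I₀.lo) / 2 ^ k := by
  induction h with
  | base h => exact ⟨_, h, by simp⟩
  | child h hJ ih =>
    obtain ⟨I₀, h1, h2⟩ := ih
    refine ⟨I₀, h1, ?_⟩
    rw [(TimeInterval.lo_lt_hi_of_bisect h.lt hJ).2.2.2, h2, pow_succ]
    field_simp

theorem exists_ancestor (h : InTimeForest M k I) {j : ℕ} (hj : j ≤ k) :
    ∃ A, InTimeForest M j A ∧ TimeDesc A I := by
  induction h with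
  | base h =>
    obtain rfl : j = 0 := by omega
    exact ⟨_, base h, TimeDesc.refl⟩
  | @child k I J h hJ ih =>
    rcases hj.eq_or_lt with h1 | h1
    · subst h1
      exact ⟨J, h.child hJ, TimeDesc.refl⟩
    · obtain ⟨A, h2, h3⟩ := ih (by omega)
      exact ⟨A, h2, h3.child hJ⟩

theorem desc_props (h : InTimeForest M k I) (hd : TimeDesc I J) :
    J.carrier ⊆ I.carrier ∧ I.lo ≤ J.lo ∧ J.hi ≤ I.hi ∧ J.lo < J.hi ∧
      ∀ r, 2 ≤ r → ∀ t ∈ I.nodes r, t ∈ Icc J.lo J.hi → t ∈ J.nodes r := by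
  induction hd with
  | refl => exact ⟨Subset.rfl, le_rfl, le_rfl, h.lt, fun r _ t ht _ => ht⟩
  | @child J J' _ hJ ih =>
    obtain ⟨h1, h2, h3, h4, h5⟩ := ih
    obtain ⟨h6, h7, h8, -⟩ := TimeInterval.lo_lt_hi_of_bisect h4 hJ
    refine ⟨(TimeInterval.carrier_subset_of_bisect h4 hJ).trans h1, h2.trans h7, h8.trans h3, h6,
      fun r hr t ht ht' => ?_⟩
    exact TimeInterval.nodes_bisect h4 hJ hr
      (h5 r hr t ht ⟨h7.trans ht'.1, ht'.2.trans h8⟩) ht'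

theorem eq_of_mem : ∀ {k : ℕ} {I J : TimeInterval}, InTimeForest M k I → InTimeForest M k J →
    ∀ {t : ℝ}, t ∈ I.carrier → t ∈ J.carrier → I = J := by
  intro k
  induction k with
  | zero =>
    intro I J hI hJ t ht ht'
    cases hI with
    | base hI => cases hJ with
      | base hJ => exact intervals_eq_of_mem hI hJ ht ht'
  | succ k ih =>
    intro I J hI hJ t ht ht'
    cases hI with
    | @child _ I₀ _ hI h1 => cases hJ with
      | @child _ J₀ _ hJ h2 =>
        have := ih hI hJ (TimeInterval.carrier_subset_of_bisect hI.lt h1 ht)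
          (TimeInterval.carrier_subset_of_bisect hJ.lt h2 ht')
        subst this
        exact TimeInterval.eq_of_mem_bisect h1 h2 ht ht'

theorem desc_of_mem (hI : InTimeForest M k I) (hJ : InTimeForest M k' J) (hk : k ≤ k') {t : ℝ}
    (ht : t ∈ I.carrier) (ht' : t ∈ J.carrier) : TimeDesc I J := by
  obtain ⟨A, hA, hAJ⟩ := hJ.exists_ancestor hk
  rw [hI.eq_of_mem hA ht ((hA.desc_props hAJ).1 ht')]
  exact hAJ

/-- Intervals of the forest that meet are nested. -/
theorem nested (hI : InTimeForest M k I) (hJ : InTimeForest M k' J)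
    (h : (I.carrier ∩ J.carrier).Nonempty) : TimeDesc I J ∨ TimeDesc J I := by
  obtain ⟨t, ht, ht'⟩ := h
  rcases le_total k k' with hk | hk
  · exact Or.inl (hI.desc_of_mem hJ hk ht ht')
  · exact Or.inr (hJ.desc_of_mem hI hk ht' ht)

theorem volume_inter_pos_iff (hI : InTimeForest M k I) (hJ : InTimeForest M k' J) :
    0 < volume (I.carrier ∩ J.carrier) ↔ (I.carrier ∩ J.carrier).Nonempty := by
  constructor
  · intro h
    rw [Set.nonempty_iff_ne_empty]
    intro hc
    rw [hc, measure_empty] at h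
    exact lt_irrefl _ h
  · intro h
    have key : ∀ {J : TimeInterval}, J.lo < J.hi → 0 < volume J.carrier := fun {J} hJ =>
      lt_of_lt_of_le (by rw [Real.volume_Ioo, ENNReal.ofReal_pos]; linarith)
        (measure_mono J.Ioo_subset_carrier)
    rcases hI.nested hJ h with h1 | h1
    · rw [inter_eq_right.2 (hI.desc_props h1).1]; exact key hJ.lt
    · rw [inter_eq_left.2 (hJ.desc_props h1).1]; exact key hI.lt

theorem disjoint_of_ncard (hI : InTimeForest M k I) (hJ : InTimeForest M k' J)
    (h : (closure I.carrier ∩ closure J.carrier).ncard = 1) :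
    ¬ (I.carrier ∩ J.carrier).Nonempty := by
  intro hne
  have key : ∀ {J : TimeInterval}, J.lo < J.hi → (Icc J.lo J.hi).ncard = 0 := fun {J} hJ =>
    (Set.Icc_infinite hJ).ncard
  rcases hI.nested hJ hne with h1 | h1
  · rw [inter_eq_right.2 (closure_mono (hI.desc_props h1).1), hJ.closure_eq, key hJ.lt] at h
    omega
  · rw [inter_eq_left.2 (closure_mono (hJ.desc_props h1).1), hI.closure_eq, key hI.lt] at h
    omega

theorem inter_eq_singleton (hI : InTimeForest M k I) (hJ : InTimeForest M k' J)
    (h : ¬ (I.carrier ∩ J.carrier).Nonempty) {t : ℝ} (ht : t ∈ Icc I.lo I.hi)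
    (ht' : t ∈ Icc J.lo J.hi) : closure I.carrier ∩ closure J.carrier = {t} ∧
      ((t = I.lo ∧ t = J.hi) ∨ (t = I.hi ∧ t = J.lo)) := by
  have hIl := hI.lt
  have hJl := hJ.lt
  have h1 : I.hi ≤ J.lo ∨ J.hi ≤ I.lo := by
    by_contra hc
    rw [not_or, not_le, not_le] at hc
    obtain ⟨s, hs1, hs2⟩ := exists_between (show max I.lo J.lo < min I.hi J.hi by
      rw [max_lt_iff, lt_min_iff, lt_min_iff]; exact ⟨⟨hIl, hc.2⟩, hc.1, hJl⟩)
    rw [max_lt_iff] at hs1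
    rw [lt_min_iff] at hs2
    exact h ⟨s, I.Ioo_subset_carrier ⟨hs1.1, hs2.1⟩, J.Ioo_subset_carrier ⟨hs1.2, hs2.2⟩⟩
  rw [hI.closure_eq, hJ.closure_eq]
  obtain ⟨a1, a2⟩ := ht
  obtain ⟨b1, b2⟩ := ht'
  refine ⟨Subset.antisymm (fun s hs => ?_) (singleton_subset_iff.2 ⟨⟨a1, a2⟩, b1, b2⟩), ?_⟩
  · obtain ⟨⟨c1, c2⟩, c3, c4⟩ := hs
    rw [mem_singleton_iff]
    rcases h1 with h1 | h1 <;> linarith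
  · rcases h1 with h1 | h1
    · right; constructor <;> linarith
    · left; constructor <;> linarith

end InTimeForest

namespace TimeInterval

theorem bisectIter_desc {m : ℕ} {I J : TimeInterval} (hJ : J ∈ bisectIter m I) : TimeDesc I J := by
  induction m generalizing J with
  | zero => simp only [bisectIter, Finset.mem_singleton] at hJ; rw [hJ]; exact TimeDesc.refl
  | succ m ih =>
    simp only [bisectIter, Finset.mem_biUnion] at hJ
    obtain ⟨J', h1, h2⟩ := hJ
    exact (ih h1).child h2

theorem bisectIter_forest {m k : ℕ} {I J : TimeInterval} (hI : InTimeForest M k I)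
    (hJ : J ∈ bisectIter m I) : InTimeForest M (k + m) J := by
  induction m generalizing J with
  | zero => simp only [bisectIter, Finset.mem_singleton] at hJ; rw [hJ]; exact hI
  | succ m ih =>
    simp only [bisectIter, Finset.mem_biUnion] at hJ
    obtain ⟨J', h1, h2⟩ := hJ
    exact (ih h1).child h2

theorem exists_bisectIter_of_mem (m : ℕ) {I : TimeInterval} {t : ℝ} (ht : t ∈ I.carrier) :
    ∃ J ∈ bisectIter m I, t ∈ J.carrier := by
  induction m with
  | zero => exact ⟨I, by simp [bisectIter], ht⟩
  | succ m ih =>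
    obtain ⟨J, h1, h2⟩ := ih
    obtain ⟨J', h3, h4⟩ := exists_bisect_of_mem h2
    exact ⟨J', by simp only [bisectIter, Finset.mem_biUnion]; exact ⟨J, h1, h3⟩, h4⟩

end TimeInterval

/-! ### Meshes obtained by atomic splits -/

/-- The number of temporal bisections that belong to a simplex of level `n`. -/
noncomputable def timeDepth (d : ℕ) (s₁ s₂ : ℝ) (n : ℕ) : ℕ := ⌈(n : ℝ) * s₂ / (s₁ * d)⌉₊

theorem timeDepth_zero (d : ℕ) (s₁ s₂ : ℝ) : timeDepth d s₁ s₂ 0 = 0 := by simp [timeDepth]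

theorem timeDepth_mono {s₁ s₂ : ℝ} (hs₁ : 0 < s₁) (hs₂ : 0 < s₂) :
    Monotone (timeDepth d s₁ s₂) := by
  intro m n h
  refine Nat.ceil_mono ?_
  have : (m : ℝ) ≤ n := by exact_mod_cast h
  gcongr

variable {s₁ s₂ : ℝ}

theorem mem_atomicSplit {Q R : Prism d} : R ∈ Q.atomicSplit s₁ s₂ ↔
    R.1 ∈ TimeInterval.bisectIter (timeDepth d s₁ s₂ (Q.level + 1) - timeDepth d s₁ s₂ Q.level) Q.1 ∧
      Q.2.IsChild R.2 := by
  rw [Prism.atomicSplit]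
  simp only [Finset.mem_product, TaggedSimplex.mem_bisect, timeDepth, Prism.level]
  push_cast
  rw [add_sub_cancel_right]

theorem level_of_mem_atomicSplit {Q R : Prism d} (h : R ∈ Q.atomicSplit s₁ s₂) :
    R.level = Q.level + 1 := (mem_atomicSplit.1 h).2.level

/-- The invariants of meshes obtained by atomic splits: they consist of prisms of the forest, their
elements do not overlap, and at every time the active simplices form a cut through the forest. -/
structure MeshInv (M : InitialMesh d) (s₁ s₂ : ℝ) (P : Finset (Prism d)) : Prop where
  space : ∀ Q ∈ P, InForest M Q.2
  time : ∀ Q ∈ P, InTimeForest M (timeDepth d s₁ s₂ Q.level) Q.1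
  unique : ∀ Q ∈ P, ∀ Q' ∈ P, (Q.1.carrier ∩ Q'.1.carrier).Nonempty →
    affineDim (Q.2.carrier ∩ Q'.2.carrier) = d → Q = Q'
  complete : ∀ t ∈ Icc 0 M.T, ∀ S, InForest M S → ∀ x ∈ S.carrier,
    ∃ Q ∈ P, t ∈ Q.1.carrier ∧ x ∈ Q.2.carrier ∧ Comparable S Q.2

theorem split_props (hd : 1 ≤ d) (hs₁ : 0 < s₁) (hs₂ : 0 < s₂) {Q R : Prism d}
    (hQ : InForest M Q.2) (hQt : InTimeForest M (timeDepth d s₁ s₂ Q.level) Q.1)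
    (hR : R ∈ Q.atomicSplit s₁ s₂) :
    InForest M R.2 ∧ InTimeForest M (timeDepth d s₁ s₂ R.level) R.1 ∧ TimeDesc Q.1 R.1 ∧
      R.1.carrier ⊆ Q.1.carrier ∧ R.2.carrier ⊆ Q.2.carrier := by
  have hl := level_of_mem_atomicSplit hR
  obtain ⟨h1, h2⟩ := mem_atomicSplit.1 hR
  refine ⟨hQ.child h2, ?_, TimeInterval.bisectIter_desc h1,
    (hQt.desc_props (TimeInterval.bisectIter_desc h1)).1,
    hQ.desc_carrier hd (Desc.refl.child h2)⟩
  have := TimeInterval.bisectIter_forest hQt h1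
  rw [Nat.add_sub_cancel' (timeDepth_mono hs₁ hs₂ (Nat.le_succ _))] at this
  rw [hl]; exact this

theorem exists_split_of_mem {Q : Prism d} {t : ℝ} (ht : t ∈ Q.1.carrier) {c : TaggedSimplex d}
    (hc : Q.2.IsChild c) : ∃ R ∈ Q.atomicSplit s₁ s₂, t ∈ R.1.carrier ∧ R.2 = c := by
  obtain ⟨J, h1, h2⟩ := TimeInterval.exists_bisectIter_of_mem
    (timeDepth d s₁ s₂ (Q.level + 1) - timeDepth d s₁ s₂ Q.level) ht
  exact ⟨(J, c), mem_atomicSplit.2 ⟨h1, hc⟩, h2, rfl⟩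

theorem MeshInv.initial (hd : 1 ≤ d) : MeshInv M s₁ s₂ M.mesh := by
  have hmem : ∀ Q ∈ M.mesh, Q.1 ∈ M.intervals ∧ Q.2 ∈ M.triangulation := fun Q hQ =>
    Finset.mem_product.1 hQ
  refine ⟨fun Q hQ => .base (hmem Q hQ).2, fun Q hQ => ?_, fun Q hQ Q' hQ' ht hx => ?_,
    fun t ht S hS x hx => ?_⟩
  · rw [show Q.level = 0 from M.level_eq_zero _ (hmem Q hQ).2, timeDepth_zero]
    exact .base (hmem Q hQ).1
  · obtain ⟨t, h1, h2⟩ := ht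
    refine Prod.ext (intervals_eq_of_mem (hmem Q hQ).1 (hmem Q' hQ').1 h1 h2) ?_
    exact (InForest.base (hmem Q hQ).2).eq_of_overlap hd (.base (hmem Q' hQ').2) (by
      rw [M.level_eq_zero _ (hmem Q hQ).2, M.level_eq_zero _ (hmem Q' hQ').2]) hx
  · obtain ⟨A, hA, hAl, hAS⟩ := hS.exists_ancestor (Nat.zero_le _)
    obtain ⟨I, hI, htI⟩ := exists_interval ht
    exact ⟨(I, A), Finset.mem_product.2 ⟨hI, hA.mem_of_level_eq_zero hAl⟩, htI,
      hA.desc_carrier hd hAS hx, Or.inr hAS⟩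

theorem MeshInv.split (hd : 1 ≤ d) (hs₁ : 0 < s₁) (hs₂ : 0 < s₂) {P P' : Finset (Prism d)}
    (hP : MeshInv M s₁ s₂ P) {Q : Prism d} (hQ : Q ∈ P)
    (hP' : ∀ R, R ∈ P' ↔ (R ∈ P ∧ R ≠ Q) ∨ R ∈ Q.atomicSplit s₁ s₂) : MeshInv M s₁ s₂ P' := by
  have hsp := fun R hR => split_props hd hs₁ hs₂ (hP.space Q hQ) (hP.time Q hQ) (R := R) hR
  have hforest : ∀ R ∈ P', InForest M R.2 := fun R hR => by
    rcases (hP' R).1 hR with h | h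
    · exact hP.space R h.1
    · exact (hsp R h).1
  have hnew : ∀ R ∈ P, R ≠ Q → ∀ R' ∈ Q.atomicSplit s₁ s₂, (R.1.carrier ∩ R'.1.carrier).Nonempty →
      affineDim (R.2.carrier ∩ R'.2.carrier) = d → False := by
    intro R hR hne R' hR' ht hx
    obtain ⟨-, -, -, h1, h2⟩ := hsp R' hR'
    exact hne (hP.unique R hR Q hQ (ht.mono (inter_subset_inter Subset.rfl h1))
      (le_antisymm (affineDim_le _) (hx.symm.le.trans
        (affineDim_mono (inter_subset_inter Subset.rfl h2)))))
  refine ⟨hforest, fun R hR => ?_, fun R hR R' hR' ht hx => ?_, fun t ht S hS x hx => ?_⟩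
  · rcases (hP' R).1 hR with h | h
    · exact hP.time R h.1
    · exact (hsp R h).2.1
  · rcases (hP' R).1 hR with h | h <;> rcases (hP' R').1 hR' with h' | h'
    · exact hP.unique R h.1 R' h'.1 ht hx
    · exact (hnew R h.1 h.2 R' h' ht hx).elim
    · rw [inter_comm] at ht hx
      exact (hnew R' h'.1 h'.2 R h ht hx).elim
    · have hl : R.level = R'.level := by
        rw [level_of_mem_atomicSplit h, level_of_mem_atomicSplit h']
      obtain ⟨t, h1, h2⟩ := ht
      refine Prod.ext ((hsp R h).2.1.eq_of_mem (hl ▸ (hsp R' h').2.1) h1 h2) ?_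
      exact (hsp R h).1.eq_of_overlap hd (hsp R' h').1 hl hx
  · obtain ⟨R, hR, htR, hxR, hc⟩ := hP.complete t ht S hS x hx
    by_cases hRQ : R = Q
    · subst hRQ
      have hf := hP.space R hR
      -- the child of the split simplex that contains `x` and remains on the branch of `S`
      have key : ∃ c, R.2.IsChild c ∧ x ∈ c.carrier ∧ Comparable S c := by
        rcases hc with hc | hc
        · obtain ⟨c, h1, h2⟩ := TaggedSimplex.exists_child_of_mem (hf.nondeg hd) hd (hf.type_lt hd)
            hxR
          exact ⟨c, h1, h2, Or.inl (hc.child h1)⟩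
        · rcases hc.level_le.eq_or_lt with hl | hl
          · have := hc.eq_of_level hl.symm.le
            obtain ⟨c, h1, h2⟩ := TaggedSimplex.exists_child_of_mem (hf.nondeg hd) hd
              (hf.type_lt hd) hxR
            exact ⟨c, h1, h2, Or.inl (this ▸ Desc.refl.child h1)⟩
          · obtain ⟨c, h1, h2⟩ := hc.exists_child hl
            exact ⟨c, h1, (hf.child h1).desc_carrier hd h2 hx, Or.inr h2⟩
      obtain ⟨c, h1, h2, h3⟩ := key
      obtain ⟨R', h4, h5, h6⟩ := exists_split_of_mem (s₁ := s₁) (s₂ := s₂) htR h1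
      exact ⟨R', (hP' R').2 (Or.inr h4), h5, h6 ▸ h2, h6 ▸ h3⟩
    · exact ⟨R, (hP' R).2 (Or.inl ⟨hR, hRQ⟩), htR, hxR, hc⟩

theorem AtomicReachable.meshInv (hd : 1 ≤ d) (hs₁ : 0 < s₁) (hs₂ : 0 < s₂) {P : Finset (Prism d)}
    (h : AtomicReachable s₁ s₂ M.mesh P) : MeshInv M s₁ s₂ P := by
  induction h with
  | refl => exact MeshInv.initial hd
  | step _ hQ hP' ih => exact ih.split hd hs₁ hs₂ hQ hP'

end SpaceTimeMesh
namespace SpaceTimeMesh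

/-! ### Stars of vertices in Lipschitz domains are connected through hyperfaces -/

variable {d : ℕ}

open TaggedSimplex

/-- A Lipschitz domain is locally connected at its boundary. -/
theorem IsBoundedLipschitzDomain.exists_preconnected {Ω : Set (Space d)}
    (hΩ : IsBoundedLipschitzDomain Ω) {x : Space d} (hx : x ∈ closure Ω) {ε : ℝ} (hε : 0 < ε) :
    ∃ U : Set (Space d), IsOpen U ∧ IsPreconnected U ∧ U ⊆ Metric.ball x ε ∩ Ω ∧
      ∃ δ > 0, Metric.ball x δ ∩ Ω ⊆ U := by
  by_cases hxΩ : x ∈ Ω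
  · obtain ⟨δ, hδ, hsub⟩ := Metric.isOpen_iff.1 hΩ.isOpen x hxΩ
    refine ⟨Metric.ball x (min δ ε), Metric.isOpen_ball,
      (convex_ball _ _).isPreconnected, subset_inter (Metric.ball_subset_ball (min_le_right _ _))
        ((Metric.ball_subset_ball (min_le_left _ _)).trans hsub), min δ ε, lt_min hδ hε,
        inter_subset_left⟩
  · have hfr : x ∈ frontier Ω := ⟨hx, fun h => hxΩ (interior_subset h)⟩
    obtain ⟨e, g, L, r, he, hg, hr, hchart⟩ := hΩ.lipschitz x hfr
    set q : Space d → Space d := fun y => y - inner ℝ e y • e with hq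
    have hqc : Continuous q := by fun_prop
    have hgc : Continuous g := hg.continuous
    have hqe : ∀ (y : Space d) (a : ℝ), q (q y + a • e) = q y := by
      intro y a
      simp only [hq, inner_add_right, inner_sub_right, inner_smul_right,
        real_inner_self_eq_norm_sq, he]
      module
    have hie : ∀ (y : Space d) (a : ℝ), inner ℝ e (q y + a • e) = a := by
      intro y a
      simp only [hq, inner_add_right, inner_sub_right, inner_smul_right,
        real_inner_self_eq_norm_sq, he]
      ring
    have hdec : ∀ y, q y + inner ℝ e y • e = y := fun y => by simp [hq]
    set c : ℝ := inner ℝ e x with hc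
    have hgx : g (q x) = c := by
      refine le_antisymm ?_ ?_
      · by_contra hlt
        rw [not_le] at hlt
        have hopen : IsOpen {y | inner ℝ e y < g (q y)} :=
          isOpen_lt (by fun_prop) (hgc.comp hqc)
        obtain ⟨y, ⟨hy1, hy2⟩, hy3⟩ := mem_closure_iff.1 hx _
          (hopen.inter (Metric.isOpen_ball (x := x) (ε := r))) ⟨hlt, Metric.mem_ball_self hr⟩
        exact lt_asymm hy1 ((hchart y hy2).1 hy3)
      · by_contra hlt
        rw [not_le] at hlt
        exact hxΩ ((hchart x (Metric.mem_ball_self hr)).2 hlt)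
    set η : ℝ := min ε r / 2 with hη
    have hηp : 0 < η := by positivity
    set δ : ℝ := η / (L + 1) with hδ
    have hL : (0 : ℝ) ≤ L := L.2
    have hδp : 0 < δ := by positivity
    have hδη : δ ≤ η := div_le_self hηp.le (by linarith)
    have hLδ : L * δ < η := by
      rw [hδ, ← mul_div_assoc, div_lt_iff₀ (by linarith)]; nlinarith
    have hgd : ∀ y, ‖q y - q x‖ < δ → |g (q y) - c| ≤ L * δ := by
      intro y hy
      have := hg.dist_le_mul (q y) (q x)
      rw [Real.dist_eq, hgx, dist_eq_norm] at this
      exact this.trans (by gcongr)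
    have hnorm : ∀ y, ‖y - x‖ ≤ ‖q y - q x‖ + |inner ℝ e y - c| := by
      intro y
      calc ‖y - x‖ = ‖(q y - q x) + (inner ℝ e y - c) • e‖ := by
            congr 1; simp only [hq, hc]; module
        _ ≤ _ := (norm_add_le _ _).trans (by rw [norm_smul, he, mul_one, Real.norm_eq_abs])
    -- `U` is the part of a cylinder around the axis `e` between the graph of `g` and the height `c + η`
    set D : Set (Space d) := {y | ‖q y - q x‖ < δ} with hD
    set U : Set (Space d) := {y | y ∈ D ∧ g (q y) < inner ℝ e y ∧ inner ℝ e y < c + η} with hU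
    have hDo : IsOpen D := isOpen_lt (by fun_prop) continuous_const
    have hDc : Convex ℝ D := by
      intro y hy z hz s t hs ht hst
      have h1 : q (s • y + t • z) - q x = s • (q y - q x) + t • (q z - q x) := by
        obtain rfl : t = 1 - s := by linarith
        simp only [hq, inner_add_right, inner_smul_right]
        module
      have := (convex_ball (0 : Space d) δ) (mem_ball_zero_iff.2 hy) (mem_ball_zero_iff.2 hz)
        hs ht hst
      rw [hD, mem_ofPred_eq, h1]
      exact mem_ball_zero_iff.1 this
    have hgη : ∀ y ∈ D, g (q y) < c + η := fun y hy => by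
      have := (abs_le.1 (hgd y hy)).2
      linarith
    -- straightening the graph exhibits `U` as a continuous image of a convex set
    have himg : U = (fun z : Space d × ℝ =>
        q z.1 + ((1 - z.2) * g (q z.1) + z.2 * (c + η)) • e) '' (D ×ˢ Ioo (0 : ℝ) 1) := by
      ext y
      constructor
      · rintro ⟨h1, h2, h3⟩
        have h4 := hgη y h1
        have h5 : 0 < c + η - g (q y) := by linarith
        refine ⟨(y, (inner ℝ e y - g (q y)) / (c + η - g (q y))), ⟨h1, ?_, ?_⟩, ?_⟩
        · exact div_pos (by linarith) h5
        · rw [div_lt_one h5]; linarith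
        · have h6 : (1 - (inner ℝ e y - g (q y)) / (c + η - g (q y))) * g (q y) +
              (inner ℝ e y - g (q y)) / (c + η - g (q y)) * (c + η) = inner ℝ e y := by
            field_simp
            ring
          simp only [h6]
          exact hdec y
      · rintro ⟨⟨z, s⟩, ⟨h1, h2, h3⟩, rfl⟩
        have h4 := hgη z h1
        simp only at h2 h3 h1
        refine ⟨?_, ?_, ?_⟩
        · simp only [hD, mem_ofPred_eq, hqe]; exact h1
        · simp only [hqe, hie]; nlinarith
        · simp only [hie]; nlinarith
    refine ⟨U, ?_, ?_, ?_, δ, hδp, ?_⟩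
    · have hec : Continuous fun y : Space d => inner ℝ e y := by fun_prop
      exact hDo.inter ((isOpen_lt (hgc.comp hqc) hec).inter (isOpen_lt hec continuous_const))
    · rw [himg]
      refine IsPreconnected.image (hDc.isPreconnected.prod isPreconnected_Ioo) _ ?_
      fun_prop
    · rintro y ⟨h1, h2, h3⟩
      have h4 := hgd y h1
      have h5 : |inner ℝ e y - c| < η := by
        rw [abs_lt]
        have := (abs_le.1 h4).1
        constructor <;> linarith
      have h6 : ‖y - x‖ < min ε r := by
        have h7 : ‖q y - q x‖ < δ := h1
        have := hnorm y
        have : min ε r = η + η := by rw [hη]; ring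
        linarith
      rw [← dist_eq_norm] at h6
      exact ⟨h6.trans_le (min_le_left _ _), (hchart y (h6.trans_le (min_le_right _ _))).2 h2⟩
    · rintro y ⟨h1, h2⟩
      rw [mem_ball_iff_norm] at h1
      have h3 : min ε r = η + η := by rw [hη]; ring
      have h4 : g (q y) < inner ℝ e y := (hchart y (by
        rw [mem_ball_iff_norm]
        have := min_le_right ε r
        linarith)).1 h2
      have h5 : ‖q y - q x‖ ≤ ‖y - x‖ := by
        have e1 : ‖y - x‖ ^ 2 = ‖q y - q x‖ ^ 2 + (inner ℝ e y - c) ^ 2 := by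
          have e2 : y - x = (q y - q x) + (inner ℝ e y - c) • e := by
            simp only [hq, hc]; module
          have e3 : inner ℝ (q y - q x) ((inner ℝ e y - c) • e) = 0 := by
            rw [inner_smul_right, real_inner_comm e (q y - q x), inner_sub_right]
            have := hie y 0
            have h' := hie x 0
            rw [zero_smul, add_zero] at this h'
            rw [this, h']; ring
          rw [e2, norm_add_sq_real, e3, norm_smul, he]
          simp
        nlinarith [norm_nonneg (y - x), norm_nonneg (q y - q x), sq_nonneg (inner ℝ e y - c)]
      have h6 : |inner ℝ e y - c| ≤ ‖y - x‖ := by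
        rw [hc, ← inner_sub_right]
        have := abs_real_inner_le_norm e (y - x)
        rwa [he, one_mul] at this
      have h7 := (abs_le.1 h6).2
      exact ⟨show ‖q y - q x‖ < δ by linarith, h4, by linarith⟩

theorem affineSpan_finset_ne_top {W : Finset (Space d)} (hW : W.card ≤ d) :
    affineSpan ℝ (W : Set (Space d)) ≠ ⊤ := by
  intro h
  rcases W.eq_empty_or_nonempty with rfl | hne
  · simp at h
  · have h1 := affineDim_finset_lt hne
    rw [affineDim_convexHull, affineDim, h, AffineSubspace.direction_top, finrank_top] at h1
    simp at h1
    omega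

/-- Points of an open set avoid finitely many affine hulls of at most `d` points. -/
theorem exists_mem_notMem_affineSpan {ι : Type*} (s : Finset ι) (W : ι → Finset (Space d))
    (hW : ∀ i ∈ s, (W i).card ≤ d) {U : Set (Space d)} (hU : IsOpen U) (hne : U.Nonempty) :
    ∃ y ∈ U, ∀ i ∈ s, y ∉ affineSpan ℝ (W i : Set (Space d)) := by
  by_contra hc
  push Not at hc
  have h1 : U ⊆ ⋃ i ∈ s, (affineSpan ℝ (W i : Set (Space d)) : Set (Space d)) := by
    intro y hy
    obtain ⟨i, hi, hyi⟩ := hc y hy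
    exact mem_biUnion hi hyi
  have h2 : volume (⋃ i ∈ s, (affineSpan ℝ (W i : Set (Space d)) : Set (Space d))) = 0 := by
    refine (measure_biUnion_null_iff s.countable_toSet).2 fun i hi => ?_
    exact Measure.addHaar_affineSubspace volume _ (affineSpan_finset_ne_top (hW i hi))
  exact (hU.measure_pos volume hne).ne' (measure_mono_null h1 h2)

theorem TaggedSimplex.Nondeg.interior_nonempty {S : TaggedSimplex d} (h : S.Nondeg) :
    (interior S.carrier).Nonempty := by
  rw [carrier, interior_convexHull_nonempty_iff_affineSpan_eq_top,
    AffineIndependent.affineSpan_eq_top_iff_card_eq_finrank_add_one h]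
  simp

/-- In a conforming triangulation of a Lipschitz domain, the simplices around a point cannot be
divided into two groups without two adjacent simplices ending up in different groups: otherwise the
two groups would only meet in faces of codimension two, and those do not separate the domain. -/
theorem exists_adjacent_of_star {Ω : Set (Space d)}
    (hΩ : IsBoundedLipschitzDomain Ω) {T : Finset (TaggedSimplex d)} (hn : ∀ S ∈ T, S.Nondeg)
    (hT : Conforming T) (hcov : ⋃ S ∈ T, S.carrier = closure Ω) {x : Space d}
    (p : TaggedSimplex d → Prop) {S₀ S₁ : TaggedSimplex d} (h₀ : S₀ ∈ T) (hx₀ : x ∈ S₀.carrier)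
    (hp₀ : p S₀) (h₁ : S₁ ∈ T) (hx₁ : x ∈ S₁.carrier) (hp₁ : ¬ p S₁) :
    ∃ S ∈ T, ∃ S' ∈ T, x ∈ S.carrier ∧ x ∈ S'.carrier ∧ p S ∧ ¬ p S' ∧ Adjacent S S' := by
  classical
  by_contra hcon
  push Not at hcon
  set A := T.filter fun S => x ∈ S.carrier ∧ p S with hA
  set B := T.filter fun S => x ∈ S.carrier ∧ ¬ p S with hB
  set UA := ⋃ S ∈ A, S.carrier with hUA
  set UB := ⋃ S ∈ B, S.carrier with hUB
  have hclosed : ∀ C : Finset (TaggedSimplex d), IsClosed (⋃ S ∈ C, S.carrier) := fun C =>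
    C.finite_toSet.isClosed_biUnion fun S _ => S.isCompact_carrier.isClosed
  have hx : x ∈ closure Ω := by rw [← hcov]; exact mem_biUnion h₀ hx₀
  -- the two groups meet in faces of codimension at least two
  have hinter : ∀ z ∈ UA ∩ UB, ∃ i ∈ A ×ˢ B, z ∈ convexHull ℝ
      ((i.1.verts ∩ i.2.verts : Finset (Space d)) : Set (Space d)) := by
    rintro z ⟨hz, hz'⟩
    simp only [hUA, hUB, mem_iUnion] at hz hz'
    obtain ⟨S, hS, hzS⟩ := hz
    obtain ⟨S', hS', hzS'⟩ := hz'
    refine ⟨(S, S'), Finset.mem_product.2 ⟨hS, hS'⟩, ?_⟩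
    rw [hA, Finset.mem_filter] at hS
    rw [hB, Finset.mem_filter] at hS'
    have hm := hT.meetInFace hS.1 hS'.1 (hn _ hS.1) (hn _ hS'.1)
      (fun h => hS'.2.2 (h ▸ hS.2.2))
    rw [← hm.inter_eq]
    exact ⟨hzS, hzS'⟩
  have hcard : ∀ i ∈ A ×ˢ B, (i.1.verts ∩ i.2.verts).card < d := by
    rintro ⟨S, S'⟩ hi
    obtain ⟨hS, hS'⟩ := Finset.mem_product.1 hi
    rw [hA, Finset.mem_filter] at hS
    rw [hB, Finset.mem_filter] at hS'
    have hm := hT.meetInFace hS.1 hS'.1 (hn _ hS.1) (hn _ hS'.1)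
      (fun h => hS'.2.2 (h ▸ hS.2.2))
    refine lt_of_le_of_ne (hm.card_le (hn _ hS.1) (hn _ hS'.1)) fun h => ?_
    exact hcon S hS.1 S' hS'.1 hS.2.1 hS'.2.1 hS.2.2 hS'.2.2 ⟨hm, h⟩
  -- near `x`, the domain is covered by the simplices that contain `x`
  obtain ⟨ε, hε, hball⟩ : ∃ ε > 0, ∀ y ∈ Metric.ball x ε ∩ Ω, y ∈ UA ∪ UB := by
    set C := T.filter fun S => x ∉ S.carrier with hC
    have hxC : x ∈ (⋃ S ∈ C, S.carrier)ᶜ := by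
      simp only [mem_compl_iff, mem_iUnion, not_exists]
      intro S hS
      exact (Finset.mem_filter.1 hS).2
    obtain ⟨ε, hε, hsub⟩ := Metric.isOpen_iff.1 (hclosed C).isOpen_compl x hxC
    refine ⟨ε, hε, fun y hy => ?_⟩
    have hy' : y ∈ ⋃ S ∈ T, S.carrier := by rw [hcov]; exact subset_closure hy.2
    simp only [mem_iUnion] at hy'
    obtain ⟨S, hS, hyS⟩ := hy'
    have hxS : x ∈ S.carrier := by
      by_contra hxS
      exact hsub hy.1 (mem_biUnion (show S ∈ C from Finset.mem_filter.2 ⟨hS, hxS⟩) hyS)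
    by_cases hpS : p S
    · exact Or.inl (mem_biUnion (show S ∈ A from Finset.mem_filter.2 ⟨hS, hxS, hpS⟩) hyS)
    · exact Or.inr (mem_biUnion (show S ∈ B from Finset.mem_filter.2 ⟨hS, hxS, hpS⟩) hyS)
  obtain ⟨U, hUo, hUc, hUsub, δ, hδ, hδU⟩ := hΩ.exists_preconnected hx hε
  -- Every point `y` of `U` is interior to one of the groups. Otherwise there are points `a` and `b'`
  -- near `y` outside of one group each, where `b'` can be chosen in general position. The segment
  -- between them leaves the first group through a face of codimension two, but `b'` avoids the
  -- hyperplanes spanned by such a face and `a`.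
  have hloc : ∀ y ∈ U, y ∈ interior UA ∨ y ∈ interior UB := by
    intro y hy
    obtain ⟨ρ, hρ, hρU⟩ := Metric.isOpen_iff.1 hUo y hy
    by_contra hc
    rw [not_or] at hc
    have hnot : ∀ C : Set (Space d), y ∉ interior C → ∃ a ∈ Metric.ball y ρ, a ∉ C := by
      intro C hC
      by_contra h
      push Not at h
      exact hC (interior_maximal h Metric.isOpen_ball (Metric.mem_ball_self hρ))
    obtain ⟨a, ha, haB⟩ := hnot _ hc.2
    obtain ⟨b, hb, hbA⟩ := hnot _ hc.1
    obtain ⟨b', ⟨hb1, hb2⟩, hb3⟩ := exists_mem_notMem_affineSpan (A ×ˢ B)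
      (fun i => insert a (i.1.verts ∩ i.2.verts))
      (fun i hi => (Finset.card_insert_le _ _).trans (hcard i hi))
      ((Metric.isOpen_ball (x := y) (ε := ρ)).inter (hclosed A).isOpen_compl) ⟨b, hb, hbA⟩
    have hseg : segment ℝ a b' ⊆ UA ∪ UB := fun z hz =>
      hball z (hUsub (hρU ((convex_ball y ρ).segment_subset ha hb1 hz)))
    have haA : a ∈ UA := (hseg (left_mem_segment ℝ a b')).resolve_right haB
    have hbB : b' ∈ UB := (hseg (right_mem_segment ℝ a b')).resolve_left hb2
    obtain ⟨z, hz, hzAB⟩ := isPreconnected_closed_iff.1 (convex_segment a b').isPreconnected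
      UA UB (hclosed A) (hclosed B) hseg ⟨a, left_mem_segment ℝ a b', haA⟩
      ⟨b', right_mem_segment ℝ a b', hbB⟩
    obtain ⟨i, hi, hzi⟩ := hinter z hzAB
    refine hb3 i hi ?_
    have hza : z ≠ a := fun h => haB (h ▸ hzAB.2)
    have hz1 : z ∈ affineSpan ℝ ((insert a (i.1.verts ∩ i.2.verts) : Finset (Space d)) :
        Set (Space d)) := by
      refine affineSpan_mono ℝ ?_ (convexHull_subset_affineSpan _ hzi)
      rw [Finset.coe_insert]
      exact subset_insert _ _
    have ha1 : a ∈ affineSpan ℝ ((insert a (i.1.verts ∩ i.2.verts) : Finset (Space d)) :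
        Set (Space d)) := mem_affineSpan ℝ (by simp)
    rw [segment_eq_image_lineMap] at hz
    obtain ⟨s, hs, rfl⟩ := hz
    have hs0 : s ≠ 0 := by
      rintro rfl
      exact hza (by simp)
    have hb' : b' = AffineMap.lineMap a (AffineMap.lineMap a b' s) s⁻¹ := by
      rw [AffineMap.lineMap_lineMap_right, inv_mul_cancel₀ hs0, AffineMap.lineMap_apply_one]
    rw [hb']
    exact AffineMap.lineMap_mem _ ha1 hz1
  -- `U` meets the interiors of all simplices that contain `x`, so that both groups occur
  have hmeet : ∀ S ∈ T, x ∈ S.carrier → (U ∩ interior S.carrier).Nonempty := by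
    intro S hS hxS
    have h1 : x ∈ closure (interior S.carrier) := by
      rw [S.convex_carrier.closure_interior_eq_closure_of_nonempty_interior
        (hn S hS).interior_nonempty]
      exact subset_closure hxS
    obtain ⟨y, hy1, hy2⟩ := mem_closure_iff.1 h1 _ (Metric.isOpen_ball (x := x) (ε := δ))
      (Metric.mem_ball_self hδ)
    have hy3 : y ∈ closure Ω := by rw [← hcov]; exact mem_biUnion hS (interior_subset hy2)
    obtain ⟨z, ⟨hz1, hz2⟩, hz3⟩ := mem_closure_iff.1 hy3 _
      ((Metric.isOpen_ball (x := x) (ε := δ)).inter (isOpen_interior (s := S.carrier))) ⟨hy1, hy2⟩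
    exact ⟨z, hδU ⟨hz1, hz3⟩, hz2⟩
  -- by connectedness the interiors of the groups overlap, but the overlap would be contained in
  -- finitely many proper affine subspaces
  obtain ⟨y, hy, hyA, hyB⟩ := hUc _ _ isOpen_interior isOpen_interior (fun y hy => hloc y hy)
    ((hmeet S₀ h₀ hx₀).mono (inter_subset_inter Subset.rfl (interior_mono
      (subset_biUnion_of_mem (u := fun S : TaggedSimplex d => S.carrier)
        (show S₀ ∈ A from Finset.mem_filter.2 ⟨h₀, hx₀, hp₀⟩)))))
    ((hmeet S₁ h₁ hx₁).mono (inter_subset_inter Subset.rfl (interior_mono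
      (subset_biUnion_of_mem (u := fun S : TaggedSimplex d => S.carrier)
        (show S₁ ∈ B from Finset.mem_filter.2 ⟨h₁, hx₁, hp₁⟩)))))
  obtain ⟨z, ⟨hz1, hz2⟩, hz3⟩ := exists_mem_notMem_affineSpan (A ×ˢ B)
    (fun i => i.1.verts ∩ i.2.verts) (fun i hi => (hcard i hi).le)
    (isOpen_interior.inter isOpen_interior) ⟨y, hyA, hyB⟩
  obtain ⟨i, hi, hzi⟩ := hinter z ⟨interior_subset hz1, interior_subset hz2⟩
  exact hz3 i hi (convexHull_subset_affineSpan _ hzi)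

end SpaceTimeMesh
namespace SpaceTimeMesh

/-! ### Unisolvence of the Lagrange nodes -/

section Unisolvence

variable {d : ℕ}

open TaggedSimplex

theorem totalDegree_aeval_le {σ τ : Type*} [Fintype σ] (f : σ → MvPolynomial τ ℝ)
    (hf : ∀ i, (f i).totalDegree ≤ 1) (p : MvPolynomial σ ℝ) :
    (MvPolynomial.aeval f p).totalDegree ≤ p.totalDegree := by
  rw [MvPolynomial.aeval_def, MvPolynomial.eval₂_eq]
  refine MvPolynomial.totalDegree_finsetSum_le fun s hs => ?_
  refine (MvPolynomial.totalDegree_mul _ _).trans ?_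
  rw [MvPolynomial.algebraMap_eq, MvPolynomial.totalDegree_C, zero_add]
  refine (MvPolynomial.totalDegree_finsetProd _ _).trans ?_
  refine le_trans (Finset.sum_le_sum fun i _ => ?_) (MvPolynomial.le_totalDegree hs)
  exact (MvPolynomial.totalDegree_pow _ _).trans (by nlinarith [hf i])

/-- A polynomial of degree at most `k` that vanishes at all points with natural coordinates whose
sum is at most `k` is zero, by the combinatorial Nullstellensatz for the grid below one of its
monomials of maximal degree. -/
theorem eq_zero_of_eval_natCast {σ : Type*} [Fintype σ] {k : ℕ} (p : MvPolynomial σ ℝ)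
    (hp : p.totalDegree ≤ k)
    (h : ∀ n : σ → ℕ, ∑ i, n i ≤ k → MvPolynomial.eval (fun i => (n i : ℝ)) p = 0) : p = 0 := by
  classical
  by_contra hne
  obtain ⟨t, ht, htd⟩ := Finset.exists_mem_eq_sup p.support
    (MvPolynomial.support_nonempty.2 hne) (fun s => s.sum fun _ e => e)
  have hdeg : p.totalDegree = t.degree := htd
  obtain ⟨s, hs, hs'⟩ := MvPolynomial.combinatorial_nullstellensatz_exists_eval_nonzero p t
    (MvPolynomial.mem_support_iff.1 ht) hdeg
    (fun i => (Finset.range (t i + 1)).image (fun n : ℕ => (n : ℝ)))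
    (fun i => by
      rw [Finset.card_image_of_injective _ Nat.cast_injective, Finset.card_range]; omega)
  have : ∀ i, ∃ n : ℕ, n ≤ t i ∧ (n : ℝ) = s i := fun i => by
    obtain ⟨n, hn, hns⟩ := Finset.mem_image.1 (hs i)
    exact ⟨n, by rw [Finset.mem_range] at hn; omega, hns⟩
  choose n hn hns using this
  refine hs' ?_
  rw [← funext hns]
  refine h n ((Finset.sum_le_sum fun i _ => hn i).trans ?_)
  rw [hdeg, Finsupp.degree_eq_sum] at hp
  exact hp

theorem exists_vertex_weights {S : TaggedSimplex d} (hS : S.Nondeg) {x : Space d}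
    (hx : x ∈ S.carrier) : ∃ a : Fin (d + 1) → ℝ, ∑ i, a i = 1 ∧ x = ∑ i, a i • S.vertex i := by
  classical
  rw [carrier_eq] at hx
  obtain ⟨a, -, h1, h2⟩ := exists_weights hx
  refine ⟨fun i => a (S.vertex i), ?_, ?_⟩
  · rw [verts, Finset.sum_image (fun i _ j _ hij => hS.injective hij)] at h1
    exact h1
  · rw [verts, Finset.sum_image (fun i _ j _ hij => hS.injective hij)] at h2
    exact h2

/-- The Lagrange nodes of a simplex are unisolvent for polynomials of degree less than `r`. -/
theorem eval_eq_zero_of_nodes {S : TaggedSimplex d} (hS : S.Nondeg) {r : ℕ} (hr : 2 ≤ r)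
    (p : MvPolynomial (Fin d) ℝ) (hp : p.totalDegree < r)
    (h : ∀ x ∈ S.nodes r, MvPolynomial.eval (fun k => x k) p = 0) {x : Space d}
    (hx : x ∈ S.carrier) : MvPolynomial.eval (fun k => x k) p = 0 := by
  have hr2 : (2 : ℝ) ≤ r := by exact_mod_cast hr
  have hr0 : (r : ℝ) - 1 ≠ 0 := by linarith
  -- barycentric coordinates, scaled by `r - 1`
  set f : Fin d → MvPolynomial (Fin d) ℝ := fun j => MvPolynomial.C (S.vertex 0 j) +
    ∑ i : Fin d, MvPolynomial.C ((S.vertex i.succ j - S.vertex 0 j) / ((r : ℝ) - 1)) *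
      MvPolynomial.X i with hf
  have hfd : ∀ j, (f j).totalDegree ≤ 1 := by
    intro j
    refine (MvPolynomial.totalDegree_add _ _).trans (max_le ?_ ?_)
    · rw [MvPolynomial.totalDegree_C]; omega
    · refine MvPolynomial.totalDegree_finsetSum_le fun i _ => ?_
      refine (MvPolynomial.totalDegree_mul _ _).trans ?_
      rw [MvPolynomial.totalDegree_C, MvPolynomial.totalDegree_X]
  have heval : ∀ (y : Fin d → ℝ) (a : Fin (d + 1) → ℝ), ∑ i, a i = 1 →
      (∀ i : Fin d, a i.succ = y i / ((r : ℝ) - 1)) →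
      MvPolynomial.eval y (MvPolynomial.aeval f p) =
        MvPolynomial.eval (fun k => (∑ i, a i • S.vertex i : Space d) k) p := by
    intro y a ha hay
    rw [MvPolynomial.map_aeval, MvPolynomial.eval]
    congr 2
    · ext; simp
    · funext j
      have ha0 : a 0 = 1 - ∑ i : Fin d, y i / ((r : ℝ) - 1) := by
        rw [Fin.sum_univ_succ] at ha
        simp only [hay] at ha
        linarith
      simp only [hf, map_add, map_sum, map_mul, MvPolynomial.coe_eval₂Hom, MvPolynomial.eval₂_C,
        MvPolynomial.eval₂_X, RingHom.id_apply]
      rw [Fin.sum_univ_succ, ha0]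
      simp only [hay, PiLp.add_apply, PiLp.smul_apply, WithLp.ofLp_sum, Finset.sum_apply,
        WithLp.ofLp_smul, Pi.smul_apply, smul_eq_mul, sub_mul, one_mul, Finset.sum_mul]
      rw [sub_add_eq_add_sub, add_sub_assoc, ← Finset.sum_sub_distrib]
      congr 1
      refine Finset.sum_congr rfl fun i _ => ?_
      ring
  have hq : MvPolynomial.aeval f p = 0 := by
    refine eq_zero_of_eval_natCast (k := r - 1) _
      ((totalDegree_aeval_le f hfd p).trans (by omega)) fun n hn => ?_
    set α : Fin (d + 1) → ℕ := Fin.cons (r - 1 - ∑ i, n i) n with hα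
    have hαs : ∑ i, α i = r - 1 := by
      rw [Fin.sum_univ_succ]
      simp only [hα, Fin.cons_zero, Fin.cons_succ]
      omega
    rw [heval _ (fun i => (α i : ℝ) / ((r : ℝ) - 1)) (sum_lattice_weights hr hαs)
      (fun i => by simp [hα])]
    exact h _ ⟨α, hαs, rfl⟩
  obtain ⟨a, ha, rfl⟩ := exists_vertex_weights hS hx
  rw [← heval (fun i => a i.succ * ((r : ℝ) - 1)) a ha (fun i => by rw [mul_div_assoc, div_self hr0, mul_one]), hq, map_zero]

theorem eval_eq_zero_of_time_nodes {I : TimeInterval} (hI : I.lo < I.hi) {r : ℕ} (hr : 2 ≤ r)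
    (c : Fin r → ℝ) (h : ∀ t ∈ I.nodes r, ∑ i : Fin r, t ^ (i : ℕ) * c i = 0) (t : ℝ) :
    ∑ i : Fin r, t ^ (i : ℕ) * c i = 0 := by
  have hr2 : (2 : ℝ) ≤ r := by exact_mod_cast hr
  have hr0 : (r : ℝ) - 1 ≠ 0 := by linarith
  set q : Polynomial ℝ := ∑ i : Fin r, Polynomial.C (c i) * Polynomial.X ^ (i : ℕ) with hq
  have hev : ∀ t, q.eval t = ∑ i : Fin r, t ^ (i : ℕ) * c i := fun t => by
    rw [hq, Polynomial.eval_finsetSum]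
    refine Finset.sum_congr rfl fun i _ => ?_
    rw [Polynomial.eval_mul, Polynomial.eval_C, Polynomial.eval_pow, Polynomial.eval_X, mul_comm]
  rw [← hev]
  have : q = 0 := by
    refine Polynomial.eq_zero_of_natDegree_lt_card_of_eval_eq_zero q (ι := Fin r)
      (f := fun n : Fin r => I.lo + ((n : ℕ) : ℝ) / ((r : ℝ) - 1) * (I.hi - I.lo)) ?_ ?_ ?_
    · intro m n hmn
      have h1 : I.hi - I.lo ≠ 0 := by linarith
      have := mul_right_cancel₀ h1 (add_left_cancel hmn)
      rw [div_left_inj' hr0] at this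
      exact Fin.ext (by exact_mod_cast this)
    · intro n
      rw [hev]
      exact h _ ⟨n, by have := n.isLt; omega, rfl⟩
    · rw [Fintype.card_fin]
      refine lt_of_le_of_lt (Polynomial.natDegree_sum_le_of_forall_le (n := r - 1) _ _
        fun i _ => ?_) (by omega)
      exact (Polynomial.natDegree_C_mul_X_pow_le _ _).trans (by have := i.isLt; omega)
  rw [this, Polynomial.eval_zero]

/-- At a fixed time, an anisotropic polynomial is determined by the spatial nodes. -/
theorem IsAnisoPolyOn.exists_space_node {r₁ r₂ : ℕ} (hr : 2 ≤ r₂) {D : Set (ℝ × Space d)}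
    {F : ℝ × Space d → ℝ} (hF : IsAnisoPolyOn r₁ r₂ D F) {S : TaggedSimplex d} (hS : S.Nondeg)
    {t : ℝ} (hD : ∀ x ∈ S.carrier, (t, x) ∈ D) {x : Space d} (hx : x ∈ S.carrier)
    (hne : F (t, x) ≠ 0) : ∃ y ∈ S.nodes r₂, F (t, y) ≠ 0 := by
  obtain ⟨p, hp, hpF⟩ := hF
  by_contra hc
  push Not at hc
  set q : MvPolynomial (Fin d) ℝ := ∑ i : Fin r₁, MvPolynomial.C (t ^ (i : ℕ)) * p i with hq
  have hev : ∀ y ∈ S.carrier, F (t, y) = MvPolynomial.eval (fun k => y k) q := fun y hy => by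
    rw [hpF _ (hD y hy), hq, map_sum]
    simp
  refine hne ?_
  rw [hev x hx]
  refine eval_eq_zero_of_nodes hS hr q ?_ (fun y hy => ?_) hx
  · refine lt_of_le_of_lt (MvPolynomial.totalDegree_finsetSum_le (d := r₂ - 1) fun i _ => ?_)
      (by omega)
    refine (MvPolynomial.totalDegree_mul _ _).trans ?_
    rw [MvPolynomial.totalDegree_C]
    have := hp i
    omega
  · rw [← hev y (nodes_subset_carrier hS hr hy), hc y hy]

/-- At a fixed point in space, an anisotropic polynomial is determined by the temporal nodes. -/
theorem IsAnisoPolyOn.exists_time_node {r₁ r₂ : ℕ} (hr : 2 ≤ r₁) {D : Set (ℝ × Space d)}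
    {F : ℝ × Space d → ℝ} (hF : IsAnisoPolyOn r₁ r₂ D F) {I : TimeInterval} (hI : I.lo < I.hi)
    {x : Space d} (hD : ∀ t ∈ Icc I.lo I.hi, (t, x) ∈ D) {t : ℝ} (ht : t ∈ Icc I.lo I.hi)
    (hne : F (t, x) ≠ 0) : ∃ s ∈ I.nodes r₁, F (s, x) ≠ 0 := by
  obtain ⟨p, hp, hpF⟩ := hF
  by_contra hc
  push Not at hc
  refine hne ?_
  rw [hpF _ (hD t ht)]
  refine eval_eq_zero_of_time_nodes hI hr _ (fun s hs => ?_) t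
  have := hpF _ (hD s (TimeInterval.nodes_subset_Icc hI hr hs))
  rw [← hc s hs, this]

/-- An anisotropic polynomial on a set, continuous on the closure, is one on the closure. -/
theorem IsAnisoPolyOn.closure {r₁ r₂ : ℕ} {D : Set (ℝ × Space d)} {F : ℝ × Space d → ℝ}
    (hF : IsAnisoPolyOn r₁ r₂ D F) (hc : ContinuousOn F (closure D)) :
    IsAnisoPolyOn r₁ r₂ (closure D) F := by
  obtain ⟨p, hp, hpF⟩ := hF
  refine ⟨p, hp, ?_⟩
  have hcont : Continuous fun z : ℝ × Space d =>
      ∑ i : Fin r₁, z.1 ^ (i : ℕ) * MvPolynomial.eval (fun k => z.2 k) (p i) := by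
    refine continuous_finsetSum _ fun i _ => (continuous_fst.pow _).mul ?_
    exact (MvPolynomial.continuous_eval (p i)).comp (by fun_prop)
  exact Set.EqOn.of_subset_closure hpF hc hcont.continuousOn subset_closure Subset.rfl

end Unisolvence

end SpaceTimeMesh
namespace SpaceTimeMesh

/-! ### Active triangulations -/

variable {d : ℕ}

open TaggedSimplex

variable {M : InitialMesh d} {s₁ s₂ : ℝ} {P : Finset (Prism d)}

theorem mem_activeTriangulation {t : ℝ} {S : TaggedSimplex d} :
    S ∈ activeTriangulation P t ↔ ∃ Q ∈ P, t ∈ Q.1.carrier ∧ Q.2 = S := by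
  classical
  simp only [activeTriangulation, Finset.mem_image, Finset.mem_filter, and_assoc]

/-- In one dimension, two simplices that meet in a common face meet in at most one point. -/
theorem MeetInFace.ncard_inter_eq_one {S S' : TaggedSimplex d} (h : MeetInFace S S')
    (hS : S.Nondeg) (hS' : S'.Nondeg) (hd : d = 1) (hne : (S.carrier ∩ S'.carrier).Nonempty) :
    (S.carrier ∩ S'.carrier).ncard = 1 := by
  have hcard := h.card_le hS hS'
  rw [h.inter_eq] at hne ⊢
  have h2 : (S.verts ∩ S'.verts).Nonempty := by
    rw [← Finset.coe_nonempty]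
    exact convexHull_nonempty_iff.1 hne
  obtain ⟨v, hv⟩ := Finset.card_eq_one.1 (le_antisymm (hcard.trans hd.le) h2.card_pos)
  rw [hv, Finset.coe_singleton, convexHull_singleton, ncard_singleton]

theorem InForest.carrier_subset (hd : 1 ≤ d) {S : TaggedSimplex d} (hS : InForest M S) :
    S.carrier ⊆ closure M.Ω := by
  obtain ⟨A, hA, hAl, hAS⟩ := hS.exists_ancestor (Nat.zero_le _)
  refine (hA.desc_carrier hd hAS).trans ?_
  rw [← M.cover]
  exact subset_biUnion_of_mem (u := fun S : TaggedSimplex d => S.carrier)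
    (hA.mem_of_level_eq_zero hAl)

namespace MeshInv

theorem iUnion_active (hd : 1 ≤ d) (hP : MeshInv M s₁ s₂ P) {t : ℝ} (ht : t ∈ Icc 0 M.T) :
    ⋃ S ∈ activeTriangulation P t, S.carrier = closure M.Ω := by
  refine Subset.antisymm (iUnion₂_subset fun S hS => ?_) fun x hx => ?_
  · obtain ⟨Q, hQ, -, rfl⟩ := mem_activeTriangulation.1 hS
    exact (hP.space Q hQ).carrier_subset hd
  · rw [← M.cover] at hx
    simp only [mem_iUnion] at hx
    obtain ⟨S, hS, hxS⟩ := hx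
    obtain ⟨Q, hQ, h1, h2, -⟩ := hP.complete t ht S (.base hS) x hxS
    exact mem_biUnion (mem_activeTriangulation.2 ⟨Q, hQ, h1, rfl⟩) h2

theorem nondeg_active (hd : 1 ≤ d) (hP : MeshInv M s₁ s₂ P) {t : ℝ} :
    ∀ S ∈ activeTriangulation P t, S.Nondeg := fun S hS => by
  obtain ⟨Q, hQ, -, rfl⟩ := mem_activeTriangulation.1 hS
  exact (hP.space Q hQ).nondeg hd

/-- Prisms over comparable simplices that are active at the same time are equal. -/
theorem eq_of_active (hd : 1 ≤ d) (hP : MeshInv M s₁ s₂ P) {Q Q' : Prism d} (hQ : Q ∈ P)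
    (hQ' : Q' ∈ P) {t : ℝ} (ht : t ∈ Q.1.carrier) (ht' : t ∈ Q'.1.carrier)
    (h : Comparable Q.2 Q'.2) : Q = Q' :=
  hP.unique Q hQ Q' hQ' ⟨t, ht, ht'⟩
    ((hP.space Q hQ).overlap_of_comparable hd (hP.space Q' hQ') h)

theorem meetInFace (hd : 1 ≤ d) (hP : MeshInv M s₁ s₂ P) (hc : ConformingInSpace P)
    {Q Q' : Prism d} (hQ : Q ∈ P) (hQ' : Q' ∈ P) {t : ℝ} (ht : t ∈ Q.1.carrier)
    (ht' : t ∈ Q'.1.carrier) (hne : Q.2 ≠ Q'.2) : MeetInFace Q.2 Q'.2 :=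
  (hc t).meetInFace (mem_activeTriangulation.2 ⟨Q, hQ, ht, rfl⟩)
    (mem_activeTriangulation.2 ⟨Q', hQ', ht', rfl⟩) ((hP.space Q hQ).nondeg hd)
    ((hP.space Q' hQ').nondeg hd) hne

/-- At a fixed time, being a Lagrange node does not depend on the simplex. -/
theorem node_of_active (hd : 1 ≤ d) (hP : MeshInv M s₁ s₂ P) (hc : ConformingInSpace P)
    {Q Q' : Prism d} (hQ : Q ∈ P) (hQ' : Q' ∈ P) {t : ℝ} (ht : t ∈ Q.1.carrier)
    (ht' : t ∈ Q'.1.carrier) {r : ℕ} (hr : 2 ≤ r) {x : Space d} (hx : x ∈ Q.2.nodes r)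
    (hx' : x ∈ Q'.2.carrier) : x ∈ Q'.2.nodes r := by
  by_cases hne : Q.2 = Q'.2
  · exact hne ▸ hx
  have hn := (hP.space Q hQ).nondeg hd
  have hn' := (hP.space Q' hQ').nondeg hd
  have hm := hP.meetInFace hd hc hQ hQ' ht ht' hne
  have hx1 : x ∈ Q.2.carrier ∩ Q'.2.carrier := ⟨nodes_subset_carrier hn hr hx, hx'⟩
  rw [hm.inter_eq] at hx1
  rw [nodes_eq hn] at hx
  rw [nodes_eq hn']
  exact latticeNodes_mono Finset.inter_subset_right
    (latticeNodes_face hr hn.verts Finset.inter_subset_left hx1 hx)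

theorem level_le_of_touch (hd : 1 ≤ d) (hP : MeshInv M s₁ s₂ P) (h1 : OneIrregularInTime P)
    {Q Q' : Prism d} (hQ : Q ∈ P) (hQ' : Q' ∈ P) {t : ℝ} (ht : t ∈ Icc Q.1.lo Q.1.hi)
    (ht' : t ∈ Icc Q'.1.lo Q'.1.hi) (h : Comparable Q.2 Q'.2) : Q.level ≤ Q'.level + 1 := by
  have hov := (hP.space Q hQ).overlap_of_comparable hd (hP.space Q' hQ') h
  by_cases hI : (Q.1.carrier ∩ Q'.1.carrier).Nonempty
  · rw [hP.unique Q hQ Q' hQ' hI hov]; omega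
  · refine h1 Q hQ Q' hQ' ?_ hov
    rw [((hP.time Q hQ).inter_eq_singleton (hP.time Q' hQ') hI ht ht').1, ncard_singleton]

theorem closure_carrier (hP : MeshInv M s₁ s₂ P) {Q : Prism d} (hQ : Q ∈ P) :
    closure Q.carrier = Icc Q.1.lo Q.1.hi ×ˢ Q.2.carrier := by
  rw [Prism.carrier, closure_prod_eq, (hP.time Q hQ).closure_eq,
    Q.2.isCompact_carrier.isClosed.closure_eq]

theorem closure_subset_cylinder (hd : 1 ≤ d) (hP : MeshInv M s₁ s₂ P) {Q : Prism d} (hQ : Q ∈ P) :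
    closure Q.carrier ⊆ M.cylinder := by
  rw [hP.closure_carrier hQ]
  exact prod_mono (hP.time Q hQ).Icc_subset ((hP.space Q hQ).carrier_subset hd)

theorem mem_neighbourhood (hP : MeshInv M s₁ s₂ P) {Q Q' : Prism d} (hQ : Q ∈ P)
    (hQ' : Q' ∈ P) {t : ℝ} {x : Space d} (ht : t ∈ Icc Q.1.lo Q.1.hi) (hx : x ∈ Q.2.carrier)
    (ht' : t ∈ Icc Q'.1.lo Q'.1.hi) (hx' : x ∈ Q'.2.carrier) : Q' ∈ neighbourhood P Q := by
  refine ⟨hQ', (t, x), ?_, ?_⟩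
  · rw [hP.closure_carrier hQ]; exact ⟨ht, hx⟩
  · rw [hP.closure_carrier hQ']; exact ⟨ht', hx'⟩

end MeshInv

/-! ### Hanging nodes -/

/-- The times `τ` and `τ'` represent the two sides of the time `t`: the prisms that touch `t` are
those which are active at one of them. -/
structure Sides (M : InitialMesh d) (P : Finset (Prism d)) (t τ τ' : ℝ) : Prop where
  mem : τ ∈ Icc 0 M.T
  mem' : τ' ∈ Icc 0 M.T
  closed : ∀ Q ∈ P, τ ∈ Q.1.carrier → t ∈ Icc Q.1.lo Q.1.hi
  closed' : ∀ Q ∈ P, τ' ∈ Q.1.carrier → t ∈ Icc Q.1.lo Q.1.hi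
  cover : ∀ Q ∈ P, t ∈ Icc Q.1.lo Q.1.hi → τ ∈ Q.1.carrier ∨ τ' ∈ Q.1.carrier
  inner : ∀ Q ∈ P, Q.1.lo < t → t < Q.1.hi → τ ∈ Q.1.carrier ∧ τ' ∈ Q.1.carrier

theorem Sides.symm {t τ τ' : ℝ} (h : Sides M P t τ τ') : Sides M P t τ' τ :=
  ⟨h.mem', h.mem, h.closed', h.closed, fun Q hQ ht => (h.cover Q hQ ht).symm,
    fun Q hQ h1 h2 => (h.inner Q hQ h1 h2).symm⟩

/-- The two sides are represented by `t - ε` and `t + ε`, truncated at the end points of the time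
interval, where `ε` is less than the distance of `t` to all other end points of the intervals. -/
theorem MeshInv.exists_sides (hP : MeshInv M s₁ s₂ P) {t : ℝ} (ht : t ∈ Icc 0 M.T) :
    ∃ τ τ', Sides M P t τ τ' := by
  classical
  obtain ⟨ε, hε, hlo, hhi⟩ : ∃ ε > 0, (∀ Q ∈ P, t < Q.1.lo → t + ε < Q.1.lo) ∧
      (∀ Q ∈ P, t < Q.1.hi → t + ε < Q.1.hi) ∧ (∀ Q ∈ P, Q.1.lo < t → Q.1.lo < t - ε) ∧
      (∀ Q ∈ P, Q.1.hi < t → Q.1.hi < t - ε) := by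
    set E : Set ℝ := ((P.image fun Q => Q.1.lo) ∪ (P.image fun Q => Q.1.hi) : Finset ℝ) \ {t}
    have hE : IsClosed E := ((Finset.finite_toSet _).sdiff).isClosed
    obtain ⟨ε, hε, hsub⟩ := Metric.isOpen_iff.1 hE.isOpen_compl t (by simp [E])
    have key : ∀ a, a ∈ ((P.image fun Q => Q.1.lo) ∪ (P.image fun Q => Q.1.hi) : Finset ℝ) →
        a ≠ t → ε ≤ |a - t| := by
      intro a ha hat
      by_contra hlt
      rw [not_le] at hlt
      exact hsub (show a ∈ Metric.ball t ε by rwa [Metric.mem_ball, Real.dist_eq]) ⟨ha, hat⟩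
    have k1 : ∀ Q ∈ P, Q.1.lo ≠ t → ε ≤ |Q.1.lo - t| := fun Q hQ =>
      key _ (Finset.mem_union_left _ (Finset.mem_image_of_mem _ hQ))
    have k2 : ∀ Q ∈ P, Q.1.hi ≠ t → ε ≤ |Q.1.hi - t| := fun Q hQ =>
      key _ (Finset.mem_union_right _ (Finset.mem_image_of_mem _ hQ))
    refine ⟨ε / 2, by positivity, fun Q hQ h => ?_, fun Q hQ h => ?_, fun Q hQ h => ?_,
      fun Q hQ h => ?_⟩
    · have := k1 Q hQ h.ne'
      rw [abs_of_pos (by linarith)] at this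
      linarith
    · have := k2 Q hQ h.ne'
      rw [abs_of_pos (by linarith)] at this
      linarith
    · have := k1 Q hQ h.ne
      rw [abs_of_neg (by linarith)] at this
      linarith
    · have := k2 Q hQ h.ne
      rw [abs_of_neg (by linarith)] at this
      linarith
  obtain ⟨hhi, hlo', hhi'⟩ := hhi
  have hT : ∀ Q ∈ P, 0 ≤ Q.1.lo ∧ Q.1.hi ≤ M.T := fun Q hQ => by
    have h1 := (hP.time Q hQ).Icc_subset
    have h2 := (hP.time Q hQ).lt.le
    exact ⟨(h1 (left_mem_Icc.2 h2)).1, (h1 (right_mem_Icc.2 h2)).2⟩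
  have hleft : ∀ Q ∈ P, Q.1.lo < t → t ≤ Q.1.hi → max 0 (t - ε) ∈ Q.1.carrier := by
    intro Q hQ h1 h2
    have h3 := hT Q hQ
    have h4 := hlo' Q hQ h1
    refine Q.1.Ioo_subset_carrier ⟨lt_of_lt_of_le h4 (le_max_right _ _), ?_⟩
    exact max_lt (by linarith) (by linarith)
  have hright : ∀ Q ∈ P, Q.1.lo ≤ t → t < Q.1.hi → min M.T (t + ε) ∈ Q.1.carrier := by
    intro Q hQ h1 h2
    have h3 := hT Q hQ
    have h4 := hhi Q hQ h2
    rw [TimeInterval.mem_carrier]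
    exact ⟨h1.trans (le_min (by linarith) (by linarith)),
      ((min_le_right _ _).trans_lt h4).le, Or.inl ((min_le_right _ _).trans_lt h4)⟩
  refine ⟨max 0 (t - ε), min M.T (t + ε), ⟨le_max_left _ _, max_le (ht.1.trans ht.2)
    (by linarith [ht.2])⟩, ⟨le_min (ht.1.trans ht.2) (by linarith [ht.1]), min_le_left _ _⟩,
    fun Q hQ h => ?_, fun Q hQ h => ?_, fun Q hQ h => ?_, fun Q hQ h1 h2 =>
      ⟨hleft Q hQ h1 h2.le, hright Q hQ h1.le h2⟩⟩
  · have h1 := Q.1.carrier_subset_Icc h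
    have h2 : max 0 (t - ε) ≤ t := max_le ht.1 (by linarith)
    refine ⟨h1.1.trans h2, ?_⟩
    by_contra hc
    have h3 := hhi' Q hQ (not_le.1 hc)
    have := h1.2.trans_lt' (h3.trans_le (le_max_right 0 _))
    exact lt_irrefl _ this
  · have h1 := Q.1.carrier_subset_Icc h
    have h2 : t ≤ min M.T (t + ε) := le_min ht.2 (by linarith)
    refine ⟨?_, h2.trans h1.2⟩
    by_contra hc
    have h3 := hlo Q hQ (not_le.1 hc)
    have := h1.1.trans (min_le_right _ _)
    linarith
  · rcases h.2.eq_or_lt with h1 | h1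
    · exact Or.inl (hleft Q hQ (h1 ▸ (hP.time Q hQ).lt) h.2)
    · exact Or.inr (hright Q hQ h.1 h1)

/-- Suppose that a node `(t, x)` hangs since `x` is not a node of the simplex `S` of a prism `Q`
touching it. Then across the time `t` all simplices that overlap `S` are finer than `S`, so that
all nodes of `S` are nodes there, too. In one dimension these even are nodes in time. -/
theorem MeshInv.nodes_of_hanging_in_space (hd : 1 ≤ d) (hs₁ : 0 < s₁) (hs₂ : 0 < s₂)
    (hP : MeshInv M s₁ s₂ P) (hc : ConformingInSpace P)
    (hone : d = 1 → OneIrregularInSpace P)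
    {r₁ r₂ : ℕ} (hr₁ : 2 ≤ r₁) (hr : 2 ≤ r₂) {Q Q' : Prism d} (hQ : Q ∈ P) (hQ' : Q' ∈ P)
    {t : ℝ} {x : Space d}
    (ht : t ∈ Icc Q.1.lo Q.1.hi) (hx : x ∈ Q.2.carrier) (hxn : x ∉ Q.2.nodes r₂)
    (ht' : t ∈ Icc Q'.1.lo Q'.1.hi) (hx' : x ∈ Q'.2.nodes r₂)
    {y : Space d} (hy : y ∈ Q.2.nodes r₂) {R : Prism d} (hR : R ∈ P)
    (htR : t ∈ Icc R.1.lo R.1.hi) (hyR : y ∈ R.2.carrier) :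
    y ∈ R.2.nodes r₂ ∧ t ∈ Q.1.nodes r₁ ∧ (d = 1 → t ∈ R.1.nodes r₁) := by
  have hn := (hP.space Q hQ).nondeg hd
  have hn' := (hP.space Q' hQ').nondeg hd
  have hyQ := nodes_subset_carrier hn hr hy
  have hxQ' := nodes_subset_carrier hn' hr hx'
  have htT := (hP.time Q hQ).Icc_subset ht
  obtain ⟨τ, τ', hs, hτ⟩ : ∃ τ τ', Sides M P t τ τ' ∧ τ ∈ Q.1.carrier := by
    obtain ⟨τ, τ', hs⟩ := hP.exists_sides htT
    rcases hs.cover Q hQ ht with h | h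
    · exact ⟨τ, τ', hs, h⟩
    · exact ⟨τ', τ, hs.symm, h⟩
  have hτ' : τ' ∈ Q'.1.carrier := (hs.cover Q' hQ' ht').resolve_left fun h =>
    hxn (hP.node_of_active hd hc hQ' hQ h hτ hr hx' hx)
  have hQτ' : τ' ∉ Q.1.carrier := fun h =>
    hxn (hP.node_of_active hd hc hQ' hQ hτ' h hr hx' hx)
  -- a strict descendant on the other side
  obtain ⟨A, hA, hτA, hxA, hcA⟩ := hP.complete τ' hs.mem' Q.2 (hP.space Q hQ) x hx
  have hxA' := hP.node_of_active hd hc hQ' hA hτ' hτA hr hx' hxA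
  have hnd : ∀ B ∈ P, τ' ∈ B.1.carrier → ¬ Desc B.2 Q.2 := by
    intro B hB hτB hBQ
    have hQA : Desc Q.2 A.2 := hcA.resolve_right fun h =>
      hxn ((hP.space A hA).nodes_desc hd h hr hxA' hx)
    have hBA := hP.eq_of_active hd hB hA hτB hτA (Or.inl (hBQ.trans hQA))
    subst hBA
    have := hBQ.eq_of_level hQA.level_le
    exact hxn (this ▸ hxA')
  obtain ⟨B, hB, hτB, hyB, hcB⟩ := hP.complete τ' hs.mem' Q.2 (hP.space Q hQ) y hyQ
  have hQB : Desc Q.2 B.2 := hcB.resolve_right (hnd B hB hτB)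
  have hyB' := (hP.space Q hQ).nodes_desc hd hQB hr hy hyB
  have htQ : t ∈ Q.1.nodes r₁ := by
    rcases ht.1.eq_or_lt with h | h
    · exact h ▸ Q.1.lo_mem_nodes r₁
    · rcases ht.2.eq_or_lt with h' | h'
      · exact h' ▸ Q.1.hi_mem_nodes hr₁
      · exact absurd (hs.inner Q hQ h h').2 hQτ'
  refine ⟨?_, htQ, fun hd1 => ?_⟩
  · rcases hs.cover R hR htR with h | h
    · exact hP.node_of_active hd hc hQ hR hτ h hr hy hyR
    · exact hP.node_of_active hd hc hB hR hτB h hr hyB' hyR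
  · have hR1 := hP.time R hR
    by_contra htn
    have hlo : R.1.lo < t := lt_of_le_of_ne htR.1 fun h => htn (h ▸ R.1.lo_mem_nodes r₁)
    have hhi : t < R.1.hi := lt_of_le_of_ne htR.2 fun h => htn (h ▸ R.1.hi_mem_nodes hr₁)
    obtain ⟨hτR, hτR'⟩ := hs.inner R hR hlo hhi
    have hl1 : R.level < Q.level := by
      by_contra hl
      have := (hP.time Q hQ).desc_of_mem hR1 (timeDepth_mono hs₁ hs₂ (not_lt.1 hl)) hτ hτR
      exact htn (((hP.time Q hQ).desc_props this).2.2.2.2 r₁ hr₁ t htQ htR)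
    have hl2 : Q.level < B.level := by
      refine lt_of_le_of_ne hQB.level_le fun h => hnd B hB hτB ?_
      rw [hQB.eq_of_level h.symm.le]
      exact Desc.refl
    have hne : B.2 ≠ R.2 := fun h => by
      have : B.level = R.level := by rw [Prism.level, h, Prism.level]
      omega
    have hm := hP.meetInFace hd hc hB hR hτB hτR' hne
    have h1 := hm.ncard_inter_eq_one ((hP.space B hB).nondeg hd) ((hP.space R hR).nondeg hd) hd1
      ⟨y, hyB, hyR⟩
    have := hone hd1 B hB R hR
      (((hP.time B hB).volume_inter_pos_iff hR1).2 ⟨τ', hτB, hτR'⟩) h1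
    omega

/-- If bisection turns a point of a common hyperface into a node, then the refinement edge lies in
that hyperface. -/
theorem Adjacent.edge_of_new_node {S S' c : TaggedSimplex d} (h : Adjacent S S') (hS : S.Nondeg)
    {e e' : Space d} (hc : IsHalf S c e e') {r : ℕ} (hr : 2 ≤ r) {x : Space d}
    (hx : x ∈ S.carrier ∩ S'.carrier) (hxc : x ∈ c.nodes r) (hxS : x ∉ S.nodes r) :
    S.head ∈ S.verts ∩ S'.verts ∧ S.tail ∈ S.verts ∩ S'.verts := by
  classical
  by_contra hcon
  have hnot := hc.not_edge hcon
  have hcn := hc.nondeg hS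
  rw [not_and_or] at hnot
  have hxc' := nodes_subset_carrier hcn hr hxc
  rw [carrier_eq, hc.verts_eq] at hxc'
  rw [h.inter_eq] at hx
  have h1 := hull_inter_half_of_notMem hS.verts
    (Finset.inter_subset_left (s₁ := S.verts) (s₂ := S'.verts)) hc.mem hc.mem' hc.ne hnot
  have h2 : x ∈ convexHull ℝ (((S.verts ∩ S'.verts).erase e' : Finset (Space d)) :
      Set (Space d)) := h1 ▸ ⟨hx, hxc'⟩
  have hsub : (S.verts ∩ S'.verts).erase e' ⊆ S.verts :=
    (Finset.erase_subset _ _).trans Finset.inter_subset_left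
  have hsub' : (S.verts ∩ S'.verts).erase e' ⊆ c.verts := fun v hv => by
    rw [hc.verts_eq, mem_halfVerts]
    exact Or.inr ⟨(Finset.mem_erase.1 hv).1, hsub hv⟩
  rw [nodes_eq hcn] at hxc
  rw [nodes_eq hS] at hxS
  exact hxS (latticeNodes_mono hsub (latticeNodes_face hr hcn.verts hsub' h2 hxc))

/-- Suppose that the prism `Q` touches `(t, x)` and is of minimal level among the prisms that do,
that `x` is a node of all their simplices, and that `t` is a node in time for one of them, but not
for `Q`. Then all the points `(s, x)` with a node `s` of the interval of `Q` are nodes of all the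
prisms that touch them. -/
theorem MeshInv.nodes_of_hanging_in_time (hd : 1 ≤ d) (hs₁ : 0 < s₁) (hs₂ : 0 < s₂)
    (hP : MeshInv M s₁ s₂ P) (hc : ConformingInSpace P) (h1 : OneIrregularInTime P)
    {r₁ r₂ : ℕ} (hr₁ : 2 ≤ r₁) (hr : 2 ≤ r₂) {Q Q' : Prism d} (hQ : Q ∈ P) (hQ' : Q' ∈ P)
    {t : ℝ} {x : Space d} (ht : t ∈ Icc Q.1.lo Q.1.hi) (hx : x ∈ Q.2.nodes r₂)
    (htn : t ∉ Q.1.nodes r₁) (htQ' : t ∈ Q'.1.nodes r₁) (hxQ' : x ∈ Q'.2.carrier)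
    (hmin : ∀ R ∈ P, t ∈ Icc R.1.lo R.1.hi → x ∈ R.2.carrier → Q.level ≤ R.level)
    {s : ℝ} (hsQ : s ∈ Q.1.nodes r₁) {R : Prism d} (hR : R ∈ P) (hsR : s ∈ Icc R.1.lo R.1.hi)
    (hxR : x ∈ R.2.carrier) : s ∈ R.1.nodes r₁ ∧ x ∈ R.2.nodes r₂ := by
  have hf : ∀ B ∈ P, InForest M B.2 := hP.space
  have hQt := hP.time Q hQ
  have hxc := nodes_subset_carrier ((hf Q hQ).nondeg hd) hr hx
  have hlo : Q.1.lo < t := lt_of_le_of_ne ht.1 fun h => htn (h ▸ Q.1.lo_mem_nodes r₁)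
  have hhi : t < Q.1.hi := lt_of_le_of_ne ht.2 fun h => htn (h ▸ Q.1.hi_mem_nodes hr₁)
  have hsIcc := TimeInterval.nodes_subset_Icc hQt.lt hr₁ hsQ
  -- prisms around `x` whose intervals meet the interval of `Q` have intervals contained in it
  have hnest : ∀ B ∈ P, x ∈ B.2.carrier → (Q.1.carrier ∩ B.1.carrier).Nonempty →
      TimeDesc Q.1 B.1 := by
    intro B hB hxB hne
    rcases hQt.nested (hP.time B hB) hne with h | h
    · exact h
    · obtain ⟨u, hu, hu'⟩ := hne
      have hp := (hP.time B hB).desc_props h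
      have hl := hmin B hB ⟨hp.2.1.trans ht.1, ht.2.trans hp.2.2.1⟩ hxB
      exact hQt.desc_of_mem (hP.time B hB) (timeDepth_mono hs₁ hs₂ hl) hu hu'
  by_cases hne : (Q.1.carrier ∩ R.1.carrier).Nonempty
  · obtain ⟨u, hu, hu'⟩ := hne
    exact ⟨(hQt.desc_props (hnest R hR hxR ⟨u, hu, hu'⟩)).2.2.2.2 r₁ hr₁ s hsQ hsR,
      hP.node_of_active hd hc hQ hR hu hu' hr hx hxR⟩
  refine ⟨?_, ?_⟩
  · obtain ⟨-, ⟨-, h⟩ | ⟨-, h⟩⟩ := hQt.inter_eq_singleton (hP.time R hR) hne hsIcc hsR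
    · exact h ▸ R.1.hi_mem_nodes hr₁
    · exact h ▸ R.1.lo_mem_nodes r₁
  by_contra hxn
  obtain ⟨τ, τ', hsd, hτ⟩ : ∃ τ τ', Sides M P s τ τ' ∧ τ ∈ Q.1.carrier := by
    obtain ⟨τ, τ', hs⟩ := hP.exists_sides (hQt.Icc_subset hsIcc)
    rcases hs.cover Q hQ hsIcc with h | h
    · exact ⟨τ, τ', hs, h⟩
    · exact ⟨τ', τ, hs.symm, h⟩
  have hτR : τ' ∈ R.1.carrier := (hsd.cover R hR hsR).resolve_left fun h => hne ⟨τ, hτ, h⟩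
  have hgood : ∀ B ∈ P, τ ∈ B.1.carrier → x ∈ B.2.carrier → x ∈ B.2.nodes r₂ := fun B hB hτB hxB =>
    hP.node_of_active hd hc hQ hB hτ hτB hr hx hxB
  have hbad : ∀ B ∈ P, τ' ∈ B.1.carrier → x ∈ B.2.carrier → x ∉ B.2.nodes r₂ :=
    fun B hB hτB hxB h => hxn (hP.node_of_active hd hc hB hR hτB hτR hr h hxR)
  -- across the time `s`, the simplices around `x` arise by exactly one bisection
  have hcross : ∀ A ∈ P, ∀ B ∈ P, τ ∈ A.1.carrier → x ∈ A.2.carrier → τ' ∈ B.1.carrier →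
      x ∈ B.2.carrier → Comparable A.2 B.2 → B.2.IsChild A.2 ∧ A.level = B.level + 1 := by
    intro A hA B hB hτA hxA hτB hxB hcomp
    have hBA : Desc B.2 A.2 := hcomp.resolve_left fun h =>
      hbad B hB hτB hxB ((hf A hA).nodes_desc hd h hr (hgood A hA hτA hxA) hxB)
    have hlt : B.2.level < A.2.level := lt_of_le_of_ne hBA.level_le fun h => by
      have := hBA.eq_of_level h.symm.le
      exact hbad B hB hτB hxB (this ▸ hgood A hA hτA hxA)
    obtain ⟨c, hc1, hc2⟩ := hBA.exists_child hlt
    have hle := hP.level_le_of_touch hd h1 hA hB (hsd.closed A hA hτA) (hsd.closed' B hB hτB) hcomp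
    have hcl := hc1.level
    rw [← hc2.eq_of_level (by change A.2.level ≤ _ at hle; rw [hcl]; exact hle)]
    refine ⟨hc1, ?_⟩
    change A.2.level ≤ B.2.level + 1 at hle
    change A.2.level = B.2.level + 1
    omega
  -- On the side of `τ'` all levels agree: otherwise two adjacent simplices around `x` are of
  -- different levels, but both refinement edges lie in the common hyperface, since the bisections
  -- turn `x` into a node of each of them.
  have hlevel : ∀ B ∈ P, τ' ∈ B.1.carrier → x ∈ B.2.carrier → B.level = R.level := by
    intro B hB hτB hxB
    by_contra hBl
    obtain ⟨S, hS, S', hS', hxS, hxS', hpS, hpS', hadj⟩ := exists_adjacent_of_star M.domain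
      (hP.nondeg_active hd) (hc τ') (hP.iUnion_active hd hsd.mem') (x := x)
      (fun S => S.level = R.level) (S₀ := R.2) (S₁ := B.2)
      (mem_activeTriangulation.2 ⟨R, hR, hτR, rfl⟩) hxR rfl
      (mem_activeTriangulation.2 ⟨B, hB, hτB, rfl⟩) hxB hBl
    have hedge : ∀ S S' : TaggedSimplex d, S ∈ activeTriangulation P τ' → x ∈ S.carrier →
        x ∈ S'.carrier → Adjacent S S' →
        S.head ∈ S.verts ∩ S'.verts ∧ S.tail ∈ S.verts ∩ S'.verts := by
      intro S S' hS hxS hxS' hadj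
      obtain ⟨A, hA, hτA, rfl⟩ := mem_activeTriangulation.1 hS
      obtain ⟨C, hC, hτC, hxC, hcC⟩ := hP.complete τ hsd.mem A.2 (hf A hA) x hxS
      have hch := (hcross C hC A hA hτC hxC hτA hxS hcC.symm).1
      obtain ⟨e, e', he⟩ := (hf A hA).exists_isHalf hd hch
      exact hadj.edge_of_new_node ((hf A hA).nondeg hd) he hr ⟨hxS, hxS'⟩ (hgood C hC hτC hxC)
        (hbad A hA hτA hxS)
    have hfS : InForest M S := by
      obtain ⟨A, hA, -, rfl⟩ := mem_activeTriangulation.1 hS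
      exact hf A hA
    have hfS' : InForest M S' := by
      obtain ⟨A, hA, -, rfl⟩ := mem_activeTriangulation.1 hS'
      exact hf A hA
    have l1 := hadj.level_le_of_edge hd hfS hfS' (hedge S S' hS hxS hxS' hadj)
    have l2 := hadj.symm.level_le_of_edge hd hfS' hfS (hedge S' S hS' hxS' hxS hadj.symm)
    exact hpS' (le_antisymm l1 l2 |>.trans hpS)
  -- hence all prisms around `x` that are active at `τ` have the same time interval
  have hsame : ∀ A ∈ P, τ ∈ A.1.carrier → x ∈ A.2.carrier → A.1 = Q.1 := by
    have hl : ∀ A ∈ P, τ ∈ A.1.carrier → x ∈ A.2.carrier → A.level = R.level + 1 := by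
      intro A hA hτA hxA
      obtain ⟨B, hB, hτB, hxB, hcB⟩ := hP.complete τ' hsd.mem' A.2 (hf A hA) x hxA
      rw [(hcross A hA B hB hτA hxA hτB hxB hcB).2, hlevel B hB hτB hxB]
    intro A hA hτA hxA
    refine (hP.time A hA).eq_of_mem ?_ hτA hτ
    rw [hl A hA hτA hxA, ← hl Q hQ hτ hxc]
    exact hQt
  -- the prism with the temporal node `t` contradicts this
  have hmeet : (Q.1.carrier ∩ Q'.1.carrier).Nonempty := by
    by_contra hcon
    obtain ⟨-, ⟨h, -⟩ | ⟨h, -⟩⟩ := hQt.inter_eq_singleton (hP.time Q' hQ') hcon ht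
      (TimeInterval.nodes_subset_Icc (hP.time Q' hQ').lt hr₁ htQ')
    · exact hlo.ne' h
    · exact hhi.ne h
  obtain ⟨A, hA, hτA, hxA, hcA⟩ := hP.complete τ hsd.mem Q'.2 (hf Q' hQ') x hxQ'
  obtain ⟨u, hu, hu'⟩ := hmeet
  have hAQ := hsame A hA hτA hxA
  have := hP.eq_of_active hd hQ' hA hu' (hAQ ▸ hu) hcA
  subst this
  exact htn (hAQ ▸ htQ')

end SpaceTimeMesh
namespace SpaceTimeMesh

/-! ### Supports of nodal basis functions -/

variable {d : ℕ}

open TaggedSimplex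

variable {M : InitialMesh d} {s₁ s₂ : ℝ} {P : Finset (Prism d)}

theorem mem_neighbourhood_self {Q : Prism d} (hQ : Q ∈ P) (hne : Q.carrier.Nonempty) :
    Q ∈ neighbourhood P Q :=
  ⟨hQ, by rw [inter_self]; exact hne.mono subset_closure⟩

theorem MeshInv.carrier_nonempty (hP : MeshInv M s₁ s₂ P) {Q : Prism d} (hQ : Q ∈ P) :
    Q.carrier.Nonempty := by
  obtain ⟨x, hx⟩ := Q.2.carrier_nonempty
  obtain ⟨t, ht⟩ := exists_between (hP.time Q hQ).lt
  exact ⟨(t, x), Q.1.Ioo_subset_carrier ht, hx⟩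

theorem MeshInv.extendedNeighbourhood_mono (hP : MeshInv M s₁ s₂ P) {Q : Prism d} {j : ℕ}
    {Q' : Prism d} (hQ' : Q' ∈ P) (h : Q' ∈ extendedNeighbourhood P Q j) {k : ℕ} (hk : j ≤ k) :
    Q' ∈ extendedNeighbourhood P Q k := by
  induction hk with
  | refl => exact h
  | step _ ih => exact ⟨Q', ih, mem_neighbourhood_self hQ' (hP.carrier_nonempty hQ')⟩

theorem mem_hangingNodes_or {r₁ r₂ : ℕ} {z : ℝ × Space d} (hz : z ∈ allNodes P r₁ r₂) :
    z ∈ freeNodes P r₁ r₂ ∨ ∃ Q ∈ P, z ∈ closure Q.carrier ∧ z ∉ Q.nodes r₁ r₂ := by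
  by_cases h : z ∈ hangingNodes P r₁ r₂
  · exact Or.inr h.2
  · exact Or.inl ⟨hz, h⟩

theorem IsNodalBasisFunction.eq_of_free {ΩT : Set (ℝ × Space d)} {r₁ r₂ : ℕ} {ν : ℝ × Space d}
    {φ : ℝ × Space d → ℝ} (hφ : IsNodalBasisFunction ΩT P r₁ r₂ ν φ) {z : ℝ × Space d}
    (hz : z ∈ freeNodes P r₁ r₂) (hne : φ z ≠ 0) : z = ν := by
  by_contra hc
  exact hne (by rw [hφ.nodal z hz, if_neg hc])

section Support

variable {r₁ r₂ : ℕ} {ν : ℝ × Space d} {φ : ℝ × Space d → ℝ}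

theorem MeshInv.poly_closure (hd : 1 ≤ d) (hP : MeshInv M s₁ s₂ P)
    (hφ : IsNodalBasisFunction M.cylinder P r₁ r₂ ν φ) {Q : Prism d} (hQ : Q ∈ P) :
    IsAnisoPolyOn r₁ r₂ (closure Q.carrier) φ :=
  (hφ.isFiniteElement.poly Q hQ).closure
    (hφ.isFiniteElement.continuousOn.mono (hP.closure_subset_cylinder hd hQ))

/-- A node in time and space at which `φ` does not vanish, and which hangs only in time, lies in the
closure of a prism that contains `ν`. -/
theorem MeshInv.exists_prism_of_hanging_in_time (hd : 1 ≤ d) (hs₁ : 0 < s₁) (hs₂ : 0 < s₂)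
    (hP : MeshInv M s₁ s₂ P) (hc : ConformingInSpace P) (h1 : OneIrregularInTime P)
    (hr₁ : 2 ≤ r₁) (hr : 2 ≤ r₂) (hφ : IsNodalBasisFunction M.cylinder P r₁ r₂ ν φ)
    {t : ℝ} {x : Space d} {Q' : Prism d} (hQ' : Q' ∈ P) (htQ' : t ∈ Q'.1.nodes r₁)
    (hxQ' : x ∈ Q'.2.carrier)
    (hx : ∀ R ∈ P, t ∈ Icc R.1.lo R.1.hi → x ∈ R.2.carrier → x ∈ R.2.nodes r₂)
    (hne : φ (t, x) ≠ 0) {R : Prism d} (hR : R ∈ P) (htR : t ∈ Icc R.1.lo R.1.hi)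
    (hxR : x ∈ R.2.carrier) (htn : t ∉ R.1.nodes r₁) :
    ∃ Q ∈ P, ν ∈ closure Q.carrier ∧ t ∈ Icc Q.1.lo Q.1.hi ∧ x ∈ Q.2.carrier := by
  classical
  obtain ⟨Q, hQ, hmin⟩ := Finset.exists_min_image
    (P.filter fun Q => t ∈ Icc Q.1.lo Q.1.hi ∧ x ∈ Q.2.carrier) (fun Q => Q.level)
    ⟨R, Finset.mem_filter.2 ⟨hR, htR, hxR⟩⟩
  rw [Finset.mem_filter] at hQ
  obtain ⟨hQ, htQ, hxQ⟩ := hQ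
  have hmin' : ∀ B ∈ P, t ∈ Icc B.1.lo B.1.hi → x ∈ B.2.carrier → Q.level ≤ B.level :=
    fun B hB h1 h2 => hmin B (Finset.mem_filter.2 ⟨hB, h1, h2⟩)
  have hlo : R.1.lo < t := lt_of_le_of_ne htR.1 fun h => htn (h ▸ R.1.lo_mem_nodes r₁)
  have hhi : t < R.1.hi := lt_of_le_of_ne htR.2 fun h => htn (h ▸ R.1.hi_mem_nodes hr₁)
  have htn' : t ∉ Q.1.nodes r₁ := by
    intro hn
    have hmeet : (Q.1.carrier ∩ R.1.carrier).Nonempty := by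
      by_contra hcon
      obtain ⟨-, ⟨-, h⟩ | ⟨-, h⟩⟩ := (hP.time Q hQ).inter_eq_singleton (hP.time R hR) hcon htQ htR
      · exact hhi.ne h
      · exact hlo.ne' h
    obtain ⟨u, hu, hu'⟩ := hmeet
    have := (hP.time Q hQ).desc_of_mem (hP.time R hR)
      (timeDepth_mono hs₁ hs₂ (hmin' R hR htR hxR)) hu hu'
    exact htn (((hP.time Q hQ).desc_props this).2.2.2.2 r₁ hr₁ t hn htR)
  obtain ⟨s, hs, hsne⟩ := (hP.poly_closure hd hφ hQ).exists_time_node hr₁ (hP.time Q hQ).lt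
    (x := x) (fun u hu => by rw [hP.closure_carrier hQ]; exact ⟨hu, hxQ⟩) htQ hne
  have hsI := TimeInterval.nodes_subset_Icc (hP.time Q hQ).lt hr₁ hs
  refine ⟨Q, hQ, ?_, htQ, hxQ⟩
  have hfree : (s, x) ∈ freeNodes P r₁ r₂ := by
    refine (mem_hangingNodes_or (mem_biUnion hQ ⟨hs, hx Q hQ htQ hxQ⟩)).resolve_right ?_
    rintro ⟨B, hB, hcl, hnB⟩
    rw [hP.closure_carrier hB] at hcl
    exact hnB (hP.nodes_of_hanging_in_time hd hs₁ hs₂ hc h1 hr₁ hr hQ hQ' htQ (hx Q hQ htQ hxQ)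
      htn' htQ' hxQ' hmin' hs hB hcl.1 hcl.2)
  rw [← hφ.eq_of_free hfree hsne, hP.closure_carrier hQ]
  exact ⟨hsI, hxQ⟩

/-- A prism on which the nodal basis function of `ν` does not vanish belongs to the extended
neighbourhood of each prism with the node `ν`. -/
theorem MeshInv.mem_extendedNeighbourhood (hd : 1 ≤ d) (hs₁ : 0 < s₁) (hs₂ : 0 < s₂)
    (hP : MeshInv M s₁ s₂ P) (hc : ConformingInSpace P) (h1 : OneIrregularInTime P)
    (hone : d = 1 → OneIrregularInSpace P)
    (hr₁ : 2 ≤ r₁) (hr : 2 ≤ r₂) (hφ : IsNodalBasisFunction M.cylinder P r₁ r₂ ν φ)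
    {Q : Prism d} (hQ : Q ∈ P) (hν : ν ∈ Q.nodes r₁ r₂) {Q' : Prism d} (hQ' : Q' ∈ P)
    {z : ℝ × Space d} (hz : z ∈ Q'.carrier) (hne : φ z ≠ 0) :
    Q' ∈ extendedNeighbourhood P Q (supportDegree d) := by
  have hlt : ∀ B ∈ P, B.1.lo < B.1.hi := fun B hB => (hP.time B hB).lt
  have hnd : ∀ B ∈ P, B.2.Nondeg := fun B hB => (hP.space B hB).nondeg hd
  have hcl := fun B hB => hP.closure_carrier (Q := B) hB
  have hnode_sub : ∀ B ∈ P, B.nodes r₁ r₂ ⊆ closure B.carrier := fun B hB => by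
    rw [hcl B hB]
    exact prod_mono (TimeInterval.nodes_subset_Icc (hlt B hB) hr₁)
      (nodes_subset_carrier (hnd B hB) hr)
  have hνQ := hnode_sub Q hQ hν
  have hdeg : 2 ≤ supportDegree d := by unfold supportDegree; split_ifs <;> omega
  -- prisms that contain `ν` are neighbours of `Q`
  have hext1 : ∀ B ∈ P, ν ∈ closure B.carrier → B ∈ extendedNeighbourhood P Q 1 := fun B hB hB' =>
    ⟨Q, rfl, hB, ν, hνQ, hB'⟩
  have hstep : ∀ j, ∀ B ∈ P, ∀ B' ∈ P, B ∈ extendedNeighbourhood P Q j → ∀ t x,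
      t ∈ Icc B.1.lo B.1.hi → x ∈ B.2.carrier → t ∈ Icc B'.1.lo B'.1.hi → x ∈ B'.2.carrier →
      B' ∈ extendedNeighbourhood P Q (j + 1) := fun j B hB B' hB' h t x a1 a2 a3 a4 =>
    ⟨B, h, hP.mem_neighbourhood hB hB' a1 a2 a3 a4⟩
  -- a node of `Q'` where `φ` does not vanish
  obtain ⟨t₀, x₀⟩ := z
  obtain ⟨ht₀, hx₀⟩ : (t₀, x₀) ∈ Icc Q'.1.lo Q'.1.hi ×ˢ Q'.2.carrier := by
    rw [← hcl Q' hQ']; exact subset_closure hz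
  obtain ⟨x, hx, hne⟩ := (hP.poly_closure hd hφ hQ').exists_space_node hr (hnd Q' hQ')
    (t := t₀) (fun x hx => by rw [hcl Q' hQ']; exact ⟨ht₀, hx⟩) hx₀ hne
  have hxQ' := nodes_subset_carrier (hnd Q' hQ') hr hx
  obtain ⟨t, ht, hne⟩ := (hP.poly_closure hd hφ hQ').exists_time_node hr₁ (hlt Q' hQ')
    (x := x) (fun t ht => by rw [hcl Q' hQ']; exact ⟨ht, hxQ'⟩) ht₀ hne
  have htQ' := TimeInterval.nodes_subset_Icc (hlt Q' hQ') hr₁ ht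
  by_cases hX : ∀ R ∈ P, t ∈ Icc R.1.lo R.1.hi → x ∈ R.2.carrier → x ∈ R.2.nodes r₂
  · rcases mem_hangingNodes_or (P := P) (z := (t, x))
        (mem_biUnion hQ' ⟨ht, hx⟩) with hfree | ⟨R, hR, hclR, hnR⟩
    · refine hP.extendedNeighbourhood_mono hQ' (hext1 Q' hQ' ?_) (by omega)
      rw [← hφ.eq_of_free hfree hne]
      exact hnode_sub Q' hQ' ⟨ht, hx⟩
    · rw [hcl R hR] at hclR
      obtain ⟨B, hB, hνB, htB, hxB⟩ := hP.exists_prism_of_hanging_in_time hd hs₁ hs₂ hc h1 hr₁ hr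
        hφ hQ' ht hxQ' hX hne hR hclR.1 hclR.2 fun h => hnR ⟨h, hX R hR hclR.1 hclR.2⟩
      exact hP.extendedNeighbourhood_mono hQ'
        (hstep 1 B hB Q' hQ' (hext1 B hB hνB) t x htB hxB htQ' hxQ') hdeg
  · push Not at hX
    obtain ⟨B, hB, htB, hxB, hnB⟩ := hX
    obtain ⟨y, hy, hney⟩ := (hP.poly_closure hd hφ hB).exists_space_node hr (hnd B hB)
      (t := t) (fun x hx => by rw [hcl B hB]; exact ⟨htB, hx⟩) hxB hne
    have hyB := nodes_subset_carrier (hnd B hB) hr hy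
    have key := fun R hR htR hyR => hP.nodes_of_hanging_in_space (r₁ := r₁) hd hs₁ hs₂ hc hone hr₁
      hr hB hQ' htB hxB hnB htQ' hx hy (R := R) hR htR hyR
    -- `t` is a node in time for some prism that touches `(t, y)`
    by_cases hT : ∃ R ∈ P, t ∈ Icc R.1.lo R.1.hi ∧ y ∈ R.2.carrier ∧ t ∉ R.1.nodes r₁
    · obtain ⟨R, hR, htR, hyR, hnR⟩ := hT
      have hd1 : d ≠ 1 := fun h => hnR ((key R hR htR hyR).2.2 h)
      have htnB : t ∈ B.1.nodes r₁ := (key R hR htR hyR).2.1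
      obtain ⟨A, hA, hνA, htA, hyA⟩ := hP.exists_prism_of_hanging_in_time hd hs₁ hs₂ hc h1 hr₁ hr
        hφ hB htnB hyB (fun R hR htR hyR => (key R hR htR hyR).1) hney hR htR hyR hnR
      have e2 := hstep 1 A hA B hB (hext1 A hA hνA) t y htA hyA htB hyB
      have e3 := hstep 2 B hB Q' hQ' e2 t x htB hxB htQ' hxQ'
      rwa [supportDegree, if_neg hd1]
    · push Not at hT
      have hfree : (t, y) ∈ freeNodes P r₁ r₂ := by
        refine (mem_hangingNodes_or (P := P) (z := (t, y))
          (mem_biUnion hB ⟨hT B hB htB hyB, hy⟩)).resolve_right ?_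
        rintro ⟨R, hR, hclR, hnR⟩
        rw [hcl R hR] at hclR
        exact hnR ⟨hT R hR hclR.1 hclR.2, (key R hR hclR.1 hclR.2).1⟩
      have hνB : ν ∈ closure B.carrier := by
        rw [← hφ.eq_of_free hfree hney, hcl B hB]
        exact ⟨htB, hyB⟩
      exact hP.extendedNeighbourhood_mono hQ'
        (hstep 1 B hB Q' hQ' (hext1 B hB hνB) t x htB hxB htQ' hxQ') hdeg

theorem MeshInv.support_subset (hd : 1 ≤ d) (hs₁ : 0 < s₁) (hs₂ : 0 < s₂)
    (hP : MeshInv M s₁ s₂ P) (hc : ConformingInSpace P) (h1 : OneIrregularInTime P)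
    (hone : d = 1 → OneIrregularInSpace P)
    (hr₁ : 2 ≤ r₁) (hr : 2 ≤ r₂) (hφ : IsNodalBasisFunction M.cylinder P r₁ r₂ ν φ)
    {Q : Prism d} (hQ : Q ∈ P) (hν : ν ∈ Q.nodes r₁ r₂) :
    Function.support φ ⊆ ⋃ Q' ∈ extendedNeighbourhood P Q (supportDegree d), Q'.carrier := by
  intro z hz
  have hzc : z ∈ M.cylinder := by
    by_contra hcon
    exact hz (hφ.isFiniteElement.zero_off z hcon)
  have h2 := hzc.2
  rw [← M.cover] at h2
  simp only [mem_iUnion] at h2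
  obtain ⟨S, hS, hxS⟩ := h2
  obtain ⟨Q', hQ', ht, hx, -⟩ := hP.complete z.1 hzc.1 S (.base hS) z.2 hxS
  exact mem_biUnion (hP.mem_extendedNeighbourhood hd hs₁ hs₂ hc h1 hone hr₁ hr hφ hQ hν hQ'
    ⟨ht, hx⟩ hz) ⟨ht, hx⟩

theorem extendedNeighbourhood_subset {Q : Prism d} (hQ : Q ∈ P) (j : ℕ) :
    extendedNeighbourhood P Q j ⊆ (P : Set (Prism d)) := by
  cases j with
  | zero =>
    intro Q' h
    rw [show Q' = Q from h]
    exact hQ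
  | succ j =>
    rintro Q' ⟨Q'', -, h⟩
    exact h.1

theorem tsupport_subset_of_support_subset {Q : Prism d} (hQ : Q ∈ P) {j : ℕ}
    (h : Function.support φ ⊆ ⋃ Q' ∈ extendedNeighbourhood P Q j, Q'.carrier) :
    tsupport φ ⊆ ⋃ Q' ∈ extendedNeighbourhood P Q j, closure Q'.carrier := by
  refine closure_minimal (h.trans (biUnion_mono Subset.rfl fun _ _ => subset_closure)) ?_
  exact (P.finite_toSet.subset (extendedNeighbourhood_subset hQ j)).isClosed_biUnion
    fun _ _ => isClosed_closure

end Support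

end SpaceTimeMesh
namespace SpaceTimeMesh

/-! ### Necessary refinements of neighbours -/

variable {d : ℕ}

open TaggedSimplex

variable {M : InitialMesh d} {s₁ s₂ : ℝ} {P P' : Finset (Prism d)}

/-- The meshes of `IsRegularRefinement`, with the invariants of the forest in place of the
reachability by atomic splits. -/
structure Regular (M : InitialMesh d) (s₁ s₂ : ℝ) (P : Finset (Prism d)) : Prop
    extends MeshInv M s₁ s₂ P where
  conforming : ConformingInSpace P
  irregTime : OneIrregularInTime P
  irregSpace : d = 1 → OneIrregularInSpace P

/-- The refinement of `Q` requires the one of its neighbour `R` in time. -/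
def TimeNbr (Q R : Prism d) : Prop :=
  R ≠ Q ∧ (closure Q.1.carrier ∩ closure R.1.carrier).ncard = 1 ∧
    affineDim (Q.2.carrier ∩ R.2.carrier) = d ∧ R.level + 1 = Q.level

/-- The refinement of `Q` requires the one of its neighbour `R` in space. -/
def SpaceNbr (Q R : Prism d) : Prop :=
  R ≠ Q ∧ 0 < volume (Q.1.carrier ∩ R.1.carrier) ∧
    if 2 ≤ d then
      affineDim (Q.2.carrier ∩ R.2.carrier) = d - 1 ∧ Q.2.refinementEdge ⊆ R.2.carrier
    else (Q.2.carrier ∩ R.2.carrier).ncard = 1 ∧ R.level + 1 = Q.level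

theorem mem_spaceNeighbours {Q R : Prism d} :
    R ∈ spaceNeighbours P Q ↔ R ∈ P ∧ SpaceNbr Q R := by
  classical
  rw [spaceNeighbours, Finset.mem_filter, SpaceNbr]

theorem mem_necessaryRefinements {Q R : Prism d} :
    R ∈ necessaryRefinements P Q ↔ R ∈ P ∧ (TimeNbr Q R ∨ SpaceNbr Q R) := by
  classical
  rw [necessaryRefinements, Finset.mem_union, mem_spaceNeighbours, timeNeighbours,
    Finset.mem_filter, TimeNbr, and_or_left]

theorem necessaryRefinements_of_mem {Q R : Prism d} (h : R ∈ necessaryRefinements P Q)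
    (hR : R ∈ P') : R ∈ necessaryRefinements P' Q :=
  mem_necessaryRefinements.2 ⟨hR, (mem_necessaryRefinements.1 h).2⟩

theorem Adjacent.affineDim_eq {S S' : TaggedSimplex d} (h : Adjacent S S') (hS : S.Nondeg) :
    affineDim (S.carrier ∩ S'.carrier) = d - 1 := by
  rw [h.inter_eq, affineDim_of_affineIndependent
    (affineIndependent_subset hS.verts Finset.inter_subset_left), h.card_eq]

theorem MeetInFace.adjacent_of_card {S S' : TaggedSimplex d} (h : MeetInFace S S')
    (hS : S.Nondeg) (hS' : S'.Nondeg) (hc : d ≤ (S.verts ∩ S'.verts).card) : Adjacent S S' :=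
  ⟨h, le_antisymm (h.card_le hS hS') hc⟩

namespace Regular

theorem nondeg (hd : 1 ≤ d) (hP : Regular M s₁ s₂ P) {Q : Prism d} (hQ : Q ∈ P) : Q.2.Nondeg :=
  (hP.space Q hQ).nondeg hd

theorem meet (hd : 1 ≤ d) (hP : Regular M s₁ s₂ P) {Q R : Prism d} (hQ : Q ∈ P) (hR : R ∈ P)
    (h : (Q.1.carrier ∩ R.1.carrier).Nonempty) (hne : Q ≠ R) : MeetInFace Q.2 R.2 := by
  obtain ⟨t, ht, ht'⟩ := h
  refine hP.toMeshInv.meetInFace hd hP.conforming hQ hR ht ht' fun h => hne ?_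
  exact hP.eq_of_active hd hQ hR ht ht' (h ▸ Or.inl Desc.refl)

theorem spaceNbr_iff (hd : 2 ≤ d) (hP : Regular M s₁ s₂ P) {Q R : Prism d} (hQ : Q ∈ P)
    (hR : R ∈ P) : SpaceNbr Q R ↔ R ≠ Q ∧ (Q.1.carrier ∩ R.1.carrier).Nonempty ∧
      Adjacent Q.2 R.2 ∧ Q.2.head ∈ Q.2.verts ∩ R.2.verts ∧ Q.2.tail ∈ Q.2.verts ∩ R.2.verts := by
  have hd1 : 1 ≤ d := by omega
  have hn := hP.nondeg hd1 hQ
  have hn' := hP.nondeg hd1 hR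
  rw [SpaceNbr, if_pos hd, (hP.time Q hQ).volume_inter_pos_iff (hP.time R hR)]
  refine and_congr_right fun hne => and_congr_right fun ht => ?_
  have hm := hP.meet hd1 hQ hR ht hne.symm
  rw [hm.edge_subset_iff hn]
  refine and_congr_left fun he => ⟨fun h => hm.adjacent hn hn' ⟨?_, by omega⟩,
    fun h => h.affineDim_eq hn⟩
  exact ⟨Q.2.head, verts_subset_carrier _ Q.2.head_mem,
    verts_subset_carrier _ (Finset.mem_inter.1 he.1).2⟩

theorem spaceNbr_one_iff (hd : d = 1) (hP : Regular M s₁ s₂ P) {Q R : Prism d} (hQ : Q ∈ P)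
    (hR : R ∈ P) : SpaceNbr Q R ↔ R ≠ Q ∧ (Q.1.carrier ∩ R.1.carrier).Nonempty ∧
      (Q.2.carrier ∩ R.2.carrier).Nonempty ∧ R.level + 1 = Q.level := by
  rw [SpaceNbr, if_neg (by omega), (hP.time Q hQ).volume_inter_pos_iff (hP.time R hR)]
  refine and_congr_right fun hne => and_congr_right fun ht => and_congr_left fun _ =>
    ⟨fun h => ?_, fun h => ?_⟩
  · obtain ⟨x, hx⟩ := ncard_eq_one.1 h
    exact ⟨x, hx ▸ rfl⟩
  · exact (hP.meet hd.ge hQ hR ht hne.symm).ncard_inter_eq_one (hP.nondeg hd.ge hQ)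
      (hP.nondeg hd.ge hR) hd h

/-- Necessary refinements of neighbours are of the same level or of the previous one. -/
theorem level_of_nbr (hd : 1 ≤ d) (hP : Regular M s₁ s₂ P) {Q R : Prism d} (hQ : Q ∈ P)
    (hR : R ∈ necessaryRefinements P Q) : R.level = Q.level ∨ R.level + 1 = Q.level := by
  obtain ⟨hR, h | h⟩ := mem_necessaryRefinements.1 hR
  · exact Or.inr h.2.2.2
  · by_cases hd2 : 2 ≤ d
    · obtain ⟨-, -, hadj, he⟩ := (hP.spaceNbr_iff hd2 hQ hR).1 h
      have h1 := hadj.level_le_of_edge hd (hP.space Q hQ) (hP.space R hR) he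
      have h2 := hadj.symm.level_le_succ hd2 (hP.space R hR) (hP.space Q hQ)
      simp only [Prism.level]
      omega
    · exact Or.inr ((hP.spaceNbr_one_iff (by omega) hQ hR).1 h).2.2.2

/-- Necessary refinements of neighbours of the same level share the time interval and the
refinement edge. -/
theorem nbr_same_level (hd : 1 ≤ d) (hP : Regular M s₁ s₂ P) {Q R : Prism d} (hQ : Q ∈ P)
    (hR : R ∈ necessaryRefinements P Q) (hl : R.level = Q.level) :
    2 ≤ d ∧ SpaceNbr Q R ∧ R.1 = Q.1 ∧ SameEdge Q.2 R.2 := by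
  obtain ⟨hR, h | h⟩ := mem_necessaryRefinements.1 hR
  · have := h.2.2.2; omega
  · by_cases hd2 : 2 ≤ d
    · obtain ⟨-, ⟨t, ht, ht'⟩, hadj, he⟩ := (hP.spaceNbr_iff hd2 hQ hR).1 h
      exact ⟨hd2, h, (hP.time R hR).eq_of_mem (hl ▸ hP.time Q hQ) ht' ht,
        (hP.space Q hQ).sameEdge hd (hP.space R hR) hl.symm hadj he⟩
    · have := ((hP.spaceNbr_one_iff (by omega) hQ hR).1 h).2.2.2
      omega

/-- If a refinement produces a new necessary refinement `R` of a neighbour of `Q`, then `R` is of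
the level of `Q`, and it arises from a spatial neighbour of `Q` of the previous level. -/
theorem nbr_of_refined (hd : 1 ≤ d) (hP : Regular M s₁ s₂ P) (hP' : Regular M s₁ s₂ P')
    {Q R A : Prism d} (hQ : Q ∈ P) (hQ' : Q ∈ P') (hA : A ∈ P)
    (hR : R ∈ necessaryRefinements P' Q) (hAR : Desc A.2 R.2) (hAR' : TimeDesc A.1 R.1)
    (hl : A.level < R.level) :
    2 ≤ d ∧ R.level = Q.level ∧ A.level + 1 = Q.level ∧ SpaceNbr Q A := by
  have hlev := hP'.level_of_nbr hd hQ' hR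
  obtain ⟨hRP, h⟩ := mem_necessaryRefinements.1 hR
  have hprop := (hP.time A hA).desc_props hAR'
  have hsub := (hP.space A hA).desc_carrier hd hAR
  have hne : A ≠ Q := by rintro rfl; omega
  rcases h with h | h
  · -- a neighbour in time is one level below `Q`, so that `A` would be two levels below
    exfalso
    obtain ⟨-, h1, h2, h3⟩ := h
    obtain ⟨t, ht⟩ := ncard_eq_one.1 h1
    have htm : t ∈ closure Q.1.carrier ∩ closure R.1.carrier := ht ▸ rfl
    rw [(hP.time Q hQ).closure_eq, (hP'.time R hRP).closure_eq] at htm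
    have hov : affineDim (Q.2.carrier ∩ A.2.carrier) = d := le_antisymm (affineDim_le _)
      (h2.symm.le.trans (affineDim_mono (inter_subset_inter Subset.rfl hsub)))
    have := hP.level_le_of_touch hd hP.irregTime hQ hA htm.1
      (Icc_subset_Icc hprop.2.1 hprop.2.2.1 htm.2)
      ((hP.space Q hQ).comparable_of_overlap hd (hP.space A hA) hov)
    omega
  · by_cases hd2 : 2 ≤ d
    · obtain ⟨-, ⟨t, ht, ht'⟩, hadj, he⟩ := (hP'.spaceNbr_iff hd2 hQ' hRP).1 h
      have htA : (Q.1.carrier ∩ A.1.carrier).Nonempty := ⟨t, ht, hprop.1 ht'⟩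
      have hm := hP.meet hd hQ hA htA hne.symm
      have hadj' := hm.adjacent (hP.nondeg hd hQ) (hP.nondeg hd hA)
        ((hadj.hyperDim hd (hP.nondeg hd hQ)).mono (inter_subset_inter Subset.rfl hsub))
      have h2 := hadj'.symm.level_le_succ hd2 (hP.space A hA) (hP.space Q hQ)
      have h3 : Q.level ≤ A.level + 1 := h2
      refine ⟨hd2, by omega, by omega, (hP.spaceNbr_iff hd2 hQ hA).2 ⟨hne, htA, hadj', ?_⟩⟩
      have hn := hP.nondeg hd hQ
      exact ⟨hm.mem_inter hn Q.2.head_mem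
          (hsub (verts_subset_carrier _ (Finset.mem_inter.1 he.1).2)),
        hm.mem_inter hn Q.2.tail_mem (hsub (verts_subset_carrier _ (Finset.mem_inter.1 he.2).2))⟩
    · -- in one dimension a neighbour in space is one level below `Q` as well
      exfalso
      have hd1 : d = 1 := by omega
      obtain ⟨-, ⟨t, ht, ht'⟩, ⟨x, hx, hx'⟩, hl'⟩ := (hP'.spaceNbr_one_iff hd1 hQ' hRP).1 h
      have htA : (Q.1.carrier ∩ A.1.carrier).Nonempty := ⟨t, ht, hprop.1 ht'⟩
      have h1 := (hP.meet hd hQ hA htA hne.symm).ncard_inter_eq_one (hP.nondeg hd hQ)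
        (hP.nondeg hd hA) hd1 ⟨x, hx, hsub hx'⟩
      have := hP.irregSpace hd1 Q hQ A hA
        (((hP.time Q hQ).volume_inter_pos_iff (hP.time A hA)).2 htA) h1
      omega

end Regular

theorem exists_bisectIter_of_mem_Icc (m : ℕ) {I : TimeInterval} {t : ℝ} (ht : t ∈ Icc I.lo I.hi) :
    ∃ J ∈ TimeInterval.bisectIter m I, t ∈ Icc J.lo J.hi := by
  induction m with
  | zero => exact ⟨I, by simp [TimeInterval.bisectIter], ht⟩
  | succ m ih =>
    obtain ⟨J, h1, h2⟩ := ih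
    have : ∃ J' ∈ J.bisect, t ∈ Icc J'.lo J'.hi := by
      rcases le_total t ((J.lo + J.hi) / 2) with h | h
      · exact ⟨_, TimeInterval.mem_bisect.2 (Or.inl rfl), h2.1, h⟩
      · exact ⟨_, TimeInterval.mem_bisect.2 (Or.inr rfl), h, h2.2⟩
    obtain ⟨J', h3, h4⟩ := this
    exact ⟨J', by simp only [TimeInterval.bisectIter, Finset.mem_biUnion]; exact ⟨J, h1, h3⟩, h4⟩

/-- The elements of a mesh into which a prism has been split. -/
structure IsRefined (M : InitialMesh d) (s₁ s₂ : ℝ) (P : Finset (Prism d)) (Q : Prism d) : Prop where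
  space : InForest M Q.2
  time : InTimeForest M (timeDepth d s₁ s₂ Q.level) Q.1
  split : Q.atomicSplit s₁ s₂ ⊆ P

/-- A prism that has already been split does not require further refinements: its parts belong to the
regular mesh, so that a neighbour which contains its whole refinement edge would violate conformity,
and the level of any other necessary refinement would differ by two from that of a part. -/
theorem IsRefined.necessaryRefinements_eq_empty (hd : 1 ≤ d) {Q : Prism d}
    (hQ : IsRefined M s₁ s₂ P Q) (hP : Regular M s₁ s₂ P) : necessaryRefinements P Q = ∅ := by
  rw [Finset.eq_empty_iff_forall_notMem]
  intro R hR
  obtain ⟨hR, h | h⟩ := mem_necessaryRefinements.1 hR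
  · -- a part of `Q` would be two levels above the neighbour in time
    obtain ⟨-, h1, h2, h3⟩ := h
    obtain ⟨t, ht⟩ := ncard_eq_one.1 h1
    have htm : t ∈ closure Q.1.carrier ∩ closure R.1.carrier := ht ▸ rfl
    rw [hQ.time.closure_eq, (hP.time R hR).closure_eq] at htm
    have hRQ : Desc R.2 Q.2 := (hP.space R hR).desc_of_overlap hd hQ.space
      (by simp only [Prism.level] at h3; omega) (by rwa [inter_comm])
    obtain ⟨J, hJ, htJ⟩ := exists_bisectIter_of_mem_Icc
      (timeDepth d s₁ s₂ (Q.level + 1) - timeDepth d s₁ s₂ Q.level) htm.1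
    have hB : (J, Q.2.leftChild) ∈ Q.atomicSplit s₁ s₂ := mem_atomicSplit.2 ⟨hJ, Or.inl rfl⟩
    have h4 := hP.level_le_of_touch hd hP.irregTime (hQ.split hB) hR htJ htm.2
      (Or.inr (hRQ.child (Or.inl rfl)))
    rw [level_of_mem_atomicSplit hB] at h4
    omega
  · obtain ⟨hne, h1, h2⟩ := h
    rw [hQ.time.volume_inter_pos_iff (hP.time R hR)] at h1
    obtain ⟨t, ht, ht'⟩ := h1
    have hn := hQ.space.nondeg hd
    by_cases hd2 : 2 ≤ d
    · rw [if_pos hd2] at h2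
      -- the vertices of the children in `R` are vertices of `R`, so that the end points of the
      -- refinement edge and its midpoint would all be vertices of `R`
      have key : ∀ c e e', Q.2.IsChild c → IsHalf Q.2 c e e' → ∀ v ∈ c.verts,
          v ∈ R.2.carrier → v ∈ R.2.verts := by
        intro c e e' hc he v hv hvR
        obtain ⟨B, hB, htB, hBc⟩ := exists_split_of_mem (s₁ := s₁) (s₂ := s₂) ht hc
        have hBR : B ≠ R := by
          rintro rfl
          have : e' ∈ Q.2.refinementEdge := by
            rcases he.ends with ⟨-, rfl⟩ | ⟨-, rfl⟩
            · exact right_mem_segment ℝ _ _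
            · exact left_mem_segment ℝ _ _
          exact he.notMem_carrier hn (hBc ▸ h2.2 this)
        have hm := hP.meet hd (hQ.split hB) hR ⟨t, htB, ht'⟩ hBR
        rw [← hBc] at hv
        exact (Finset.mem_inter.1 (hm.mem_inter (hP.nondeg hd (hQ.split hB)) hv hvR)).2
      have hl := isHalf_left hn hd
      have hr := isHalf_right hn hd (hQ.space.type_lt hd)
      have e1 := key _ _ _ (Or.inl rfl) hl Q.2.head (by
        rw [hl.verts_eq, mem_halfVerts]; exact Or.inr ⟨hl.ne, Q.2.head_mem⟩)
        (h2.2 (left_mem_segment ℝ _ _))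
      have e2 := key _ _ _ (Or.inr rfl) hr Q.2.tail (by
        rw [hr.verts_eq, mem_halfVerts]; exact Or.inr ⟨hr.ne, Q.2.tail_mem⟩)
        (h2.2 (right_mem_segment ℝ _ _))
      have e3 := key _ _ _ (Or.inl rfl) hl Q.2.mid hl.mid_mem
        (h2.2 (midpoint_mem_segment _ _))
      exact midpoint_notMem (hP.nondeg hd hR).verts e1 e2 hl.ne e3
    · -- in one dimension, the part of `Q` at the common point would be two levels above `R`
      have hd1 : d = 1 := by omega
      rw [if_neg hd2] at h2
      obtain ⟨x, hx⟩ := ncard_eq_one.1 h2.1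
      have hxm : x ∈ Q.2.carrier ∩ R.2.carrier := hx ▸ rfl
      obtain ⟨c, hc, hxc⟩ := exists_child_of_mem hn hd (hQ.space.type_lt hd) hxm.1
      obtain ⟨B, hB, htB, hBc⟩ := exists_split_of_mem (s₁ := s₁) (s₂ := s₂) ht hc
      have hl := level_of_mem_atomicSplit hB
      have h3 := h2.2
      have hBR : B ≠ R := by rintro rfl; omega
      have hBP := hQ.split hB
      have h4 := (hP.meet hd hBP hR ⟨t, htB, ht'⟩ hBR).ncard_inter_eq_one (hP.nondeg hd hBP)
        (hP.nondeg hd hR) hd1 ⟨x, hBc ▸ hxc, hxm.2⟩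
      have := hP.irregSpace hd1 B hBP R hR
        (((hP.time B hBP).volume_inter_pos_iff (hP.time R hR)).2 ⟨t, htB, ht'⟩) h4
      omega

/-- A coarser neighbour of `S'` has a child whose vertices are those of the common hyperface and
the midpoint of the refinement edge. Every other simplex that arises by bisection of the
refinement edge and shares a hyperface with `S'` has the same vertices. -/
theorem Adjacent.child_of_coarser (hd : 1 ≤ d) {S S' : TaggedSimplex d} (hS : InForest M S)
    (hS' : InForest M S') (h : Adjacent S S') (hl : S.level + 1 = S'.level) :
    (∃ c, S.IsChild c ∧ ∀ v, v ∈ c.verts ↔ v = S.mid ∨ v ∈ S.verts ∩ S'.verts) ∧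
    ∀ c, S.IsChild c → Adjacent c S' → ∀ v, v ∈ c.verts ↔ v = S.mid ∨ v ∈ S.verts ∩ S'.verts := by
  have hn := hS.nondeg hd
  obtain ⟨A, a, f, f', hA, hAl, hadj, hh, -, -, hW, hf', -⟩ := h.finer hd hS hS' (by omega)
  have hedge : ¬ (S.head ∈ S.verts ∩ S'.verts ∧ S.tail ∈ S.verts ∩ S'.verts) := by
    intro he
    rw [← hW] at he hf'
    have hse := hS.sameEdge hd hA hAl.symm hadj he
    rcases hh.ends with ⟨-, h2⟩ | ⟨-, h2⟩ <;> rcases hse with ⟨h3, h4⟩ | ⟨h3, h4⟩ <;>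
      simp_all
  have key : ∀ c e e', IsHalf S c e e' → e' ∉ S.verts ∩ S'.verts →
      e ∈ S.verts ∩ S'.verts ∧ ∀ v, v ∈ c.verts ↔ v = S.mid ∨ v ∈ S.verts ∩ S'.verts := by
    intro c e e' he hne
    have hW' : S.verts ∩ S'.verts = S.verts.erase e' := Finset.eq_of_subset_of_card_le
      (fun v hv => Finset.mem_erase.2 ⟨fun h => hne (h ▸ hv), (Finset.mem_inter.1 hv).1⟩)
      (by rw [Finset.card_erase_of_mem he.mem', hn.card, h.card_eq]; omega)
    refine ⟨by rw [hW']; exact Finset.mem_erase.2 ⟨he.ne, he.mem⟩, fun v => ?_⟩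
    rw [he.verts_eq, mem_halfVerts, he.mid_eq, hW', Finset.mem_erase]
  have hl' := isHalf_left hn hd
  have hr' := isHalf_right hn hd (hS.type_lt hd)
  refine ⟨?_, fun c hc hcadj => ?_⟩
  · by_cases ht : S.tail ∈ S.verts ∩ S'.verts
    · exact ⟨_, Or.inr rfl, (key _ _ _ hr' fun hh => hedge ⟨hh, ht⟩).2⟩
    · exact ⟨_, Or.inl rfl, (key _ _ _ hl' ht).2⟩
  · obtain ⟨e, e', he⟩ := hS.exists_isHalf hd hc
    refine (key c e e' he fun hmem => ?_).2
    -- the common hyperface of the child is that of `S`, which contains `e'`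
    have hcW : c.verts ∩ S'.verts = S.verts ∩ S'.verts := Finset.eq_of_subset_of_card_le
      (fun v hv => by
        rw [Finset.inter_comm]
        exact h.symm.toMeetInFace.mem_inter (hS'.nondeg hd) (Finset.mem_inter.1 hv).2
          (he.carrier_subset (verts_subset_carrier c (Finset.mem_inter.1 hv).1)))
      (by rw [h.card_eq, hcadj.card_eq])
    rw [← hcW] at hmem
    exact he.notMem hn (Finset.mem_inter.1 hmem).1

/-- Let two spatial neighbours `A`, `B` of `Q` of the previous level be split together. Then the
part of `B` that requires the refinement is the neighbour of a part of `A`. -/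
theorem Regular.exists_nbr_of_joint_split (hd : 2 ≤ d) (hs₁ : 0 < s₁) (hs₂ : 0 < s₂)
    (hP : Regular M s₁ s₂ P)
    (hP' : Regular M s₁ s₂ P') {Q A B R : Prism d} (hQ : Q ∈ P) (hQ' : Q ∈ P') (hA : A ∈ P)
    (hB : B ∈ P) (hQA : SpaceNbr Q A) (hQB : SpaceNbr Q B) (hlA : A.level + 1 = Q.level)
    (hAB : B.1 = A.1) (hse : SameEdge A.2 B.2)
    (hAs : A.atomicSplit s₁ s₂ ⊆ P') (hR : R ∈ B.atomicSplit s₁ s₂)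
    (hRn : R ∈ necessaryRefinements P' Q) (hl : R.level = Q.level) :
    ∃ R₁ ∈ A.atomicSplit s₁ s₂, R₁ ∈ necessaryRefinements P' Q ∧
      (R = R₁ ∨ R ∈ necessaryRefinements P' R₁) := by
  have hd1 : 1 ≤ d := by omega
  have hlB : B.level + 1 = Q.level := by rw [← hl, level_of_mem_atomicSplit hR]
  obtain ⟨hRP, -⟩ := mem_necessaryRefinements.1 hRn
  have hRx := (hP'.nbr_same_level hd1 hQ' hRn hl).2.1
  obtain ⟨hAne, -, hadjA, heA⟩ := (hP.spaceNbr_iff hd hQ hA).1 hQA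
  obtain ⟨-, -, hadjB, heB⟩ := (hP.spaceNbr_iff hd hQ hB).1 hQB
  obtain ⟨-, ⟨t, ht, htR⟩, hadjR, heR⟩ := (hP'.spaceNbr_iff hd hQ' hRP).1 hRx
  have hRB := (mem_atomicSplit.1 hR).2
  have htA : t ∈ A.1.carrier := by
    rw [← hAB]
    exact (split_props hd1 hs₁ hs₂ (hP.space B hB) (hP.time B hB) hR).2.2.2.1 htR
  obtain ⟨⟨c, hc, hcv⟩, -⟩ := hadjA.symm.child_of_coarser hd1 (hP.space A hA) (hP.space Q hQ) hlA
  have hRv := (hadjB.symm.child_of_coarser hd1 (hP.space B hB) (hP.space Q hQ) hlB).2 R.2 hRB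
    hadjR.symm
  rw [hse.mid_eq] at hRv
  obtain ⟨R₁, hR₁, htR₁, rfl⟩ := exists_split_of_mem (s₁ := s₁) (s₂ := s₂) htA hc
  have hR₁P := hAs hR₁
  have hl₁ : R₁.level = Q.level := by rw [level_of_mem_atomicSplit hR₁, hlA]
  have hnQ := hP.nondeg hd1 hQ
  have hn₁ := hP'.nondeg hd1 hR₁P
  have hnR := hP'.nondeg hd1 hRP
  have hR₁Q : R₁ ≠ Q := by
    rintro rfl
    have := hP.eq_of_active hd1 hA hQ htA ht (Or.inl (Desc.refl.child hc))
    subst this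
    omega
  have hmQ := hP'.meet hd1 hQ' hR₁P ⟨t, ht, htR₁⟩ hR₁Q.symm
  have hadj₁ : Adjacent Q.2 R₁.2 := hmQ.adjacent_of_card hnQ hn₁ (by
    refine hadjA.card_eq.ge.trans (Finset.card_le_card fun v hv =>
      Finset.mem_inter.2 ⟨(Finset.mem_inter.1 hv).1, ?_⟩)
    rw [hcv, Finset.inter_comm]
    exact Or.inr hv)
  have hA₁ : ∀ v ∈ Q.2.verts ∩ A.2.verts, v ∈ R₁.2.verts := fun v hv => by
    rw [hcv, Finset.inter_comm]; exact Or.inr hv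
  have hBR : ∀ v ∈ Q.2.verts ∩ B.2.verts, v ∈ R.2.verts := fun v hv => by
    rw [hRv, Finset.inter_comm]; exact Or.inr hv
  have he₁ : Q.2.head ∈ Q.2.verts ∩ R₁.2.verts ∧ Q.2.tail ∈ Q.2.verts ∩ R₁.2.verts :=
    ⟨Finset.mem_inter.2 ⟨Q.2.head_mem, hA₁ _ heA.1⟩, Finset.mem_inter.2 ⟨Q.2.tail_mem, hA₁ _ heA.2⟩⟩
  refine ⟨R₁, hR₁, mem_necessaryRefinements.2 ⟨hR₁P, Or.inr ((hP'.spaceNbr_iff hd hQ' hR₁P).2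
    ⟨hR₁Q, ⟨t, ht, htR₁⟩, hadj₁, he₁⟩)⟩, ?_⟩
  by_cases hRR : R = R₁
  · exact Or.inl hRR
  have hm := hP'.meet hd1 hR₁P hRP ⟨t, htR₁, htR⟩ (Ne.symm hRR)
  -- two hyperfaces of `Q` share `d - 1` vertices
  have hcard : d ≤ (R₁.2.verts ∩ R.2.verts).card := by
    classical
    have h1 : (Q.2.verts ∩ A.2.verts) ∪ (Q.2.verts ∩ B.2.verts) ⊆ Q.2.verts :=
      Finset.union_subset Finset.inter_subset_left Finset.inter_subset_left
    have h2 := Finset.card_le_card h1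
    have h3 := Finset.card_union_add_card_inter (Q.2.verts ∩ A.2.verts) (Q.2.verts ∩ B.2.verts)
    rw [hnQ.card] at h2
    rw [hadjA.card_eq, hadjB.card_eq] at h3
    have hmid : A.2.mid ∉ (Q.2.verts ∩ A.2.verts) ∩ (Q.2.verts ∩ B.2.verts) := fun h =>
      mid_notMem (hP.nondeg hd1 hA) hd1
        (Finset.mem_inter.1 (Finset.mem_inter.1 h).1).2
    have h4 : insert A.2.mid ((Q.2.verts ∩ A.2.verts) ∩ (Q.2.verts ∩ B.2.verts)) ⊆
        R₁.2.verts ∩ R.2.verts := by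
      intro v hv
      rw [Finset.mem_insert] at hv
      rcases hv with rfl | hv
      · exact Finset.mem_inter.2 ⟨(hcv _).2 (Or.inl rfl), (hRv _).2 (Or.inl rfl)⟩
      · exact Finset.mem_inter.2 ⟨hA₁ v (Finset.mem_inter.1 hv).1, hBR v (Finset.mem_inter.1 hv).2⟩
    have h5 := Finset.card_le_card h4
    rw [Finset.card_insert_of_notMem hmid] at h5
    omega
  have hadj := hm.adjacent_of_card hn₁ hnR hcard
  have hse₁ := (hP.space Q hQ).sameEdge hd1 (hP'.space R₁ hR₁P) hl₁.symm hadj₁ he₁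
  have hQm : ∀ v, v ∈ Q.2.verts ∩ A.2.verts → v ∈ Q.2.verts ∩ B.2.verts →
      v ∈ R₁.2.verts ∩ R.2.verts := fun v h1 h2 => Finset.mem_inter.2 ⟨hA₁ v h1, hBR v h2⟩
  refine Or.inr (mem_necessaryRefinements.2 ⟨hRP, Or.inr ((hP'.spaceNbr_iff hd hR₁P hRP).2
    ⟨hRR, ⟨t, htR₁, htR⟩, hadj, ?_⟩)⟩)
  rcases hse₁ with ⟨h1, h2⟩ | ⟨h1, h2⟩ <;> rw [h1, h2]
  · exact ⟨hQm _ heA.1 heB.1, hQm _ heA.2 heB.2⟩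
  · exact ⟨hQm _ heA.2 heB.2, hQm _ heA.1 heB.1⟩

end SpaceTimeMesh
namespace SpaceTimeMesh

/-! ### Refinement of a full star -/

variable {d : ℕ}

open TaggedSimplex

variable {M : InitialMesh d} {s₁ s₂ : ℝ} {P P' : Finset (Prism d)}

theorem TimeDesc.trans {I J J' : TimeInterval} (h : TimeDesc I J) (h' : TimeDesc J J') :
    TimeDesc I J' := by
  induction h' with
  | refl => exact h
  | child _ hc ih => exact ih.child hc

/-- `P'` arises from `P` by an atomic split of an element of level less than `n`. -/
def SplitStep (s₁ s₂ : ℝ) (n : ℕ) (P P' : Finset (Prism d)) : Prop :=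
  ∃ Q ∈ P, Q.level < n ∧ ∀ R, R ∈ P' ↔ (R ∈ P ∧ R ≠ Q) ∨ R ∈ Q.atomicSplit s₁ s₂

/-- `P'` arises from `P` by atomic splits of elements of levels less than `n`. -/
def SplitChain (s₁ s₂ : ℝ) (n : ℕ) : Finset (Prism d) → Finset (Prism d) → Prop :=
  Relation.ReflTransGen (SplitStep s₁ s₂ n)

namespace SplitChain

variable {n : ℕ}

theorem mono {k : ℕ} (h : SplitChain s₁ s₂ n P P') (hk : n ≤ k) : SplitChain s₁ s₂ k P P' :=
  Relation.ReflTransGen.mono (fun _ _ hs => by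
    obtain ⟨Q, h1, h2, h3⟩ := hs
    exact ⟨Q, h1, h2.trans_le hk, h3⟩) _ _ h

theorem meshInv (hd : 1 ≤ d) (hs₁ : 0 < s₁) (hs₂ : 0 < s₂) (h : SplitChain s₁ s₂ n P P')
    (hP : MeshInv M s₁ s₂ P) : MeshInv M s₁ s₂ P' := by
  induction h with
  | refl => exact hP
  | tail _ hs ih =>
    obtain ⟨Q, hQ, -, hQ'⟩ := hs
    exact ih.split hd hs₁ hs₂ hQ hQ'

theorem mem_of_level (h : SplitChain s₁ s₂ n P P') {R : Prism d} (hR : R ∈ P)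
    (hl : n ≤ R.level) : R ∈ P' := by
  induction h with
  | refl => exact hR
  | tail _ hs ih =>
    obtain ⟨Q, hQ, hQl, hQ'⟩ := hs
    refine (hQ' R).2 (Or.inl ⟨ih, ?_⟩)
    rintro rfl
    omega

/-- A new element is a descendant of an old one. -/
theorem origin (h : SplitChain s₁ s₂ n P P') {R : Prism d} (hR : R ∈ P') :
    R ∈ P ∨ ∃ A ∈ P, A.level < n ∧ Desc A.2 R.2 ∧ TimeDesc A.1 R.1 ∧ A.level < R.level := by
  induction h generalizing R with
  | refl => exact Or.inl hR
  | tail _ hs ih =>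
    obtain ⟨Q, hQ, hQl, hQ'⟩ := hs
    rcases (hQ' R).1 hR with h | h
    · exact ih h.1
    · have hl := level_of_mem_atomicSplit h
      obtain ⟨h1, h2⟩ := mem_atomicSplit.1 h
      have h3 := TimeInterval.bisectIter_desc h1
      rcases ih hQ with h4 | ⟨A, hA, hAl, h4, h5, h6⟩
      · exact Or.inr ⟨Q, h4, hQl, Desc.refl.child h2, h3, by omega⟩
      · exact Or.inr ⟨A, hA, hAl, h4.child h2, h5.trans h3, by omega⟩

end SplitChain

theorem MeshInv.notMem_of_mem_split (hd : 1 ≤ d) (hs₁ : 0 < s₁) (hs₂ : 0 < s₂)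
    (hP : MeshInv M s₁ s₂ P) {B R : Prism d} (hB : B ∈ P) (hR : R ∈ B.atomicSplit s₁ s₂) :
    R ∉ P := by
  intro hRP
  have h1 := split_props hd hs₁ hs₂ (hP.space B hB) (hP.time B hB) hR
  obtain ⟨t, ht⟩ := exists_between h1.2.1.lt
  have ht' := R.1.Ioo_subset_carrier ht
  have := hP.eq_of_active hd hB hRP (h1.2.2.2.1 ht') ht'
    (Or.inl (Desc.refl.child (mem_atomicSplit.1 hR).2))
  have hl := level_of_mem_atomicSplit hR
  rw [this] at hl
  omega

/-- Splitting the elements of a set one after the other. -/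
theorem splitChain_of_split_all (hd : 1 ≤ d) (hs₁ : 0 < s₁) (hs₂ : 0 < s₂)
    (hP : MeshInv M s₁ s₂ P) {n : ℕ} (K : Finset (Prism d)) (hK : K ⊆ P)
    (hl : ∀ B ∈ K, B.level < n)
    (hP' : ∀ R, R ∈ P' ↔ (R ∈ P ∧ R ∉ K) ∨ ∃ B ∈ K, R ∈ B.atomicSplit s₁ s₂) :
    SplitChain s₁ s₂ n P P' := by
  classical
  induction K using Finset.induction_on generalizing P' with
  | empty =>
    have : P' = P := by ext R; simp [hP']
    rw [this]
    exact Relation.ReflTransGen.refl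
  | insert a K ha ih =>
    set P₁ := (P \ K) ∪ K.biUnion (Prism.atomicSplit s₁ s₂) with hP₁
    have hmem : ∀ R, R ∈ P₁ ↔ (R ∈ P ∧ R ∉ K) ∨ ∃ B ∈ K, R ∈ B.atomicSplit s₁ s₂ := fun R => by
      rw [hP₁, Finset.mem_union, Finset.mem_sdiff, Finset.mem_biUnion]
    have haP := hK (Finset.mem_insert_self a K)
    refine (ih (fun B hB => hK (Finset.mem_insert_of_mem hB))
      (fun B hB => hl B (Finset.mem_insert_of_mem hB)) hmem).tail
      ⟨a, (hmem a).2 (Or.inl ⟨haP, ha⟩), hl a (Finset.mem_insert_self a K), fun R => ?_⟩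
    rw [hP', hmem]
    constructor
    · rintro (⟨h1, h2⟩ | ⟨B, hB, hR⟩)
      · rw [Finset.mem_insert, not_or] at h2
        exact Or.inl ⟨Or.inl ⟨h1, h2.2⟩, h2.1⟩
      · rcases Finset.mem_insert.1 hB with rfl | hB'
        · exact Or.inr hR
        · refine Or.inl ⟨Or.inr ⟨B, hB', hR⟩, ?_⟩
          rintro rfl
          exact hP.notMem_of_mem_split hd hs₁ hs₂ (hK hB) hR haP
    · rintro (⟨⟨h1, h2⟩ | ⟨B, hB, hR⟩, h3⟩ | hR)
      · exact Or.inl ⟨h1, by rw [Finset.mem_insert, not_or]; exact ⟨h3, h2⟩⟩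
      · exact Or.inr ⟨B, Finset.mem_insert_of_mem hB, hR⟩
      · exact Or.inr ⟨a, Finset.mem_insert_self a K, hR⟩

theorem conforming_of_meetInFace {T : Finset (TaggedSimplex d)} (hn : ∀ S ∈ T, S.Nondeg)
    (h : ∀ S ∈ T, ∀ S' ∈ T, S ≠ S' → MeetInFace S S') : Conforming T := by
  classical
  intro S hS S' hS'
  by_cases hne : S = S'
  · exact Or.inl hne
  right
  have hm := h S hS S' hS' hne
  by_cases hemp : S.carrier ∩ S'.carrier = ∅
  · exact Or.inl hemp
  right
  have hWne : (S.verts ∩ S'.verts).Nonempty := by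
    rw [hm.inter_eq, ← ne_eq, ← nonempty_iff_ne_empty, convexHull_nonempty_iff] at hemp
    exact_mod_cast hemp
  -- the indices of the common vertices
  have key : ∀ R : TaggedSimplex d, R.Nondeg → S.verts ∩ S'.verts ⊆ R.verts →
      ∃ a : Finset (Fin (d + 1)), a.Nonempty ∧ a.card ≤ d ∧
        R.vertex '' a = ((S.verts ∩ S'.verts : Finset (Space d)) : Set (Space d)) := by
    intro R hR hsub
    have himg : (Finset.univ.filter fun i => R.vertex i ∈ S.verts ∩ S'.verts).image R.vertex =
        S.verts ∩ S'.verts := by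
      ext v
      simp only [Finset.mem_image, Finset.mem_filter, Finset.mem_univ, true_and]
      constructor
      · rintro ⟨i, hi, rfl⟩
        exact hi
      · intro hv
        obtain ⟨i, rfl⟩ := mem_verts.1 (hsub hv)
        exact ⟨i, hv, rfl⟩
    refine ⟨Finset.univ.filter fun i => R.vertex i ∈ S.verts ∩ S'.verts, ?_, ?_, ?_⟩
    · rw [← Finset.image_nonempty (f := R.vertex), himg]; exact hWne
    · rw [← Finset.card_image_of_injective _ hR.injective, himg]
      exact hm.card_le (hn S hS) (hn S' hS')
    · rw [← Finset.coe_image, himg]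
  obtain ⟨a, a1, a2, a3⟩ := key S (hn S hS) Finset.inter_subset_left
  obtain ⟨b, b1, b2, b3⟩ := key S' (hn S' hS') Finset.inter_subset_right
  exact ⟨a, b, a1, b1, a2, b2, by rw [a3, hm.inter_eq], by rw [b3, hm.inter_eq]⟩

/-- A family of prisms with the same time interval and the same refinement edge that contains all
necessary refinements of neighbours consists of the whole star of the midpoint of that edge. -/
theorem Regular.mem_of_mid_mem (hd : 1 ≤ d) (hP : Regular M s₁ s₂ P) {K : Finset (Prism d)}
    {Q : Prism d} (hQ : Q ∈ K) (hK : K ⊆ P) (hI : ∀ B ∈ K, B.1 = Q.1)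
    (hE : ∀ B ∈ K, SameEdge Q.2 B.2) (hN : ∀ B ∈ K, necessaryRefinements P B ⊆ K) {t : ℝ}
    (ht : t ∈ Q.1.carrier) {R : Prism d} (hR : R ∈ P) (htR : t ∈ R.1.carrier)
    (hm : Q.2.mid ∈ R.2.carrier) : R ∈ K := by
  by_contra hRK
  obtain ⟨S, hS, S', hS', hmS, hmS', ⟨B, hB, rfl⟩, hpS', hadj⟩ := exists_adjacent_of_star M.domain
    (hP.nondeg_active hd) (hP.conforming t) (hP.iUnion_active hd ((hP.time Q (hK hQ)).Icc_subset
      (Q.1.carrier_subset_Icc ht))) (x := Q.2.mid) (fun S => ∃ B ∈ K, B.2 = S) (S₀ := Q.2)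
    (S₁ := R.2) (mem_activeTriangulation.2 ⟨Q, hK hQ, ht, rfl⟩) Q.2.mid_mem_carrier ⟨Q, hQ, rfl⟩
    (mem_activeTriangulation.2 ⟨R, hR, htR, rfl⟩) hm (by
      rintro ⟨B, hB, hBR⟩
      have := hP.eq_of_active hd (hK hB) hR (hI B hB ▸ ht) htR (hBR ▸ Or.inl Desc.refl)
      exact hRK (this ▸ hB))
  obtain ⟨R', hR', htR', rfl⟩ := mem_activeTriangulation.1 hS'
  have hn := hP.nondeg hd (hK hB)
  have htB : t ∈ B.1.carrier := hI B hB ▸ ht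
  have hmF : Q.2.mid ∈ B.2.carrier ∩ R'.2.carrier := ⟨hmS, hmS'⟩
  rw [hadj.inter_eq, ← (hE B hB).mid_eq] at hmF
  have he := edge_subset_of_midpoint_mem hn.verts
    (Finset.inter_subset_left (s₂ := R'.2.verts)) B.2.head_mem B.2.tail_mem
    (hn.head_ne_tail hd) hmF
  have hR'B : R' ≠ B := by
    rintro rfl
    exact hadj.ne rfl
  by_cases hd2 : 2 ≤ d
  · exact hpS' ⟨R', hN B hB (mem_necessaryRefinements.2 ⟨hR', Or.inr
      ((hP.spaceNbr_iff hd2 (hK hB) hR').2 ⟨hR'B, ⟨t, htB, htR'⟩, hadj, he⟩)⟩), rfl⟩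
  · have := Finset.card_le_one.1 (hadj.card_eq.le.trans (show d ≤ 1 by omega)) _ he.1 _ he.2
    exact hn.head_ne_tail hd this

/-- The simultaneous refinement of a full star preserves the regularity of the mesh: an element that
is not refined does not contain the midpoint of the refinement edge, so that it still meets the
children in common faces, and a touching element of lower level would be a necessary refinement of
neighbours. -/
theorem Regular.split_star (hd : 1 ≤ d) (hs₁ : 0 < s₁) (hs₂ : 0 < s₂) (hP : Regular M s₁ s₂ P)
    {K : Finset (Prism d)} {Q : Prism d} (hQ : Q ∈ K) (hK : K ⊆ P) (hI : ∀ B ∈ K, B.1 = Q.1)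
    (hl : ∀ B ∈ K, B.level = Q.level)
    (hE : ∀ B ∈ K, SameEdge Q.2 B.2) (hN : ∀ B ∈ K, necessaryRefinements P B ⊆ K)
    (hP' : ∀ R, R ∈ P' ↔ (R ∈ P ∧ R ∉ K) ∨ ∃ B ∈ K, R ∈ B.atomicSplit s₁ s₂) :
    Regular M s₁ s₂ P' := by
  have hinv : MeshInv M s₁ s₂ P' := (splitChain_of_split_all hd hs₁ hs₂ hP.toMeshInv K hK
    (n := Q.level + 1) (fun B hB => by rw [hl B hB]; omega) hP').meshInv hd hs₁ hs₂ hP.toMeshInv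
  have hsp : ∀ B ∈ K, ∀ R ∈ B.atomicSplit s₁ s₂, _ := fun B hB R hR =>
    split_props hd hs₁ hs₂ (hP.space B (hK hB)) (hP.time B (hK hB)) hR
  have hlev : ∀ B ∈ K, ∀ R ∈ B.atomicSplit s₁ s₂, R.level = Q.level + 1 := fun B hB R hR => by
    rw [level_of_mem_atomicSplit hR, hl B hB]
  have hne : ∀ B ∈ K, ∀ X ∉ K, B ≠ X := fun B hB X hX h => hX (h ▸ hB)
  -- an old element next to a refined one
  have hold : ∀ B ∈ K, ∀ X ∈ P, X ∉ K → ∀ R ∈ B.atomicSplit s₁ s₂, ∀ t, t ∈ R.1.carrier →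
      t ∈ X.1.carrier → MeetInFace R.2 X.2 := by
    intro B hB X hX hXK R hR t htR htX
    have htB := (hsp B hB R hR).2.2.2.1 htR
    have hm := hP.meet hd (hK hB) hX ⟨t, htB, htX⟩ (hne B hB X hXK)
    have hmid : B.2.mid ∉ X.2.carrier := fun h => hXK
      (hP.mem_of_mid_mem hd hQ hK hI hE hN (hI B hB ▸ htB) hX htX ((hE B hB).mid_eq ▸ h))
    obtain ⟨e, e', he⟩ := (hP.space B (hK hB)).exists_isHalf hd (mem_atomicSplit.1 hR).2
    refine hm.half_left (hP.nondeg hd (hK hB)) (hP.nondeg hd hX) he ?_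
      fun h => hmid (verts_subset_carrier _ h)
    by_contra hcon
    push Not at hcon
    refine hmid ?_
    rw [he.mid_eq]
    exact X.2.convex_carrier.midpoint_mem (verts_subset_carrier _ hcon.1)
      (verts_subset_carrier _ hcon.2)
  -- two refined elements: siblings, or halves with respect to the same edge
  have hnew : ∀ B ∈ K, ∀ B' ∈ K, ∀ R ∈ B.atomicSplit s₁ s₂, ∀ R' ∈ B'.atomicSplit s₁ s₂, ∀ t,
      t ∈ R.1.carrier → t ∈ R'.1.carrier → R.2 ≠ R'.2 → MeetInFace R.2 R'.2 := by
    intro B hB B' hB' R hR R' hR' t htR htR' hRR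
    have hn := hP.nondeg hd (hK hB)
    have hn' := hP.nondeg hd (hK hB')
    have hc := (mem_atomicSplit.1 hR).2
    have hc' := (mem_atomicSplit.1 hR').2
    by_cases hBB : B = B'
    · subst hBB
      have h1 := isHalf_left hn hd
      have h2 := isHalf_right hn hd ((hP.space B (hK hB)).type_lt hd)
      rcases hc with hc | hc <;> rcases hc' with hc' | hc'
      · exact absurd (hc.trans hc'.symm) hRR
      · rw [hc, hc']; exact (siblings_adjacent hn h1 h2).toMeetInFace
      · rw [hc, hc']; exact (siblings_adjacent hn h2 h1).toMeetInFace
      · exact absurd (hc.trans hc'.symm) hRR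
    · have hm := hP.meet hd (hK hB) (hK hB') ⟨t, (hsp B hB R hR).2.2.2.1 htR,
        (hsp B' hB' R' hR').2.2.2.1 htR'⟩ hBB
      obtain ⟨e, e', he⟩ := (hP.space B (hK hB)).exists_isHalf hd hc
      obtain ⟨f, f', hf⟩ := (hP.space B' (hK hB')).exists_isHalf hd hc'
      have hse := (hE B hB).symm.trans (hE B' hB')
      have : (f = e ∧ f' = e') ∨ (f = e' ∧ f' = e) := by
        rcases he.ends with ⟨h1, h2⟩ | ⟨h1, h2⟩ <;> rcases hf.ends with ⟨h3, h4⟩ | ⟨h3, h4⟩ <;>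
          rcases hse with ⟨h5, h6⟩ | ⟨h5, h6⟩ <;> simp [h1, h2, h3, h4, h5, h6]
      rcases this with ⟨rfl, rfl⟩ | ⟨rfl, rfl⟩
      · exact hm.halves hn hn' he hf
      · exact (hm.opposite_halves hn hn' he hf).1
  refine ⟨hinv, fun t => conforming_of_meetInFace (hinv.nondeg_active hd) ?_, ?_, ?_⟩
  · intro S hS S' hS' hSS
    obtain ⟨X, hX, htX, rfl⟩ := mem_activeTriangulation.1 hS
    obtain ⟨X', hX', htX', rfl⟩ := mem_activeTriangulation.1 hS'
    rcases (hP' X).1 hX with ⟨h1, h2⟩ | ⟨B, hB, hXB⟩ <;>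
      rcases (hP' X').1 hX' with ⟨h1', h2'⟩ | ⟨B', hB', hXB'⟩
    · exact hP.meet hd h1 h1' ⟨t, htX, htX'⟩ fun h => hSS (h ▸ rfl)
    · exact (hold B' hB' X h1 h2 X' hXB' t htX' htX).symm
    · exact hold B hB X' h1' h2' X hXB t htX htX'
    · exact hnew B hB B' hB' X hXB X' hXB' t htX htX' hSS
  · -- an old element that touches a refined one in time
    have key : ∀ B ∈ K, ∀ X ∈ P, X ∉ K → ∀ R ∈ B.atomicSplit s₁ s₂,
        (closure R.1.carrier ∩ closure X.1.carrier).ncard = 1 →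
        affineDim (R.2.carrier ∩ X.2.carrier) = d →
        Q.level ≤ X.level ∧ X.level ≤ Q.level + 1 := by
      intro B hB X hX hXK R hR h1 h2
      obtain ⟨-, hRt, hdesc, hs1, hs2⟩ := hsp B hB R hR
      have hov : affineDim (B.2.carrier ∩ X.2.carrier) = d := le_antisymm (affineDim_le _)
        (h2.symm.le.trans (affineDim_mono (inter_subset_inter hs2 Subset.rfl)))
      have hdis : ¬ (B.1.carrier ∩ X.1.carrier).Nonempty := fun h =>
        hne B hB X hXK (hP.unique B (hK hB) X hX h hov)
      obtain ⟨t, ht⟩ := ncard_eq_one.1 h1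
      have htm : t ∈ closure R.1.carrier ∩ closure X.1.carrier := ht ▸ rfl
      have htB := closure_mono hs1 htm.1
      rw [(hP.time B (hK hB)).closure_eq] at htB
      have htX := htm.2
      rw [(hP.time X hX).closure_eq] at htX
      have hcomp := (hP.space B (hK hB)).comparable_of_overlap hd (hP.space X hX) hov
      have l1 := hP.level_le_of_touch hd hP.irregTime (hK hB) hX htB htX hcomp
      have l2 := hP.level_le_of_touch hd hP.irregTime hX (hK hB) htX htB hcomp.symm
      rw [hl B hB] at l1 l2
      refine ⟨?_, l2⟩
      by_contra hlt
      refine hXK (hN B hB (mem_necessaryRefinements.2 ⟨hX, Or.inl ⟨(hne B hB X hXK).symm, ?_, hov,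
        by rw [hl B hB]; omega⟩⟩))
      rw [((hP.time B (hK hB)).inter_eq_singleton (hP.time X hX) hdis htB htX).1, ncard_singleton]
    intro X hX X' hX' h1 h2
    rcases (hP' X).1 hX with ⟨a1, a2⟩ | ⟨B, hB, hXB⟩ <;>
      rcases (hP' X').1 hX' with ⟨b1, b2⟩ | ⟨B', hB', hXB'⟩
    · exact hP.irregTime X a1 X' b1 h1 h2
    · rw [inter_comm] at h1 h2
      have := key B' hB' X a1 a2 X' hXB' h1 h2
      rw [hlev B' hB' X' hXB']
      omega
    · have := key B hB X' b1 b2 X hXB h1 h2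
      rw [hlev B hB X hXB]
      omega
    · rw [hlev B hB X hXB, hlev B' hB' X' hXB']
      omega
  · intro hd1
    -- an old element that touches a refined one in space
    have key : ∀ B ∈ K, ∀ X ∈ P, X ∉ K → ∀ R ∈ B.atomicSplit s₁ s₂,
        (R.1.carrier ∩ X.1.carrier).Nonempty → (R.2.carrier ∩ X.2.carrier).Nonempty →
        Q.level ≤ X.level ∧ X.level ≤ Q.level + 1 := by
      intro B hB X hX hXK R hR h1 h2
      obtain ⟨-, hRt, hdesc, hs1, hs2⟩ := hsp B hB R hR
      have ht := h1.mono (inter_subset_inter hs1 (Subset.rfl (s := X.1.carrier)))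
      have hx := h2.mono (inter_subset_inter hs2 (Subset.rfl (s := X.2.carrier)))
      have hcard := (hP.meet hd (hK hB) hX ht (hne B hB X hXK)).ncard_inter_eq_one
        (hP.nondeg hd (hK hB)) (hP.nondeg hd hX) hd1 hx
      have hv := ((hP.time B (hK hB)).volume_inter_pos_iff (hP.time X hX)).2 ht
      have l1 := hP.irregSpace hd1 B (hK hB) X hX hv hcard
      have l2 := hP.irregSpace hd1 X hX B (hK hB) (by rwa [inter_comm]) (by rwa [inter_comm])
      rw [hl B hB] at l1 l2
      refine ⟨?_, l2⟩
      by_contra hlt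
      refine hXK (hN B hB (mem_necessaryRefinements.2 ⟨hX, Or.inr ?_⟩))
      exact (hP.spaceNbr_one_iff hd1 (hK hB) hX).2 ⟨(hne B hB X hXK).symm, ht, hx,
        by rw [hl B hB]; omega⟩
    intro X hX X' hX' h1 h2
    rw [(hinv.time X hX).volume_inter_pos_iff (hinv.time X' hX')] at h1
    obtain ⟨x, hx⟩ := ncard_eq_one.1 h2
    have hxne : (X.2.carrier ∩ X'.2.carrier).Nonempty := ⟨x, hx ▸ rfl⟩
    rcases (hP' X).1 hX with ⟨a1, a2⟩ | ⟨B, hB, hXB⟩ <;>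
      rcases (hP' X').1 hX' with ⟨b1, b2⟩ | ⟨B', hB', hXB'⟩
    · exact hP.irregSpace hd1 X a1 X' b1
        (((hP.time X a1).volume_inter_pos_iff (hP.time X' b1)).2 h1) h2
    · rw [inter_comm] at h1 hxne
      have := key B' hB' X a1 a2 X' hXB' h1 hxne
      rw [hlev B' hB' X' hXB']
      omega
    · have := key B hB X' b1 b2 X hXB h1 hxne
      rw [hlev B hB X hXB]
      omega
    · rw [hlev B hB X hXB, hlev B' hB' X' hXB']
      omega

end SpaceTimeMesh
namespace SpaceTimeMesh

/-! ### The patch refinement preserves regularity -/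

variable {d : ℕ}

open TaggedSimplex

variable {M : InitialMesh d} {s₁ s₂ : ℝ}

theorem IsRefined.notMem {P : Finset (Prism d)} (hd : 1 ≤ d) (hs₁ : 0 < s₁) (hs₂ : 0 < s₂)
    {Q : Prism d} (hQ : IsRefined M s₁ s₂ P Q) (hP : MeshInv M s₁ s₂ P) : Q ∉ P := by
  intro h
  obtain ⟨t, ht⟩ := exists_between hQ.time.lt
  obtain ⟨R, hR, -, -⟩ := exists_split_of_mem (s₁ := s₁) (s₂ := s₂)
    (Q.1.Ioo_subset_carrier ht) (Or.inl rfl : Q.2.IsChild Q.2.leftChild)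
  exact hP.notMem_of_mem_split hd hs₁ hs₂ h hR (hQ.split hR)

/-- The result of a call of the patch refinement with an element of the mesh. -/
structure PatchSpec (M : InitialMesh d) (s₁ s₂ : ℝ) (P : Finset (Prism d)) (Q : Prism d)
    (P' : Finset (Prism d)) : Prop where
  regular : Regular M s₁ s₂ P'
  chain : SplitChain s₁ s₂ (Q.level + 1) P P'
  split : Q.atomicSplit s₁ s₂ ⊆ P'
  same : ∀ R ∈ P, R.level = Q.level → R ∉ P' →
    R.1 = Q.1 ∧ SameEdge Q.2 R.2 ∧ R.atomicSplit s₁ s₂ ⊆ P'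

/-- A call with an element of the mesh meets its specification, and a call with a prism that has
already been split, which occurs in the recursion, has no effect. -/
def PatchGoal (M : InitialMesh d) (s₁ s₂ : ℝ) (P : Finset (Prism d)) (Q : Prism d)
    (P' : Finset (Prism d)) : Prop :=
  Regular M s₁ s₂ P → (Q ∈ P → PatchSpec M s₁ s₂ P Q P') ∧ (IsRefined M s₁ s₂ P Q → P' = P)

/-- The invariant of the inner loop, which was entered with the mesh `P₀` in order to treat the
neighbours of `Q`. By `joint`, those parts of neighbours which require the refinement of `Q` are
collected, or they will be found when a collected element is visited. -/
structure InnerInv (M : InitialMesh d) (s₁ s₂ : ℝ) (P₀ : Finset (Prism d)) (Q : Prism d)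
    (P N : Finset (Prism d)) : Prop where
  regular : Regular M s₁ s₂ P
  chain : SplitChain s₁ s₂ Q.level P₀ P
  nodes : ∀ B ∈ N, B ∈ P ∧ B.1 = Q.1 ∧ B.level = Q.level ∧ SameEdge Q.2 B.2
  split : ∀ A ∈ necessaryRefinements P₀ Q, A ∉ P → A.atomicSplit s₁ s₂ ⊆ P
  joint : ∀ A ∈ P₀, SpaceNbr Q A → A ∉ P → ∀ R ∈ A.atomicSplit s₁ s₂,
    R ∈ necessaryRefinements P Q → R ∈ N ∨ ∃ R₁ ∈ N, R₁ ∉ P₀ ∧ R ∈ necessaryRefinements P R₁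

/-- What the inner loop achieves. -/
def InnerGoal (M : InitialMesh d) (s₁ s₂ : ℝ) (Q : Prism d) (l : List (Prism d))
    (P N P' N' : Finset (Prism d)) : Prop :=
  ∀ P₀, Regular M s₁ s₂ P₀ → Q ∈ P₀ → InnerInv M s₁ s₂ P₀ Q P N →
    (∀ A ∈ l, A ∈ necessaryRefinements P₀ Q) →
    InnerInv M s₁ s₂ P₀ Q P' N' ∧ N ⊆ N' ∧ SplitChain s₁ s₂ Q.level P P' ∧
      ∀ A ∈ l, (A.level = Q.level ∧ A ∈ N') ∨ (A.level ≠ Q.level ∧ A ∉ P')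

/-- The invariant of the outer loops: `A` is the set of collected elements, and `V` the set of those
whose neighbours have been treated. -/
structure OuterInv (M : InitialMesh d) (s₁ s₂ : ℝ) (Q : Prism d) (P A V : Finset (Prism d)) :
    Prop where
  regular : Regular M s₁ s₂ P
  nodes : ∀ B ∈ A, B ∈ P ∧ B.1 = Q.1 ∧ B.level = Q.level ∧ SameEdge Q.2 B.2
  sub : V ⊆ A
  visited : ∀ B ∈ V, ∀ R ∈ necessaryRefinements P B, R.level = Q.level ∧
    (R ∈ A ∨ ∃ R₁ ∈ A, R₁ ∉ V ∧ R ∈ necessaryRefinements P R₁)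

open scoped Classical in
/-- What the loop over the elements of `F` achieves. -/
def OuterGoal (M : InitialMesh d) (s₁ s₂ : ℝ) (K F : Finset (Prism d)) (l : List (Prism d))
    (P N P' N' : Finset (Prism d)) : Prop :=
  ∀ Q V, l.toFinset ⊆ K ∪ F → OuterInv M s₁ s₂ Q P (K ∪ F ∪ N) V →
    OuterInv M s₁ s₂ Q P' (K ∪ F ∪ N') (V ∪ l.toFinset) ∧ SplitChain s₁ s₂ Q.level P P'

open scoped Classical in
/-- What the `while` loop achieves. -/
def WhileGoal (M : InitialMesh d) (s₁ s₂ : ℝ) (P K F P' K' : Finset (Prism d)) : Prop :=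
  ∀ Q, OuterInv M s₁ s₂ Q P (K ∪ F) K →
    OuterInv M s₁ s₂ Q P' K' K' ∧ SplitChain s₁ s₂ Q.level P P' ∧ K ∪ F ⊆ K'

open scoped Classical in
/-- The step of the inner loop for a neighbour of the same level, which is collected. -/
theorem innerGoal_same (hd : 1 ≤ d) {Q A : Prism d} {l : List (Prism d)}
    {P N P' N' : Finset (Prism d)} (hl : Q.level = A.level)
    (ih : InnerGoal M s₁ s₂ Q l P (N ∪ {A}) P' N') :
    InnerGoal M s₁ s₂ Q (A :: l) P N P' N' := by
  intro P₀ hP₀ hQ hinv hmem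
  have hA := hmem A List.mem_cons_self
  obtain ⟨-, -, hA1, hA2⟩ := hP₀.nbr_same_level hd hQ hA hl.symm
  have hAP := hinv.chain.mem_of_level (mem_necessaryRefinements.1 hA).1 hl.le
  have hsub : N ⊆ N ∪ {A} := Finset.subset_union_left
  obtain ⟨h1, h2, h3, h4⟩ := ih P₀ hP₀ hQ
    ⟨hinv.regular, hinv.chain, fun B hB => by
      rcases Finset.mem_union.1 hB with h | h
      · exact hinv.nodes B h
      · rw [Finset.mem_singleton.1 h]
        exact ⟨hAP, hA1, hl.symm, hA2⟩, hinv.split, fun B hB hQB hBP R hR hRn => by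
      rcases hinv.joint B hB hQB hBP R hR hRn with h | ⟨R₁, h, h'⟩
      · exact Or.inl (hsub h)
      · exact Or.inr ⟨R₁, hsub h, h'⟩⟩
    (fun B hB => hmem B (List.mem_cons_of_mem _ hB))
  refine ⟨h1, hsub.trans h2, h3, fun B hB => ?_⟩
  rcases List.mem_cons.1 hB with rfl | hB
  · exact Or.inl ⟨hl.symm, h2 (Finset.mem_union_right _ (Finset.mem_singleton_self _))⟩
  · exact h4 B hB

open scoped Classical in
/-- The step of the inner loop for a neighbour `A` of the previous level. If `A` has already been
split by an earlier recursive call, nothing happens. Otherwise the call splits `A` together with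
other elements of its level. Those among them that are neighbours of `Q` share the refinement edge
of `A`, and their relevant parts are found through a part of `A`, see
`Regular.exists_nbr_of_joint_split`. -/
theorem innerGoal_recurse (hd : 1 ≤ d) (hs₁ : 0 < s₁) (hs₂ : 0 < s₂) {Q A : Prism d}
    {l : List (Prism d)} {P N P₁ P' N' : Finset (Prism d)} (hne : Q.level ≠ A.level)
    (ih : PatchGoal M s₁ s₂ P A P₁)
    (ih' : InnerGoal M s₁ s₂ Q l P₁ (if A ∈ spaceNeighbours P Q then
      N ∪ (A.atomicSplit s₁ s₂).filter (fun R => R ∈ necessaryRefinements P₁ Q) else N) P' N') :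
    InnerGoal M s₁ s₂ Q (A :: l) P N P' N' := by
  intro P₀ hP₀ hQ hinv hmem
  have hA := hmem A List.mem_cons_self
  have hAP₀ := (mem_necessaryRefinements.1 hA).1
  have hAl : A.level + 1 = Q.level :=
    (hP₀.level_of_nbr hd hQ hA).resolve_left fun h => hne h.symm
  have hQP := hinv.chain.mem_of_level hQ le_rfl
  obtain ⟨ih1, ih2⟩ := ih hinv.regular
  set N₁ := if A ∈ spaceNeighbours P Q then
    N ∪ (A.atomicSplit s₁ s₂).filter (fun R => R ∈ necessaryRefinements P₁ Q) else N with hN₁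
  -- the state after the recursive call
  have key : InnerInv M s₁ s₂ P₀ Q P₁ N₁ ∧ N ⊆ N₁ ∧ SplitChain s₁ s₂ Q.level P P₁ ∧
      IsRefined M s₁ s₂ P₁ A := by
    by_cases hAP : A ∈ P
    · have hspec := ih1 hAP
      have hchain : SplitChain s₁ s₂ Q.level P P₁ := hAl ▸ hspec.chain
      have hQP₁ := hchain.mem_of_level hQP le_rfl
      have hsub : N ⊆ N₁ := by
        rw [hN₁]
        split_ifs
        · exact Finset.subset_union_left
        · exact Finset.Subset.rfl
      have hN₁mem : ∀ B ∈ N₁, B ∈ N ∨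
          (B ∈ A.atomicSplit s₁ s₂ ∧ B ∈ necessaryRefinements P₁ Q) := by
        intro B hB
        rw [hN₁] at hB
        split_ifs at hB
        · rw [Finset.mem_union, Finset.mem_filter] at hB
          exact hB
        · exact Or.inl hB
      refine ⟨⟨hspec.regular, hinv.chain.trans hchain, fun B hB => ?_, fun B hB hBP₁ => ?_,
        fun B hB hQB hBP₁ R hR hRn => ?_⟩, hsub, hchain,
        hP₀.space A hAP₀, hP₀.time A hAP₀, hspec.split⟩
      · rcases hN₁mem B hB with h | ⟨h, h'⟩
        · obtain ⟨a1, a2, a3, a4⟩ := hinv.nodes B h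
          exact ⟨hchain.mem_of_level a1 a3.ge, a2, a3, a4⟩
        · have hBl : B.level = Q.level := by rw [level_of_mem_atomicSplit h, hAl]
          obtain ⟨-, -, a1, a2⟩ := hspec.regular.nbr_same_level hd hQP₁ h' hBl
          exact ⟨(mem_necessaryRefinements.1 h').1, a1, hBl, a2⟩
      · have hBl := hP₀.level_of_nbr hd hQ hB
        by_cases hBP : B ∈ P
        · refine (hspec.same B hBP ?_ hBP₁).2.2
          rcases hBl with h | h
          · exact absurd (hchain.mem_of_level hBP h.ge) hBP₁
          · omega
        · intro R hR
          refine hchain.mem_of_level (hinv.split B hB hBP hR) ?_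
          rw [level_of_mem_atomicSplit hR]
          omega
      · have hBn : B ∈ necessaryRefinements P₀ Q := mem_necessaryRefinements.2 ⟨hB, Or.inr hQB⟩
        by_cases hBP : B ∈ P
        · have hBl : B.level + 1 = Q.level := (hP₀.level_of_nbr hd hQ hBn).resolve_left
            fun h => hBP₁ (hchain.mem_of_level hBP h.ge)
          have hRl : R.level = Q.level := by rw [level_of_mem_atomicSplit hR, hBl]
          obtain ⟨hBA, hse, -⟩ := hspec.same B hBP (by omega) hBP₁
          have hd2 := (hspec.regular.nbr_same_level hd hQP₁ hRn hRl).1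
          have hQA : SpaceNbr Q A := by
            refine ((mem_necessaryRefinements.1 hA).2).resolve_left fun h => ?_
            refine (hP₀.time Q hQ).disjoint_of_ncard (hP₀.time A hAP₀) h.2.1 ?_
            rw [← hBA]
            exact ((hP₀.spaceNbr_iff hd2 hQ hB).1 hQB).2.1
          obtain ⟨R₁, hR₁, hR₁n, hRR₁⟩ := hinv.regular.exists_nbr_of_joint_split hd2 hs₁ hs₂
            hspec.regular hQP hQP₁ hAP hBP hQA hQB hAl hBA hse hspec.split hR hRn hRl
          have hR₁N : R₁ ∈ N₁ := by
            rw [hN₁, if_pos (mem_spaceNeighbours.2 ⟨hAP, hQA⟩)]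
            exact Finset.mem_union_right _ (Finset.mem_filter.2 ⟨hR₁, hR₁n⟩)
          rcases hRR₁ with rfl | h
          · exact Or.inl hR₁N
          · exact Or.inr ⟨R₁, hR₁N, hP₀.notMem_of_mem_split hd hs₁ hs₂ hAP₀ hR₁, h⟩
        · have hRP := hinv.split B hBn hBP hR
          rcases hinv.joint B hB hQB hBP R hR (necessaryRefinements_of_mem hRn hRP) with
            h | ⟨R₁, h1, h2, h3⟩
          · exact Or.inl (hsub h)
          · exact Or.inr ⟨R₁, hsub h1, h2, necessaryRefinements_of_mem h3
              (mem_necessaryRefinements.1 hRn).1⟩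
    · have href : IsRefined M s₁ s₂ P A :=
        ⟨hP₀.space A hAP₀, hP₀.time A hAP₀, hinv.split A hA hAP⟩
      have hP₁ := ih2 href
      have hN : N₁ = N := if_neg fun h => hAP (mem_spaceNeighbours.1 h).1
      rw [hN, hP₁]
      exact ⟨hinv, Finset.Subset.rfl, Relation.ReflTransGen.refl, href⟩
  obtain ⟨k1, k2, k3, k4⟩ := key
  obtain ⟨h1, h2, h3, h4⟩ := ih' P₀ hP₀ hQ k1 (fun B hB => hmem B (List.mem_cons_of_mem _ hB))
  refine ⟨h1, k2.trans h2, k3.trans h3, fun B hB => ?_⟩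
  rcases List.mem_cons.1 hB with rfl | hB
  · refine Or.inr ⟨hne.symm, ?_⟩
    have : IsRefined M s₁ s₂ P' B := ⟨k4.space, k4.time, fun R hR =>
      h3.mem_of_level (k4.split hR) (by rw [level_of_mem_atomicSplit hR]; omega)⟩
    exact this.notMem hd hs₁ hs₂ h1.regular.toMeshInv
  · exact h4 B hB

open scoped Classical in
/-- The step of the outer loop: after the neighbours of `Q'` have been treated, `Q'` may be counted
among the visited elements, and the elements visited before retain their property. -/
theorem outerGoal_cons (hd : 1 ≤ d) {K F P N P₁ N₁ P' N' : Finset (Prism d)} {Q' : Prism d}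
    {l l' : List (Prism d)} (hl' : l'.toFinset = necessaryRefinements P Q' \ (K ∪ F))
    (ih : InnerGoal M s₁ s₂ Q' l' P N P₁ N₁) (ih' : OuterGoal M s₁ s₂ K F l P₁ N₁ P' N') :
    OuterGoal M s₁ s₂ K F (Q' :: l) P N P' N' := by
  intro Q V hlsub hinv
  rw [List.toFinset_cons] at hlsub ⊢
  have hQ'KF : Q' ∈ K ∪ F := hlsub (Finset.mem_insert_self _ _)
  obtain ⟨hQ', hI', hl'e, hE'⟩ := hinv.nodes Q' (Finset.mem_union_left _ hQ'KF)
  have hreg := hinv.regular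
  obtain ⟨hin, hNN, hchain, hproc⟩ := ih P hreg hQ'
    ⟨hreg, Relation.ReflTransGen.refl, fun B hB => by
      obtain ⟨h1, h2, h3, h4⟩ := hinv.nodes B (Finset.mem_union_right _ hB)
      exact ⟨h1, h2.trans hI'.symm, h3.trans hl'e.symm, hE'.symm.trans h4⟩,
      fun A hA hAP => absurd (mem_necessaryRefinements.1 hA).1 hAP,
      fun A hA _ hAP => absurd hA hAP⟩
    (fun A hA => by
      have : A ∈ l'.toFinset := List.mem_toFinset.2 hA
      rw [hl', Finset.mem_sdiff] at this
      exact this.1)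
  have hlist : ∀ A ∈ necessaryRefinements P Q', A ∉ K ∪ F → A ∈ l' := fun A hA hAKF => by
    rw [← List.mem_toFinset, hl', Finset.mem_sdiff]
    exact ⟨hA, hAKF⟩
  have hreg₁ := hin.regular
  have hQ'₁ := hchain.mem_of_level hQ' le_rfl
  have hnodes : ∀ B ∈ K ∪ F ∪ N₁, B ∈ P₁ ∧ B.1 = Q.1 ∧ B.level = Q.level ∧ SameEdge Q.2 B.2 := by
    intro B hB
    rcases Finset.mem_union.1 hB with h | h
    · obtain ⟨h1, h2, h3, h4⟩ := hinv.nodes B (Finset.mem_union_left _ h)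
      exact ⟨hchain.mem_of_level h1 (by omega), h2, h3, h4⟩
    · obtain ⟨h1, h2, h3, h4⟩ := hin.nodes B h
      exact ⟨h1, h2.trans hI', h3.trans hl'e, hE'.trans h4⟩
  have hVP : ∀ B ∈ insert Q' V, B ∈ P := fun B hB => by
    rcases Finset.mem_insert.1 hB with rfl | hB
    · exact hQ'
    · exact (hinv.nodes B (hinv.sub hB)).1
  have hsub : K ∪ F ∪ N ⊆ K ∪ F ∪ N₁ := Finset.union_subset_union Finset.Subset.rfl hNN
  -- A neighbour of `Q'` in the new mesh was one before, and then it has been collected, or it arises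
  -- from the split of a neighbour of the previous level, and then `InnerInv.joint` applies.
  have claim : ∀ R ∈ necessaryRefinements P₁ Q', R.level = Q.level ∧ (R ∈ K ∪ F ∪ N₁ ∨
      ∃ R₁ ∈ K ∪ F ∪ N₁, R₁ ∉ insert Q' V ∧ R ∈ necessaryRefinements P₁ R₁) := by
    intro R hR
    have hRP₁ := (mem_necessaryRefinements.1 hR).1
    rcases hchain.origin hRP₁ with hRP | ⟨A, hA, -, hAR, hAR', hAl⟩
    · by_cases hRKF : R ∈ K ∪ F
      · have := hinv.nodes R (Finset.mem_union_left _ hRKF)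
        exact ⟨this.2.2.1, Or.inl (Finset.mem_union_left _ hRKF)⟩
      · rcases hproc R (hlist R (necessaryRefinements_of_mem hR hRP) hRKF) with h | h
        · exact ⟨h.1.trans hl'e, Or.inl (Finset.mem_union_right _ h.2)⟩
        · exact absurd hRP₁ h.2
    · obtain ⟨-, hRl, hAl', hQA⟩ := hreg.nbr_of_refined hd hreg₁ hQ' hQ'₁ hA hR hAR hAR' hAl
      have hAn : A ∈ necessaryRefinements P Q' := mem_necessaryRefinements.2 ⟨hA, Or.inr hQA⟩
      have hAKF : A ∉ K ∪ F := fun h => by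
        have := (hinv.nodes A (Finset.mem_union_left _ h)).2.2.1
        omega
      have hAP₁ : A ∉ P₁ := by
        rcases hproc A (hlist A hAn hAKF) with h | h
        · omega
        · exact h.2
      have hRA : R ∈ A.atomicSplit s₁ s₂ := by
        obtain ⟨c, hc, hcR⟩ := hAR.exists_child hAl
        have hcR' := hcR.eq_of_level (by
          rw [hc.level]; simp only [Prism.level] at hRl hAl'; omega)
        subst hcR'
        obtain ⟨t, ht⟩ := exists_between (hreg₁.time R hRP₁).lt
        have ht' := R.1.Ioo_subset_carrier ht
        obtain ⟨R', hR', htR', hR'2⟩ := exists_split_of_mem (s₁ := s₁) (s₂ := s₂)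
          (((hreg.time A hA).desc_props hAR').1 ht') hc
        rw [hreg₁.eq_of_active hd hRP₁ (hin.split A hAn hAP₁ hR') ht' htR'
          (hR'2 ▸ Or.inl Desc.refl)]
        exact hR'
      refine ⟨hRl.trans hl'e, ?_⟩
      rcases hin.joint A hA hQA hAP₁ R hRA hR with h | ⟨R₁, h1, h2, h3⟩
      · exact Or.inl (Finset.mem_union_right _ h)
      · exact Or.inr ⟨R₁, Finset.mem_union_right _ h1, fun h => h2 (hVP R₁ h), h3⟩
  have hinv₁ : OuterInv M s₁ s₂ Q P₁ (K ∪ F ∪ N₁) (insert Q' V) := by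
    refine ⟨hreg₁, hnodes, ?_, fun B hB R hR => ?_⟩
    · intro B hB
      rcases Finset.mem_insert.1 hB with rfl | hB
      · exact Finset.mem_union_left _ hQ'KF
      · exact hsub (hinv.sub hB)
    rcases Finset.mem_insert.1 hB with rfl | hBV
    · exact claim R hR
    have hBn := hinv.nodes B (hinv.sub hBV)
    have hRP₁ := (mem_necessaryRefinements.1 hR).1
    rcases hchain.origin hRP₁ with hRP | ⟨A, hA, -, hAR, hAR', hAl⟩
    · obtain ⟨h1, h2⟩ := hinv.visited B hBV R (necessaryRefinements_of_mem hR hRP)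
      refine ⟨h1, ?_⟩
      rcases h2 with h2 | ⟨R₁, h2, h3, h4⟩
      · exact Or.inl (hsub h2)
      · -- the unvisited element that leads to `R` may be `Q'` itself; then the claim leads further
        by_cases hR₁ : R₁ = Q'
        · subst hR₁
          exact (claim R (necessaryRefinements_of_mem h4 hRP₁)).2
        · refine Or.inr ⟨R₁, hsub h2, ?_, necessaryRefinements_of_mem h4 hRP₁⟩
          rw [Finset.mem_insert, not_or]
          exact ⟨hR₁, h3⟩
    · -- the parent of `R` would be a neighbour of `B` of the previous level, which visited elements lack
      obtain ⟨-, -, hAl', hBA⟩ := hreg.nbr_of_refined hd hreg₁ hBn.1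
        (hchain.mem_of_level hBn.1 (by omega)) hA hR hAR hAR' hAl
      have := (hinv.visited B hBV A (mem_necessaryRefinements.2 ⟨hA, Or.inr hBA⟩)).1
      omega
  obtain ⟨h1, h2⟩ := ih' Q (insert Q' V)
    ((Finset.subset_insert _ _).trans hlsub) hinv₁
  rw [Finset.insert_union, ← Finset.union_insert] at h1
  exact ⟨h1, (hl'e ▸ hchain).trans h2⟩

theorem WhileLoop.of_empty {P K F P' K' : Finset (Prism d)}
    (h : WhileLoop s₁ s₂ P K F P' K') (hF : F = ∅) : P' = P ∧ K' = K := by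
  cases h with
  | done => exact ⟨rfl, rfl⟩
  | step hF' => exact absurd hF hF'

open scoped Classical in
theorem OuterLoop.of_cons_nil {P K F N P' N' : Finset (Prism d)} {Q : Prism d}
    {l : List (Prism d)} (h : OuterLoop s₁ s₂ K F l P N P' N') (hl : l = [Q])
    (hemp : necessaryRefinements P Q = ∅) : P' = P ∧ N' = N := by
  cases h with
  | nil => simp at hl
  | @cons _ _ _ _ P₁ N₁ _ _ Q' l l' hnd hl' hi ho =>
    obtain ⟨rfl, rfl⟩ := List.cons.inj hl
    rw [hemp, Finset.empty_sdiff, List.toFinset_eq_empty_iff] at hl'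
    subst hl'
    cases hi
    cases ho
    exact ⟨rfl, rfl⟩

open scoped Classical in
/-- If no neighbour of `Q` has to be refined, then the loop started with `Q` only collects `Q`. -/
theorem WhileLoop.of_singleton {P P' K : Finset (Prism d)} {Q : Prism d}
    (h : WhileLoop s₁ s₂ P ∅ {Q} P' K) (hemp : necessaryRefinements P Q = ∅) :
    P' = P ∧ K = {Q} := by
  generalize hF : ({Q} : Finset (Prism d)) = F at h
  generalize hK : (∅ : Finset (Prism d)) = K₀ at h
  cases h with
  | done => simp at hF
  | @step _ _ _ P₁ N _ _ l _ hnd hl ho hw =>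
    have hlQ : l = [Q] := by
      have h1 : l.length = 1 := by
        rw [← List.toFinset_card_of_nodup hnd, hl, ← hF, Finset.card_singleton]
      obtain ⟨a, rfl⟩ := List.length_eq_one_iff.1 h1
      have : a ∈ ({Q} : Finset (Prism d)) := by rw [hF, ← hl]; simp
      rw [Finset.mem_singleton.1 this]
    obtain ⟨rfl, rfl⟩ := ho.of_cons_nil hlQ hemp
    obtain ⟨rfl, rfl⟩ := hw.of_empty rfl
    exact ⟨rfl, by rw [← hK, ← hF, Finset.empty_union]⟩

open scoped Classical in
/-- At the end of the `while` loop all collected elements have been visited. They contain all their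
necessary refinements of neighbours, so that they form a full star. -/
theorem patchGoal_mk (hd : 1 ≤ d) (hs₁ : 0 < s₁) (hs₂ : 0 < s₂) {P P₁ K : Finset (Prism d)}
    {Q : Prism d} (hw : WhileLoop s₁ s₂ P ∅ {Q} P₁ K) (ih : WhileGoal M s₁ s₂ P ∅ {Q} P₁ K) :
    PatchGoal M s₁ s₂ P Q ((P₁ \ K) ∪ K.biUnion (Prism.atomicSplit s₁ s₂)) := by
  intro hP
  have hmem : ∀ R, R ∈ (P₁ \ K) ∪ K.biUnion (Prism.atomicSplit s₁ s₂) ↔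
      (R ∈ P₁ ∧ R ∉ K) ∨ ∃ B ∈ K, R ∈ B.atomicSplit s₁ s₂ := fun R => by
    rw [Finset.mem_union, Finset.mem_sdiff, Finset.mem_biUnion]
  refine ⟨fun hQ => ?_, fun hQ => ?_⟩
  · obtain ⟨h1, h2, h3⟩ := ih Q ⟨hP, fun B hB => by
      have : B = Q := by simpa using hB
      rw [this]
      exact ⟨hQ, rfl, rfl, SameEdge.refl _⟩, Finset.empty_subset _, fun B hB => by simp at hB⟩
    have hQK : Q ∈ K := h3 (by simp)
    have hKP : K ⊆ P₁ := fun B hB => (h1.nodes B hB).1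
    have hN : ∀ B ∈ K, necessaryRefinements P₁ B ⊆ K := fun B hB R hR => by
      rcases (h1.visited B hB R hR).2 with h | ⟨R₁, h, h', -⟩
      · exact h
      · exact absurd h h'
    have hsplit : ∀ B ∈ K, B.atomicSplit s₁ s₂ ⊆
        (P₁ \ K) ∪ K.biUnion (Prism.atomicSplit s₁ s₂) := fun B hB R hR =>
      (hmem R).2 (Or.inr ⟨B, hB, hR⟩)
    refine ⟨h1.regular.split_star hd hs₁ hs₂ hQK hKP (fun B hB => (h1.nodes B hB).2.1)
      (fun B hB => (h1.nodes B hB).2.2.1) (fun B hB => (h1.nodes B hB).2.2.2) hN hmem,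
      (h2.mono (Nat.le_succ _)).trans (splitChain_of_split_all hd hs₁ hs₂ h1.regular.toMeshInv K
        hKP (fun B hB => by rw [(h1.nodes B hB).2.2.1]; omega) hmem), hsplit Q hQK,
      fun R hR hRl hRn => ?_⟩
    have hRP₁ := h2.mem_of_level hR hRl.ge
    have hRK : R ∈ K := by
      by_contra h
      exact hRn ((hmem R).2 (Or.inl ⟨hRP₁, h⟩))
    exact ⟨(h1.nodes R hRK).2.1, (h1.nodes R hRK).2.2.2, hsplit R hRK⟩
  · -- no neighbour has to be refined, so that the loop only collects `Q`
    have hres := hw.of_singleton (hQ.necessaryRefinements_eq_empty hd hP)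
    rw [hres.1, hres.2, Finset.singleton_biUnion,
      Finset.sdiff_singleton_eq_erase,
      Finset.erase_eq_of_notMem (hQ.notMem hd hs₁ hs₂ hP.toMeshInv)]
    exact Finset.union_eq_left.2 hQ.split

open scoped Classical in
/-- The specification of the patch refinement, by mutual induction on the run of the algorithm. -/
theorem PatchRefine.patchGoal (hd : 1 ≤ d) (hs₁ : 0 < s₁) (hs₂ : 0 < s₂)
    {P P' : Finset (Prism d)} {Q : Prism d} (h : PatchRefine s₁ s₂ P Q P') :
    PatchGoal M s₁ s₂ P Q P' := by
  refine PatchRefine.rec (motive_1 := fun P Q P' _ => PatchGoal M s₁ s₂ P Q P')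
    (motive_2 := fun P K F P' K' _ => WhileGoal M s₁ s₂ P K F P' K')
    (motive_3 := fun K F l P N P' N' _ => OuterGoal M s₁ s₂ K F l P N P' N')
    (motive_4 := fun Q l P N P' N' _ => InnerGoal M s₁ s₂ Q l P N P' N')
    (fun hw ih => patchGoal_mk hd hs₁ hs₂ hw ih) ?_ ?_ ?_ ?_ ?_ ?_ ?_ h
  · intro P K Q hinv
    rw [Finset.union_empty] at hinv ⊢
    exact ⟨hinv, Relation.ReflTransGen.refl, Finset.Subset.rfl⟩
  · intro P K F P₁ N P₂ K₂ l hF hnd hl _ _ ih ih' Q hinv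
    obtain ⟨h1, h2⟩ := ih Q K (by rw [hl]; exact Finset.subset_union_right)
      (by rw [Finset.union_empty]; exact hinv)
    rw [hl] at h1
    obtain ⟨h3, h4, h5⟩ := ih' Q h1
    exact ⟨h3, h2.trans h4, Finset.subset_union_left.trans h5⟩
  · intro K F P N Q V _ hinv
    rw [List.toFinset_nil, Finset.union_empty]
    exact ⟨hinv, Relation.ReflTransGen.refl⟩
  · intro K F P N P₁ N₁ P₂ N₂ Q' l l' _ hl' _ _ ih ih'
    exact outerGoal_cons hd hl' ih ih'
  · intro Q P N P₀ _ _ hinv _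
    exact ⟨hinv, Finset.Subset.rfl, Relation.ReflTransGen.refl, fun A hA => by simp at hA⟩
  · intro Q A l P N P₂ N₂ hl _ ih
    exact innerGoal_same hd hl ih
  · intro Q A l P N P₁ P₂ N₂ hne _ _ ih ih'
    exact innerGoal_recurse hd hs₁ hs₂ hne ih ih'

theorem regular_mesh (hd : 1 ≤ d) : Regular M s₁ s₂ M.mesh := by
  have hl : ∀ Q ∈ M.mesh, Q.level = 0 := fun Q hQ =>
    M.level_eq_zero _ (Finset.mem_product.1 hQ).2
  refine ⟨MeshInv.initial hd, fun t => ?_, fun Q hQ Q' _ _ _ => ?_, fun _ Q hQ Q' _ _ _ => ?_⟩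
  · have hsub : ∀ S ∈ activeTriangulation M.mesh t, S ∈ M.triangulation := fun S hS => by
      obtain ⟨I, hI, -, rfl⟩ := mem_activeTriangulation.1 hS
      exact (Finset.mem_product.1 hI).2
    exact fun S hS S' hS' => M.conforming S (hsub S hS) S' (hsub S' hS')
  · rw [hl Q hQ]; exact Nat.zero_le _
  · rw [hl Q hQ]; exact Nat.zero_le _

theorem IsRegularRefinement.regular (hd : 1 ≤ d) (hs₁ : 0 < s₁) (hs₂ : 0 < s₂)
    {P : Finset (Prism d)} (h : IsRegularRefinement s₁ s₂ M.mesh P) : Regular M s₁ s₂ P :=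
  ⟨h.atomicReachable.meshInv hd hs₁ hs₂, h.conformingInSpace, h.oneIrregularInTime,
    h.oneIrregularInSpace⟩

theorem Reachable.regular (hd : 1 ≤ d) (hs₁ : 0 < s₁) (hs₂ : 0 < s₂)
    {P : Finset (Prism d)} (h : Reachable s₁ s₂ M.mesh P) : Regular M s₁ s₂ P := by
  induction h with
  | refl => exact regular_mesh hd
  | step _ hQ hp ih => exact ((hp.patchGoal hd hs₁ hs₂ ih).1 hQ).regular

end SpaceTimeMesh

namespace SpaceTimeMesh

/-! ### Diameters of the simplices of the forest -/

variable {d : ℕ}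

open TaggedSimplex

/-- The length of the polygonal path `f 0, f 1, …, f n`. -/
noncomputable def pathLength (f : ℕ → Space d) (n : ℕ) : ℝ :=
  ∑ j ∈ Finset.range n, dist (f j) (f (j + 1))

theorem dist_le_pathLength (f : ℕ → Space d) (n : ℕ) : dist (f 0) (f n) ≤ pathLength f n :=
  dist_le_range_sum_dist f n

theorem pathLength_mono (f : ℕ → Space d) : Monotone (pathLength f) := fun _ _ h =>
  Finset.sum_le_sum_of_subset_of_nonneg (Finset.range_mono h) fun _ _ _ => dist_nonneg

theorem pathLength_nonneg (f : ℕ → Space d) (n : ℕ) : 0 ≤ pathLength f n :=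
  Finset.sum_nonneg fun _ _ => dist_nonneg

theorem pathLength_reverse (f : ℕ → Space d) (n : ℕ) :
    pathLength (fun j => f (n - j)) n = pathLength f n := by
  rw [pathLength, pathLength, ← Finset.sum_range_reflect]
  refine Finset.sum_congr rfl fun j hj => ?_
  have := Finset.mem_range.1 hj
  rw [dist_comm]
  congr 2 <;> omega

theorem pathLength_cons (f : ℕ → Space d) (a : Space d) {n m : ℕ} (hn : n + 1 = m) :
    pathLength (fun j => if j = 0 then a else f (j - 1)) m = pathLength f n + dist a (f 0) := by
  subst hn
  rw [pathLength, Finset.sum_range_succ', pathLength]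
  simp

theorem pathLength_le {f : ℕ → Space d} {n : ℕ} {D : ℝ} (h : ∀ j, dist (f j) (f (j + 1)) ≤ D) :
    pathLength f n ≤ n * D := by
  refine (Finset.sum_le_sum fun j _ => h j).trans ?_
  simp

/-- The outer path of a tagged simplex `(x₀, …, x_d)_γ` visits `x₀, x_{γ+1}, …, x_d`, and the inner
path visits `(x₀ + x_d)/2, x₁, …, x_γ`. The length of the outer path plus twice the length of the
inner path is at most `L`. Bisection does not increase this quantity, and it is halved whenever the
type returns to `0`. -/
def PathBound (S : TaggedSimplex d) (L : ℝ) : Prop :=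
  ∃ o i : ℕ → Space d, o 0 = S.head ∧
    (∀ j (hj : j < d + 1), S.type < j → o (j - S.type) = S.vertex ⟨j, hj⟩) ∧ i 0 = S.mid ∧
    (∀ j (hj : j < d + 1), 1 ≤ j → j ≤ S.type → i j = S.vertex ⟨j, hj⟩) ∧
    pathLength o (d - S.type) + 2 * pathLength i S.type ≤ L

theorem PathBound.reverse {S : TaggedSimplex d} {L : ℝ} (ht : S.type < d) (h : PathBound S L) :
    PathBound S.reverse L := by
  obtain ⟨o, i, h1, h2, h3, h4, h5⟩ := h
  have htl : o (d - S.type) = S.tail := h2 d (by omega) ht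
  refine ⟨fun j => o (d - S.type - j), i, by rw [head_reverse]; exact htl,
    fun j hj hjt => ?_, ?_, fun j hj h1j hjt => ?_, ?_⟩
  · change S.type < j at hjt
    change o (d - S.type - (j - S.type)) = _
    have h0 : ¬ j = 0 := by omega
    by_cases hjd : j = d
    · subst hjd
      rw [Nat.sub_self, h1]
      simp [TaggedSimplex.reverse, head, h0]
    · simp only [TaggedSimplex.reverse, h0, hjd, if_false, dif_neg (not_le.2 hjt)]
      rw [← h2 (d + S.type - j) (by omega) (by omega)]
      congr 1
      omega
  · rw [h3, mid, mid, head_reverse, tail_reverse _ (by omega), midpoint_comm]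
  · change j ≤ S.type at hjt
    have h0 : ¬ j = 0 := by omega
    have hjd : ¬ j = d := by omega
    simp only [TaggedSimplex.reverse, h0, hjd, if_false, dif_pos hjt]
    exact h4 j hj h1j hjt
  · change pathLength (fun j => o (d - S.type - j)) (d - S.type) + 2 * pathLength i S.type ≤ L
    rw [pathLength_reverse]
    exact h5

/-- The outer path loses its last step. The inner path is extended to the midpoint of the child, and
this new step is at most half as long as the lost one. -/
theorem PathBound.leftChild_of_lt {S : TaggedSimplex d} {L : ℝ} (ht : S.type + 1 < d)
    (h : PathBound S L) : PathBound S.leftChild L := by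
  obtain ⟨o, i, h1, h2, h3, h4, h5⟩ := h
  have hty : S.leftChild.type = S.type + 1 := Nat.mod_eq_of_lt ht
  have htl : o (d - S.type) = S.tail := h2 d (by omega) (by omega)
  have hctl : o (d - S.type - 1) = S.leftChild.tail := by
    have := leftChild_vertex S d (by omega)
    rw [← h2 (d - 1) (by omega) (by omega)] at this
    rw [tail]
    refine Eq.trans ?_ this.symm
    congr 1
    omega
  refine ⟨o, fun j => if j = 0 then S.leftChild.mid else i (j - 1), h1, fun j hj hjt => ?_, by simp,
    fun j hj h1j hjt => ?_, ?_⟩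
  · rw [hty] at hjt ⊢
    rw [leftChild_vertex S j (by omega), ← h2 (j - 1) (by omega) (by omega)]
    congr 1
    omega
  · rw [hty] at hjt
    simp only [if_neg (show ¬ j = 0 by omega)]
    by_cases h : j = 1
    · subst h
      rw [Nat.sub_self, h3]
      rfl
    · rw [leftChild_vertex S j (by omega), ← h4 (j - 1) (by omega) (by omega) (by omega)]
  · rw [hty]
    have e1 : pathLength o (d - S.type) = pathLength o (d - (S.type + 1)) +
        dist S.leftChild.tail S.tail := by
      have : d - S.type = d - (S.type + 1) + 1 := by omega
      rw [← hctl, ← htl, this, pathLength, Finset.sum_range_succ, pathLength,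
        Nat.add_sub_cancel]
    have e2 : pathLength (fun j => if j = 0 then S.leftChild.mid else i (j - 1)) (S.type + 1) =
        pathLength i S.type + dist S.leftChild.mid S.mid := by
      rw [pathLength_cons i _ rfl, h3]
    have e3 : dist S.leftChild.mid S.mid ≤ dist S.leftChild.tail S.tail / 2 := by
      rw [mid, mid]
      have := dist_midpoint_midpoint_le (S.leftChild.head) (S.leftChild.tail) S.head S.tail
      rw [show S.leftChild.head = S.head from rfl, dist_self, zero_add] at this
      exact this
    rw [e2]
    linarith

/-- For the maximal type the outer path is the refinement edge, and the inner path, extended to the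
end point of this edge, becomes the outer path of the child. -/
theorem PathBound.leftChild_of_eq {S : TaggedSimplex d} {L : ℝ} (ht : S.type + 1 = d)
    (h : PathBound S L) : PathBound S.leftChild (L / 2) := by
  obtain ⟨o, i, h1, h2, h3, h4, h5⟩ := h
  have hty : S.leftChild.type = 0 := by
    change (S.type + 1) % d = 0
    rw [ht, Nat.mod_self]
  have htl : o (d - S.type) = S.tail := h2 d (by omega) (by omega)
  refine ⟨fun j => if j = 0 then S.head else i (j - 1), fun _ => S.leftChild.mid, by simp; rfl,
    fun j hj hjt => ?_, rfl, fun j hj h1j hjt => ?_, ?_⟩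
  · rw [hty] at hjt ⊢
    rw [Nat.sub_zero]
    simp only [if_neg (show ¬ j = 0 by omega)]
    by_cases h : j = 1
    · subst h
      rw [Nat.sub_self, h3]
      rfl
    · rw [leftChild_vertex S j (by omega), ← h4 (j - 1) (by omega) (by omega) (by omega)]
  · omega
  · rw [hty]
    have e1 : pathLength o (d - S.type) = dist S.head S.tail := by
      have : d - S.type = 1 := by omega
      rw [this] at htl ⊢
      simp [pathLength, h1, htl]
    have e2 : pathLength (fun j => if j = 0 then S.head else i (j - 1)) (d - 0) =
        pathLength i S.type + dist S.head S.mid := by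
      rw [Nat.sub_zero, pathLength_cons i _ ht, h3]
    have e3 : dist S.head S.mid = dist S.head S.tail / 2 := by
      rw [mid, dist_left_midpoint]
      norm_num
      ring
    rw [e1] at h5
    rw [e2, e3]
    simp [pathLength] at h5 ⊢
    linarith

theorem PathBound.child {S c : TaggedSimplex d} {L : ℝ} (ht : S.type < d) (hc : S.IsChild c)
    (h : PathBound S L) :
    (S.type + 1 < d → PathBound c L) ∧ (S.type + 1 = d → PathBound c (L / 2)) := by
  rcases hc with rfl | rfl
  · exact ⟨fun h' => h.leftChild_of_lt h', fun h' => h.leftChild_of_eq h'⟩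
  · rw [← leftChild_reverse S (by omega)]
    exact ⟨fun h' => (h.reverse ht).leftChild_of_lt h', fun h' => (h.reverse ht).leftChild_of_eq h'⟩

theorem PathBound.dist_le {S : TaggedSimplex d} {L : ℝ} (ht : S.type < d) (h : PathBound S L)
    {x y : Space d} (hx : x ∈ S.carrier) (hy : y ∈ S.carrier) : dist x y ≤ 2 * L := by
  obtain ⟨o, i, h1, h2, h3, h4, h5⟩ := h
  have htl : o (d - S.type) = S.tail := h2 d (by omega) (by omega)
  have hn := pathLength_nonneg i S.type
  have hsub : S.carrier ⊆ Metric.closedBall S.head L := by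
    refine convexHull_min ?_ (convex_closedBall _ _)
    rintro _ ⟨⟨j, hj⟩, rfl⟩
    rw [Metric.mem_closedBall']
    by_cases hj0 : j = 0
    · subst hj0
      have : S.vertex ⟨0, hj⟩ = S.head := rfl
      rw [this, dist_self]
      exact (add_nonneg (pathLength_nonneg _ _) (by positivity)).trans h5
    by_cases hjt : S.type < j
    · rw [← h2 j hj hjt, ← h1]
      have e1 := dist_le_pathLength o (j - S.type)
      have e2 := pathLength_mono o (show j - S.type ≤ d - S.type by omega)
      linarith
    · have e1 := dist_le_pathLength i j
      have e2 := pathLength_mono i (not_lt.1 hjt)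
      have e3 := dist_le_pathLength o (d - S.type)
      have e4 : dist S.head S.mid ≤ dist S.head S.tail := by
        rw [mid, dist_left_midpoint]
        norm_num
        linarith [dist_nonneg (x := S.head) (y := S.tail)]
      rw [h4 j hj (by omega) (not_lt.1 hjt), h3] at e1
      rw [h1, htl] at e3
      have := dist_triangle S.head S.mid (S.vertex ⟨j, hj⟩)
      linarith
  have hx' := hsub hx
  have hy' := hsub hy
  rw [Metric.mem_closedBall] at hx' hy'
  have := dist_triangle_right x y S.head
  linarith

theorem pathBound_of_dist_le {S : TaggedSimplex d} {D : ℝ} (ht : S.type < d)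
    (h : ∀ x ∈ S.carrier, ∀ y ∈ S.carrier, dist x y ≤ D) : PathBound S (2 * d * D) := by
  have hv : ∀ j, S.vertex ⟨min j d, by omega⟩ ∈ S.carrier := fun j =>
    verts_subset_carrier S (S.vertex_mem _)
  have hD : 0 ≤ D := dist_nonneg.trans (h _ (hv 0) _ (hv 0))
  have ho : ∀ j : ℕ, (if j = 0 then S.head else S.vertex ⟨min (S.type + j) d, by omega⟩) ∈
      S.carrier := fun j => by
    split_ifs
    · exact verts_subset_carrier S S.head_mem
    · exact hv _
  have hi : ∀ j : ℕ, (if j = 0 then S.mid else S.vertex ⟨min j d, by omega⟩) ∈ S.carrier :=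
    fun j => by
    split_ifs
    · exact S.mid_mem_carrier
    · exact hv _
  refine ⟨fun j => if j = 0 then S.head else S.vertex ⟨min (S.type + j) d, by omega⟩,
    fun j => if j = 0 then S.mid else S.vertex ⟨min j d, by omega⟩, by simp, fun j hj hjt => ?_,
    by simp, fun j hj h1j hjt => ?_, ?_⟩
  · dsimp only
    rw [if_neg (by omega)]
    exact S.vertex_congr (by simp only; omega)
  · dsimp only
    rw [if_neg (by omega)]
    exact S.vertex_congr (by simp only; omega)
  · have e1 := pathLength_le (n := d - S.type) fun j => h _ (ho j) _ (ho (j + 1))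
    have e2 := pathLength_le (n := S.type) fun j => h _ (hi j) _ (hi (j + 1))
    have e3 : ((d - S.type : ℕ) : ℝ) = d - S.type := Nat.cast_sub ht.le
    rw [e3] at e1
    have e4 : (S.type : ℝ) ≤ d := by exact_mod_cast ht.le
    nlinarith

variable {M : InitialMesh d}

/-- The diameters of the simplices of level `n` are of the order `2 ^ (-n / d)`. -/
theorem InForest.dist_pow_le (hd : 1 ≤ d) {D : ℝ}
    (hD : ∀ S ∈ M.triangulation, ∀ x ∈ S.carrier, ∀ y ∈ S.carrier, dist x y ≤ D)
    {S : TaggedSimplex d} (hS : InForest M S) {x y : Space d} (hx : x ∈ S.carrier)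
    (hy : y ∈ S.carrier) : dist x y ^ d ≤ (8 * d * D) ^ d / 2 ^ S.level := by
  -- `h` is the number of completed cycles of `d` bisections
  have key : ∀ {S : TaggedSimplex d}, InForest M S →
      ∃ h : ℕ, S.level ≤ d * h + S.type ∧ PathBound S (2 * d * D / 2 ^ h) := by
    intro S hS
    induction hS with
    | base hS =>
      refine ⟨0, by rw [M.level_eq_zero _ hS]; omega, ?_⟩
      rw [pow_zero, div_one]
      exact pathBound_of_dist_le (InForest.type_lt hd (.base hS)) (hD _ hS)
    | child hS hc ih =>
      obtain ⟨h, h1, h2⟩ := ih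
      have ht := hS.type_lt hd
      rcases Nat.lt_or_ge (_ + 1) d with hlt | hge
      · refine ⟨h, ?_, (h2.child ht hc).1 hlt⟩
        rw [hc.level, hc.type, Nat.mod_eq_of_lt hlt]
        omega
      · have heq := le_antisymm ht hge
        refine ⟨h + 1, ?_, ?_⟩
        · rw [hc.level, hc.type, heq, Nat.mod_self, mul_add]
          omega
        · rw [pow_succ, ← div_div]
          exact (h2.child ht hc).2 heq
  obtain ⟨h, h1, h2⟩ := key hS
  have ht := hS.type_lt hd
  have h3 := h2.dist_le ht hx hy
  have h4 : (2 : ℝ) ^ S.level ≤ 2 ^ d * (2 ^ h) ^ d := by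
    rw [← pow_mul, ← pow_add]
    refine pow_le_pow_right₀ (by norm_num) ?_
    rw [mul_comm h d]
    omega
  rw [le_div_iff₀ (by positivity)]
  calc dist x y ^ d * 2 ^ S.level ≤ (2 * (2 * d * D / 2 ^ h)) ^ d * (2 ^ d * (2 ^ h) ^ d) := by
        have := (dist_nonneg (x := x) (y := y)).trans h3
        gcongr
    _ = (8 * d * D) ^ d := by
        rw [← mul_pow, ← mul_pow]
        congr 1
        field_simp
        ring

end SpaceTimeMesh

namespace SpaceTimeMesh

/-! ### Volumes of the simplices of the forest -/

variable {d : ℕ}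

open TaggedSimplex

/-- The two children have the same volume, since the affine involution that interchanges the end
points of the refinement edge and fixes the other vertices maps one to the other. -/
theorem TaggedSimplex.volume_children_eq {S : TaggedSimplex d} (hS : S.Nondeg) (hd : 1 ≤ d)
    (ht : S.type < d) : volume S.rightChild.carrier = volume S.leftChild.carrier := by
  classical
  have htop : affineSpan ℝ (range S.vertex) = ⊤ := by
    rw [AffineIndependent.affineSpan_eq_top_iff_card_eq_finrank_add_one hS]
    simp
  let b : AffineBasis (Fin (d + 1)) ℝ (Space d) := ⟨S.vertex, hS, htop⟩
  have hb : ∀ i, b i = S.vertex i := fun _ => rfl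
  have hl0 : Fin.last d ≠ 0 := Fin.ne_of_val_ne (by simp; omega)
  set l : Space d →ᵃ[ℝ] ℝ := b.coord 0 - b.coord (Fin.last d) with hl
  set u : Space d := S.tail - S.head with hu
  -- `f` moves `head` by `tail - head`, `tail` by the opposite vector, and fixes the other vertices
  let f : Space d →ᵃ[ℝ] Space d :=
    AffineMap.id ℝ _ + (LinearMap.toSpanSingleton ℝ (Space d) u).toAffineMap.comp l
  have hf : ∀ x, f x = x + l x • u := fun x => by simp [f]
  have hlv : ∀ i, l (S.vertex i) = (if i = 0 then 1 else 0) - if i = Fin.last d then 1 else 0 := by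
    intro i
    rw [← hb, hl]
    simp only [AffineMap.coe_sub, Pi.sub_apply, AffineBasis.coord_apply, eq_comm]
  have hhead : l S.head = 1 := by
    rw [head, hlv, if_pos rfl, if_neg hl0.symm, sub_zero]
  have htail : l S.tail = -1 := by
    rw [tail, hlv, if_neg hl0, if_pos rfl, zero_sub]
  have hlu : l.linear u = -2 := by
    have := l.linearMap_vsub S.tail S.head
    rw [vsub_eq_sub, vsub_eq_sub, hhead, htail] at this
    rw [hu, this]
    norm_num
  have hff : ∀ x, f (f x) = x := fun x => by
    have : l (x + l x • u) = -l x := by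
      have h := l.map_vadd x (l x • u)
      rw [vadd_eq_add, vadd_eq_add, add_comm, map_smul, hlu, smul_eq_mul] at h
      rw [h]
      ring
    rw [hf (f x), hf x, this, neg_smul, add_neg_cancel_right]
  have hfh : f S.head = S.tail := by rw [hf, hhead, one_smul, hu, add_sub_cancel]
  have hft : f S.tail = S.head := by rw [← hfh, hff]
  have hfv : ∀ v ∈ S.verts, v ≠ S.head → v ≠ S.tail → f v = v := by
    intro v hv h1 h2
    obtain ⟨i, rfl⟩ := mem_verts.1 hv
    have h0 : i ≠ 0 := fun h => h1 (by rw [h]; rfl)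
    have hi : i ≠ Fin.last d := fun h => h2 (by rw [h]; rfl)
    rw [hf, hlv, if_neg h0, if_neg hi, sub_zero, zero_smul, add_zero]
  have hmid : f S.mid = S.mid := by
    rw [mid, AffineMap.map_midpoint, hfh, hft, midpoint_comm]
  have himage : f '' S.leftChild.carrier ⊆ S.rightChild.carrier := by
    rw [carrier_eq, carrier_eq, AffineMap.image_convexHull]
    refine convexHull_mono ?_
    rintro _ ⟨v, hv, rfl⟩
    rw [Finset.mem_coe, verts_leftChild hS hd, mem_halfVerts] at hv
    rw [Finset.mem_coe, verts_rightChild hS hd ht, mem_halfVerts]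
    rcases hv with rfl | ⟨h1, h2⟩
    · exact Or.inl (hmid.trans (midpoint_comm ..))
    · refine Or.inr ?_
      by_cases h3 : v = S.head
      · rw [h3, hfh]
        exact ⟨(hS.head_ne_tail hd).symm, S.tail_mem⟩
      · rw [hfv v h2 h3 h1]
        exact ⟨h3, h2⟩
  have himage' : f '' S.rightChild.carrier ⊆ S.leftChild.carrier := by
    rw [carrier_eq, carrier_eq, AffineMap.image_convexHull]
    refine convexHull_mono ?_
    rintro _ ⟨v, hv, rfl⟩
    rw [Finset.mem_coe, verts_rightChild hS hd ht, mem_halfVerts] at hv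
    rw [Finset.mem_coe, verts_leftChild hS hd, mem_halfVerts]
    rcases hv with rfl | ⟨h1, h2⟩
    · exact Or.inl ((congrArg f (midpoint_comm ..)).trans hmid)
    · refine Or.inr ?_
      by_cases h3 : v = S.tail
      · rw [h3, hft]
        exact ⟨hS.head_ne_tail hd, S.head_mem⟩
      · rw [hfv v h2 h1 h3]
        exact ⟨h3, h2⟩
  have heq : S.rightChild.carrier = f '' S.leftChild.carrier := by
    refine Subset.antisymm (fun x hx => ⟨f x, himage' ⟨x, hx, rfl⟩, hff x⟩) himage
  -- the linear part of an involution is of determinant `±1`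
  have hdet : |LinearMap.det f.linear| = 1 := by
    have hcomp : f.linear ∘ₗ f.linear = LinearMap.id := by
      have : f.comp f = AffineMap.id ℝ _ := by
        ext1 x
        exact hff x
      rw [← AffineMap.comp_linear, this]
      rfl
    have := congrArg LinearMap.det hcomp
    rw [LinearMap.det_comp, LinearMap.det_id] at this
    rw [← sq_eq_sq₀ (abs_nonneg _) zero_le_one, sq_abs, one_pow, sq, this]
  have hdecomp : f '' S.leftChild.carrier =
      (fun x => x + f 0) '' (f.linear '' S.leftChild.carrier) := by
    rw [image_image]
    refine image_congr fun x _ => ?_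
    exact congrFun f.decomp x
  rw [heq, hdecomp, image_add_right, measure_preimage_add_right,
    Measure.addHaar_image_linearMap, hdet, ENNReal.ofReal_one, one_mul]

theorem TaggedSimplex.volume_ne_top (S : TaggedSimplex d) : volume S.carrier ≠ ⊤ :=
  S.isCompact_carrier.measure_lt_top.ne

theorem TaggedSimplex.IsChild.volume_ge {S c : TaggedSimplex d} (hS : S.Nondeg) (hd : 1 ≤ d)
    (ht : S.type < d) (hc : S.IsChild c) :
    volume.real S.carrier / 2 ≤ volume.real c.carrier := by
  have h1 : S.carrier ⊆ S.leftChild.carrier ∪ S.rightChild.carrier := fun x hx => by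
    obtain ⟨R, hR, hxR⟩ := exists_child_of_mem hS hd ht hx
    rcases hR with rfl | rfl
    · exact Or.inl hxR
    · exact Or.inr hxR
  have h2 : volume.real S.rightChild.carrier = volume.real S.leftChild.carrier := by
    rw [Measure.real, Measure.real, volume_children_eq hS hd ht]
  have h3 := (measureReal_mono h1 (measure_union_ne_top (volume_ne_top _) (volume_ne_top _))).trans
    (measureReal_union_le _ _)
  rcases hc with rfl | rfl <;> linarith

variable {M : InitialMesh d}

theorem InForest.volume_ge (hd : 1 ≤ d) {m : ℝ}
    (hm : ∀ S ∈ M.triangulation, m ≤ volume.real S.carrier) {S : TaggedSimplex d}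
    (hS : InForest M S) : m / 2 ^ S.level ≤ volume.real S.carrier := by
  induction hS with
  | base h => rw [M.level_eq_zero _ h, pow_zero, div_one]; exact hm _ h
  | child hS hc ih =>
    refine le_trans ?_ (hc.volume_ge (hS.nondeg hd) hd (hS.type_lt hd))
    rw [hc.level, pow_succ, ← div_div]
    linarith

/-! ### The size of the initial elements -/

namespace InitialMesh

variable (M)

theorem exists_mem_intervals : ∃ I, I ∈ M.intervals := by
  obtain ⟨I, hI, -⟩ := exists_interval (M := M) (t := 0) ⟨le_rfl, by
    rw [T, ← M.time_zero]
    exact M.time_strictMono.monotone (Fin.zero_le _)⟩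
  exact ⟨I, hI⟩

theorem exists_mem_triangulation : ∃ S, S ∈ M.triangulation := by
  obtain ⟨x, hx⟩ := M.domain.isConnected.nonempty
  have := subset_closure hx
  rw [← M.cover, mem_iUnion₂] at this
  obtain ⟨S, hS, -⟩ := this
  exact ⟨S, hS⟩

instance : Nonempty M.mesh := by
  obtain ⟨I, hI⟩ := M.exists_mem_intervals
  obtain ⟨S, hS⟩ := M.exists_mem_triangulation
  exact ⟨⟨(I, S), Finset.mem_product.2 ⟨hI, hS⟩⟩⟩

variable {M}

theorem volume_real_interval {I : TimeInterval} (h : I.lo < I.hi) :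
    volume.real I.carrier = I.hi - I.lo := by
  rw [Measure.real, TimeInterval.carrier]
  split_ifs
  · rw [Real.volume_Icc, ENNReal.toReal_ofReal (by linarith)]
  · rw [Real.volume_Ico, ENNReal.toReal_ofReal (by linarith)]

theorem length_bounds {I : TimeInterval} (hI : I ∈ M.intervals) :
    M.mu₂ ≤ I.hi - I.lo ∧ I.hi - I.lo ≤ M.mu₁ := by
  obtain ⟨S, hS⟩ := M.exists_mem_triangulation
  rw [← volume_real_interval (intervals_lt hI).1]
  exact ⟨ciInf_le (Set.finite_range _).bddBelow
      (⟨(I, S), Finset.mem_product.2 ⟨hI, hS⟩⟩ : M.mesh),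
    le_ciSup (f := fun Q : M.mesh => volume.real (Q : Prism d).1.carrier)
      (Set.finite_range _).bddAbove ⟨(I, S), Finset.mem_product.2 ⟨hI, hS⟩⟩⟩

theorem volume_bounds {S : TaggedSimplex d} (hS : S ∈ M.triangulation) :
    M.mu₄ ≤ volume.real S.carrier ∧ volume.real S.carrier ≤ M.mu₃ ∧ S.shapeConstant ≤ M.kappa := by
  obtain ⟨I, hI⟩ := M.exists_mem_intervals
  have hQ : (I, S) ∈ M.mesh := Finset.mem_product.2 ⟨hI, hS⟩
  exact ⟨ciInf_le (Set.finite_range _).bddBelow (⟨(I, S), hQ⟩ : M.mesh),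
    le_ciSup (f := fun Q : M.mesh => volume.real (Q : Prism d).2.carrier)
      (Set.finite_range _).bddAbove ⟨(I, S), hQ⟩,
    le_ciSup (f := fun Q : M.mesh => (Q : Prism d).2.shapeConstant)
      (Set.finite_range _).bddAbove ⟨(I, S), hQ⟩⟩

theorem mu₂_pos : 0 < M.mu₂ := by
  obtain ⟨Q, hQ⟩ := exists_eq_ciInf_of_finite
    (f := fun Q : M.mesh => volume.real (Q : Prism d).1.carrier)
  have h := (intervals_lt (Finset.mem_product.1 Q.2).1).1
  rw [mu₂, ← hQ, volume_real_interval h]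
  exact sub_pos.2 h

theorem mu₄_pos : 0 < M.mu₄ := by
  obtain ⟨Q, hQ⟩ := exists_eq_ciInf_of_finite
    (f := fun Q : M.mesh => volume.real (Q : Prism d).2.carrier)
  have h : (Q : Prism d).2.Nondeg := M.nondegenerate _ (Finset.mem_product.1 Q.2).2
  rw [mu₄, ← hQ]
  exact ENNReal.toReal_pos ((isOpen_interior.measure_pos volume h.interior_nonempty).trans_le
    (measure_mono interior_subset)).ne' (volume_ne_top _)

/-- The diameters of the initial simplices are controlled: by shape regularity a simplex of large
diameter contains a large ball, whose volume is at most the volume of the simplex. -/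
theorem dist_le {S : TaggedSimplex d} (hd : 1 ≤ d) (hS : S ∈ M.triangulation) {x y : Space d}
    (hx : x ∈ S.carrier) (hy : y ∈ S.carrier) :
    dist x y ≤ M.kappa * max 1 (M.mu₃ / volume.real (Metric.ball (0 : Space d) 1)) := by
  set B : Set ℝ := {ρ : ℝ | 0 < ρ ∧ ∃ x₀ ∈ S.carrier, Metric.ball x₀ ρ ⊆ S.carrier} with hB
  set v := volume.real (Metric.ball (0 : Space d) 1) with hv
  obtain ⟨-, hvol, hκ⟩ := volume_bounds hS
  have hvpos : 0 < v := ENNReal.toReal_pos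
    (Metric.measure_ball_pos volume _ one_pos).ne' measure_ball_lt_top.ne
  have hbound : ∀ ρ ∈ B, ρ ≤ max 1 (M.mu₃ / v) := by
    rintro ρ ⟨hρ, x₀, -, hsub⟩
    rcases le_total ρ 1 with h1 | h1
    · exact h1.trans (le_max_left _ _)
    refine le_trans ?_ (le_max_right _ _)
    rw [le_div_iff₀ hvpos]
    have h2 : volume.real (Metric.ball x₀ ρ) = ρ ^ d * v := by
      rw [Measure.real, Measure.addHaar_ball_of_pos volume x₀ hρ, ENNReal.toReal_mul,
        ENNReal.toReal_ofReal (by positivity), finrank_euclideanSpace_fin]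
      rfl
    have h3 := measureReal_mono hsub (volume_ne_top S)
    rw [h2] at h3
    have h4 : ρ ≤ ρ ^ d := le_self_pow₀ h1 (by omega)
    nlinarith
  obtain ⟨z, hz⟩ := (show S.Nondeg from M.nondegenerate _ hS).interior_nonempty
  obtain ⟨ρ, hρ, hsub⟩ := Metric.isOpen_iff.1 isOpen_interior z hz
  have hρB : ρ ∈ B := ⟨hρ, z, interior_subset hz, hsub.trans interior_subset⟩
  have hsup : 0 < sSup B := hρ.trans_le (le_csSup ⟨_, hbound⟩ hρB)
  have hdiam := Metric.dist_le_diam_of_mem S.isCompact_carrier.isBounded hx hy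
  have hsc : S.shapeConstant * sSup B = Metric.diam S.carrier :=
    div_mul_cancel₀ _ hsup.ne'
  have hnn : 0 ≤ S.shapeConstant := div_nonneg Metric.diam_nonneg hsup.le
  calc dist x y ≤ S.shapeConstant * sSup B := hsc ▸ hdiam
    _ ≤ M.kappa * max 1 (M.mu₃ / v) :=
      mul_le_mul hκ (csSup_le ⟨ρ, hρB⟩ hbound) hsup.le (hnn.trans hκ)

end InitialMesh

end SpaceTimeMesh

namespace SpaceTimeMesh

/-! ### Comparable levels of touching prisms -/

variable {d : ℕ}

open TaggedSimplex

theorem MeetInFace.aedisjoint {S S' : TaggedSimplex d} (h : MeetInFace S S') (hS : S.Nondeg)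
    (hS' : S'.Nondeg) : AEDisjoint volume S.carrier S'.carrier := by
  have h1 : S.carrier ∩ S'.carrier ⊆
      affineSpan ℝ ((S.verts ∩ S'.verts : Finset (Space d)) : Set (Space d)) :=
    (carrier_inter_subset_hull h Subset.rfl Subset.rfl).trans (convexHull_subset_affineSpan _)
  exact measure_mono_null h1
    (Measure.addHaar_affineSubspace volume _ (affineSpan_finset_ne_top (h.card_le hS hS')))

/-- A shape-regular star has a bounded number of elements: shrunk towards the centre `x` of the
star, all its simplices fit into a ball of radius `r`, and each of them still has a volume that is
comparable to `r ^ d`. -/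
theorem card_star_le (hd : 1 ≤ d) {T : Finset (TaggedSimplex d)} {x : Space d}
    (hn : ∀ S ∈ T, S.Nondeg) (hT : ∀ S ∈ T, ∀ S' ∈ T, S ≠ S' → MeetInFace S S')
    (hx : ∀ S ∈ T, x ∈ S.carrier) {m A : ℝ} (hA : 0 < A)
    (hvol : ∀ S ∈ T, m / 2 ^ S.level ≤ volume.real S.carrier)
    (hdiam : ∀ S ∈ T, ∀ y ∈ S.carrier, dist y x ^ d ≤ A / 2 ^ S.level) :
    T.card * m ≤ A * volume.real (Metric.ball (0 : Space d) 1) := by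
  classical
  have hd0 : d ≠ 0 := by omega
  set b := T.sup TaggedSimplex.level with hb
  have hle : ∀ S ∈ T, S.level ≤ b := fun S hS => Finset.le_sup hS
  set r : ℝ := (A / 2 ^ b) ^ ((d : ℝ)⁻¹) with hr
  have hrpos : 0 < r := by positivity
  have hrd : r ^ d = A / 2 ^ b := Real.rpow_inv_natCast_pow (by positivity) hd0
  -- the factor by which a simplex of level `n` is shrunk
  set c : ℕ → ℝ := fun n => (2 ^ n / 2 ^ b : ℝ) ^ ((d : ℝ)⁻¹) with hc
  have hcpos : ∀ n, 0 < c n := fun n => by positivity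
  have hcd : ∀ n, c n ^ d = 2 ^ n / 2 ^ b := fun n =>
    Real.rpow_inv_natCast_pow (by positivity) hd0
  have hc1 : ∀ S ∈ T, c S.level ≤ 1 := fun S hS => by
    rw [← pow_le_one_iff_of_nonneg (hcpos _).le hd0, hcd, div_le_one (by positivity)]
    exact pow_le_pow_right₀ (by norm_num) (hle S hS)
  set F : TaggedSimplex d → Set (Space d) := fun S =>
    AffineMap.homothety x (c S.level) '' S.carrier with hF
  have hFsub : ∀ S ∈ T, F S ⊆ S.carrier := by
    rintro S hS _ ⟨y, hy, rfl⟩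
    rw [AffineMap.homothety_eq_lineMap]
    exact S.convex_carrier.lineMap_mem (hx S hS) hy ⟨(hcpos _).le, hc1 S hS⟩
  have hFball : ∀ S ∈ T, F S ⊆ Metric.closedBall x r := by
    rintro S hS _ ⟨y, hy, rfl⟩
    rw [Metric.mem_closedBall, dist_homothety_center, Real.norm_of_nonneg (hcpos _).le,
      ← pow_le_pow_iff_left₀ (by have := (hcpos S.level).le; positivity) hrpos.le hd0, mul_pow, hcd,
      hrd, dist_comm]
    calc (2 : ℝ) ^ S.level / 2 ^ b * dist y x ^ d
        ≤ 2 ^ S.level / 2 ^ b * (A / 2 ^ S.level) := by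
          gcongr
          exact hdiam S hS y hy
      _ = A / 2 ^ b := by field_simp
  have hFvol : ∀ S ∈ T, m / 2 ^ b ≤ volume.real (F S) := by
    intro S hS
    have h1 : volume.real (F S) = 2 ^ S.level / 2 ^ b * volume.real S.carrier := by
      rw [hF, Measure.real, Measure.addHaar_image_homothety, finrank_euclideanSpace_fin, hcd,
        ENNReal.toReal_mul, ENNReal.toReal_ofReal (abs_nonneg _), abs_of_pos (by positivity)]
      rfl
    rw [h1]
    calc m / 2 ^ b = 2 ^ S.level / 2 ^ b * (m / 2 ^ S.level) := by field_simp
      _ ≤ _ := by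
        gcongr
        exact hvol S hS
  have hFclosed : ∀ S ∈ T, IsClosed (F S) := fun S _ =>
    (S.isCompact_carrier.image (AffineMap.continuous_of_finiteDimensional _)).isClosed
  have hsum : volume (⋃ S ∈ T, F S) = ∑ S ∈ T, volume (F S) :=
    measure_biUnion_finset₀ (fun S hS S' hS' hne =>
      ((hT S hS S' hS' hne).aedisjoint (hn S hS) (hn S' hS')).mono (hFsub S hS) (hFsub S' hS'))
      fun S hS => (hFclosed S hS).measurableSet.nullMeasurableSet
  have hball : volume.real (Metric.closedBall x r) =
      r ^ d * volume.real (Metric.ball (0 : Space d) 1) := by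
    rw [Measure.real, Measure.addHaar_closedBall volume x hrpos.le, ENNReal.toReal_mul,
      ENNReal.toReal_ofReal (by positivity), finrank_euclideanSpace_fin]
    rfl
  have hfin : ∀ S ∈ T, volume (F S) ≠ ⊤ := fun S hS =>
    ((measure_mono (hFsub S hS)).trans_lt (lt_top_iff_ne_top.2 (volume_ne_top S))).ne
  have hmain : T.card * (m / 2 ^ b) ≤ A / 2 ^ b * volume.real (Metric.ball (0 : Space d) 1) := by
    calc T.card * (m / 2 ^ b) = ∑ _S ∈ T, m / 2 ^ b := by rw [Finset.sum_const, nsmul_eq_mul]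
      _ ≤ ∑ S ∈ T, volume.real (F S) := Finset.sum_le_sum hFvol
      _ = volume.real (⋃ S ∈ T, F S) := by
        rw [Measure.real, hsum, ENNReal.toReal_sum hfin]
        rfl
      _ ≤ volume.real (Metric.closedBall x r) :=
        measureReal_mono (iUnion₂_subset hFball) measure_closedBall_lt_top.ne
      _ = _ := by rw [hball, hrd]
  rw [← mul_div_assoc, div_mul_eq_mul_div] at hmain
  exact (div_le_div_iff_of_pos_right (by positivity)).1 hmain

variable {M : InitialMesh d} {s₁ s₂ : ℝ} {P : Finset (Prism d)}

theorem Regular.level_le_of_adjacent (hd : 1 ≤ d) (hP : Regular M s₁ s₂ P) {Q R : Prism d}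
    (hQ : Q ∈ P) (hR : R ∈ P) (ht : (Q.1.carrier ∩ R.1.carrier).Nonempty)
    (h : Adjacent Q.2 R.2) (hx : (Q.2.carrier ∩ R.2.carrier).Nonempty) :
    R.level ≤ Q.level + 1 := by
  rcases hd.eq_or_lt with h1 | h2
  · refine hP.irregSpace h1.symm R hR Q hQ ?_ ?_
    · rw [inter_comm]
      exact ((hP.time Q hQ).volume_inter_pos_iff (hP.time R hR)).2 ht
    · rw [inter_comm]
      exact h.toMeetInFace.ncard_inter_eq_one (hP.nondeg hd hQ) (hP.nondeg hd hR) h1.symm hx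
  · exact h.level_le_succ h2 (hP.space Q hQ) (hP.space R hR)

/-- Around a point, the active simplices attain every level between two attained ones. Hence the
levels differ by less than the number `N` of simplices of the star. -/
theorem Regular.level_lt_of_active (hd : 1 ≤ d) (hP : Regular M s₁ s₂ P) {N : ℕ}
    (hN : ∀ t x, ∀ T ⊆ activeTriangulation P t, (∀ S ∈ T, x ∈ S.carrier) → T.card ≤ N)
    {Q R : Prism d} (hQ : Q ∈ P) (hR : R ∈ P) {t : ℝ} (htQ : t ∈ Q.1.carrier)
    (htR : t ∈ R.1.carrier) {x : Space d} (hxQ : x ∈ Q.2.carrier) (hxR : x ∈ R.2.carrier) :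
    R.level < Q.level + N := by
  classical
  by_contra hlt
  rw [not_lt] at hlt
  set T := (activeTriangulation P t).filter fun S => x ∈ S.carrier with hTdef
  have hmem : ∀ S, S ∈ T ↔ (∃ Q ∈ P, t ∈ Q.1.carrier ∧ Q.2 = S) ∧ x ∈ S.carrier := fun S => by
    rw [hTdef, Finset.mem_filter, mem_activeTriangulation]
  have htM : t ∈ Icc 0 M.T :=
    (hP.time Q hQ).Icc_subset (Q.1.carrier_subset_Icc htQ)
  have hQT : Q.2 ∈ T := (hmem _).2 ⟨⟨Q, hQ, htQ, rfl⟩, hxQ⟩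
  have hRT : R.2 ∈ T := (hmem _).2 ⟨⟨R, hR, htR, rfl⟩, hxR⟩
  have hsub : Finset.Icc Q.2.level R.2.level ⊆ T.image TaggedSimplex.level := by
    intro k hk
    rw [Finset.mem_Icc] at hk
    by_contra hkn
    have hne : ∀ S ∈ T, S.level ≠ k := fun S hS h =>
      hkn (Finset.mem_image.2 ⟨S, hS, h⟩)
    have hQk := hne _ hQT
    obtain ⟨S, hS, S', hS', hxS, hxS', hp, hp', hadj⟩ := exists_adjacent_of_star M.domain
      (hP.nondeg_active hd) (hP.conforming t) (hP.iUnion_active hd htM)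
      (fun S => S.level < k) (Finset.mem_filter.1 hQT).1 hxQ (by omega)
      (Finset.mem_filter.1 hRT).1 hxR (by omega)
    obtain ⟨A, hA, htA, rfl⟩ := mem_activeTriangulation.1 hS
    obtain ⟨B, hB, htB, rfl⟩ := mem_activeTriangulation.1 hS'
    have h1 := hP.level_le_of_adjacent hd hA hB ⟨t, htA, htB⟩ hadj ⟨x, hxS, hxS'⟩
    have h2 := hne _ ((hmem _).2 ⟨⟨B, hB, htB, rfl⟩, hxS'⟩)
    simp only [Prism.level] at h1
    omega
  have h1 := (Finset.card_le_card hsub).trans Finset.card_image_le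
  have h2 := hN t x T (Finset.filter_subset _ _) fun S hS => ((hmem S).1 hS).2
  rw [Nat.card_Icc] at h1
  simp only [Prism.level] at hlt
  omega

theorem Regular.level_le_of_touch (hd : 1 ≤ d) (hP : Regular M s₁ s₂ P) {N : ℕ}
    (hN : ∀ t x, ∀ T ⊆ activeTriangulation P t, (∀ S ∈ T, x ∈ S.carrier) → T.card ≤ N)
    {Q R : Prism d} (hQ : Q ∈ P) (hR : R ∈ P)
    (h : (closure Q.carrier ∩ closure R.carrier).Nonempty) : R.level ≤ Q.level + (N + 1) := by
  obtain ⟨⟨t, x⟩, hzQ, hzR⟩ := h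
  rw [hP.closure_carrier hQ] at hzQ
  rw [hP.closure_carrier hR] at hzR
  obtain ⟨htQ, hxQ⟩ := hzQ
  obtain ⟨htR, hxR⟩ := hzR
  have htM := (hP.time Q hQ).Icc_subset htQ
  -- both prisms are compared with prisms that are active at the time of contact
  obtain ⟨A, hA, htA, hxA, hcA⟩ := hP.complete t htM Q.2 (hP.space Q hQ) x hxQ
  obtain ⟨B, hB, htB, hxB, hcB⟩ := hP.complete t htM R.2 (hP.space R hR) x hxR
  have h1 := hP.toMeshInv.level_le_of_touch hd hP.irregTime hA hQ (A.1.carrier_subset_Icc htA) htQ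
    hcA.symm
  have h2 := hP.toMeshInv.level_le_of_touch hd hP.irregTime hR hB htR (B.1.carrier_subset_Icc htB)
    hcB
  have h3 := hP.level_lt_of_active hd hN hA hB htA htB hxA hxB
  omega

theorem Regular.level_le_of_extendedNeighbourhood (hd : 1 ≤ d) (hP : Regular M s₁ s₂ P) {N : ℕ}
    (hN : ∀ t x, ∀ T ⊆ activeTriangulation P t, (∀ S ∈ T, x ∈ S.carrier) → T.card ≤ N)
    {Q : Prism d} (hQ : Q ∈ P) {j : ℕ} : ∀ {R : Prism d}, R ∈ extendedNeighbourhood P Q j →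
      R.level ≤ Q.level + j * (N + 1) ∧ Q.level ≤ R.level + j * (N + 1) := by
  induction j with
  | zero =>
    rintro R rfl
    omega
  | succ j ih =>
    rintro R ⟨A, hA, hR, hne⟩
    have hAP := extendedNeighbourhood_subset hQ j hA
    obtain ⟨h1, h2⟩ := ih hA
    have h3 := hP.level_le_of_touch hd hN hAP hR hne
    have h4 := hP.level_le_of_touch hd hN hR hAP (by rwa [inter_comm])
    rw [add_mul]
    omega

end SpaceTimeMesh

namespace SpaceTimeMesh

/-! ### The size of the support -/

variable {d : ℕ}

open TaggedSimplex

theorem timeDepth_add_le (d : ℕ) (s₁ s₂ : ℝ) (n k : ℕ) :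
    timeDepth d s₁ s₂ (n + k) ≤ timeDepth d s₁ s₂ n + timeDepth d s₁ s₂ k := by
  rw [timeDepth, timeDepth, timeDepth, Nat.cast_add, add_mul, add_div]
  exact Nat.ceil_add_le _ _

/-- A constant `A` such that the simplices of level `n` have diameters at most `(A / 2 ^ n) ^ (1/d)`;
the summand `1` makes it positive for all values of the parameters. -/
noncomputable def diameterConstant (d : ℕ) (κ μ₃ : ℝ) : ℝ :=
  (8 * d * (κ * max 1 (μ₃ / volume.real (Metric.ball (0 : Space d) 1)))) ^ d + 1

/-- A bound for the number of simplices around a point in an active triangulation. -/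
noncomputable def starConstant (d : ℕ) (κ μ₃ μ₄ : ℝ) : ℕ :=
  ⌈diameterConstant d κ μ₃ * volume.real (Metric.ball (0 : Space d) 1) / μ₄⌉₊

/-- A bound for the difference of the levels of two touching prisms. -/
noncomputable def levelGap (d : ℕ) (κ μ₃ μ₄ : ℝ) : ℕ := starConstant d κ μ₃ μ₄ + 1

/-- A bound for the volume of the support divided by that of a prism contained in it: a box around
the support is compared with the lower bound for the volumes of prisms of comparable level. -/
noncomputable def sizeConstant (d : ℕ) (s₁ s₂ κ μ₁ μ₂ μ₃ μ₄ : ℝ) : ℝ :=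
  8 * μ₁ * (4 ^ d * (diameterConstant d κ μ₃ * 2 ^ (3 * levelGap d κ μ₃ μ₄)) *
      volume.real (Metric.ball (0 : Space d) 1)) *
    (2 ^ timeDepth d s₁ s₂ (7 * levelGap d κ μ₃ μ₄) * 2 ^ (4 * levelGap d κ μ₃ μ₄)) / (μ₂ * μ₄)

variable {M : InitialMesh d} {s₁ s₂ : ℝ} {P : Finset (Prism d)}

theorem InitialMesh.kappa_nonneg (M : InitialMesh d) : 0 ≤ M.kappa :=
  Real.iSup_nonneg fun _ => div_nonneg Metric.diam_nonneg (Real.sSup_nonneg fun _ h => h.1.le)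

theorem diameterConstant_pos (M : InitialMesh d) : 0 < diameterConstant d M.kappa M.mu₃ := by
  have := M.kappa_nonneg
  rw [diameterConstant]
  positivity

theorem InForest.dist_pow_le_diameterConstant (hd : 1 ≤ d) {S : TaggedSimplex d}
    (hS : InForest M S) {x y : Space d} (hx : x ∈ S.carrier) (hy : y ∈ S.carrier) :
    dist x y ^ d ≤ diameterConstant d M.kappa M.mu₃ / 2 ^ S.level := by
  refine (hS.dist_pow_le hd (fun S hS x hx y hy => InitialMesh.dist_le hd hS hx hy) hx hy).trans ?_
  rw [diameterConstant]
  gcongr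
  linarith

theorem Regular.card_star_le (hd : 1 ≤ d) (hP : Regular M s₁ s₂ P) (t : ℝ) (x : Space d)
    (T : Finset (TaggedSimplex d)) (hT : T ⊆ activeTriangulation P t)
    (hx : ∀ S ∈ T, x ∈ S.carrier) : T.card ≤ starConstant d M.kappa M.mu₃ M.mu₄ := by
  have hn : ∀ S ∈ T, S.Nondeg := fun S hS => hP.nondeg_active hd S (hT hS)
  have hF : ∀ S ∈ T, InForest M S := fun S hS => by
    obtain ⟨Q, hQ, -, rfl⟩ := mem_activeTriangulation.1 (hT hS)
    exact hP.space Q hQ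
  have h := SpaceTimeMesh.card_star_le hd hn
    (fun S hS S' hS' hne => (hP.conforming t).meetInFace (hT hS) (hT hS') (hn S hS) (hn S' hS') hne)
    hx (diameterConstant_pos M)
    (fun S hS => (hF S hS).volume_ge hd fun S hS => (InitialMesh.volume_bounds hS).1)
    (fun S hS y hy => (hF S hS).dist_pow_le_diameterConstant hd hy (hx S hS))
  rw [← le_div_iff₀ InitialMesh.mu₄_pos] at h
  exact_mod_cast h.trans (Nat.le_ceil _)

theorem MeshInv.length_bounds (hP : MeshInv M s₁ s₂ P) {Q : Prism d} (hQ : Q ∈ P) :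
    M.mu₂ / 2 ^ timeDepth d s₁ s₂ Q.level ≤ Q.1.hi - Q.1.lo ∧
      Q.1.hi - Q.1.lo ≤ M.mu₁ / 2 ^ timeDepth d s₁ s₂ Q.level := by
  obtain ⟨I, hI, h⟩ := (hP.time Q hQ).exists_length
  obtain ⟨h1, h2⟩ := InitialMesh.length_bounds hI
  rw [h]
  constructor <;> gcongr

theorem MeshInv.volume_carrier_ge (hd : 1 ≤ d) (hP : MeshInv M s₁ s₂ P) {Q : Prism d}
    (hQ : Q ∈ P) : M.mu₂ / 2 ^ timeDepth d s₁ s₂ Q.level * (M.mu₄ / 2 ^ Q.level) ≤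
      volume.real Q.carrier := by
  have h : volume.real Q.carrier = volume.real Q.1.carrier * volume.real Q.2.carrier := by
    rw [Prism.carrier, Measure.volume_eq_prod, measureReal_prod_prod]
  rw [h, InitialMesh.volume_real_interval (hP.time Q hQ).lt]
  have h1 := (hP.length_bounds hQ).1
  have h2 := (hP.space Q hQ).volume_ge hd fun S hS => (InitialMesh.volume_bounds hS).1
  have h3 := InitialMesh.mu₂_pos (M := M)
  have h4 := InitialMesh.mu₄_pos (M := M)
  exact mul_le_mul h1 h2 (by positivity) (le_trans (by positivity) h1)

/-- An extended neighbourhood is contained in a box whose size is a multiple of the largest size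
`τ × δ` of its prisms. -/
theorem MeshInv.dist_le_of_extendedNeighbourhood (hP : MeshInv M s₁ s₂ P) {Q : Prism d}
    (hQ : Q ∈ P) {τ δ : ℝ} {k : ℕ}
    (hsize : ∀ i ≤ k, ∀ R ∈ extendedNeighbourhood P Q i, R.1.hi - R.1.lo ≤ τ ∧
      ∀ x ∈ R.2.carrier, ∀ y ∈ R.2.carrier, dist x y ≤ δ) {z₀ : ℝ × Space d}
    (hz₀ : z₀ ∈ closure Q.carrier) {j : ℕ} (hj : j ≤ k) : ∀ {R : Prism d} {z : ℝ × Space d},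
      R ∈ extendedNeighbourhood P Q j → z ∈ closure R.carrier →
        dist z.1 z₀.1 ≤ (j + 1) * τ ∧ dist z.2 z₀.2 ≤ (j + 1) * δ := by
  have hone : ∀ i ≤ k, ∀ R ∈ extendedNeighbourhood P Q i, ∀ z ∈ closure R.carrier,
      ∀ z' ∈ closure R.carrier, dist z.1 z'.1 ≤ τ ∧ dist z.2 z'.2 ≤ δ := by
    intro i hi R hR z hz z' hz'
    rw [hP.closure_carrier (extendedNeighbourhood_subset hQ i hR)] at hz hz'
    obtain ⟨h1, h2⟩ := hsize i hi R hR
    exact ⟨(Real.dist_le_of_mem_Icc hz.1 hz'.1).trans h1, h2 _ hz.2 _ hz'.2⟩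
  induction j with
  | zero =>
    intro R z hR hz
    obtain rfl : R = Q := hR
    simpa using hone 0 hj R rfl z hz z₀ hz₀
  | succ j ih =>
    intro R z hR hz
    obtain ⟨A, hA, -, z', hz'A, hz'R⟩ := id hR
    obtain ⟨h1, h2⟩ := ih (by omega) hA hz'A
    obtain ⟨h3, h4⟩ := hone (j + 1) hj R hR z hz z' hz'R
    push_cast
    exact ⟨by linarith [dist_triangle z.1 z'.1 z₀.1], by linarith [dist_triangle z.2 z'.2 z₀.2]⟩

theorem tsupport_volume_ne_top {φ : ℝ × Space d → ℝ} (h : ∀ z ∉ M.cylinder, φ z = 0) :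
    volume (tsupport φ) ≠ ⊤ := by
  have hK : IsCompact M.cylinder := isCompact_Icc.prod M.domain.isBounded.isCompact_closure
  refine ((measure_mono (closure_minimal (fun z hz => ?_) hK.isClosed)).trans_lt
    hK.measure_lt_top).ne
  by_contra hzn
  exact hz (h z hzn)

/-- The support of a function that vanishes outside the extended neighbourhood of degree `j ≤ 3` of
a prism has a volume comparable to that of each prism contained in it, as all levels involved
differ by a bounded amount. -/
theorem Regular.volume_tsupport_le (hd : 1 ≤ d) (hs₁ : 0 < s₁) (hs₂ : 0 < s₂)
    (hP : Regular M s₁ s₂ P) {Q Q' : Prism d} (hQ : Q ∈ P) (hQ' : Q' ∈ P) {j : ℕ} (hj : j ≤ 3)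
    {φ : ℝ × Space d → ℝ}
    (hsup : tsupport φ ⊆ ⋃ R ∈ extendedNeighbourhood P Q j, closure R.carrier)
    (hsub : Q'.carrier ⊆ tsupport φ) :
    volume.real (tsupport φ) ≤
      sizeConstant d s₁ s₂ M.kappa M.mu₁ M.mu₂ M.mu₃ M.mu₄ * volume.real Q'.carrier := by
  have hd0 : d ≠ 0 := by omega
  set v := volume.real (Metric.ball (0 : Space d) 1) with hv
  set A := diameterConstant d M.kappa M.mu₃ with hA
  set L := levelGap d M.kappa M.mu₃ M.mu₄ with hL
  have hApos : 0 < A := diameterConstant_pos M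
  have hN := hP.card_star_le hd
  have hlev : ∀ i ≤ 3, ∀ R ∈ extendedNeighbourhood P Q i,
      R.level ≤ Q.level + 3 * L ∧ Q.level ≤ R.level + 3 * L := fun i hi R hR => by
    obtain ⟨h1, h2⟩ := hP.level_le_of_extendedNeighbourhood hd hN hQ hR
    have : i * L ≤ 3 * L := Nat.mul_le_mul_right _ hi
    change _ ≤ _ + i * L at h1
    change _ ≤ _ + i * L at h2
    omega
  -- the level of `Q'`
  obtain ⟨z', hz'⟩ := hP.carrier_nonempty hQ'
  obtain ⟨R, hR, hz'R⟩ := mem_iUnion₂.1 (hsup (hsub hz'))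
  have hlQ' : Q'.level ≤ Q.level + 4 * L := by
    have h1 := hP.level_le_of_touch hd hN (extendedNeighbourhood_subset hQ j hR) hQ'
      ⟨z', hz'R, subset_closure hz'⟩
    have h2 := (hlev j hj R hR).1
    change _ ≤ _ + L at h1
    omega
  -- the box containing the support
  set p := timeDepth d s₁ s₂ (Q.level - 3 * L) with hp
  set τ := M.mu₁ / 2 ^ p with hτ
  set δ := (A * 2 ^ (3 * L) / 2 ^ Q.level) ^ ((d : ℝ)⁻¹) with hδ
  have hδpos : 0 < δ := by positivity
  have hδd : δ ^ d = A * 2 ^ (3 * L) / 2 ^ Q.level :=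
    Real.rpow_inv_natCast_pow (by positivity) hd0
  have hμ₁ : 0 < M.mu₁ := by
    obtain ⟨I, hI⟩ := M.exists_mem_intervals
    exact (sub_pos.2 (intervals_lt hI).1).trans_le (InitialMesh.length_bounds hI).2
  have hτpos : 0 < τ := by positivity
  have hsize : ∀ i ≤ 3, ∀ R ∈ extendedNeighbourhood P Q i, R.1.hi - R.1.lo ≤ τ ∧
      ∀ x ∈ R.2.carrier, ∀ y ∈ R.2.carrier, dist x y ≤ δ := by
    intro i hi R hR
    have hRP := extendedNeighbourhood_subset hQ i hR
    have hl := (hlev i hi R hR).2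
    refine ⟨(hP.length_bounds hRP).2.trans ?_, fun x hx y hy => ?_⟩
    · rw [hτ]
      gcongr
      · norm_num
      · exact timeDepth_mono hs₁ hs₂ (by omega)
    · rw [← pow_le_pow_iff_left₀ dist_nonneg hδpos.le hd0, hδd]
      refine ((hP.space R hRP).dist_pow_le_diameterConstant hd hx hy).trans ?_
      rw [div_le_div_iff₀ (by positivity) (by positivity), mul_assoc, ← pow_add]
      gcongr
      · norm_num
      · rw [add_comm]
        exact hl
  obtain ⟨z₀, hz₀⟩ := hP.carrier_nonempty hQ
  have hbox : tsupport φ ⊆ Metric.closedBall z₀.1 (4 * τ) ×ˢ Metric.closedBall z₀.2 (4 * δ) := by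
    intro z hz
    obtain ⟨R, hR, hzR⟩ := mem_iUnion₂.1 (hsup hz)
    obtain ⟨h1, h2⟩ := hP.dist_le_of_extendedNeighbourhood hQ hsize (subset_closure hz₀) hj hR hzR
    have hj' : (j : ℝ) + 1 ≤ 4 := by
      have : (j : ℝ) ≤ 3 := by exact_mod_cast hj
      linarith
    exact ⟨h1.trans (by gcongr), h2.trans (by gcongr)⟩
  have hbvol : volume.real (Metric.closedBall z₀.1 (4 * τ) ×ˢ Metric.closedBall z₀.2 (4 * δ)) =
      8 * τ * ((4 * δ) ^ d * v) := by
    rw [Measure.volume_eq_prod, measureReal_prod_prod, Real.volume_real_closedBall (by positivity)]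
    congr 1
    · ring
    · rw [Measure.real, Measure.addHaar_closedBall volume _ (by positivity), ENNReal.toReal_mul,
        ENNReal.toReal_ofReal (by positivity), finrank_euclideanSpace_fin]
      rfl
  have hup : volume.real (tsupport φ) ≤ 8 * τ * ((4 * δ) ^ d * v) := by
    rw [← hbvol]
    refine measureReal_mono hbox ?_
    exact (((isCompact_closedBall _ _).prod (isCompact_closedBall _ _)).measure_lt_top).ne
  -- the lower bound for the volume of `Q'`
  have hlow := hP.volume_carrier_ge hd hQ'
  have hμ₂ := InitialMesh.mu₂_pos (M := M)
  have hμ₄ := InitialMesh.mu₄_pos (M := M)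
  have hdepth : timeDepth d s₁ s₂ Q'.level ≤ p + timeDepth d s₁ s₂ (7 * L) :=
    (timeDepth_mono hs₁ hs₂ (show Q'.level ≤ (Q.level - 3 * L) + 7 * L by omega)).trans
      (timeDepth_add_le d s₁ s₂ _ _)
  have hlow' : M.mu₂ / (2 ^ p * 2 ^ timeDepth d s₁ s₂ (7 * L)) *
      (M.mu₄ / (2 ^ Q.level * 2 ^ (4 * L))) ≤ volume.real Q'.carrier := by
    refine le_trans ?_ hlow
    rw [← pow_add, ← pow_add]
    gcongr <;> norm_num
  have hC : 0 ≤ sizeConstant d s₁ s₂ M.kappa M.mu₁ M.mu₂ M.mu₃ M.mu₄ := by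
    rw [sizeConstant, ← hA, ← hL]
    positivity
  refine hup.trans (le_trans (le_of_eq ?_) (mul_le_mul_of_nonneg_left hlow' hC))
  rw [mul_pow, hδd, sizeConstant, ← hA, ← hL, ← hv, hτ]
  field_simp

end SpaceTimeMesh

theorem mainTheorem5 (d : ℕ) (hd : 1 ≤ d) (s₁ s₂ : ℝ) (hs₁ : 0 < s₁) (hs₂ : 0 < s₂)
    (κ μ₁ μ₂ μ₃ μ₄ : ℝ) :
    ∃ C : ℝ, 0 < C ∧
      ∀ M : SpaceTimeMesh.InitialMesh d,
        M.kappa = κ → M.mu₁ = μ₁ → M.mu₂ = μ₂ → M.mu₃ = μ₃ → M.mu₄ = μ₄ →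
      ∀ P : Finset (SpaceTimeMesh.Prism d),
        (SpaceTimeMesh.Reachable s₁ s₂ M.mesh P ∨
          SpaceTimeMesh.IsRegularRefinement s₁ s₂ M.mesh P) →
      ∀ r₁ r₂ : ℕ, 2 ≤ r₁ → 2 ≤ r₂ →
      ∀ ν ∈ SpaceTimeMesh.freeNodes P r₁ r₂,
      ∀ φ : ℝ × SpaceTimeMesh.Space d → ℝ,
        SpaceTimeMesh.IsNodalBasisFunction M.cylinder P r₁ r₂ ν φ →
        (∀ Q ∈ P, ν ∈ SpaceTimeMesh.Prism.nodes r₁ r₂ Q →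
          Function.support φ ⊆
            ⋃ Q' ∈ SpaceTimeMesh.extendedNeighbourhood P Q (SpaceTimeMesh.supportDegree d),
              SpaceTimeMesh.Prism.carrier Q' ∧
          tsupport φ ⊆
            ⋃ Q' ∈ SpaceTimeMesh.extendedNeighbourhood P Q (SpaceTimeMesh.supportDegree d),
              closure (SpaceTimeMesh.Prism.carrier Q')) ∧
        (∀ Q' ∈ P, SpaceTimeMesh.Prism.carrier Q' ⊆ tsupport φ →
          volume.real (SpaceTimeMesh.Prism.carrier Q') ≤ C * volume.real (tsupport φ) ∧
          volume.real (tsupport φ) ≤ C * volume.real (SpaceTimeMesh.Prism.carrier Q')) := by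
  refine ⟨max 1 (SpaceTimeMesh.sizeConstant d s₁ s₂ κ μ₁ μ₂ μ₃ μ₄), by positivity, ?_⟩
  rintro M rfl rfl rfl rfl rfl P hP r₁ r₂ hr₁ hr₂ ν hν φ hφ
  have hreg : SpaceTimeMesh.Regular M s₁ s₂ P := hP.elim
    (fun h => h.regular hd hs₁ hs₂) fun h => h.regular hd hs₁ hs₂
  have hsupp : ∀ Q ∈ P, ν ∈ Q.nodes r₁ r₂ → Function.support φ ⊆
      ⋃ Q' ∈ SpaceTimeMesh.extendedNeighbourhood P Q (SpaceTimeMesh.supportDegree d),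
        Q'.carrier := fun Q hQ hQν =>
    hreg.support_subset hd hs₁ hs₂ hreg.conforming hreg.irregTime hreg.irregSpace hr₁ hr₂ hφ hQ hQν
  refine ⟨fun Q hQ hQν => ⟨hsupp Q hQ hQν,
    SpaceTimeMesh.tsupport_subset_of_support_subset hQ (hsupp Q hQ hQν)⟩, fun Q' hQ' hsub => ?_⟩
  obtain ⟨Q, hQ, hQν⟩ := mem_iUnion₂.1 hν.1
  have hj : SpaceTimeMesh.supportDegree d ≤ 3 := by
    rw [SpaceTimeMesh.supportDegree]
    split_ifs <;> norm_num
  constructor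
  · refine (measureReal_mono hsub
      (SpaceTimeMesh.tsupport_volume_ne_top hφ.isFiniteElement.zero_off)).trans ?_
    exact le_mul_of_one_le_left measureReal_nonneg (le_max_left _ _)
  · refine (hreg.volume_tsupport_le hd hs₁ hs₂ hQ hQ' hj
      (SpaceTimeMesh.tsupport_subset_of_support_subset hQ (hsupp Q hQ hQν)) hsub).trans ?_
    exact mul_le_mul_of_nonneg_right (le_max_right _ _) measureReal_nonneg
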